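/- **Conventions.** A representation $\rho:\Gamma\to SL(2,\mathbb C)$ is irreducible if the matrices $\rho(g)$, $g\in\Gamma$, have no common eigenvector; $\chi_\rho(g)=\mathrm{tr}\,\rho(g)$ is its character; $\mathcal X^{\rm irr}(\Gamma)$ is the set of characters of irreducible representations. For a diagram of a link (or tangle) use the Wirtinger group: directed arcs are generators, reversing an arc inverts it, and at each crossing $c=aba^{-1}$, where $a$ is the over-strand, $b$ the incoming under-arc on its right and $c$ the outgoing under-arc on its left. The four ends $T^{nw},T^{ne},T^{sw},T^{se}$ of a tangle $T$ are directed outward. $[0]$ has strands nw–ne and sw–se; $[\infty]$ has strands nw–sw and ne–se; $[1]$ (resp. $[-1]$) is the one-crossing tangle whose over-strand joins nw to se (resp. sw to ne). $S+T$ (resp. $S*T$) puts $S$ to the left of (resp. above) $T$. $[k]$ and $[1/k]$ are the horizontal and vertical composites of $|k|$ copies of $[\pm1]$ with the sign of $k$ (for $k=0$: $[0]$ and $[\infty]$). $N(T)$ joins nw to ne and sw to se; $D(T)$ joins nw to sw and ne to se. For integers $k_1,\dots,k_s$ let $[[k_1],\dots,[k_s]]$ be $[k_1]*[1/k_2]+\cdots+[k_s]$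 for odd $s$ and $[1/k_1]+[k_2]*\cdots+[k_s]$ for even $s$ (composed from left to right). Its fraction $p/q$ (in lowest terms) is given by $[[k_1]]=k_1$, $[[k_1,\dots,k_j]]=k_j+1/[[k_1,\dots,k_{j-1}]]$, where all these numbers are assumed to be defined; the tangle is odd if $p$ is odd. Let $m\ge1$, let $T_1,\dots,T_m$ be such rational tangles, with fractions $p_i/q_i$, and assume that the Montesinos link $K=D(T_1*\cdots*T_m)$ is a knot, with group $\pi(K)$. Indices $i$ are cyclic modulo $m$. **Generating pairs.** For $T=[[k_1],\dots,[k_s]]$ let $x=T^{nw}$. Let $y_0$ be the sw end of the first block, directed inward, if $s$ is odd, and the ne end of the first block, directed outward, if $s$ is even. Let $y=y_0^{\sigma}$, where $\sigma\in\{\pm1\}$ is chosen such that $y$ is on the strand of $T^{ne}$ with the same direction, or, if $x$ and $T^{ne}$ are on the same strand, on the strand of $T^{sw}$ with the same direction. Put $x_0=x^{(-1)^s}$. **Trace polynomials.** Let $\omega_n(\eta+\eta^{-1})=\frac{\eta^n-\eta^{-n}}{\eta-\eta^{-1}}$ and $\theta_n(\eta+\eta^{-1})=\eta^n+\eta^{-n}$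 (polynomials). For $t,r\in\mathbb C$ let $e_0=r$ if $\sigma=(-1)^s$ and $e_0=t^2-r$ otherwise, and $$\psi_0(n)=\theta_n(-e_0)+\tfrac{2-\theta_n(-e_0)}{2+e_0}t^2,\qquad e_j=\psi_{j-1}(k_j)\quad(1\le j\le s-1),$$ $$\psi_j(n)=e_{j-1}\omega_{n+1}(-e_j)-\psi_{j-1}(k_j-1)\,\omega_n(-e_j)+\tfrac{2t^2(1-\omega_{n+1}(-e_j)+\omega_n(-e_j))}{2+e_j},$$ where the quotients by $2+e_j$ are read as the polynomials that they are. Put $z=\psi_{s-1}(k_s)-2$, $\dot z=e_{s-1}-2$, $\grave z=\psi_{s-1}(k_s-1)-2$. These are polynomials in $t,r$; for $T_i$ write $z_i,\dot z_i,\grave z_i$, evaluated at $(t,r_i)$. With $\tau=\lambda+\lambda^{-1}$ let $$H(\lambda,t;r_1,\dots,r_m)=\frac1{\lambda+1}\Big(\prod_{i=1}^m\big((1+\lambda^{-1})\dot z_i+(1+\lambda)\grave z_i+2(\tau+2-t^2)\big)-(1-\lambda)^m(\tau+2-t^2)^m\Big),$$ which extends to $\lambda=-1$ with the value $(-1)^m\big(mt^2+\sum_i(\dot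 z_i-\grave z_i)\big)(2t^2)^{m-1}$. **Generic condition.** In a group, given $x_0,y_0$, put $Y_{-1}=x_0$, $Y_0=X_0=y_0$, and for $1\le j\le s$ let $Y_j=w_{k_j}$, $X_j=w_{k_j-1}^{-1}$, where $(w_n)_{n\in\mathbb Z}$ is the sequence with $w_0=Y_{j-2}$, $w_{-1}=X_{j-1}$, $w_{n+1}=w_nw_{n-1}w_n^{-1}$. For $\kappa\in\mathbb C^*$ take $x=\begin{pmatrix}\kappa&0\\0&\kappa^{-1}\end{pmatrix}$, $y=\begin{pmatrix}\kappa&1\\0&\kappa^{-1}\end{pmatrix}$, $x_0=x^{(-1)^s}$, $y_0=y^{\sigma}$, and let $\vartheta^{ne}_T(\kappa)$, $\vartheta^{sw}_T(\kappa)$ be the upper right entries of $Y_s$ and $Y_{s-1}$. $K$ is *generic* if for all $i\ne j$ with $p_i,p_j$ odd and all $\iota,\epsilon\in\{\pm1\}$ the equations $\vartheta^{ne}_{T_i}(\kappa^\iota)=0$ and $\vartheta^{ne}_{T_j}(\kappa^\epsilon)=(1+\kappa^{-2\epsilon})\vartheta^{sw}_{T_j}(\kappa^\epsilon)$ have no common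 solution $\kappa\in\mathbb C^*$ with $\kappa^4\ne1$. **The four parts.** For a character $\chi$ of $\pi(K)$ put $t=\chi(T_1^{nw})$, $\tau=\chi(T_1^{nw}T_1^{ne})$, $r_i=\chi(x_iy_i)$, where $(x_i,y_i)$ is the generating pair of $T_i$. A representation $\rho$ of $\pi(K)$ is the *union* of representations $\rho_i$ of the groups of the rational links $N(T_i)$ if $\rho$ and $\rho_i$ agree on all arcs of $T_i$, for all $i$. Let * $\mathcal X_0$ be the set of irreducible characters that vanish at all meridians; * $\mathcal X_1$ be the set of characters with $t\neq0$ of irreducible representations that are unions of representations of the $N(T_i)$; * $\mathcal X_2$ be the set of irreducible characters with $t\ne0$ and $\tau\ne2,\,t^2-2$; * $\mathcal X'$ be the set of irreducible characters with $t\ne0$ and $\tau=t^2-2\neq\pm2$. **Theorem.** For every Montesinos knot $K$ as above: 1. $\mathcal X^{\rm irr}(\pi(K))=\mathcal X_0\sqcup\mathcal X_1\sqcup\mathcal X_2\sqcup\mathcal X'$. 2. All the links $N(T_i)$ are knots, except possibly one, which may have two components. If $\rho_i$ are representations of the groups of the $N(T_i)$ such that $\rho_{i+1}(T_{i+1}^{nw})=\rho_i(T_i^{sw})^{-1}$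 and $\rho_{i+1}(T_{i+1}^{ne})=\rho_i(T_i^{se})^{-1}$ for all $i$, then there is exactly one representation of $\pi(K)$ that is the union of the $\rho_i$. 3. Let $C\subset\mathbb C^{m+2}$ be the set of all $(\lambda,t,r_1,\dots,r_m)$ with $\lambda,t\ne0$, $\lambda+\lambda^{-1}\ne2,\,t^2-2$, $z_i=\lambda+\lambda^{-1}-2$ for $1\le i\le m$, and $H(\lambda,t;r_1,\dots,r_m)=0$. Then $C$ is a (possibly empty or reducible, quasi-affine) algebraic curve: it is Zariski locally closed, and all its irreducible components have dimension one. If $\chi\in\mathcal X_2$ and $\lambda+\lambda^{-1}=\tau(\chi)$, then $(\lambda,t(\chi),r_1(\chi),\dots,r_m(\chi))\in C$; and for each $(\lambda,t,r_1,\dots,r_m)\in C$ there is exactly one $\chi\in\mathcal X_2$ with these values of $t,r_1,\dots,r_m$ and with $\tau(\chi)=\lambda+\lambda^{-1}$. Thus $\mathcal X_2$ is the curve $C$ modulo $\lambda\leftrightarrow\lambda^{-1}$. 4. If $K$ is generic, then $\mathcal X'$ is finite. -/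

import Mathlib

noncomputable section

namespace Montesinos

/-! ### Unoriented tangle and link diagrams -/

/-- A directed arc: an arc of a diagram together with one of its two directions. Which of the two
directions of an arc is named `true` is an arbitrary choice made once for each arc. -/
abbrev Dart (A : Type) : Type := A × Bool

/-- The same arc with the opposite direction. -/
def Dart.rev {A : Type} (a : Dart A) : Dart A := (a.1, !a.2)

def Dart.map {A B : Type} (f : A → B) (a : Dart A) : Dart B := (f a.1, a.2)

/-- The letter of the free group on the arcs that belongs to a directed arc; reversing the direction
inverts it. -/
def Dart.word {A : Type} (a : Dart A) : FreeGroup A :=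
  if a.2 then FreeGroup.of a.1 else (FreeGroup.of a.1)⁻¹

/-- An unoriented diagram, recorded by its arcs and by how they meet.
* `(a, b, c) ∈ crossing` is a crossing with over-strand `a`, where `b` is the under-arc to the right of
  `a`, directed towards the crossing, and `c` is the under-arc to the left of `a`, directed away
  from the crossing.
* `(a, b) ∈ join` says that at some point of the diagram `a` runs on, without a crossing, as `b`. -/
structure Diagram where
  Arc : Type
  crossing : Set (Dart Arc × Dart Arc × Dart Arc)
  join : Set (Dart Arc × Dart Arc)

namespace Diagram

variable (d : Diagram)

/-- The Wirtinger relators: `c = a b a⁻¹` at each crossing, and `a = b` at each join. -/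
def relators : Set (FreeGroup d.Arc) :=
  {w | ∃ a b c, (a, b, c) ∈ d.crossing ∧ w = a.word * b.word * a.word⁻¹ * c.word⁻¹} ∪
  {w | ∃ a b, (a, b) ∈ d.join ∧ w = a.word * b.word⁻¹}

/-- The Wirtinger group, that is, the fundamental group of the complement. -/
abbrev group : Type := PresentedGroup d.relators

/-- The meridian that belongs to a directed arc. -/
def loop (a : Dart d.Arc) : d.group := PresentedGroup.mk d.relators a.word

/-- One step along a strand, in either direction. -/
inductive Step : Dart d.Arc → Dart d.Arc → Prop
  | under {a b c : Dart d.Arc} : (a, b, c) ∈ d.crossing → Step b c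
  | under_rev {a b c : Dart d.Arc} : (a, b, c) ∈ d.crossing → Step c.rev b.rev
  | join {a b : Dart d.Arc} : (a, b) ∈ d.join → Step a b
  | join_rev {a b : Dart d.Arc} : (a, b) ∈ d.join → Step b.rev a.rev

/-- `[a] = [b]`: the directed arcs `a`, `b` lie on the same strand, with the same direction. -/
def SameDir : Dart d.Arc → Dart d.Arc → Prop := Relation.EqvGen d.Step

/-- The number of components of the 1-manifold that the diagram stands for. -/
def numComponents : ℕ :=
  Nat.card (Quot fun a b : d.Arc => ∃ v w : Bool, d.SameDir (a, v) (b, w))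

/-- The diagram of a link with exactly one component. -/
def IsKnot : Prop := d.numComponents = 1

end Diagram

/-- A 4-ended tangle diagram. The four ends are directed outward. -/
structure Tangle extends Diagram where
  nw : Dart Arc
  ne : Dart Arc
  sw : Dart Arc
  se : Dart Arc

namespace Tangle

/-- `[0]`: an upper arc from `nw` to `ne`, and a lower arc from `sw` to `se`. -/
def zero : Tangle where
  Arc := Fin 2
  crossing := ∅
  join := ∅
  nw := (0, true)
  ne := (0, false)
  sw := (1, true)
  se := (1, false)

/-- `[∞]`: a left arc from `nw` to `sw`, and a right arc from `ne` to `se`. -/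
def infinity : Tangle where
  Arc := Fin 2
  crossing := ∅
  join := ∅
  nw := (0, true)
  sw := (0, false)
  ne := (1, true)
  se := (1, false)

/-- `[1]`: the over-strand `0` joins `nw` to `se`; the under-strand consists of the arc `1` at `sw`
and the arc `2` at `ne`. Seen along the over-strand from `nw` to `se`, the arc `1` is on the right. -/
def one : Tangle where
  Arc := Fin 3
  crossing := {((0, false), (1, false), (2, true))}
  join := ∅
  nw := (0, true)
  se := (0, false)
  sw := (1, true)
  ne := (2, true)

/-- `[-1]`: the over-strand `0` joins `sw` to `ne`; the under-strand consists of the arc `1` at `nw`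
and the arc `2` at `se`. Seen along the over-strand from `sw` to `ne`, the arc `2` is on the right. -/
def negOne : Tangle where
  Arc := Fin 3
  crossing := {((0, true), (2, false), (1, true))}
  join := ∅
  ne := (0, true)
  sw := (0, false)
  nw := (1, true)
  se := (2, true)

/-- Two diagrams side by side, not yet joined: crossings. -/
def sumCrossing (S T : Diagram) :
    Set (Dart (S.Arc ⊕ T.Arc) × Dart (S.Arc ⊕ T.Arc) × Dart (S.Arc ⊕ T.Arc)) :=
  (fun x => (x.1.map Sum.inl, x.2.1.map Sum.inl, x.2.2.map Sum.inl)) '' S.crossing ∪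
  (fun x => (x.1.map Sum.inr, x.2.1.map Sum.inr, x.2.2.map Sum.inr)) '' T.crossing

/-- Two diagrams side by side, not yet joined: joins. -/
def sumJoin (S T : Diagram) : Set (Dart (S.Arc ⊕ T.Arc) × Dart (S.Arc ⊕ T.Arc)) :=
  (fun x => (x.1.map Sum.inl, x.2.map Sum.inl)) '' S.join ∪
  (fun x => (x.1.map Sum.inr, x.2.map Sum.inr)) '' T.join

/-- Horizontal composition `S + T`, with `S` on the left. -/
def hcomp (S T : Tangle) : Tangle where
  Arc := S.Arc ⊕ T.Arc
  crossing := sumCrossing S.toDiagram T.toDiagram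
  join := sumJoin S.toDiagram T.toDiagram ∪
    {(S.ne.map Sum.inl, (T.nw.map Sum.inr).rev), (S.se.map Sum.inl, (T.sw.map Sum.inr).rev)}
  nw := S.nw.map Sum.inl
  sw := S.sw.map Sum.inl
  ne := T.ne.map Sum.inr
  se := T.se.map Sum.inr

/-- Vertical composition `S * T`, with `S` on top. -/
def vcomp (S T : Tangle) : Tangle where
  Arc := S.Arc ⊕ T.Arc
  crossing := sumCrossing S.toDiagram T.toDiagram
  join := sumJoin S.toDiagram T.toDiagram ∪
    {(S.sw.map Sum.inl, (T.nw.map Sum.inr).rev), (S.se.map Sum.inl, (T.ne.map Sum.inr).rev)}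
  nw := S.nw.map Sum.inl
  ne := S.ne.map Sum.inl
  sw := T.sw.map Sum.inr
  se := T.se.map Sum.inr

/-- The horizontal composite of `n` copies of `T`, started from the neutral tangle `[0]`. -/
def hcopies (T : Tangle) : ℕ → Tangle
  | 0 => zero
  | n + 1 => (hcopies T n).hcomp T

/-- The vertical composite of `n` copies of `T`, started from the neutral tangle `[∞]`. -/
def vcopies (T : Tangle) : ℕ → Tangle
  | 0 => infinity
  | n + 1 => (vcopies T n).vcomp T

/-- `[k]`. -/
def hTwist : ℤ → Tangle
  | Int.ofNat n => hcopies one n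
  | Int.negSucc n => hcopies negOne (n + 1)

/-- `[1/k]`. -/
def vTwist : ℤ → Tangle
  | Int.ofNat n => vcopies one n
  | Int.negSucc n => vcopies negOne (n + 1)

/-- The numerator `N(T)`: `nw` is connected with `ne`, and `sw` with `se`. -/
def numerator (T : Tangle) : Diagram where
  Arc := T.Arc
  crossing := T.crossing
  join := T.join ∪ {(T.nw, T.ne.rev), (T.sw, T.se.rev)}

/-- `D(T₁ * ⋯ * Tₘ)`: the tangles are stacked from top to bottom, the lower ends of each one
connected with the upper ends of the next, and the lower ends of the last one are connected with the
upper ends of the first. -/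
def denominatorOfStack {m : ℕ} [NeZero m] (T : Fin m → Tangle) : Diagram where
  Arc := Σ i, (T i).Arc
  crossing := {x | ∃ i, ∃ y ∈ (T i).crossing,
    x = (y.1.map (Sigma.mk i), y.2.1.map (Sigma.mk i), y.2.2.map (Sigma.mk i))}
  join := {x | ∃ i, ∃ y ∈ (T i).join, x = (y.1.map (Sigma.mk i), y.2.map (Sigma.mk i))} ∪
    {x | ∃ i, x = ((T i).sw.map (Sigma.mk i), ((T (i + 1)).nw.map (Sigma.mk (i + 1))).rev)} ∪
    {x | ∃ i, x = ((T i).se.map (Sigma.mk i), ((T (i + 1)).ne.map (Sigma.mk (i + 1))).rev)}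

end Tangle

/-! ### Rational tangles -/

/-- `HasFraction [k₁, …, kₛ] q` says that the continued fraction given by `[[k₁]] = k₁` and
`[[k₁, …, kⱼ]] = kⱼ + 1 / [[k₁, …, kⱼ₋₁]]` is defined, and that its value is `q`. -/
inductive HasFraction : List ℤ → ℚ → Prop
  | single (k : ℤ) : HasFraction [k] k
  | snoc {l : List ℤ} {q : ℚ} (k : ℤ) : HasFraction l q → q ≠ 0 → HasFraction (l ++ [k]) (k + 1 / q)

/-- A tangle with a marked directed arc. -/
structure MarkedTangle extends Tangle where
  y₀ : Dart Arc

/-- Alternately compose with `[k]` on the right (when the flag is `true`) and with `[1/k]` at the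
bottom (when it is `false`). -/
def extendTangle : Bool → MarkedTangle → List ℤ → MarkedTangle
  | _, R, [] => R
  | true, R, k :: l =>
      extendTangle false ⟨R.hcomp (Tangle.hTwist k), R.y₀.map Sum.inl⟩ l
  | false, R, k :: l =>
      extendTangle true ⟨R.vcomp (Tangle.vTwist k), R.y₀.map Sum.inl⟩ l

/-- The rational tangle `[[k₁],…,[kₛ]]`, which is `[k₁] * [1/k₂] + ⋯ + [kₛ]` for odd `s` and
`[1/k₁] + [k₂] * ⋯ + [kₛ]` for even `s`. The marked directed arc starts at the first block: it is the
lower left end of `[k₁]`, directed inward, for odd `s`, and the upper right end of `[1/k₁]`, directed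
outward, for even `s`. (The empty list is a dummy.) -/
def rational : List ℤ → MarkedTangle
  | [] => ⟨Tangle.zero, Tangle.zero.sw.rev⟩
  | k :: l =>
      if Even l.length then extendTangle false ⟨Tangle.hTwist k, (Tangle.hTwist k).sw.rev⟩ l
      else extendTangle true ⟨Tangle.vTwist k, (Tangle.vTwist k).ne⟩ l

/-- The sign in `y = y₀^{±1}` is `+`: the marked arc has the direction of the outward end `ne`, or, if
`nw` and `ne` are ends of the same strand, it has the direction of the outward end `sw`. -/
def GenSignPos (k : List ℤ) : Prop :=
  let R := rational k
  R.SameDir R.y₀ R.ne ∨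
    ((R.SameDir R.nw R.ne ∨ R.SameDir R.nw.rev R.ne) ∧ R.SameDir R.y₀ R.sw)

open Classical in
/-- The second directed arc of the generating pair `(x, y)`; the first one is `x = nw`. -/
def genY (k : List ℤ) : Dart (rational k).Arc :=
  if GenSignPos k then (rational k).y₀ else (rational k).y₀.rev

/-! ### Representations and characters -/

abbrev SL2 : Type := Matrix.SpecialLinearGroup (Fin 2) ℂ

/-- The images of all elements have a common eigenvector. -/
def IsReducible {Γ : Type} [Group Γ] (ρ : Γ →* SL2) : Prop :=
  ∃ v : Fin 2 → ℂ, v ≠ 0 ∧ ∀ g : Γ, ∃ c : ℂ, (ρ g).1.mulVec v = c • v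

def character {Γ : Type} [Group Γ] (ρ : Γ →* SL2) : Γ → ℂ := fun g => (ρ g).1.trace

/-- The irreducible `SL(2,ℂ)`-character variety. -/
def irrCharacters (Γ : Type) [Group Γ] : Set (Γ → ℂ) :=
  {χ | ∃ ρ : Γ →* SL2, ¬ IsReducible ρ ∧ character ρ = χ}

/-! ### The Montesinos link `D([[k 1]] * ⋯ * [[k m]])` -/

section Link

variable {m : ℕ} [NeZero m] (k : Fin m → List ℤ)

/-- The Montesinos link whose `i`-th rational tangle is given by the list `k i`. -/
def link : Diagram := Tangle.denominatorOfStack fun i => (rational (k i)).toTangle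

/-- The meridian of the Montesinos link that belongs to a directed arc of the `i`-th tangle. -/
def arc (i : Fin m) (a : Dart (rational (k i)).Arc) : (link k).group :=
  (link k).loop (a.map (Sigma.mk i))

/-- `t`: the value at a meridian. -/
def tCoord (χ : (link k).group → ℂ) : ℂ := χ (arc k 0 (rational (k 0)).nw)

/-- `τ`: the value at `x₁^nw x₁^ne`. -/
def tauCoord (χ : (link k).group → ℂ) : ℂ :=
  χ (arc k 0 (rational (k 0)).nw * arc k 0 (rational (k 0)).ne)

/-- `r_i`: the value at `x_i y_i`. -/
def rCoord (χ : (link k).group → ℂ) (i : Fin m) : ℂ :=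
  χ (arc k i (rational (k i)).nw * arc k i (genY (k i)))

/-- `ρ` is the union of the representations `σ i` of the rational links `N(T_i)`: the restriction of `ρ`
to the `i`-th tangle agrees with `σ i`. -/
def IsUnion (ρ : (link k).group →* SL2)
    (σ : ∀ i, (rational (k i)).numerator.group →* SL2) : Prop :=
  ∀ i (a : Dart (rational (k i)).Arc), σ i ((rational (k i)).numerator.loop a) = ρ (arc k i a)

/-- The trace-free irreducible characters. -/
def X₀ : Set ((link k).group → ℂ) :=
  {χ | χ ∈ irrCharacters (link k).group ∧ ∀ a, χ ((link k).loop a) = 0}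

/-- The characters, of non-zero trace at the meridians, of irreducible unions of representations of the
`N(T_i)`. -/
def X₁ : Set ((link k).group → ℂ) :=
  {χ | ∃ ρ : (link k).group →* SL2, ¬ IsReducible ρ ∧ character ρ = χ ∧ tCoord k χ ≠ 0 ∧
    ∃ σ : ∀ i, (rational (k i)).numerator.group →* SL2, IsUnion k ρ σ}

def X₂ : Set ((link k).group → ℂ) :=
  {χ | χ ∈ irrCharacters (link k).group ∧ tCoord k χ ≠ 0 ∧
    tauCoord k χ ≠ 2 ∧ tauCoord k χ ≠ tCoord k χ ^ 2 - 2}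

def X' : Set ((link k).group → ℂ) :=
  {χ | χ ∈ irrCharacters (link k).group ∧ tCoord k χ ≠ 0 ∧
    tauCoord k χ = tCoord k χ ^ 2 - 2 ∧ tauCoord k χ ≠ 2 ∧ tauCoord k χ ≠ -2}

end Link

/-! ### The trace polynomials of a rational tangle -/

/-- `ω_n`, with `ω_n(η + η⁻¹) = (η^n - η^{-n}) / (η - η⁻¹)`. -/
def omega (n : ℤ) (a : ℂ) : ℂ := (Polynomial.Chebyshev.S ℂ (n - 1)).eval a

/-- `θ_n`, with `θ_n(η + η⁻¹) = η^n + η^{-n}`. -/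
def theta (n : ℤ) (a : ℂ) : ℂ := (Polynomial.Chebyshev.C ℂ n).eval a

/-- The polynomial `(2 - θ_n(a)) / (2 - a)` in `a`. -/
def thetaQuot (n : ℤ) : Polynomial ℂ :=
  (Polynomial.Chebyshev.C ℂ n - 2) /ₘ (Polynomial.X - Polynomial.C 2)

/-- The polynomial `(1 - ω_{n+1}(a) + ω_n(a)) / (2 - a)` in `a`. -/
def omegaQuot (n : ℤ) : Polynomial ℂ :=
  (Polynomial.Chebyshev.S ℂ n - Polynomial.Chebyshev.S ℂ (n - 1) - 1) /ₘ
    (Polynomial.X - Polynomial.C 2)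

/-- The division in `thetaQuot` leaves no remainder. -/
theorem thetaQuot_spec (n : ℤ) (a : ℂ) : (2 - a) * (thetaQuot n).eval a = 2 - theta n a := by
  have h : (Polynomial.X - Polynomial.C 2) * thetaQuot n = Polynomial.Chebyshev.C ℂ n - 2 := by
    unfold thetaQuot
    rw [Polynomial.mul_divByMonic_eq_iff_isRoot]
    simp [Polynomial.IsRoot]
  have := congrArg (Polynomial.eval a) h
  simp at this
  unfold theta
  linear_combination -this

/-- The division in `omegaQuot` leaves no remainder. -/
theorem omegaQuot_spec (n : ℤ) (a : ℂ) :
    (2 - a) * (omegaQuot n).eval a = 1 - omega (n + 1) a + omega n a := by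
  have h : (Polynomial.X - Polynomial.C 2) * omegaQuot n =
      Polynomial.Chebyshev.S ℂ n - Polynomial.Chebyshev.S ℂ (n - 1) - 1 := by
    unfold omegaQuot
    rw [Polynomial.mul_divByMonic_eq_iff_isRoot]
    simp [Polynomial.IsRoot]
  have := congrArg (Polynomial.eval a) h
  simp at this
  unfold omega
  rw [add_sub_cancel_right]
  linear_combination -this

/-- `ψ₀(n) = θ_n(-e₀) + t² (2 - θ_n(-e₀)) / (2 + e₀)`. -/
def psiZero (t e₀ : ℂ) (n : ℤ) : ℂ := theta n (-e₀) + (thetaQuot n).eval (-e₀) * t ^ 2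

/-- From `e = e_{j-1}`, `ψ_{j-1}`, and the list `[kⱼ, …, kₛ]`, compute `(z, ż, z̀)`: if `j = s`, then
`z = ψ_{s-1}(kₛ) - 2`, `ż = e_{s-1} - 2` and `z̀ = ψ_{s-1}(kₛ - 1) - 2`; otherwise pass to
`eⱼ = ψ_{j-1}(kⱼ)` and `ψⱼ(n) = e_{j-1} ω_{n+1}(-eⱼ) - ψ_{j-1}(kⱼ - 1) ω_n(-eⱼ)
+ 2 t² (1 - ω_{n+1}(-eⱼ) + ω_n(-eⱼ)) / (2 + eⱼ)`. -/
def traceRec (t : ℂ) : ℂ → (ℤ → ℂ) → List ℤ → ℂ × ℂ × ℂ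
  | _, _, [] => (0, 0, 0)
  | e, ψ, [k] => (ψ k - 2, e - 2, ψ (k - 1) - 2)
  | e, ψ, k :: k' :: l =>
      traceRec t (ψ k)
        (fun n => e * omega (n + 1) (-ψ k) - ψ (k - 1) * omega n (-ψ k)
          + 2 * t ^ 2 * (omegaQuot n).eval (-ψ k)) (k' :: l)

open Classical in
/-- `e₀`, the trace of `x₀ y₀`, in terms of `t` and `r`. Here `x₀ = x^{±1}` with the sign `+` for even `s`,
and `y₀ = y^{±1}`; the trace is `r` if the signs agree, and `t² - r` otherwise. -/
def eZero (k : List ℤ) (t r : ℂ) : ℂ := if (GenSignPos k ↔ Even k.length) then r else t ^ 2 - r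

/-- `z(t, r)`. -/
def z (k : List ℤ) (t r : ℂ) : ℂ := (traceRec t (eZero k t r) (psiZero t (eZero k t r)) k).1

/-- `ż(t, r)`. -/
def zDot (k : List ℤ) (t r : ℂ) : ℂ := (traceRec t (eZero k t r) (psiZero t (eZero k t r)) k).2.1

/-- `z̀(t, r)`. -/
def zGrave (k : List ℤ) (t r : ℂ) : ℂ := (traceRec t (eZero k t r) (psiZero t (eZero k t r)) k).2.2

/-! ### The curve -/

section Curve

variable {m : ℕ} (k : Fin m → List ℤ)

/-- `H(l, t; r₁, …, r_m)`, where `τ = l + l⁻¹`. The bracket in the second case vanishes at `l = -1`, and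
the first case is the value that the quotient by `l + 1` takes there. -/
def H (l t : ℂ) (r : Fin m → ℂ) : ℂ :=
  if l = -1 then
    (-1) ^ m * (m * t ^ 2 + ∑ i, (zDot (k i) t (r i) - zGrave (k i) t (r i))) *
      (2 * t ^ 2) ^ (m - 1)
  else
    1 / (l + 1) *
      (∏ i, ((1 + l⁻¹) * zDot (k i) t (r i) + (1 + l) * zGrave (k i) t (r i)
          + 2 * (l + l⁻¹ + 2 - t ^ 2))
        - (1 - l) ^ m * (l + l⁻¹ + 2 - t ^ 2) ^ m)

/-- The points `v = (l, t, r₁, …, r_m)` with `l, t ≠ 0`, `z_i + 2 = l + l⁻¹ ≠ 2, t² - 2` for all `i`, and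
`H(l, t; r₁, …, r_m) = 0`. -/
def curve : Set (Fin (m + 2) → ℂ) :=
  {v | v 0 ≠ 0 ∧ v 1 ≠ 0 ∧ v 0 + (v 0)⁻¹ ≠ 2 ∧ v 0 + (v 0)⁻¹ ≠ v 1 ^ 2 - 2 ∧
    (∀ i : Fin m, z (k i) (v 1) (v i.succ.succ) = v 0 + (v 0)⁻¹ - 2) ∧
    H k (v 0) (v 1) (fun i => v i.succ.succ) = 0}

/-- A (possibly empty, possibly reducible, quasi-affine) algebraic curve in `ℂ^n`: a Zariski locally closed
subset, all irreducible components of which have dimension one. -/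
def IsAlgebraicCurve {n : ℕ} (S : Set (Fin n → ℂ)) : Prop :=
  (∃ I J : Ideal (MvPolynomial (Fin n) ℂ),
    S = MvPolynomial.zeroLocus ℂ I \ MvPolynomial.zeroLocus ℂ J) ∧
  ∀ P ∈ (MvPolynomial.vanishingIdeal ℂ S).minimalPrimes,
    ringKrullDim (MvPolynomial (Fin n) ℂ ⧸ P) = 1

end Curve

/-! ### The generic condition -/

/-- One twist, `(a, b) ↦ (a b a⁻¹, a)`. -/
def twist {G : Type} [Group G] : Equiv.Perm (G × G) where
  toFun p := (p.1 * p.2 * p.1⁻¹, p.1)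
  invFun p := (p.2, p.2⁻¹ * p.1 * p.2)
  left_inv p := by ext <;> simp [mul_assoc]
  right_inv p := by ext <;> simp [mul_assoc]

/-- For `u = y^{(j-2)}`, `v = y^{(j-1)}`, `w = x^{(j-1)}` and the list `[kⱼ, …, kₛ]`, compute the pair
`(y^{(s-1)}, y^{(s)})`. The `j`-th block of `kⱼ` twists turns the pair `(u, w)` into
`(y^{(j)}, (x^{(j)})⁻¹)`. -/
def tangleRec {G : Type} [Group G] : G → G → G → List ℤ → G × G
  | u, v, _, [] => (u, v)
  | u, v, w, k :: l =>
      tangleRec v ((twist ^ k) (u, w)).1 ((twist ^ k) (u, w)).2⁻¹ l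

/-- `u⁺_κ(ξ)`. -/
def uPlus (κ : ℂˣ) (ξ : ℂ) : SL2 :=
  ⟨!![(κ : ℂ), ξ; 0, (κ : ℂ)⁻¹], by simp [Matrix.det_fin_two]⟩

open Classical in
/-- The pair `(y^{(s-1)}, y^{(s)})` for the reducible representation of `[[k₁],…,[kₛ]]` that sends the
generating pair `(x, y)` to `(u⁺_κ(0), u⁺_κ(1))`. -/
def redPair (k : List ℤ) (κ : ℂˣ) : SL2 × SL2 :=
  let x₀ : SL2 := if Even k.length then uPlus κ 0 else (uPlus κ 0)⁻¹
  let y₀ : SL2 := if GenSignPos k then uPlus κ 1 else (uPlus κ 1)⁻¹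
  tangleRec x₀ y₀ y₀ k

/-- `ϑ^ne`: the upper right entry of `y^{(s)}`. -/
def varthetaNE (k : List ℤ) (κ : ℂˣ) : ℂ := (redPair k κ).2.1 0 1

/-- `ϑ^sw`: the upper right entry of `y^{(s-1)}`. -/
def varthetaSW (k : List ℤ) (κ : ℂˣ) : ℂ := (redPair k κ).1.1 0 1

/-- The generic condition: for different odd tangles `T_i`, `T_j` and all signs `ι`, `ε`, the equations
`ϑ_i^ne(κ^ι) = 0` and `ϑ_j^ne(κ^ε) = (1 + κ^{-2ε}) ϑ_j^sw(κ^ε)` have no common solution `κ` with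
`κ + κ⁻¹ ≠ 0, ±2`. Here `q i` is the fraction of the `i`-th tangle. -/
def IsGeneric {m : ℕ} (k : Fin m → List ℤ) (q : Fin m → ℚ) : Prop :=
  ∀ i j, i ≠ j → Odd (q i).num → Odd (q j).num →
    ∀ (ι ε : ℤˣ) (κ : ℂˣ), (κ : ℂ) ^ 4 ≠ 1 →
      ¬ (varthetaNE (k i) (κ ^ (ι : ℤ)) = 0 ∧
        varthetaNE (k j) (κ ^ (ε : ℤ)) =
          (1 + (κ : ℂ) ^ (-2 * (ε : ℤ))) * varthetaSW (k j) (κ ^ (ε : ℤ)))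

end Montesinos

end

open Montesinos

/-! A representation of a link group is a coloring of the arcs by matrices. A rational tangle is
free on its two generating arcs (`isFree_rational`), so its colorings are arbitrary pairs of
matrices, and an irreducible pair with equal traces `t` is given up to conjugation by `t` and the
trace `r` of the product. The trace polynomials are the traces of products of ends
(`rational_traces`). The relation `nw * ne * se * sw = 1` between the ends implies that `g = nw *
ne` is one and the same matrix for all tangles of the stack (`IsGlued.mul_eq`). Everything depends
on the position of the matrices `A i = nw` relative to `g`, whose trace is `τ`.

If `τ = 2`, then either `g = 1`, and every tangle coloring closes up to a coloring of the numerator,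
or `g` is parabolic, and `tr A = tr (A⁻¹ g)` puts every `A i` into the stabilizer of the eigenline
of `g`, which makes the representation reducible.

If `τ ≠ 2, t² - 2`, the matrices `A` with `tr A = tr (A⁻¹ g) = t` form one orbit of the centralizer
of `g`. Its coordinate is the upper right entry of `A` for diagonal `g` and the upper left entry for
parabolic `g` (the case `l = -1`). The traces of a tangle prescribe the quotient, or the difference,
of the coordinates of `A (i + 1)` and `A i` (`diag_bracket`, `parabolic_bracket`). Tangle colorings
can be glued if and only if these quotients multiply to one around the cycle, and this is the
equation `H = 0`.

The curve is given by `m + 1` equations in `m + 2` variables, so no component is a point, by Krull's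
height theorem. For the upper bound, `z + 2` is a polynomial in `r` with leading coefficient `±1`
and degree `|p|` (`hasUnitLead_traceTriple`); hence the coordinate ring of a component is integral
over the polynomials in `τ` and `t`. If these were independent, the closure of the component would
contain a point with `t = 0` and `τ = 5/2`. At `t = 0` the trace polynomials become Chebyshev
polynomials (`traceTriple_units`), the equation `H = 0` turns into a product of roots of `l`, and
absolute values give `(∑ q i / p i) * log |l| = 0`. But `∑ q i / p i ≠ 0`, because the determinant
of a knot is odd (`sum_inv_frac_ne_zero`, proved by colorings modulo two).

In the exceptional part, `g = diag (κ², κ⁻²)`, and each `A i` is triangular with diagonal `κ, κ⁻¹`;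
the generic condition excludes diagonal ones. Infinitely many such characters would give an infinite
family with fixed types of triangular matrices and `κ` finite-to-one. In an ultrapower of `ℂ` this
family is a single object with transcendental `κ`, and there is a valuation ring in which `κ² = -1`
modulo the maximal ideal (`exists_place`). At this place the quotient of the coordinates at the two
sides of a tangle has logarithmic derivative `-q / p` with respect to `κ²`, for all types. Since the
quotients multiply to one, `∑ q i / p i = 0`, again a contradiction (`false_of_infinite_family`). -/

noncomputable section

namespace Montesinos

/-! ### Colorings of diagrams by groups -/

section Colorings

variable {G : Type} [Group G]

/-- The value of a coloring of the arcs at a directed arc. -/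
def Dart.val {A : Type} (a : Dart A) (f : A → G) : G := if a.2 then f a.1 else (f a.1)⁻¹

theorem Dart.val_rev {A : Type} (a : Dart A) (f : A → G) : a.rev.val f = (a.val f)⁻¹ := by
  rcases a with ⟨a, b⟩
  cases b <;> simp [Dart.val, Dart.rev]

theorem Dart.eq_val_rev_iff {A : Type} {a : Dart A} {f : A → G} {x : G} :
    x = a.rev.val f ↔ a.val f = x⁻¹ := by
  rw [Dart.val_rev, eq_comm, inv_eq_iff_eq_inv]

theorem Dart.val_comp {A H : Type} [Group H] (a : Dart A) (f : A → G) (φ : G →* H) :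
    a.val (φ ∘ f) = φ (a.val f) := by
  rcases a with ⟨a, b⟩
  cases b <;> simp [Dart.val]

/-- The arcs are colored by elements of a group such that the Wirtinger relations hold. -/
def Diagram.IsColoring (d : Diagram) (f : d.Arc → G) : Prop :=
  (∀ a b c, (a, b, c) ∈ d.crossing → c.val f = a.val f * b.val f * (a.val f)⁻¹) ∧
    ∀ a b, (a, b) ∈ d.join → a.val f = b.val f

/-- A set of arcs that contains, with the over-strand and one under-arc of a crossing, the other
under-arc, and is compatible with joins. -/
def Diagram.IsClosed (d : Diagram) (W : Set d.Arc) : Prop :=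
  (∀ a b c, (a, b, c) ∈ d.crossing → a.1 ∈ W → (b.1 ∈ W ↔ c.1 ∈ W)) ∧
    ∀ a b, (a, b) ∈ d.join → (a.1 ∈ W ↔ b.1 ∈ W)

/-- Closed sets isolate what generation by arcs means: the agreement set of two colorings and the
preimage of a subgroup are both closed. Arcs that lie in no proper closed set therefore determine a
coloring and control its image. -/
theorem Diagram.IsColoring.isClosed_eq {d : Diagram} {f g : d.Arc → G} (hf : d.IsColoring f)
    (hg : d.IsColoring g) : d.IsClosed {a | f a = g a} := by
  have key : ∀ a : Dart d.Arc, f a.1 = g a.1 ↔ a.val f = a.val g := by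
    rintro ⟨a, b⟩; cases b <;> simp [Dart.val]
  constructor
  · intro a b c h ha
    simp only [Set.mem_ofPred_eq, key] at *
    rw [hf.1 _ _ _ h, hg.1 _ _ _ h, ha]
    simp
  · intro a b h
    simp only [Set.mem_ofPred_eq, key] at *
    rw [hf.2 _ _ h, hg.2 _ _ h]

theorem Diagram.IsColoring.isClosed_subgroup {d : Diagram} {f : d.Arc → G} (hf : d.IsColoring f)
    (N : Subgroup G) : d.IsClosed {a | f a ∈ N} := by
  have key : ∀ a : Dart d.Arc, f a.1 ∈ N ↔ a.val f ∈ N := by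
    rintro ⟨a, b⟩; cases b <;> simp [Dart.val]
  constructor
  · intro a b c h ha
    simp only [Set.mem_ofPred_eq, key] at *
    rw [hf.1 _ _ _ h, N.mul_mem_cancel_right (N.inv_mem ha), N.mul_mem_cancel_left ha]
  · intro a b h
    simp only [Set.mem_ofPred_eq, key] at *
    rw [hf.2 _ _ h]

theorem Diagram.IsColoring.comp {d : Diagram} {H : Type} [Group H] {f : d.Arc → G}
    (hf : d.IsColoring f) (φ : G →* H) : d.IsColoring (φ ∘ f) := by
  constructor
  · intro a b c h
    simp only [Dart.val_comp, hf.1 _ _ _ h, map_mul, map_inv]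
  · intro a b h
    simp only [Dart.val_comp, hf.2 _ _ h]

theorem Dart.word_lift {A : Type} (a : Dart A) (f : A → G) : FreeGroup.lift f a.word = a.val f := by
  rcases a with ⟨a, b⟩
  cases b <;> simp [Dart.val, Dart.word]

theorem Diagram.IsColoring.lift_eq_one {d : Diagram} {f : d.Arc → G} (hf : d.IsColoring f) :
    ∀ r ∈ d.relators, FreeGroup.lift f r = 1 := by
  rintro r (⟨a, b, c, h, rfl⟩ | ⟨a, b, h, rfl⟩)
  · simp only [map_mul, map_inv, Dart.word_lift, hf.1 _ _ _ h]; group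
  · simp only [map_mul, map_inv, Dart.word_lift, hf.2 _ _ h]; group

/-- The representation of the Wirtinger group that belongs to a coloring. -/
def Diagram.IsColoring.hom {d : Diagram} {f : d.Arc → G} (hf : d.IsColoring f) : d.group →* G :=
  PresentedGroup.toGroup hf.lift_eq_one

theorem Diagram.IsColoring.hom_loop {d : Diagram} {f : d.Arc → G} (hf : d.IsColoring f)
    (a : Dart d.Arc) : hf.hom (d.loop a) = a.val f := by
  rw [← Dart.word_lift]; rfl

/-- The coloring that belongs to a representation of the Wirtinger group. -/
def Diagram.coloring (d : Diagram) (ρ : d.group →* G) : d.Arc → G := fun a => ρ (d.loop (a, true))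

theorem Diagram.val_coloring (d : Diagram) (ρ : d.group →* G) (a : Dart d.Arc) :
    a.val (d.coloring ρ) = ρ (d.loop a) := by
  rcases a with ⟨a, b⟩
  cases b <;> simp [Dart.val, Diagram.coloring, Diagram.loop, Dart.word]

theorem Diagram.isColoring_coloring (d : Diagram) (ρ : d.group →* G) :
    d.IsColoring (d.coloring ρ) := by
  constructor
  · intro a b c h
    simp only [d.val_coloring, ← map_mul, ← map_inv]
    congr 1
    symm
    rw [← mul_inv_eq_one]
    exact PresentedGroup.one_of_mem (Or.inl ⟨a, b, c, h, rfl⟩)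
  · intro a b h
    simp only [d.val_coloring]
    congr 1
    rw [← mul_inv_eq_one]
    exact PresentedGroup.one_of_mem (Or.inr ⟨a, b, h, rfl⟩)

theorem Diagram.hom_ext {d : Diagram} {ρ ρ' : d.group →* G}
    (h : ∀ a, d.coloring ρ a = d.coloring ρ' a) : ρ = ρ' :=
  PresentedGroup.ext fun a => by
    have := h a
    simp only [Diagram.coloring, Diagram.loop, Dart.word, if_true] at this
    exact this

/-- In a commutative group the crossing relation reads `c = b`, so colors are constant along
strands. Colorings in `Two`, in the integers and in `ℂˣ` serve to tell strands and directions apart.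
-/
theorem Diagram.SameDir.val_eq_of_comm {G : Type} [CommGroup G] {d : Diagram} {f : d.Arc → G}
    (hf : d.IsColoring f) {a b : Dart d.Arc} (h : d.SameDir a b) : a.val f = b.val f := by
  induction h with
  | rel x y h =>
    cases h with
    | under h => simp [hf.1 _ _ _ h]
    | under_rev h => simp [Dart.val_rev, hf.1 _ _ _ h]
    | join h => exact hf.2 _ _ h
    | join_rev h => simp [Dart.val_rev, hf.2 _ _ h]
  | refl => rfl
  | symm _ _ _ h => exact h.symm
  | trans _ _ _ _ _ h h' => exact h.trans h'

theorem Diagram.SameDir.isConj {d : Diagram} {f : d.Arc → G}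
    (hf : d.IsColoring f) {a b : Dart d.Arc} (h : d.SameDir a b) : IsConj (a.val f) (b.val f) := by
  induction h with
  | rel x y h =>
    cases h with
    | under h => exact isConj_iff.2 ⟨_, (hf.1 _ _ _ h).symm⟩
    | @under_rev a b c h =>
      refine isConj_iff.2 ⟨(a.val f)⁻¹, ?_⟩
      simp only [Dart.val_rev, hf.1 _ _ _ h]; group
    | join h => rw [hf.2 _ _ h]
    | join_rev h => simp only [Dart.val_rev, hf.2 _ _ h]; rfl
  | refl => rfl
  | symm _ _ _ h => exact h.symm
  | trans _ _ _ _ _ h h' => exact h.trans h'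

theorem Dart.rev_rev {A : Type} (a : Dart A) : a.rev.rev = a := by
  simp [Dart.rev]

theorem Diagram.SameDir.rev {d : Diagram} {a b : Dart d.Arc} (h : d.SameDir a b) :
    d.SameDir a.rev b.rev := by
  induction h with
  | rel x y h =>
    cases h with
    | under h => exact (Relation.EqvGen.rel _ _ (.under_rev h)).symm
    | under_rev h => rw [Dart.rev_rev, Dart.rev_rev]; exact (Relation.EqvGen.rel _ _ (.under h)).symm
    | join h => exact (Relation.EqvGen.rel _ _ (.join_rev h)).symm
    | join_rev h => rw [Dart.rev_rev, Dart.rev_rev]; exact (Relation.EqvGen.rel _ _ (.join h)).symm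
  | refl => exact .refl _
  | symm _ _ _ h => exact h.symm
  | trans _ _ _ _ _ h h' => exact h.trans _ _ _ h'

end Colorings

/-! ### Composition of tangles -/

namespace Tangle

variable {G : Type} [Group G]

theorem isColoring_hcomp {S T : Tangle} {f : (S.hcomp T).Arc → G} :
    (S.hcomp T).IsColoring f ↔ S.IsColoring (f ∘ Sum.inl) ∧ T.IsColoring (f ∘ Sum.inr) ∧
      T.nw.val (f ∘ Sum.inr) = (S.ne.val (f ∘ Sum.inl))⁻¹ ∧
      T.sw.val (f ∘ Sum.inr) = (S.se.val (f ∘ Sum.inl))⁻¹ := by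
  constructor
  · rintro ⟨h, h'⟩
    refine ⟨⟨fun a b c hc => ?_, fun a b hc => ?_⟩, ⟨fun a b c hc => ?_, fun a b hc => ?_⟩, ?_, ?_⟩
    · exact h (a.map _) (b.map _) (c.map _) (Or.inl ⟨_, hc, rfl⟩)
    · exact h' (a.map _) (b.map _) (Or.inl (Or.inl ⟨_, hc, rfl⟩))
    · exact h (a.map _) (b.map _) (c.map _) (Or.inr ⟨_, hc, rfl⟩)
    · exact h' (a.map _) (b.map _) (Or.inl (Or.inr ⟨_, hc, rfl⟩))
    · exact Dart.eq_val_rev_iff.1 (h' _ _ (Or.inr (Or.inl rfl)))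
    · exact Dart.eq_val_rev_iff.1 (h' _ _ (Or.inr (Or.inr rfl)))
  · rintro ⟨⟨h1, h2⟩, ⟨h3, h4⟩, h5, h6⟩
    constructor
    · rintro _ _ _ (⟨⟨a, b, c⟩, hc, h⟩ | ⟨⟨a, b, c⟩, hc, h⟩)
      · cases h; exact h1 a b c hc
      · cases h; exact h3 a b c hc
    · rintro _ _ ((⟨⟨a, b⟩, hc, h⟩ | ⟨⟨a, b⟩, hc, h⟩) | (h | h))
      · cases h; exact h2 a b hc
      · cases h; exact h4 a b hc
      · cases h; exact Dart.eq_val_rev_iff.2 h5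
      · cases h; exact Dart.eq_val_rev_iff.2 h6

theorem isColoring_vcomp {S T : Tangle} {f : (S.vcomp T).Arc → G} :
    (S.vcomp T).IsColoring f ↔ S.IsColoring (f ∘ Sum.inl) ∧ T.IsColoring (f ∘ Sum.inr) ∧
      T.nw.val (f ∘ Sum.inr) = (S.sw.val (f ∘ Sum.inl))⁻¹ ∧
      T.ne.val (f ∘ Sum.inr) = (S.se.val (f ∘ Sum.inl))⁻¹ := by
  constructor
  · rintro ⟨h, h'⟩
    refine ⟨⟨fun a b c hc => ?_, fun a b hc => ?_⟩, ⟨fun a b c hc => ?_, fun a b hc => ?_⟩, ?_, ?_⟩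
    · exact h (a.map _) (b.map _) (c.map _) (Or.inl ⟨_, hc, rfl⟩)
    · exact h' (a.map _) (b.map _) (Or.inl (Or.inl ⟨_, hc, rfl⟩))
    · exact h (a.map _) (b.map _) (c.map _) (Or.inr ⟨_, hc, rfl⟩)
    · exact h' (a.map _) (b.map _) (Or.inl (Or.inr ⟨_, hc, rfl⟩))
    · exact Dart.eq_val_rev_iff.1 (h' _ _ (Or.inr (Or.inl rfl)))
    · exact Dart.eq_val_rev_iff.1 (h' _ _ (Or.inr (Or.inr rfl)))
  · rintro ⟨⟨h1, h2⟩, ⟨h3, h4⟩, h5, h6⟩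
    constructor
    · rintro _ _ _ (⟨⟨a, b, c⟩, hc, h⟩ | ⟨⟨a, b, c⟩, hc, h⟩)
      · cases h; exact h1 a b c hc
      · cases h; exact h3 a b c hc
    · rintro _ _ ((⟨⟨a, b⟩, hc, h⟩ | ⟨⟨a, b⟩, hc, h⟩) | (h | h))
      · cases h; exact h2 a b hc
      · cases h; exact h4 a b hc
      · cases h; exact Dart.eq_val_rev_iff.2 h5
      · cases h; exact Dart.eq_val_rev_iff.2 h6

theorem isClosed_hcomp {S T : Tangle} {W : Set (S.hcomp T).Arc} (h : (S.hcomp T).IsClosed W) :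
    S.IsClosed (Sum.inl ⁻¹' W) ∧ T.IsClosed (Sum.inr ⁻¹' W) ∧
      (S.ne.1 ∈ Sum.inl ⁻¹' W → T.nw.1 ∈ Sum.inr ⁻¹' W) ∧
      (S.se.1 ∈ Sum.inl ⁻¹' W → T.sw.1 ∈ Sum.inr ⁻¹' W) := by
  obtain ⟨h, h'⟩ := h
  refine ⟨⟨fun a b c hc => ?_, fun a b hc => ?_⟩, ⟨fun a b c hc => ?_, fun a b hc => ?_⟩, ?_, ?_⟩
  · exact h (a.map _) (b.map _) (c.map _) (Or.inl ⟨_, hc, rfl⟩)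
  · exact h' (a.map _) (b.map _) (Or.inl (Or.inl ⟨_, hc, rfl⟩))
  · exact h (a.map _) (b.map _) (c.map _) (Or.inr ⟨_, hc, rfl⟩)
  · exact h' (a.map _) (b.map _) (Or.inl (Or.inr ⟨_, hc, rfl⟩))
  · exact (h' _ _ (Or.inr (Or.inl rfl))).1
  · exact (h' _ _ (Or.inr (Or.inr rfl))).1

theorem isClosed_vcomp {S T : Tangle} {W : Set (S.vcomp T).Arc} (h : (S.vcomp T).IsClosed W) :
    S.IsClosed (Sum.inl ⁻¹' W) ∧ T.IsClosed (Sum.inr ⁻¹' W) ∧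
      (S.sw.1 ∈ Sum.inl ⁻¹' W → T.nw.1 ∈ Sum.inr ⁻¹' W) ∧
      (S.se.1 ∈ Sum.inl ⁻¹' W → T.ne.1 ∈ Sum.inr ⁻¹' W) := by
  obtain ⟨h, h'⟩ := h
  refine ⟨⟨fun a b c hc => ?_, fun a b hc => ?_⟩, ⟨fun a b c hc => ?_, fun a b hc => ?_⟩, ?_, ?_⟩
  · exact h (a.map _) (b.map _) (c.map _) (Or.inl ⟨_, hc, rfl⟩)
  · exact h' (a.map _) (b.map _) (Or.inl (Or.inl ⟨_, hc, rfl⟩))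
  · exact h (a.map _) (b.map _) (c.map _) (Or.inr ⟨_, hc, rfl⟩)
  · exact h' (a.map _) (b.map _) (Or.inl (Or.inr ⟨_, hc, rfl⟩))
  · exact (h' _ _ (Or.inr (Or.inl rfl))).1
  · exact (h' _ _ (Or.inr (Or.inr rfl))).1

/-- A tangle that acts like `n` horizontal twists. -/
structure IsHTwist (T : Tangle) (n : ℤ) : Prop where
  gen : ∀ W, T.IsClosed W → T.nw.1 ∈ W → T.sw.1 ∈ W → ∀ a, a ∈ W
  ends : ∀ {G : Type} [Group G] (f : T.Arc → G), T.IsColoring f →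
    (T.ne.val f, T.se.val f) = (twist ^ n) ((T.nw.val f)⁻¹, (T.sw.val f)⁻¹)
  exists_coloring : ∀ {G : Type} [Group G] (b d : G), ∃ f : T.Arc → G, T.IsColoring f ∧
    T.nw.val f = b ∧ T.sw.val f = d

/-- A tangle that acts like `n` vertical twists. -/
structure IsVTwist (T : Tangle) (n : ℤ) : Prop where
  gen : ∀ W, T.IsClosed W → T.nw.1 ∈ W → T.ne.1 ∈ W → ∀ a, a ∈ W
  ends : ∀ {G : Type} [Group G] (f : T.Arc → G), T.IsColoring f →
    ((T.sw.val f)⁻¹, (T.se.val f)⁻¹) = (twist ^ n) (T.nw.val f, T.ne.val f)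
  exists_coloring : ∀ {G : Type} [Group G] (b d : G), ∃ f : T.Arc → G, T.IsColoring f ∧
    T.nw.val f = b ∧ T.ne.val f = d

theorem IsHTwist.hcomp {S T : Tangle} {n k : ℤ} (hS : S.IsHTwist n) (hT : T.IsHTwist k) :
    (S.hcomp T).IsHTwist (n + k) where
  gen W hW h1 h2 := by
    obtain ⟨c1, c2, c3, c4⟩ := isClosed_hcomp hW
    have hl := hS.gen _ c1 h1 h2
    have hr := hT.gen _ c2 (c3 (hl _)) (c4 (hl _))
    rintro (a | a)
    exacts [hl a, hr a]
  ends f hf := by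
    obtain ⟨h1, h2, h3, h4⟩ := isColoring_hcomp.1 hf
    have e1 := hS.ends _ h1
    have e2 := hT.ends _ h2
    rw [h3, h4, inv_inv, inv_inv, e1, ← Equiv.Perm.mul_apply, ← zpow_add, add_comm] at e2
    exact e2
  exists_coloring b d := by
    obtain ⟨f, hf, h1, h2⟩ := hS.exists_coloring b d
    obtain ⟨g, hg, h3, h4⟩ := hT.exists_coloring (S.ne.val f)⁻¹ (S.se.val f)⁻¹
    exact ⟨Sum.elim f g, isColoring_hcomp.2 ⟨hf, hg, h3, h4⟩, h1, h2⟩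

theorem IsVTwist.vcomp {S T : Tangle} {n k : ℤ} (hS : S.IsVTwist n) (hT : T.IsVTwist k) :
    (S.vcomp T).IsVTwist (n + k) where
  gen W hW h1 h2 := by
    obtain ⟨c1, c2, c3, c4⟩ := isClosed_vcomp hW
    have hl := hS.gen _ c1 h1 h2
    have hr := hT.gen _ c2 (c3 (hl _)) (c4 (hl _))
    rintro (a | a)
    exacts [hl a, hr a]
  ends f hf := by
    obtain ⟨h1, h2, h3, h4⟩ := isColoring_vcomp.1 hf
    have e1 := hS.ends _ h1
    have e2 := hT.ends _ h2
    rw [h3, h4, e1, ← Equiv.Perm.mul_apply, ← zpow_add, add_comm] at e2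
    exact e2
  exists_coloring b d := by
    obtain ⟨f, hf, h1, h2⟩ := hS.exists_coloring b d
    obtain ⟨g, hg, h3, h4⟩ := hT.exists_coloring (S.sw.val f)⁻¹ (S.se.val f)⁻¹
    exact ⟨Sum.elim f g, isColoring_vcomp.2 ⟨hf, hg, h3, h4⟩, h1, h2⟩

theorem isHTwist_zero : zero.IsHTwist 0 where
  gen W _ h1 h2 a := by
    change Fin 2 at a
    fin_cases a <;> assumption
  ends f _ := by simp [zero, Dart.val]
  exists_coloring b d := ⟨![b, d], ⟨by rintro _ _ _ ⟨⟩, by rintro _ _ ⟨⟩⟩, rfl, rfl⟩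

theorem isVTwist_infinity : infinity.IsVTwist 0 where
  gen W _ h1 h2 a := by
    change Fin 2 at a
    fin_cases a <;> assumption
  ends f _ := by simp [infinity, Dart.val]
  exists_coloring b d := ⟨![b, d], ⟨by rintro _ _ _ ⟨⟩, by rintro _ _ ⟨⟩⟩, rfl, rfl⟩

theorem isColoring_one {f : one.Arc → G} :
    one.IsColoring f ↔ f (2 : Fin 3) = (f (0 : Fin 3))⁻¹ * (f (1 : Fin 3))⁻¹ * f (0 : Fin 3) := by
  constructor
  · intro h
    have := h.1 _ _ _ rfl
    simpa [Dart.val] using this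
  · intro h
    refine ⟨?_, by rintro _ _ ⟨⟩⟩
    rintro _ _ _ ⟨⟩
    simpa [Dart.val] using h

theorem isColoring_negOne {f : negOne.Arc → G} :
    negOne.IsColoring f ↔
      f (1 : Fin 3) = f (0 : Fin 3) * (f (2 : Fin 3))⁻¹ * (f (0 : Fin 3))⁻¹ := by
  constructor
  · intro h
    have := h.1 _ _ _ rfl
    simpa [Dart.val] using this
  · intro h
    refine ⟨?_, by rintro _ _ ⟨⟩⟩
    rintro _ _ _ ⟨⟩
    simpa [Dart.val] using h

theorem isHTwist_one : one.IsHTwist 1 where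
  gen W hW h1 h2 a := by
    have h3 := (hW.1 _ _ _ rfl h1).1 h2
    change Fin 3 at a
    fin_cases a <;> assumption
  ends f hf := by
    have := isColoring_one.1 hf
    simp [one, Dart.val, twist, this]
  exists_coloring b d :=
    ⟨![b, d, b⁻¹ * d⁻¹ * b], isColoring_one.2 rfl, rfl, rfl⟩

theorem isVTwist_one : one.IsVTwist 1 where
  gen W hW h1 h2 a := by
    have h3 := (hW.1 _ _ _ rfl h1).2 h2
    change Fin 3 at a
    fin_cases a <;> assumption
  ends f hf := by
    have := isColoring_one.1 hf
    simp [one, Dart.val, twist, this, mul_assoc]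
  exists_coloring b d :=
    ⟨![b, b * d⁻¹ * b⁻¹, d], isColoring_one.2 (by simp [mul_assoc]), rfl, rfl⟩

theorem twist_zpow_neg_one (p : G × G) : (twist ^ (-1 : ℤ)) p = (p.2, p.2⁻¹ * p.1 * p.2) := by
  rw [zpow_neg_one]; rfl

theorem isHTwist_negOne : negOne.IsHTwist (-1) where
  gen W hW h1 h2 a := by
    have h3 := (hW.1 _ _ _ rfl h2).2 h1
    change Fin 3 at a
    fin_cases a <;> assumption
  ends f hf := by
    have := isColoring_negOne.1 hf
    rw [twist_zpow_neg_one]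
    simp [negOne, Dart.val, this, mul_assoc]
  exists_coloring b d :=
    ⟨![d⁻¹, b, d * b⁻¹ * d⁻¹], isColoring_negOne.2 (by simp [mul_assoc]), rfl, by simp [Dart.val, negOne]⟩

theorem isVTwist_negOne : negOne.IsVTwist (-1) where
  gen W hW h1 h2 a := by
    have h3 := (hW.1 _ _ _ rfl h2).2 h1
    change Fin 3 at a
    fin_cases a <;> assumption
  ends f hf := by
    have := isColoring_negOne.1 hf
    rw [twist_zpow_neg_one]
    simp [negOne, Dart.val, this, mul_assoc]
  exists_coloring b d :=
    ⟨![d, b, d⁻¹ * b⁻¹ * d], isColoring_negOne.2 (by simp [mul_assoc]), rfl, by simp [Dart.val, negOne]⟩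

theorem isHTwist_hcopies {T : Tangle} {k : ℤ} (hT : T.IsHTwist k) (n : ℕ) :
    (hcopies T n).IsHTwist (n * k) := by
  induction n with
  | zero => simpa [hcopies] using isHTwist_zero
  | succ n ih => simpa [add_mul, hcopies] using ih.hcomp hT

theorem isVTwist_vcopies {T : Tangle} {k : ℤ} (hT : T.IsVTwist k) (n : ℕ) :
    (vcopies T n).IsVTwist (n * k) := by
  induction n with
  | zero => simpa [vcopies] using isVTwist_infinity
  | succ n ih => simpa [add_mul, vcopies] using ih.vcomp hT

theorem isHTwist_hTwist (k : ℤ) : (hTwist k).IsHTwist k := by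
  cases k with
  | ofNat n =>
    have := isHTwist_hcopies isHTwist_one n
    rwa [mul_one] at this
  | negSucc n =>
    have := isHTwist_hcopies isHTwist_negOne (n + 1)
    rwa [mul_neg_one] at this

theorem isVTwist_vTwist (k : ℤ) : (vTwist k).IsVTwist k := by
  cases k with
  | ofNat n =>
    have := isVTwist_vcopies isVTwist_one n
    rwa [mul_one] at this
  | negSucc n =>
    have := isVTwist_vcopies isVTwist_negOne (n + 1)
    rwa [mul_neg_one] at this

/-- The relation between the four ends of a tangle. -/
def HasEndRelation (T : Tangle) : Prop :=
  ∀ {G : Type} [Group G] (f : T.Arc → G), T.IsColoring f →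
    T.nw.val f * T.ne.val f * T.se.val f * T.sw.val f = 1

/-- A twist preserves the product, as `(a b a⁻¹) a = a b`. The relation between the four ends of a
tangle, and with it the common product of the upper ends in a stack, comes from this. -/
theorem twist_zpow_mul (n : ℤ) (p : G × G) : ((twist ^ n) p).1 * ((twist ^ n) p).2 = p.1 * p.2 := by
  have h : ∀ p : G × G, (twist p).1 * (twist p).2 = p.1 * p.2 := fun p => by simp [twist]
  induction n using Int.induction_on generalizing p with
  | zero => simp
  | succ n ih => rw [zpow_add_one, Equiv.Perm.mul_apply, ih, h]
  | pred n ih =>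
    rw [zpow_sub_one, Equiv.Perm.mul_apply, ih]
    have := h (twist⁻¹ p)
    simpa using this.symm

theorem IsHTwist.hasEndRelation {T : Tangle} {n : ℤ} (hT : T.IsHTwist n) : T.HasEndRelation := by
  intro G _ f hf
  have := twist_zpow_mul n ((T.nw.val f)⁻¹, (T.sw.val f)⁻¹)
  rw [← hT.ends f hf] at this
  rw [mul_assoc _ (T.ne.val f), this]; simp

theorem IsVTwist.hasEndRelation {T : Tangle} {n : ℤ} (hT : T.IsVTwist n) : T.HasEndRelation := by
  intro G _ f hf
  have := twist_zpow_mul n (T.nw.val f, T.ne.val f)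
  rw [← hT.ends f hf] at this
  rw [← this]; simp

theorem HasEndRelation.hcomp {S T : Tangle} (hS : S.HasEndRelation) (hT : T.HasEndRelation) :
    (S.hcomp T).HasEndRelation := by
  intro G _ f hf
  obtain ⟨h1, h2, h3, h4⟩ := isColoring_hcomp.1 hf
  have e1 := hS _ h1
  have e2 := hT _ h2
  rw [h3, h4] at e2
  have e3 : T.ne.val (f ∘ Sum.inr) * T.se.val (f ∘ Sum.inr) =
      S.ne.val (f ∘ Sum.inl) * S.se.val (f ∘ Sum.inl) := by
    rw [mul_inv_eq_one, mul_assoc, inv_mul_eq_iff_eq_mul] at e2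
    exact e2
  change S.nw.val (f ∘ Sum.inl) * T.ne.val (f ∘ Sum.inr) * T.se.val (f ∘ Sum.inr) *
    S.sw.val (f ∘ Sum.inl) = 1
  rw [mul_assoc (S.nw.val (f ∘ Sum.inl)), e3, ← mul_assoc, e1]

theorem HasEndRelation.vcomp {S T : Tangle} (hS : S.HasEndRelation) (hT : T.HasEndRelation) :
    (S.vcomp T).HasEndRelation := by
  intro G _ f hf
  obtain ⟨h1, h2, h3, h4⟩ := isColoring_vcomp.1 hf
  have e1 := hS _ h1
  have e2 := hT _ h2
  rw [h3, h4] at e2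
  change S.nw.val (f ∘ Sum.inl) * S.ne.val (f ∘ Sum.inl) * T.se.val (f ∘ Sum.inr) *
    T.sw.val (f ∘ Sum.inr) = 1
  have e3 : T.se.val (f ∘ Sum.inr) * T.sw.val (f ∘ Sum.inr) =
      S.se.val (f ∘ Sum.inl) * S.sw.val (f ∘ Sum.inl) := by
    rw [mul_assoc _ (T.se.val _), ← mul_inv_rev, inv_mul_eq_one] at e2
    exact e2.symm
  rw [mul_assoc _ (T.se.val _), e3, ← mul_assoc, e1]

end Tangle

/-! ### Rational tangles -/

/-- The arcs are generated by the end `nw` and the marked arc, which are independent. -/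
structure MarkedTangle.IsFree (R : MarkedTangle) : Prop where
  gen : ∀ W, R.IsClosed W → R.nw.1 ∈ W → R.y₀.1 ∈ W → ∀ a, a ∈ W
  exists_coloring : ∀ {G : Type} [Group G] (x y : G), ∃ f : R.Arc → G, R.IsColoring f ∧
    R.nw.val f = x ∧ R.y₀.val f = y
  rel : R.HasEndRelation

theorem MarkedTangle.IsFree.hcomp {R : MarkedTangle} (hR : R.IsFree) {T : Tangle} {n : ℤ}
    (hT : T.IsHTwist n) : (⟨R.hcomp T, R.y₀.map Sum.inl⟩ : MarkedTangle).IsFree where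
  gen W hW h1 h2 := by
    obtain ⟨c1, c2, c3, c4⟩ := Tangle.isClosed_hcomp hW
    have hl := hR.gen _ c1 h1 h2
    have hr := hT.gen _ c2 (c3 (hl _)) (c4 (hl _))
    rintro (a | a)
    exacts [hl a, hr a]
  exists_coloring b d := by
    obtain ⟨f, hf, h1, h2⟩ := hR.exists_coloring b d
    obtain ⟨g, hg, h3, h4⟩ := hT.exists_coloring (R.ne.val f)⁻¹ (R.se.val f)⁻¹
    exact ⟨Sum.elim f g, Tangle.isColoring_hcomp.2 ⟨hf, hg, h3, h4⟩, h1, h2⟩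
  rel := Tangle.HasEndRelation.hcomp hR.rel hT.hasEndRelation

theorem MarkedTangle.IsFree.vcomp {R : MarkedTangle} (hR : R.IsFree) {T : Tangle} {n : ℤ}
    (hT : T.IsVTwist n) : (⟨R.vcomp T, R.y₀.map Sum.inl⟩ : MarkedTangle).IsFree where
  gen W hW h1 h2 := by
    obtain ⟨c1, c2, c3, c4⟩ := Tangle.isClosed_vcomp hW
    have hl := hR.gen _ c1 h1 h2
    have hr := hT.gen _ c2 (c3 (hl _)) (c4 (hl _))
    rintro (a | a)
    exacts [hl a, hr a]
  exists_coloring b d := by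
    obtain ⟨f, hf, h1, h2⟩ := hR.exists_coloring b d
    obtain ⟨g, hg, h3, h4⟩ := hT.exists_coloring (R.sw.val f)⁻¹ (R.se.val f)⁻¹
    exact ⟨Sum.elim f g, Tangle.isColoring_vcomp.2 ⟨hf, hg, h3, h4⟩, h1, h2⟩
  rel := Tangle.HasEndRelation.vcomp hR.rel hT.hasEndRelation

theorem isFree_extendTangle (l : List ℤ) : ∀ (b : Bool) (R : MarkedTangle), R.IsFree →
    (extendTangle b R l).IsFree := by
  induction l with
  | nil => intro b R hR; cases b <;> exact hR
  | cons k l ih =>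
    rintro (_ | _) R hR
    · exact ih _ _ (hR.vcomp (Tangle.isVTwist_vTwist k))
    · exact ih _ _ (hR.hcomp (Tangle.isHTwist_hTwist k))

theorem isFree_hTwist (k : ℤ) :
    (⟨Tangle.hTwist k, (Tangle.hTwist k).sw.rev⟩ : MarkedTangle).IsFree where
  gen W hW h1 h2 := (Tangle.isHTwist_hTwist k).gen W hW h1 h2
  exists_coloring x y := by
    obtain ⟨f, hf, h1, h2⟩ := (Tangle.isHTwist_hTwist k).exists_coloring x y⁻¹
    exact ⟨f, hf, h1, by rw [Dart.val_rev, h2, inv_inv]⟩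
  rel := (Tangle.isHTwist_hTwist k).hasEndRelation

theorem isFree_vTwist (k : ℤ) :
    (⟨Tangle.vTwist k, (Tangle.vTwist k).ne⟩ : MarkedTangle).IsFree where
  gen W hW h1 h2 := (Tangle.isVTwist_vTwist k).gen W hW h1 h2
  exists_coloring x y := (Tangle.isVTwist_vTwist k).exists_coloring x y
  rel := (Tangle.isVTwist_vTwist k).hasEndRelation

theorem isFree_rational (k : List ℤ) : (rational k).IsFree := by
  rcases k with _ | ⟨k, l⟩
  · exact isFree_hTwist 0
  · rw [rational]
    split_ifs
    · exact isFree_extendTangle _ _ _ (isFree_hTwist k)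
    · exact isFree_extendTangle _ _ _ (isFree_vTwist k)

/-- A horizontal block twists the pair (`ne`, `se`), a vertical one the pair (`sw⁻¹`, `se⁻¹`). So
the two halves of the pair exchange their roles with each block, and the third entry of the
recursion is inverted. The parity hypothesis makes the last remaining block horizontal, which fixes
the order of the resulting pair. -/
theorem extendTangle_ends {G : Type} [Group G] (l : List ℤ) :
    ∀ (b : Bool) (R : MarkedTangle) (f : (extendTangle b R l).Arc → G),
      (extendTangle b R l).IsColoring f → (b = true ↔ Odd l.length) →
      ∃ g : R.Arc → G, R.IsColoring g ∧ (extendTangle b R l).nw.val f = R.nw.val g ∧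
        (extendTangle b R l).y₀.val f = R.y₀.val g ∧
        (((extendTangle b R l).sw.val f)⁻¹, (extendTangle b R l).ne.val f) =
          if b then tangleRec (R.ne.val g) (R.sw.val g)⁻¹ (R.se.val g) l
          else tangleRec (R.sw.val g)⁻¹ (R.ne.val g) (R.se.val g)⁻¹ l := by
  induction l with
  | nil =>
    rintro (_ | _) R f hf hb
    · exact ⟨f, hf, rfl, rfl, rfl⟩
    · simp at hb
  | cons k l ih =>
    rintro (_ | _) R f hf hb
    · obtain ⟨g, hg, h1, h2, h3⟩ := ih true ⟨R.vcomp (Tangle.vTwist k), R.y₀.map Sum.inl⟩ f hf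
        (by simp only [List.length_cons, Nat.odd_add_one] at hb; simpa using hb)
      obtain ⟨c1, c2, c3, c4⟩ := Tangle.isColoring_vcomp.1 hg
      refine ⟨g ∘ Sum.inl, c1, h1, h2, h3.trans ?_⟩
      have e := (Tangle.isVTwist_vTwist k).ends _ c2
      rw [c3, c4] at e
      simp only [if_true, Bool.false_eq_true, if_false, tangleRec, ← e]
      simp only [inv_inv]
      rfl
    · obtain ⟨g, hg, h1, h2, h3⟩ := ih false ⟨R.hcomp (Tangle.hTwist k), R.y₀.map Sum.inl⟩ f hf
        (by simp only [List.length_cons, Nat.odd_add_one] at hb; simpa using hb)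
      obtain ⟨c1, c2, c3, c4⟩ := Tangle.isColoring_hcomp.1 hg
      refine ⟨g ∘ Sum.inl, c1, h1, h2, h3.trans ?_⟩
      have e := (Tangle.isHTwist_hTwist k).ends _ c2
      rw [c3, c4, inv_inv, inv_inv] at e
      simp only [if_true, Bool.false_eq_true, if_false, tangleRec, ← e]
      rfl

/-- The lower left and the upper right end of a rational tangle in terms of the generators. -/
theorem rational_ends {G : Type} [Group G] {k : List ℤ} (hk : k ≠ []) (f : (rational k).Arc → G)
    (hf : (rational k).IsColoring f) :
    (((rational k).sw.val f)⁻¹, (rational k).ne.val f) =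
      tangleRec (if Even k.length then (rational k).nw.val f else ((rational k).nw.val f)⁻¹)
        ((rational k).y₀.val f) ((rational k).y₀.val f) k := by
  rcases k with _ | ⟨k, l⟩
  · exact absurd rfl hk
  · simp only [List.length_cons, Nat.even_add_one]
    by_cases h : Even l.length
    · have e : rational (k :: l) =
          extendTangle false ⟨Tangle.hTwist k, (Tangle.hTwist k).sw.rev⟩ l := if_pos h
      revert f hf
      rw [e]
      intro f hf
      obtain ⟨g, hg, h1, h2, h3⟩ := extendTangle_ends l false _ f hf (by simpa using h)
      rw [h3, h1, h2, if_neg (not_not.2 h)]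
      simp only [Bool.false_eq_true, if_false, tangleRec, Dart.val_rev]
      have e := (Tangle.isHTwist_hTwist k).ends g hg
      rw [← e]
    · have e : rational (k :: l) =
          extendTangle true ⟨Tangle.vTwist k, (Tangle.vTwist k).ne⟩ l := if_neg h
      revert f hf
      rw [e]
      intro f hf
      obtain ⟨g, hg, h1, h2, h3⟩ := extendTangle_ends l true _ f hf (by simpa using h)
      rw [h3, h1, h2, if_pos h]
      simp only [if_true, tangleRec]
      have e := (Tangle.isVTwist_vTwist k).ends g hg
      rw [← e]
      simp only [inv_inv]

end Montesinos
end

noncomputable section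

namespace Montesinos

/-! ### The fraction -/

/-- Numerators of successive convergents: from `(p_{j-1}, p_{j-2})` and `[kⱼ, …, kₛ]` compute
`(pₛ, p_{s-1})`. -/
def fracRec : ℤ → ℤ → List ℤ → ℤ × ℤ
  | a, b, [] => (a, b)
  | a, b, k :: l => fracRec (k * a + b) a l

/-- Numerator of the fraction. -/
def fracNum (k : List ℤ) : ℤ := (fracRec 1 0 k).1

/-- Denominator of the fraction. -/
def fracDen (k : List ℤ) : ℤ := (fracRec 1 0 k).2

theorem isCoprime_fracRec (l : List ℤ) : ∀ a b : ℤ, IsCoprime a b →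
    IsCoprime (fracRec a b l).1 (fracRec a b l).2 := by
  induction l with
  | nil => intro a b h; exact h
  | cons k l ih =>
    intro a b h
    refine ih _ _ ?_
    rw [mul_comm, IsCoprime.mul_add_left_left_iff]
    exact h.symm

theorem isCoprime_frac (k : List ℤ) : IsCoprime (fracNum k) (fracDen k) :=
  isCoprime_fracRec k 1 0 isCoprime_one_left

/-- `HasFraction` extends lists at the end, whereas `fracRec` consumes them from the head; this is
the bridge. -/
theorem fracRec_append (l : List ℤ) (k : ℤ) : ∀ a b : ℤ, fracRec a b (l ++ [k]) =
    (k * (fracRec a b l).1 + (fracRec a b l).2, (fracRec a b l).1) := by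
  induction l with
  | nil => intro a b; rfl
  | cons k l ih => intro a b; exact ih _ _

theorem HasFraction.eq_div {k : List ℤ} {q : ℚ} (h : HasFraction k q) :
    fracDen k ≠ 0 ∧ q = fracNum k / fracDen k := by
  induction h with
  | single k => simp [fracNum, fracDen, fracRec]
  | @snoc l q k _ hq ih =>
    have h1 : fracNum l ≠ 0 := by
      intro h0; rw [h0] at ih; simp at ih; exact hq ih.2
    have e := fracRec_append l k 1 0
    have e1 : fracNum (l ++ [k]) = k * fracNum l + fracDen l := congrArg Prod.fst e
    have e2 : fracDen (l ++ [k]) = fracNum l := congrArg Prod.snd e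
    rw [e1, e2]
    refine ⟨h1, ?_⟩
    have : (fracNum l : ℚ) ≠ 0 := by exact_mod_cast h1
    rw [ih.2]
    push_cast
    field_simp

theorem HasFraction.ne_nil {k : List ℤ} {q : ℚ} (h : HasFraction k q) : k ≠ [] := by
  cases h <;> simp

theorem HasFraction.odd_num_iff {k : List ℤ} {q : ℚ} (h : HasFraction k q) :
    Odd q.num ↔ Odd (fracNum k) := by
  obtain ⟨h1, h2⟩ := h.eq_div
  have hc := Int.isCoprime_iff_gcd_eq_one.1 (isCoprime_frac k)
  -- The denominator computed by the recursion may be negative; changing both signs does not affect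
  -- parity.
  rcases lt_or_gt_of_ne h1 with hd | hd
  · have e : q = ((-fracNum k : ℤ) : ℚ) / ((-fracDen k : ℤ) : ℚ) := by
      rw [h2]; push_cast; rw [neg_div_neg_eq]
    rw [e, Rat.num_div_eq_of_coprime (by omega) (by simpa [Int.gcd] using hc), odd_neg]
  · rw [h2, Rat.num_div_eq_of_coprime hd hc]

/-! ### Colorings modulo two -/

section Parity

/-- The group with two elements. -/
abbrev Two : Type := Multiplicative (ZMod 2)

theorem two_inv (a : Two) : a⁻¹ = a := by
  change Multiplicative.ofAdd (-(Multiplicative.toAdd a)) = a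
  rw [ZModModule.neg_eq_self]; rfl

theorem two_mul_self (a : Two) : a * a = 1 := by
  nth_rw 2 [← two_inv a]; simp

theorem twist_two (p : Two × Two) : twist p = p.swap := by
  simp [twist, Prod.swap]

theorem twist_zpow_two (k : ℤ) (p : Two × Two) :
    (twist ^ k) p = if Even k then p else p.swap := by
  have h2 : (twist : Equiv.Perm (Two × Two)) ^ 2 = 1 := by
    ext1 p; rw [sq, Equiv.Perm.mul_apply, twist_two, twist_two]; simp
  split_ifs with h
  · obtain ⟨j, rfl⟩ := h
    rw [← two_mul, zpow_mul]
    norm_cast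
    rw [h2]; simp
  · obtain ⟨j, rfl⟩ := Int.not_even_iff_odd.1 h
    rw [zpow_add, zpow_mul]
    norm_cast
    rw [h2]; simp [twist_two]

theorem two_zpow (d : Two) (n : ℤ) : d ^ n = if Even n then 1 else d := by
  split_ifs with h
  · obtain ⟨j, rfl⟩ := h
    rw [← two_mul, zpow_mul]; norm_cast; rw [sq, two_mul_self]; simp
  · obtain ⟨j, rfl⟩ := Int.not_even_iff_odd.1 h
    rw [zpow_add, zpow_mul]; norm_cast; rw [sq, two_mul_self]; simp

/-- In `Two` a twist just swaps the pair, so only the parity of each `k` matters. Written as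
exponents of `d`, the ends then satisfy the recursion of the convergents modulo two. -/
theorem tangleRec_two (c d : Two) (l : List ℤ) : ∀ a b : ℤ,
    tangleRec (c * d ^ b) (c * d ^ a) (c * d ^ (a + b)) l =
      (c * d ^ (fracRec a b l).2, c * d ^ (fracRec a b l).1) := by
  induction l with
  | nil => intro a b; rfl
  | cons k l ih =>
    intro a b
    rw [tangleRec, fracRec, ← ih, twist_zpow_two, two_inv]
    simp only [two_zpow]
    by_cases hk : Even k <;> by_cases ha : Even a <;> by_cases hb : Even b <;>
      simp [Int.even_add, Int.even_mul, hk, ha, hb]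

theorem rational_ends_two {k : List ℤ} (hk : k ≠ []) {f : (rational k).Arc → Two}
    (hf : (rational k).IsColoring f) {c d : Two} (hx : (rational k).nw.val f = c)
    (hy : (rational k).y₀.val f = c * d) :
    (rational k).ne.val f = c * d ^ fracNum k ∧ (rational k).sw.val f = c * d ^ fracDen k ∧
      (rational k).se.val f = c * d ^ (fracNum k + fracDen k) := by
  have h := rational_ends hk f hf
  have h2 := tangleRec_two c d k 1 0
  simp only [add_zero, zpow_zero, mul_one, zpow_one] at h2
  rw [two_inv, hx, hy, two_inv, ite_self, h2] at h
  have e1 : (rational k).ne.val f = c * d ^ fracNum k := congrArg Prod.snd h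
  have e2 : (rational k).sw.val f = c * d ^ fracDen k := congrArg Prod.fst h
  refine ⟨e1, e2, ?_⟩
  have := (isFree_rational k).rel f hf
  rw [hx, e1, e2] at this
  have e3 : (rational k).se.val f = c * (c * d ^ fracNum k) * (c * d ^ fracDen k) := by
    rw [← two_inv ((rational k).se.val f), inv_eq_iff_mul_eq_one, ← this]
    simp only [mul_assoc, mul_comm, mul_left_comm]
  rw [e3, zpow_add, ← mul_assoc c c, two_mul_self, one_mul, mul_left_comm]

end Parity

/-! ### Strands of a rational tangle -/

/-- The arcs lying on the strand of a generator form a closed set, so there are no closed components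
inside a rational tangle. -/
theorem Diagram.sameDir_cases (k : List ℤ) (a : Dart (rational k).Arc) :
    (rational k).SameDir a (rational k).nw ∨ (rational k).SameDir a (rational k).nw.rev ∨
      (rational k).SameDir a (rational k).y₀ ∨ (rational k).SameDir a (rational k).y₀.rev := by
  let R := rational k
  let P : Dart R.Arc → Prop := fun a => R.SameDir a R.nw ∨ R.SameDir a R.nw.rev ∨
      R.SameDir a R.y₀ ∨ R.SameDir a R.y₀.rev
  have hrev : ∀ a, P a → P a.rev := by
    rintro a (h | h | h | h)
    · exact Or.inr (Or.inl h.rev)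
    · exact Or.inl (by simpa only [Dart.rev_rev] using h.rev)
    · exact Or.inr (Or.inr (Or.inr h.rev))
    · exact Or.inr (Or.inr (Or.inl (by simpa only [Dart.rev_rev] using h.rev)))
  have hsame : ∀ a b, R.SameDir a b → P b → P a := by
    rintro a b hab (h | h | h | h)
    · exact Or.inl (hab.trans _ _ _ h)
    · exact Or.inr (Or.inl (hab.trans _ _ _ h))
    · exact Or.inr (Or.inr (Or.inl (hab.trans _ _ _ h)))
    · exact Or.inr (Or.inr (Or.inr (hab.trans _ _ _ h)))
  have key : ∀ a : Dart R.Arc, a.1 ∈ {a | P (a, true)} ↔ P a := by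
    rintro ⟨a, b⟩
    cases b
    · exact ⟨hrev _, hrev _⟩
    · exact Iff.rfl
  refine (key a).1 ((isFree_rational k).gen {a | P (a, true)} ⟨?_, ?_⟩ ?_ ?_ a.1)
  · intro a b c h _
    rw [key, key]
    have := Relation.EqvGen.rel _ _ (Diagram.Step.under h)
    exact ⟨hsame _ _ this.symm, hsame _ _ this⟩
  · intro a b h
    rw [key, key]
    have := Relation.EqvGen.rel _ _ (Diagram.Step.join h)
    exact ⟨hsame _ _ this.symm, hsame _ _ this⟩
  · rw [key]; exact Or.inl (.refl _)
  · rw [key]; exact Or.inr (Or.inr (Or.inl (.refl _)))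

/-- The coloring modulo two that is trivial at `nw` and non-trivial at the marked arc. -/
theorem exists_parity_coloring {k : List ℤ} (hk : k ≠ []) : ∃ f : (rational k).Arc → Two,
    (rational k).IsColoring f ∧ (rational k).nw.val f = 1 ∧
      (rational k).y₀.val f = Multiplicative.ofAdd 1 ∧
      ((rational k).ne.val f = 1 ↔ Even (fracNum k)) ∧
      ((rational k).sw.val f = 1 ↔ Even (fracDen k)) ∧
      ((rational k).se.val f = 1 ↔ Even (fracNum k + fracDen k)) := by
  obtain ⟨f, hf, h1, h2⟩ :=
    (isFree_rational k).exists_coloring (1 : Two) (Multiplicative.ofAdd 1)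
  obtain ⟨e1, e2, e3⟩ := rational_ends_two hk hf h1 (by rw [h2, one_mul])
  have hne : (Multiplicative.ofAdd 1 : Two) ≠ 1 := by decide
  refine ⟨f, hf, h1, h2, ?_, ?_, ?_⟩
  · rw [e1, two_zpow]; split_ifs with h <;> simp [h, hne]
  · rw [e2, two_zpow]; split_ifs with h <;> simp [h, hne]
  · rw [e3, two_zpow]; split_ifs with h <;> simp [h, hne]

theorem sameDir_y₀_of_parity {k : List ℤ} {f : (rational k).Arc → Two}
    (hf : (rational k).IsColoring f) (h1 : (rational k).nw.val f = 1)
    {a : Dart (rational k).Arc} (ha : a.val f ≠ 1) :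
    (rational k).SameDir a (rational k).y₀ ∨ (rational k).SameDir a (rational k).y₀.rev := by
  rcases Diagram.sameDir_cases k a with h | h | h | h
  · exact absurd (by rw [h.val_eq_of_comm hf, h1]) ha
  · exact absurd (by rw [h.val_eq_of_comm hf, Dart.val_rev, h1, inv_one]) ha
  · exact Or.inl h
  · exact Or.inr h

theorem sameDir_nw_of_parity {k : List ℤ} {f : (rational k).Arc → Two}
    (hf : (rational k).IsColoring f) (h1 : (rational k).y₀.val f = Multiplicative.ofAdd 1)
    {a : Dart (rational k).Arc} (ha : a.val f = 1) :
    (rational k).SameDir a (rational k).nw ∨ (rational k).SameDir a (rational k).nw.rev := by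
  have hne : (Multiplicative.ofAdd 1 : Two) ≠ 1 := by decide
  rcases Diagram.sameDir_cases k a with h | h | h | h
  · exact Or.inl h
  · exact Or.inr h
  · exact absurd (by rw [← h1, ← h.val_eq_of_comm hf, ha]) hne
  · exact absurd (by rw [← h1, ← inv_inj, ← Dart.val_rev, ← h.val_eq_of_comm hf, ha, inv_one]) hne

/-- For even `p` the parity coloring puts `ne` on the strand of `nw`, and both lower ends on the
other strand. In the integral coloring with value 1 at `nw` and 0 at the marked arc, the end
relation then says that the values at `nw` and `ne` add up to 0, so the directions are opposite. -/
theorem sameDir_nw_rev_ne {k : List ℤ} (hk : k ≠ []) (hp : Even (fracNum k)) :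
    (rational k).SameDir (rational k).ne (rational k).nw.rev := by
  obtain ⟨f, hf, h1, h2, e1, e2, e3⟩ := exists_parity_coloring hk
  have hq : ¬ Even (fracDen k) := by
    intro hq
    have := Int.isCoprime_iff_gcd_eq_one.1 (isCoprime_frac k)
    have h2 := Int.dvd_coe_gcd hp.two_dvd hq.two_dvd
    rw [this] at h2; norm_num at h2
  obtain ⟨g, hg, g1, g2⟩ :=
    (isFree_rational k).exists_coloring (Multiplicative.ofAdd (1 : ℤ)) 1
  have key : ∀ a : Dart (rational k).Arc, a.val f ≠ 1 → a.val g = 1 := by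
    intro a ha
    rcases sameDir_y₀_of_parity hf h1 ha with h | h
    · rw [h.val_eq_of_comm hg, g2]
    · rw [h.val_eq_of_comm hg, Dart.val_rev, g2, inv_one]
  have hsw := key _ (mt e2.1 hq)
  have hse := key _ (mt e3.1 (by rw [Int.even_add]; tauto))
  have hrel := (isFree_rational k).rel g hg
  rw [hsw, hse, mul_one, mul_one, g1] at hrel
  rcases sameDir_nw_of_parity hf h2 (e1.2 hp) with h | h
  · rw [h.val_eq_of_comm hg, g1] at hrel
    exact absurd hrel (by decide)
  · exact h

/-- In a coloring by a commutative group for which `nw`, `ne` have the same value, different from its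
inverse, the second generator has this value too. -/
theorem genY_val {G : Type} [CommGroup G] {k : List ℤ} (hk : k ≠ []) {g : (rational k).Arc → G}
    (hg : (rational k).IsColoring g) {κ : G} (hκ : κ ≠ κ⁻¹) (h1 : (rational k).nw.val g = κ)
    (h2 : (rational k).ne.val g = κ) : Odd (fracNum k) ∧ (genY k).val g = κ := by
  have hp : ¬ Even (fracNum k) := by
    intro hp
    have := (sameDir_nw_rev_ne hk hp).val_eq_of_comm hg
    rw [Dart.val_rev, h1, h2] at this
    exact hκ this
  refine ⟨Int.not_even_iff_odd.1 hp, ?_⟩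
  obtain ⟨f, hf, f1, f2, e1, -, -⟩ := exists_parity_coloring hk
  have hne := mt e1.1 hp
  unfold genY
  split_ifs with h
  · rcases h with h | ⟨h | h, -⟩
    · rw [h.val_eq_of_comm hg, h2]
    · rw [← h.val_eq_of_comm hf, f1] at hne; exact absurd rfl hne
    · rw [← h.val_eq_of_comm hf, Dart.val_rev, f1, inv_one] at hne; exact absurd rfl hne
  · rcases sameDir_y₀_of_parity hf f1 hne with h' | h'
    · exact absurd (Or.inl h'.symm) h
    · rw [← h2, h'.val_eq_of_comm hg]

/-! ### The rational links -/

theorem Diagram.SameDir.numerator {T : Tangle} {a b : Dart T.Arc} (h : T.SameDir a b) :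
    T.numerator.SameDir a b := by
  have key : ∀ a b, T.Step a b → T.numerator.Step a b := by
    intro a b h
    cases h with
    | under h => exact Diagram.Step.under (d := T.numerator) h
    | under_rev h => exact Diagram.Step.under_rev (d := T.numerator) h
    | join h => exact Diagram.Step.join (d := T.numerator) (Or.inl h)
    | join_rev h => exact Diagram.Step.join_rev (d := T.numerator) (Or.inl h)
  exact Relation.EqvGen.mono key _ _ h

/-- Two arcs on the same component. -/
def Diagram.Connected (d : Diagram) (a b : d.Arc) : Prop := ∃ v w : Bool, d.SameDir (a, v) (b, w)

theorem numerator_connected (k : List ℤ) (a : (rational k).numerator.Arc) :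
    (rational k).numerator.Connected a (rational k).nw.1 ∨
      (rational k).numerator.Connected a (rational k).y₀.1 := by
  rcases Diagram.sameDir_cases k (a, true) with h | h | h | h
  · exact Or.inl ⟨_, _, h.numerator⟩
  · exact Or.inl ⟨_, _, h.numerator⟩
  · exact Or.inr ⟨_, _, h.numerator⟩
  · exact Or.inr ⟨_, _, h.numerator⟩

theorem numerator_surjective (k : List ℤ) : Function.Surjective
    (fun b : Bool => (Quot.mk _ (if b then (rational k).nw.1 else (rational k).y₀.1) :
      Quot (rational k).numerator.Connected)) := by
  rintro ⟨a⟩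
  rcases numerator_connected k a with h | h
  · exact ⟨true, (Quot.sound h).symm⟩
  · exact ⟨false, (Quot.sound h).symm⟩

theorem numComponents_numerator (k : List ℤ) :
    (rational k).numerator.numComponents = 1 ∨ (rational k).numerator.numComponents = 2 := by
  have h1 : (rational k).numerator.numComponents ≤ 2 := by
    have := Nat.card_le_card_of_surjective _ (numerator_surjective k)
    rw [Nat.card_eq_fintype_card (α := Bool), Fintype.card_bool] at this
    exact this
  have : Finite (Quot (rational k).numerator.Connected) :=
    Finite.of_surjective _ (numerator_surjective k)
  have : Nonempty (Quot (rational k).numerator.Connected) := ⟨Quot.mk _ (rational k).nw.1⟩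
  have h2 : 0 < (rational k).numerator.numComponents :=
    Nat.card_pos (α := Quot (rational k).numerator.Connected)
  omega

/-- For odd `p` the end `ne` lies on the strand of the marked arc, and the numerator closure
connects it to `nw`; so the two strands become one component. -/
theorem isKnot_numerator {k : List ℤ} (hk : k ≠ []) (hp : Odd (fracNum k)) :
    (rational k).numerator.IsKnot := by
  obtain ⟨f, hf, f1, f2, e1, -, -⟩ := exists_parity_coloring hk
  have hne := mt e1.1 (Int.not_even_iff_odd.2 hp)
  have h1 : (Quot.mk _ (rational k).ne.1 : Quot (rational k).numerator.Connected) =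
      Quot.mk _ (rational k).y₀.1 := by
    rcases sameDir_y₀_of_parity hf f1 hne with h | h
    · exact Quot.sound ⟨_, _, h.numerator⟩
    · exact Quot.sound ⟨_, _, h.numerator⟩
  have h2 : (Quot.mk _ (rational k).nw.1 : Quot (rational k).numerator.Connected) =
      Quot.mk _ (rational k).ne.1 :=
    Quot.sound ⟨_, _, .rel _ _ (.join (Or.inr (Or.inl rfl)))⟩
  have : Subsingleton (Quot (rational k).numerator.Connected) := by
    refine ⟨fun a b => ?_⟩
    obtain ⟨u, rfl⟩ := numerator_surjective k a
    obtain ⟨v, rfl⟩ := numerator_surjective k b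
    have h3 := h2.trans h1
    cases u <;> cases v <;> first | rfl | exact h3 | exact h3.symm
  have : Nonempty (Quot (rational k).numerator.Connected) := ⟨Quot.mk _ (rational k).nw.1⟩
  exact Nat.card_eq_one_iff_unique.2
    ⟨(inferInstance : Subsingleton (Quot (rational k).numerator.Connected)), this⟩

theorem isColoring_numerator {G : Type} [Group G] {T : Tangle} {f : T.Arc → G} :
    T.numerator.IsColoring f ↔
      T.IsColoring f ∧ T.nw.val f = (T.ne.val f)⁻¹ ∧ T.sw.val f = (T.se.val f)⁻¹ := by
  simp only [Diagram.IsColoring, Tangle.numerator]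
  constructor
  · rintro ⟨h1, h2⟩
    refine ⟨⟨h1, fun a b h => h2 a b (Or.inl h)⟩, ?_, ?_⟩
    · rw [h2 _ _ (Or.inr (Or.inl rfl)), Dart.val_rev]
    · rw [h2 _ _ (Or.inr (Or.inr rfl)), Dart.val_rev]
  · rintro ⟨⟨h1, h2⟩, h3, h4⟩
    refine ⟨h1, ?_⟩
    rintro a b (h | h | h)
    · exact h2 _ _ h
    · cases h; rw [h3, Dart.val_rev]
    · cases h; rw [h4, Dart.val_rev]

/-! ### The Montesinos link -/

section Link

variable {m : ℕ} [NeZero m]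

theorem isColoring_denominatorOfStack {G : Type} [Group G] {T : Fin m → Tangle}
    {f : (Tangle.denominatorOfStack T).Arc → G} :
    (Tangle.denominatorOfStack T).IsColoring f ↔ ∀ i, (T i).IsColoring (fun a => f ⟨i, a⟩) ∧
      (T (i + 1)).nw.val (fun a => f ⟨i + 1, a⟩) = ((T i).sw.val (fun a => f ⟨i, a⟩))⁻¹ ∧
      (T (i + 1)).ne.val (fun a => f ⟨i + 1, a⟩) = ((T i).se.val (fun a => f ⟨i, a⟩))⁻¹ := by
  constructor
  · rintro ⟨h1, h2⟩ i
    refine ⟨⟨fun a b c h => h1 (a.map _) (b.map _) (c.map _) ⟨i, _, h, rfl⟩,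
      fun a b h => h2 (a.map _) (b.map _) (Or.inl (Or.inl ⟨i, _, h, rfl⟩))⟩, ?_, ?_⟩
    · exact Dart.eq_val_rev_iff.1 (h2 _ _ (Or.inl (Or.inr ⟨i, rfl⟩)))
    · exact Dart.eq_val_rev_iff.1 (h2 _ _ (Or.inr ⟨i, rfl⟩))
  · intro h
    constructor
    · rintro _ _ _ ⟨i, ⟨a, b, c⟩, hc, e⟩
      cases e
      exact (h i).1.1 a b c hc
    · rintro _ _ ((⟨i, ⟨a, b⟩, hc, e⟩ | ⟨i, e⟩) | ⟨i, e⟩)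
      · cases e
        exact (h i).1.2 a b hc
      · cases e
        exact Dart.eq_val_rev_iff.2 (h i).2.1
      · cases e
        exact Dart.eq_val_rev_iff.2 (h i).2.2

/-- Components carry no direction, hence the second alternative. For matrices in `SL2` it is
harmless, since inversion preserves the trace: one coordinate `t` serves for all meridians. -/
theorem Diagram.IsKnot.isConj {G : Type} [Group G] {d : Diagram} (hd : d.IsKnot) {f : d.Arc → G}
    (hf : d.IsColoring f) (a b : d.Arc) : IsConj (f a) (f b) ∨ IsConj (f a) (f b)⁻¹ := by
  have h1 := (Nat.card_eq_one_iff_unique.1 hd).1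
  have h2 : Relation.EqvGen d.Connected a b := Quot.eqvGen_exact (h1.elim _ _)
  induction h2 with
  | rel a b h =>
    obtain ⟨v, w, h⟩ := h
    have := h.isConj hf
    cases v <;> cases w <;> simp only [Dart.val, if_true, Bool.false_eq_true, if_false] at this
    · left
      obtain ⟨c, hc⟩ := isConj_iff.1 this
      exact isConj_iff.2 ⟨c, by rw [← inv_inj, ← hc]; group⟩
    · right
      obtain ⟨c, hc⟩ := isConj_iff.1 this
      exact isConj_iff.2 ⟨c, by rw [← hc]; group⟩
    · exact Or.inr this
    · exact Or.inl this
  | refl => exact Or.inl (IsConj.refl _)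
  | symm _ _ _ h =>
    rcases h with h | h
    · exact Or.inl h.symm
    · right
      obtain ⟨c, hc⟩ := isConj_iff.1 h.symm
      exact isConj_iff.2 ⟨c, by rw [← hc]; group⟩
  | trans _ _ _ _ _ h h' =>
    have inv : ∀ {x y : G}, IsConj x y → IsConj x⁻¹ y⁻¹ := by
      intro x y hxy
      obtain ⟨c, hc⟩ := isConj_iff.1 hxy
      exact isConj_iff.2 ⟨c, by rw [← hc]; group⟩
    rcases h with h | h <;> rcases h' with h' | h'
    · exact Or.inl (h.trans h')
    · exact Or.inr (h.trans h')
    · exact Or.inr (h.trans (inv h'))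
    · exact Or.inl (h.trans (by simpa using inv h'))

/-- A cyclic sequence with prescribed quotients. -/
theorem exists_cyclic_potential {G : Type*} [CommGroup G] (u : Fin m → G) (hu : ∏ i, u i = 1) :
    ∃ b : Fin m → G, b 0 = 1 ∧ ∀ i, b (i + 1) = b i * u i := by
  obtain ⟨n, rfl⟩ := Nat.exists_eq_succ_of_ne_zero (NeZero.ne m)
  -- Partial products of all quotients but the last one; the last quotient leads back to the index 0
  -- because the total product is one.
  refine ⟨Fin.partialProd fun j : Fin n => u j.castSucc, Fin.partialProd_zero _, fun i => ?_⟩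
  induction i using Fin.lastCases with
  | last =>
    rw [Fin.last_add_one, Fin.partialProd_zero]
    have : Fin.partialProd (fun j : Fin n => u j.castSucc) (Fin.last n) =
        ∏ j : Fin n, u j.castSucc := by
      rw [Fin.partialProd, ← List.prod_ofFn, Fin.val_last, List.take_of_length_le (by simp)]
    rw [this, ← Fin.prod_univ_castSucc, hu]
  | cast j =>
    rw [← Fin.partialProd_succ]
    congr 1
    ext
    rw [Fin.val_add_one]
    simp [Fin.ext_iff, j.2.ne]

variable {k : Fin m → List ℤ}

/-- Give `nw` and the marked arc of the tangle `i` the colors `b i` and `b i * d i`. The first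
hypothesis matches the right ends of adjacent tangles, and the second one allows `b` to be chosen
such that the left ends match. A coloring of a knot modulo two is constant. -/
theorem link_parity_coloring_const (hk : ∀ i, k i ≠ []) (hK : (link k).IsKnot) (d : Fin m → Two)
    (hd : ∀ i, d (i + 1) ^ fracNum (k (i + 1)) = d i ^ fracNum (k i))
    (hq : ∏ i, d i ^ fracDen (k i) = 1) : ∀ i, d i = 1 := by
  obtain ⟨b, -, hb⟩ := exists_cyclic_potential _ hq
  choose f hf h1 h2 using fun i => (isFree_rational (k i)).exists_coloring (b i) (b i * d i)
  have he := fun i => rational_ends_two (hk i) (hf i) (h1 i) (h2 i)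
  have hcol : (link k).IsColoring (fun a : Σ i, (rational (k i)).Arc => f a.1 a.2) := by
    refine isColoring_denominatorOfStack.2 fun i => ⟨hf i, ?_, ?_⟩
    · refine (h1 (i + 1)).trans ?_
      rw [two_inv, hb]
      exact (he i).2.1.symm
    · refine (he (i + 1)).1.trans ?_
      rw [two_inv, hd, hb]
      refine Eq.trans ?_ (he i).2.2.symm
      rw [zpow_add, mul_assoc, mul_comm (d i ^ fracDen (k i))]
  intro i
  have := hK.isConj hcol ⟨i, (rational (k i)).nw.1⟩ ⟨i, (rational (k i)).y₀.1⟩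
  rw [two_inv, or_self, isConj_iff_eq] at this
  have key : ∀ (g : (rational (k i)).Arc → Two) (a : Dart (rational (k i)).Arc),
      a.val g = g a.1 := by
    intro g a; rw [Dart.val]; split_ifs; exacts [rfl, two_inv _]
  have e : (rational (k i)).nw.val (f i) = (rational (k i)).y₀.val (f i) := by
    rw [key, key]; exact this
  rw [h1, h2] at e
  simpa using e

/-- With two even numerators there would be a non-constant coloring modulo two, with `d` non-trivial
exactly at these two tangles: their upper ends have equal colors, and their two odd denominators
cancel. -/
theorem exists_even_unique (hk : ∀ i, k i ≠ []) (hK : (link k).IsKnot) :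
    ∃ i₀, ∀ i, i ≠ i₀ → Odd (fracNum (k i)) := by
  by_contra! h
  obtain ⟨i, -, hi⟩ := h 0
  obtain ⟨j, hij, hj⟩ := h i
  rw [Int.not_odd_iff_even] at hi hj
  have hden : ∀ i, Even (fracNum (k i)) → ¬ Even (fracDen (k i)) := by
    intro i hp hq
    have := Int.isCoprime_iff_gcd_eq_one.1 (isCoprime_frac (k i))
    have h2 := Int.dvd_coe_gcd hp.two_dvd hq.two_dvd
    rw [this] at h2; norm_num at h2
  let d : Fin m → Two := fun l => if l = i ∨ l = j then Multiplicative.ofAdd 1 else 1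
  have h0 : ∀ l, d l ^ fracNum (k l) = 1 := by
    intro l
    by_cases hl : l = i ∨ l = j
    · rw [two_zpow, if_pos]
      rcases hl with rfl | rfl <;> assumption
    · simp [d, hl]
  have := link_parity_coloring_const hk hK d (fun l => by rw [h0, h0]) ?_ i
  · simp only [d, true_or, if_true] at this
    exact absurd this (by decide)
  · rw [Finset.prod_eq_mul i j (Ne.symm hij)]
    · rw [two_zpow, two_zpow, if_neg (hden i hi), if_neg (hden j hj)]
      simp [d, two_mul_self]
    · rintro l - ⟨h1, h2⟩
      simp [d, h1, h2]
    · simp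
    · simp

/-- The determinant of the Montesinos knot does not vanish. -/
theorem sum_inv_frac_ne_zero (hk : ∀ i, k i ≠ []) (hK : (link k).IsKnot)
    (hp : ∀ i, fracNum (k i) ≠ 0) : ∑ i, (fracDen (k i) : ℚ) / fracNum (k i) ≠ 0 := by
  intro h
  -- Denominators are cleared. The integer obtained is, up to sign, the determinant of the knot; the
  -- contradiction will be that it is odd.
  have h1 : ∑ i, fracDen (k i) * ∏ j ∈ Finset.univ.erase i, fracNum (k j) = 0 := by
    have : (∏ j, (fracNum (k j) : ℚ)) * ∑ i, (fracDen (k i) : ℚ) / fracNum (k i) = 0 := by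
      rw [h, mul_zero]
    rw [Finset.mul_sum] at this
    have e : ((∑ i, fracDen (k i) * ∏ j ∈ Finset.univ.erase i, fracNum (k j) : ℤ) : ℚ) = 0 := by
      rw [← this]
      push_cast
      refine Finset.sum_congr rfl fun i _ => ?_
      rw [← Finset.mul_prod_erase _ _ (Finset.mem_univ i)]
      have : (fracNum (k i) : ℚ) ≠ 0 := by exact_mod_cast hp i
      field_simp
    exact_mod_cast e
  have hodd : ∀ s : Finset (Fin m), (∀ i ∈ s, Odd (fracNum (k i))) →
      Odd (∏ i ∈ s, fracNum (k i)) := by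
    intro s hs
    exact Finset.prod_induction _ Odd (fun _ _ => Odd.mul) odd_one hs
  by_cases hall : ∀ i, Odd (fracNum (k i))
  -- All numerators are odd: the integer is congruent to the sum of the `fracDen (k i)`. If this sum
  -- were even, the non-trivial constant `d` would define a non-constant coloring.
  · have h2 : Even (∑ i, fracDen (k i)) := by
      have : Even (∑ i, fracDen (k i) -
          ∑ i, fracDen (k i) * ∏ j ∈ Finset.univ.erase i, fracNum (k j)) := by
        rw [← Finset.sum_sub_distrib]
        refine Finset.even_sum _ fun i _ => ?_
        rw [← mul_one_sub]
        exact ((odd_one.sub_odd (hodd _ fun i _ => hall i))).mul_left _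
      rwa [h1, sub_zero] at this
    have := link_parity_coloring_const hk hK (fun _ => Multiplicative.ofAdd 1)
      (fun i => by simp [two_zpow, Int.not_even_iff_odd.2 (hall _)]) ?_ 0
    · exact absurd this (by decide)
    · have key : ∀ s : Finset (Fin m), ∏ i ∈ s, (Multiplicative.ofAdd 1 : Two) ^ fracDen (k i) =
          (Multiplicative.ofAdd 1) ^ ∑ i ∈ s, fracDen (k i) := by
        intro s
        induction s using Finset.induction_on with
        | empty => simp
        | insert a s ha ih => rw [Finset.prod_insert ha, Finset.sum_insert ha, zpow_add, ih]
      rw [key, two_zpow, if_pos h2]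
  -- One numerator is even: it divides every summand except its own, and its own summand is odd.
  · obtain ⟨i₀, h0⟩ := exists_even_unique hk hK
    push Not at hall
    obtain ⟨j, hj⟩ := hall
    have : j = i₀ := by by_contra hne; exact hj (h0 j hne)
    subst this
    rw [Int.not_odd_iff_even] at hj
    have hq : Odd (fracDen (k j)) := by
      rw [← Int.not_even_iff_odd]
      intro hq
      have := Int.isCoprime_iff_gcd_eq_one.1 (isCoprime_frac (k j))
      have h2 := Int.dvd_coe_gcd hj.two_dvd hq.two_dvd
      rw [this] at h2; norm_num at h2
    rw [← Finset.add_sum_erase _ _ (Finset.mem_univ j)] at h1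
    have h2 : Even (∑ i ∈ Finset.univ.erase j,
        fracDen (k i) * ∏ l ∈ Finset.univ.erase i, fracNum (k l)) := by
      refine Finset.even_sum _ fun i hi => ?_
      rw [← Finset.mul_prod_erase _ _ (Finset.mem_erase.2 ⟨(Finset.ne_of_mem_erase hi).symm, Finset.mem_univ j⟩)]
      exact (hj.mul_right _).mul_left _
    have h3 : Odd (fracDen (k j) * ∏ l ∈ Finset.univ.erase j, fracNum (k l)) :=
      hq.mul (hodd _ fun i hi => h0 i (Finset.ne_of_mem_erase hi))
    have := h3.add_even h2
    rw [h1] at this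
    exact absurd this (by decide)

/-! ### Unions of representations -/

/-- The relations of the stack are those of the tangles, which hold in the numerators already, and
the joins between adjacent tangles, which are the compatibility conditions. -/
theorem existsUnique_isUnion (σ : ∀ i, (rational (k i)).numerator.group →* SL2)
    (h : ∀ i, σ (i + 1) ((rational (k (i + 1))).numerator.loop (rational (k (i + 1))).nw) =
        (σ i ((rational (k i)).numerator.loop (rational (k i)).sw))⁻¹ ∧
      σ (i + 1) ((rational (k (i + 1))).numerator.loop (rational (k (i + 1))).ne) =
        (σ i ((rational (k i)).numerator.loop (rational (k i)).se))⁻¹) :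
    ∃! ρ : (link k).group →* SL2, IsUnion k ρ σ := by
  have hc := fun i => Diagram.isColoring_coloring _ (σ i)
  have hcol : (link k).IsColoring
      (fun a : Σ i, (rational (k i)).Arc => (rational (k a.1)).numerator.coloring (σ a.1) a.2) := by
    refine isColoring_denominatorOfStack.2 fun i => ⟨(isColoring_numerator.1 (hc i)).1, ?_, ?_⟩
    · exact ((Diagram.val_coloring _ (σ (i + 1)) _).trans (h i).1).trans
        (congrArg _ (Diagram.val_coloring _ (σ i) _).symm)
    · exact ((Diagram.val_coloring _ (σ (i + 1)) _).trans (h i).2).trans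
        (congrArg _ (Diagram.val_coloring _ (σ i) _).symm)
  refine ⟨hcol.hom, fun i a => ?_, fun ρ hρ => ?_⟩
  · exact ((hcol.hom_loop _).trans (Diagram.val_coloring _ (σ i) a)).symm
  · refine Diagram.hom_ext ?_
    rintro ⟨i, a⟩
    have h1 := hρ i (a, true)
    have h2 := hcol.hom_loop ((⟨i, a⟩ : Σ i, (rational (k i)).Arc), true)
    exact h1.symm.trans h2.symm

end Link

end Montesinos
end

noncomputable section

namespace Montesinos

/-! ### The trace polynomials over commutative algebras -/

section TracePolynomials

open Polynomial

theorem thetaQuot_mul (n : ℤ) :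
    (X - 2) * thetaQuot n = Chebyshev.C ℂ n - 2 := by
  change (X - Polynomial.C 2) * thetaQuot n = _
  unfold thetaQuot
  rw [Polynomial.mul_divByMonic_eq_iff_isRoot]
  simp [Polynomial.IsRoot]

theorem omegaQuot_mul (n : ℤ) :
    (X - 2) * omegaQuot n = Chebyshev.S ℂ n - Chebyshev.S ℂ (n - 1) - 1 := by
  change (X - Polynomial.C 2) * omegaQuot n = _
  unfold omegaQuot
  rw [Polynomial.mul_divByMonic_eq_iff_isRoot]
  simp [Polynomial.IsRoot]

theorem X_sub_two_ne_zero : (X - 2 : ℂ[X]) ≠ 0 := X_sub_C_ne_zero 2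

/-- Cancelling `X - 2` makes the Chebyshev recursion inhomogeneous; the constant is the source of
the term `2 * T` in `IsTraceSeq`. -/
theorem thetaQuot_add_one (n : ℤ) :
    thetaQuot (n + 1) = X * thetaQuot n + 2 - thetaQuot (n - 1) := by
  refine mul_left_cancel₀ X_sub_two_ne_zero ?_
  have h1 := thetaQuot_mul (n + 1)
  have h2 := thetaQuot_mul n
  have h3 := thetaQuot_mul (n - 1)
  have h4 := Chebyshev.C_add_one ℂ n
  linear_combination h1 - X * h2 + h3 + h4

theorem omegaQuot_add_one (n : ℤ) :
    omegaQuot (n + 1) = X * omegaQuot n + 1 - omegaQuot (n - 1) := by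
  refine mul_left_cancel₀ X_sub_two_ne_zero ?_
  have h1 := omegaQuot_mul (n + 1)
  have h2 := omegaQuot_mul n
  have h3 := omegaQuot_mul (n - 1)
  have h4 := Chebyshev.S_add_one ℂ n
  have h6 := Chebyshev.S_add_one ℂ (n - 1)
  simp only [add_sub_cancel_right, sub_add_cancel] at *
  linear_combination h1 - X * h2 + h3 + h4 - h6

theorem thetaQuot_zero : thetaQuot 0 = 0 := by
  refine mul_left_cancel₀ X_sub_two_ne_zero ?_
  rw [thetaQuot_mul]; simp

theorem thetaQuot_neg_one : thetaQuot (-1) = 1 := by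
  refine mul_left_cancel₀ X_sub_two_ne_zero ?_
  rw [thetaQuot_mul]; simp

theorem omegaQuot_zero : omegaQuot 0 = 0 := by
  refine mul_left_cancel₀ X_sub_two_ne_zero ?_
  rw [omegaQuot_mul]; simp

theorem omegaQuot_neg_one : omegaQuot (-1) = 0 := by
  refine mul_left_cancel₀ X_sub_two_ne_zero ?_
  rw [omegaQuot_mul]; norm_num

variable {A : Type*} [CommRing A]

/-- The recursion satisfied by the traces in a block of twists. -/
def IsTraceSeq (T e : A) (ψ : ℤ → A) : Prop := ∀ n, ψ (n + 1) = 2 * T - e * ψ n - ψ (n - 1)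

/-- The recursion can be run in both directions, so two adjacent values determine a solution. All
explicit formulas for traces are verified in this way, by comparing the values at 0 and -1. -/
theorem IsTraceSeq.eq {T e : A} {ψ φ : ℤ → A} (h : IsTraceSeq T e ψ) (h' : IsTraceSeq T e φ)
    (h0 : ψ 0 = φ 0) (h1 : ψ (-1) = φ (-1)) : ψ = φ := by
  have key : ∀ n : ℤ, ψ n = φ n ∧ ψ (n - 1) = φ (n - 1) := by
    intro n
    induction n using Int.induction_on with
    | zero => exact ⟨h0, by simpa using h1⟩
    | succ n ih => exact ⟨by rw [h, h', ih.1, ih.2], by simpa using ih.1⟩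
    | pred n ih =>
      refine ⟨ih.2, ?_⟩
      have e1 := h (-n - 1)
      have e2 := h' (-n - 1)
      rw [sub_add_cancel] at e1 e2
      rw [ih.1, ih.2] at e1
      linear_combination e1 - e2
  exact funext fun n => (key n).1

variable [Algebra ℂ A]

/-- The sequence `ψ₀`, for `T = t²`. -/
def psiStart (T e : A) (n : ℤ) : A :=
  aeval (-e) (Chebyshev.C ℂ n) + aeval (-e) (thetaQuot n) * T

/-- The sequence `ψⱼ` from `e = e_{j-1}`, `e' = eⱼ` and `c = ψ_{j-1}(kⱼ - 1)`. -/
def psiNext (T e e' c : A) (n : ℤ) : A :=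
  e * aeval (-e') (Chebyshev.S ℂ n) - c * aeval (-e') (Chebyshev.S ℂ (n - 1)) +
    2 * T * aeval (-e') (omegaQuot n)

theorem isTraceSeq_psiStart (T e : A) : IsTraceSeq T e (psiStart T e) := by
  intro n
  have h1 := congrArg (aeval (-e)) (Chebyshev.C_add_one ℂ n)
  have h2 := congrArg (aeval (-e)) (thetaQuot_add_one n)
  simp only [map_sub, map_mul, aeval_X, map_add, map_ofNat] at h1 h2
  unfold psiStart
  linear_combination h1 + T * h2

theorem psiStart_zero (T e : A) : psiStart T e 0 = 2 := by
  simp [psiStart, thetaQuot_zero, map_ofNat]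

theorem psiStart_neg_one (T e : A) : psiStart T e (-1) = T - e := by
  simp [psiStart, thetaQuot_neg_one]; ring

theorem isTraceSeq_psiNext (T e e' c : A) : IsTraceSeq T e' (psiNext T e e' c) := by
  intro n
  have h1 := congrArg (aeval (-e')) (Chebyshev.S_add_one ℂ n)
  have h3 := congrArg (aeval (-e')) (Chebyshev.S_add_one ℂ (n - 1))
  have h2 := congrArg (aeval (-e')) (omegaQuot_add_one n)
  simp only [map_sub, map_mul, aeval_X, map_add, map_one, sub_add_cancel] at h1 h2 h3
  unfold psiNext
  rw [add_sub_cancel_right]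
  linear_combination e * h1 + 2 * T * h2 - c * h3

theorem psiNext_zero (T e e' c : A) : psiNext T e e' c 0 = e := by
  simp [psiNext, omegaQuot_zero]

theorem psiNext_neg_one (T e e' c : A) : psiNext T e e' c (-1) = c := by
  simp only [psiNext, omegaQuot_neg_one, Chebyshev.S_neg_one, map_zero]
  norm_num

/-- The triple `(z + 2, ż + 2, z̀ + 2)` over a commutative algebra, from `e_{j-1}` and `ψ_{j-1}`. -/
def traceTripleRec (T : A) : A → (ℤ → A) → List ℤ → A × A × A
  | _, _, [] => (2, 2, 2)
  | e, ψ, [k] => (ψ k, e, ψ (k - 1))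
  | e, ψ, k :: k' :: l =>
      traceTripleRec T (ψ k) (psiNext T e (ψ k) (ψ (k - 1))) (k' :: l)

/-- The triple `(z + 2, ż + 2, z̀ + 2)` over a commutative algebra, as a function of `T = t²` and
`e₀`. -/
def traceTriple (T e : A) (k : List ℤ) : A × A × A := traceTripleRec T e (psiStart T e) k

/-- Naturality lets one computation serve complex numbers, polynomial rings, coordinate rings of
components, rings of functions, and valuation rings. -/
theorem map_traceTripleRec {B : Type*} [CommRing B] [Algebra ℂ B] (φ : A →ₐ[ℂ] B) (T : A)
    (l : List ℤ) : ∀ (e : A) (ψ : ℤ → A), traceTripleRec (φ T) (φ e) (fun n => φ (ψ n)) l =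
      (φ (traceTripleRec T e ψ l).1, φ (traceTripleRec T e ψ l).2.1,
        φ (traceTripleRec T e ψ l).2.2) := by
  induction l with
  | nil => intro e ψ; simp only [traceTripleRec, map_ofNat]
  | cons k l ih =>
    intro e ψ
    rcases l with _ | ⟨k', l⟩
    · rfl
    · rw [traceTripleRec, traceTripleRec, ← ih]
      congr 1
      funext n
      simp only [psiNext, map_add, map_sub, map_mul, ← aeval_algHom_apply, map_neg, map_ofNat]

theorem map_traceTriple {B : Type*} [CommRing B] [Algebra ℂ B] (φ : A →ₐ[ℂ] B) (T e : A)
    (l : List ℤ) : traceTriple (φ T) (φ e) l =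
      (φ (traceTriple T e l).1, φ (traceTriple T e l).2.1, φ (traceTriple T e l).2.2) := by
  unfold traceTriple
  rw [← map_traceTripleRec]
  congr 1
  funext n
  simp only [psiStart, map_add, map_mul, ← aeval_algHom_apply, map_neg]

theorem traceRec_eq (t : ℂ) (l : List ℤ) : ∀ (e : ℂ) (ψ : ℤ → ℂ), traceRec t e ψ l =
    ((traceTripleRec (t ^ 2) e ψ l).1 - 2, (traceTripleRec (t ^ 2) e ψ l).2.1 - 2,
      (traceTripleRec (t ^ 2) e ψ l).2.2 - 2) := by
  induction l with
  | nil => intro e ψ; simp [traceRec, traceTripleRec]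
  | cons k l ih =>
    intro e ψ
    rcases l with _ | ⟨k', l⟩
    · rfl
    · rw [traceRec, traceTripleRec, ← ih]
      congr 1
      funext n
      simp only [psiNext, omega, coe_aeval_eq_eval, add_sub_cancel_right]

theorem traceRec_psiZero (t e : ℂ) (l : List ℤ) : traceRec t e (psiZero t e) l =
    ((traceTriple (t ^ 2) e l).1 - 2, (traceTriple (t ^ 2) e l).2.1 - 2,
      (traceTriple (t ^ 2) e l).2.2 - 2) := by
  rw [traceRec_eq]
  have : psiZero t e = psiStart (t ^ 2) e := by
    funext n
    simp only [psiStart, psiZero, theta, coe_aeval_eq_eval]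
  rw [this]
  rfl

theorem z_eq (k : List ℤ) (t r : ℂ) : z k t r = (traceTriple (t ^ 2) (eZero k t r) k).1 - 2 := by
  rw [z, traceRec_psiZero]

theorem zDot_eq (k : List ℤ) (t r : ℂ) :
    zDot k t r = (traceTriple (t ^ 2) (eZero k t r) k).2.1 - 2 := by
  rw [zDot, traceRec_psiZero]

theorem zGrave_eq (k : List ℤ) (t r : ℂ) :
    zGrave k t r = (traceTriple (t ^ 2) (eZero k t r) k).2.2 - 2 := by
  rw [zGrave, traceRec_psiZero]

end TracePolynomials

/-! ### Traces of the ends of a rational tangle -/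

section Traces

/-- The trace on `SL(2,ℂ)`. -/
def tr (M : SL2) : ℂ := M.1.trace

theorem tr_eq (M : SL2) : tr M = M.1 0 0 + M.1 1 1 := Matrix.trace_fin_two _

theorem tr_mul_comm (M N : SL2) : tr (M * N) = tr (N * M) := by
  simp only [tr, Matrix.SpecialLinearGroup.coe_mul]
  exact Matrix.trace_mul_comm _ _

theorem tr_conj (M N : SL2) : tr (M * N * M⁻¹) = tr N := by
  rw [tr_mul_comm, inv_mul_cancel_left]

theorem tr_inv (M : SL2) : tr M⁻¹ = tr M := by
  rw [tr_eq, tr_eq, Matrix.SpecialLinearGroup.coe_inv, Matrix.adjugate_fin_two]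
  simp [add_comm]

theorem tr_one : tr 1 = 2 := by
  rw [tr_eq]; norm_num

theorem tr_mul_inv (M N : SL2) : tr (M * N⁻¹) = tr M * tr N - tr (M * N) := by
  simp only [tr_eq, Matrix.SpecialLinearGroup.coe_mul, Matrix.SpecialLinearGroup.coe_inv,
    Matrix.adjugate_fin_two, Matrix.mul_apply, Fin.sum_univ_two, Matrix.of_apply, Matrix.cons_val_zero,
    Matrix.cons_val_one, Matrix.cons_val', Matrix.cons_val_fin_one]
  ring

theorem tr_mul_inv_mul (M N P : SL2) : tr (M * N⁻¹ * P) = tr N * tr (M * P) - tr (M * N * P) := by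
  rw [tr_mul_comm, ← mul_assoc, tr_mul_inv, tr_mul_comm P M, mul_comm, mul_assoc P M N,
    tr_mul_comm P]

theorem IsConj.tr_eq {M N : SL2} (h : IsConj M N) : tr M = tr N := by
  obtain ⟨c, rfl⟩ := isConj_iff.1 h
  rw [tr_conj]

theorem tr_twist {t : ℂ} (n : ℤ) {p : SL2 × SL2} (h1 : tr p.1 = t) (h2 : tr p.2 = t) :
    tr ((twist ^ n) p).1 = t ∧ tr ((twist ^ n) p).2 = t := by
  induction n using Int.induction_on with
  | zero => exact ⟨h1, h2⟩
  | succ n ih =>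
    rw [add_comm, zpow_add, zpow_one, Equiv.Perm.mul_apply]
    exact ⟨(tr_conj _ _).trans ih.2, ih.1⟩
  | pred n ih =>
    rw [sub_eq_add_neg, add_comm, zpow_add, Equiv.Perm.mul_apply, Tangle.twist_zpow_neg_one]
    refine ⟨ih.2, ?_⟩
    have := tr_conj ((twist ^ (-n : ℤ)) p).2⁻¹ ((twist ^ (-n : ℤ)) p).1
    rw [inv_inv] at this
    exact this.trans ih.1

/-- If `(a, b)` is the pair after `n` twists, then `a * b` does not depend on `n`, and the next and
the previous first entries are `a b a⁻¹` and `b`. Two applications of `tr (M N⁻¹) = tr M tr N - tr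
(M N)` give the recursion; the terms `tr (X a b) tr a` and `tr X tr b` are both `t²`. -/
theorem isTraceSeq_twist {t : ℂ} {X u w : SL2} (hX : tr X = t) (hu : tr u = t) (hw : tr w = t)
    (hv : tr (X * u * w) = t) :
    IsTraceSeq (t ^ 2) (tr (u * w)) fun n => tr (X * ((twist ^ n) (u, w)).1) := by
  intro n
  obtain ⟨h1, h2⟩ := tr_twist n (p := (u, w)) hu hw
  have h3 := Tangle.twist_zpow_mul n (u, w)
  have e1 : (twist ^ (n + 1)) (u, w) = twist ((twist ^ n) (u, w)) := by
    rw [add_comm, zpow_add, zpow_one, Equiv.Perm.mul_apply]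
  have e2 : (twist ^ (n - 1)) (u, w) = (twist ^ (-1 : ℤ)) ((twist ^ n) (u, w)) := by
    rw [sub_eq_add_neg, add_comm, zpow_add, Equiv.Perm.mul_apply]
  rw [Tangle.twist_zpow_neg_one] at e2
  simp only [e1, e2]
  simp only at h3
  generalize (twist ^ n) (u, w) = p at *
  obtain ⟨a, b⟩ := p
  simp only at *
  change tr (X * (a * b * a⁻¹)) = _
  have i1 : tr (X * (a * b * a⁻¹)) = tr (X * a * b) * tr a - tr (X * a * b * a) := by
    rw [← tr_mul_inv]; simp only [mul_assoc]
  have i2 : tr (X * a * b * a) = tr (a * b) * tr (X * a) - tr (X * b⁻¹) := by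
    have := tr_mul_inv_mul X (a * b) a
    rw [mul_inv_rev] at this
    have e : X * (b⁻¹ * a⁻¹) * a = X * b⁻¹ := by group
    rw [e] at this
    rw [this]; simp only [mul_assoc]; ring
  rw [i1, i2, tr_mul_inv, hX, h1, h2, ← h3, mul_assoc X a b, h3, ← mul_assoc, hv]
  ring

/-- The trace polynomials compute the traces of products of ends. -/
theorem traceTripleRec_eq {t : ℂ} (l : List ℤ) : ∀ (k : ℤ) (X u v w : SL2), X * u * w = v →
    tr X = t → tr u = t → tr v = t → tr w = t →
    let x := if Even l.length then X else X⁻¹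
    let p := tangleRec u v w (k :: l)
    traceTripleRec (t ^ 2) (tr (u * w)) (fun n => tr (X * ((twist ^ n) (u, w)).1)) (k :: l) =
      (tr (x * p.2), tr (x⁻¹ * p.1), tr (x * (p.2⁻¹ * x⁻¹ * p.1))) ∧
      tr p.1 = t ∧ tr p.2 = t ∧ tr (p.2⁻¹ * x⁻¹ * p.1) = t := by
  induction l with
  | nil =>
    intro k X u v w h hX hu hv hw
    have h1 := Tangle.twist_zpow_mul k (u, w)
    have h2 := tr_twist k (p := (u, w)) hu hw
    have e2 : (twist ^ (k - 1)) (u, w) = (twist ^ (-1 : ℤ)) ((twist ^ k) (u, w)) := by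
      rw [sub_eq_add_neg, add_comm, zpow_add, Equiv.Perm.mul_apply]
    rw [Tangle.twist_zpow_neg_one] at e2
    simp only [traceTripleRec, tangleRec, List.length_nil, Even.zero, if_true, e2]
    simp only at h1
    have e3 : X⁻¹ * v = u * w := by rw [← h]; group
    rw [mul_assoc _ X⁻¹, e3, ← h1, inv_mul_cancel_left]
    exact ⟨rfl, hv, h2.1, h2.2⟩
  | cons k' l ih =>
    intro k X u v w h hX hu hv hw
    have h1 := Tangle.twist_zpow_mul k (u, w)
    have h2 := tr_twist k (p := (u, w)) hu hw
    have e2 : (twist ^ (k - 1)) (u, w) = (twist ^ (-1 : ℤ)) ((twist ^ k) (u, w)) := by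
      rw [sub_eq_add_neg, add_comm, zpow_add, Equiv.Perm.mul_apply]
    rw [Tangle.twist_zpow_neg_one] at e2
    -- The end relation `X * u * w = v` persists after the block, with `X` inverted and the roles of
    -- the remaining entries exchanged.
    have key := ih k' X⁻¹ v ((twist ^ k) (u, w)).1 ((twist ^ k) (u, w)).2⁻¹ ?_ ?_ hv h2.1 ?_
    · have hlen : (if Even l.length then X⁻¹ else X⁻¹⁻¹) =
          if Even (k' :: l).length then X else X⁻¹ := by
        simp only [List.length_cons, Nat.even_add_one]
        split_ifs <;> simp
      rw [hlen] at key
      rw [tangleRec, traceTripleRec]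
      refine ⟨?_, key.2⟩
      rw [← key.1]
      -- The value of the old sequence at `k` is the coefficient of the recursion for the next
      -- block: this is the definition of `e_j`.
      have he : tr (v * ((twist ^ k) (u, w)).2⁻¹) = tr (X * ((twist ^ k) (u, w)).1) := by
        rw [← h, mul_assoc X u w]
        simp only at h1
        rw [← h1]; congr 1; group
      rw [he]
      congr 1
      refine IsTraceSeq.eq (isTraceSeq_psiNext _ _ _ _) ?_ ?_ ?_
      · rw [← he]
        refine isTraceSeq_twist ?_ hv ?_ ?_
        · rw [tr_inv, hX]
        · rw [tr_inv, h2.2]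
        · rw [← h, mul_assoc X u w]
          simp only at h1
          rw [← h1]
          convert h2.1 using 2
          group
      · rw [psiNext_zero]
        simp only [zpow_zero, Equiv.Perm.one_apply]
        rw [← h]; congr 1; group
      · rw [psiNext_neg_one, Tangle.twist_zpow_neg_one]
        simp only [e2]
        rw [← tr_inv, tr_mul_comm]; simp
    · rw [← h, mul_assoc X u w]
      simp only at h1
      rw [← h1]; group
    · rw [tr_inv, hX]
    · rw [tr_inv, h2.2]

/-- Inverting one factor of a product replaces the trace `r` by `t² - r`, while inverting both keeps
the trace; so only the comparison of the two signs matters. -/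
theorem eZero_spec {k : List ℤ} {f : (rational k).Arc → SL2} {t : ℂ}
    (hx : tr ((rational k).nw.val f) = t) (hy : tr ((rational k).y₀.val f) = t) :
    tr ((if Even k.length then (rational k).nw.val f else ((rational k).nw.val f)⁻¹) *
      (rational k).y₀.val f) =
      eZero k t (tr ((rational k).nw.val f * (genY k).val f)) := by
  have inv_left : ∀ M N : SL2, tr (M⁻¹ * N) = tr (M * N⁻¹) := by
    intro M N; rw [← tr_inv, tr_mul_comm, ← tr_mul_comm]; simp [tr_mul_comm]
  by_cases h1 : GenSignPos k <;> by_cases h2 : Even k.length <;>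
    simp only [eZero, genY, h1, h2, if_true, if_false, Dart.val_rev, iff_true, iff_false, not_true,
      inv_left, tr_mul_inv, hx, hy] <;> ring

/-- The trace polynomials of a rational tangle. -/
theorem rational_traces {k : List ℤ} (hk : k ≠ []) {f : (rational k).Arc → SL2}
    (hf : (rational k).IsColoring f) {t : ℂ}
    (hx : tr ((rational k).nw.val f) = t) (hy : tr ((rational k).y₀.val f) = t) :
    z k t (tr ((rational k).nw.val f * (genY k).val f)) + 2 =
        tr ((rational k).nw.val f * (rational k).ne.val f) ∧
      zDot k t (tr ((rational k).nw.val f * (genY k).val f)) + 2 =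
        tr ((rational k).nw.val f * (rational k).sw.val f) ∧
      zGrave k t (tr ((rational k).nw.val f * (genY k).val f)) + 2 =
        tr ((rational k).nw.val f * (rational k).se.val f) ∧
      tr ((rational k).ne.val f) = t ∧ tr ((rational k).sw.val f) = t ∧
      tr ((rational k).se.val f) = t := by
  rw [z_eq, zDot_eq, zGrave_eq, ← eZero_spec hx hy]
  have hends := rational_ends hk f hf
  have hrel := (isFree_rational k).rel f hf
  obtain ⟨k, l, rfl⟩ := List.exists_cons_of_ne_nil hk
  set A := (rational (k :: l)).nw.val f
  set B := (rational (k :: l)).ne.val f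
  set C := (rational (k :: l)).sw.val f
  set D := (rational (k :: l)).se.val f
  set y := (rational (k :: l)).y₀.val f
  set x := if Even (k :: l).length then A else A⁻¹ with hxdef
  have hx' : tr x = t := by
    rw [hxdef]; split_ifs
    · exact hx
    · rw [tr_inv, hx]
  have hX : (if Even l.length then x⁻¹ else x⁻¹⁻¹) = A := by
    simp only [hxdef, List.length_cons, Nat.even_add_one]
    split_ifs <;> simp
  -- The recursion starts from `X = x⁻¹`, `u = x`, `v = w = y`, for which the end relation is
  -- trivial.
  have key := traceTripleRec_eq (t := t) l k x⁻¹ x y y (by group) (by rw [tr_inv, hx']) hx' hy hy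
  simp only at key
  rw [hX, ← hends] at key
  have hD : B⁻¹ * A⁻¹ * C⁻¹ = D := by
    have : D = B⁻¹ * A⁻¹ * (A * B * D * C) * C⁻¹ := by group
    rw [this, hrel, mul_one]
  simp only [hD] at key
  obtain ⟨key, h1, h2, h3⟩ := key
  have hψ : (fun n : ℤ => tr (x⁻¹ * ((twist ^ n) (x, y)).1)) = psiStart (t ^ 2) (tr (x * y)) := by
    refine IsTraceSeq.eq (isTraceSeq_twist ?_ hx' hy ?_) (isTraceSeq_psiStart _ _) ?_ ?_
    · rw [tr_inv, hx']
    · rw [inv_mul_cancel, one_mul, hy]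
    · rw [psiStart_zero]; simp [tr_one]
    · rw [psiStart_neg_one, Tangle.twist_zpow_neg_one, tr_mul_comm, tr_mul_inv, tr_mul_comm y, hx', hy]
      ring
  rw [hψ] at key
  simp only [traceTriple, key]
  rw [tr_inv] at h1
  refine ⟨by ring, ?_, by ring, h2, h1, h3⟩
  rw [sub_add_cancel, ← tr_inv, mul_inv_rev, inv_inv, inv_inv, tr_mul_comm]

end Traces

end Montesinos
end

noncomputable section

namespace Montesinos

/-! ### Degrees of the trace polynomials -/

section Degrees

variable {A : Type*} [CommRing A]

/-- The triples of traces with positive labels `p`, `q`, `p + q` that are reached from the simplest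
ones by flips that increase the labels. -/
inductive GrownTriple (T e : A) : A → A → A → ℕ → ℕ → Prop
  | base : GrownTriple T e e (T - e) (2 * T - e * (T - e) - 2) 1 1
  | base' : GrownTriple T e (T - e) e (2 * T - (T - e) * e - 2) 1 1
  | left {a b c p q} : GrownTriple T e a b c p q →
      GrownTriple T e a c (2 * T - a * c - b) p (p + q)
  | right {a b c p q} : GrownTriple T e a b c p q →
      GrownTriple T e c b (2 * T - c * b - a) (p + q) q

namespace GrownTriple

variable {T e a b c : A} {p q : ℕ}

theorem pos (h : GrownTriple T e a b c p q) : 0 < p ∧ 0 < q := by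
  induction h <;> omega

theorem swap (h : GrownTriple T e a b c p q) : GrownTriple T e b a c q p := by
  induction h with
  | base => convert base' using 1; ring
  | base' => convert base using 1; ring
  | @left a b c p q _ ih => rw [add_comm p q, mul_comm a c]; exact ih.right
  | @right a b c p q _ ih => rw [add_comm p q, mul_comm c b]; exact ih.left

theorem shrink (h : GrownTriple T e a b c p q) (hpq : p < q) :
    GrownTriple T e a (2 * T - a * b - c) b p (q - p) := by
  cases h with
  | base => omega
  | base' => omega
  | @left a b c p q h =>
    rw [Nat.add_sub_cancel_left]
    convert h using 1
    ring
  | right h => have := h.pos; omega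

theorem eq_base (h : GrownTriple T e a b c p q) (hpq : p = q) :
    p = 1 ∧ 2 * T - a * b - c = 2 ∧ ((a = e ∧ b = T - e) ∨ (a = T - e ∧ b = e)) := by
  cases h with
  | base => exact ⟨rfl, by ring, Or.inl ⟨rfl, rfl⟩⟩
  | base' => exact ⟨rfl, by ring, Or.inr ⟨rfl, rfl⟩⟩
  | left h => have := h.pos; omega
  | right h => have := h.pos; omega

end GrownTriple

/-- Triples of traces `a`, `b`, `c` with integer labels `x`, `y`, `x - y`. -/
def IsTriple (T e a b c : A) (x y : ℤ) : Prop :=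
  (0 < x * y ∧ GrownTriple T e a b (2 * T - a * b - c) x.natAbs y.natAbs) ∨
    (x * y < 0 ∧ GrownTriple T e a b c x.natAbs y.natAbs) ∨
    (x = 0 ∧ y.natAbs = 1 ∧ a = 2 ∧ ((b = e ∧ c = T - e) ∨ (b = T - e ∧ c = e))) ∨
    (y = 0 ∧ x.natAbs = 1 ∧ b = 2 ∧ ((a = e ∧ c = T - e) ∨ (a = T - e ∧ c = e)))

namespace IsTriple

variable {T e a b c : A} {x y : ℤ}

/-- The traces form triples as in the theory of Markov numbers: the flip of `c` to `2 T - a b - c`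
replaces the label `x - y` by `x + y`. Together with the permutations of the triple, these flips
generate all steps of the recursion, and the labels are the convergents. -/
theorem neg (h : IsTriple T e a b c x y) : IsTriple T e a b (2 * T - a * b - c) x (-y) := by
  have e1 : 2 * T - a * b - (2 * T - a * b - c) = c := by ring
  rcases h with ⟨h1, h⟩ | ⟨h1, h⟩ | ⟨h1, h2, h3, h4⟩ | ⟨h1, h2, h3, h4⟩
  · exact Or.inr (Or.inl ⟨by rw [mul_neg]; omega, by rwa [Int.natAbs_neg]⟩)
  · exact Or.inl ⟨by rw [mul_neg]; omega, by rwa [Int.natAbs_neg, e1]⟩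
  · refine Or.inr (Or.inr (Or.inl ⟨h1, by rwa [Int.natAbs_neg], h3, ?_⟩))
    rcases h4 with ⟨h4, h5⟩ | ⟨h4, h5⟩
    · exact Or.inl ⟨h4, by rw [h3, h4, h5]; ring⟩
    · exact Or.inr ⟨h4, by rw [h3, h4, h5]; ring⟩
  · refine Or.inr (Or.inr (Or.inr ⟨by omega, h2, h3, ?_⟩))
    rcases h4 with ⟨h4, h5⟩ | ⟨h4, h5⟩
    · exact Or.inl ⟨h4, by rw [h3, h4, h5]; ring⟩
    · exact Or.inr ⟨h4, by rw [h3, h4, h5]; ring⟩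

theorem swap (h : IsTriple T e a b c x y) : IsTriple T e b a c y x := by
  rcases h with ⟨h1, h⟩ | ⟨h1, h⟩ | h | h
  · exact Or.inl ⟨by rwa [mul_comm], by rw [mul_comm b a]; exact h.swap⟩
  · exact Or.inr (Or.inl ⟨by rwa [mul_comm], h.swap⟩)
  · exact Or.inr (Or.inr (Or.inr h))
  · exact Or.inr (Or.inr (Or.inl h))

theorem rotate (h : IsTriple T e a b c x y) : IsTriple T e a c b x (x - y) := by
  rcases h with ⟨h1, h⟩ | ⟨h1, h⟩ | ⟨h1, h2, h3, h4⟩ | ⟨h1, h2, h3, h4⟩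
  · rcases lt_trichotomy x.natAbs y.natAbs with hxy | hxy | hxy
    · refine Or.inr (Or.inl ⟨?_, ?_⟩)
      · rcases mul_pos_iff.1 h1 with ⟨hx, hy⟩ | ⟨hx, hy⟩
        · exact mul_neg_of_pos_of_neg hx (by omega)
        · exact mul_neg_of_neg_of_pos hx (by omega)
      · have := h.shrink hxy
        have e1 : (x - y).natAbs = y.natAbs - x.natAbs := by
          rcases mul_pos_iff.1 h1 with ⟨hx, hy⟩ | ⟨hx, hy⟩ <;> omega
        rw [e1]
        convert this using 1
        ring
    · have hxy' : x = y := by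
        rcases mul_pos_iff.1 h1 with ⟨hx, hy⟩ | ⟨hx, hy⟩ <;> omega
      subst hxy'
      obtain ⟨g1, g2, g3⟩ := h.eq_base rfl
      have hc : c = 2 := by rw [← g2]; ring
      exact Or.inr (Or.inr (Or.inr ⟨sub_self _, g1, hc, g3⟩))
    · refine Or.inl ⟨?_, ?_⟩
      · rcases mul_pos_iff.1 h1 with ⟨hx, hy⟩ | ⟨hx, hy⟩
        · exact mul_pos hx (by omega)
        · exact mul_pos_of_neg_of_neg hx (by omega)
      · have e1 : (x - y).natAbs = x.natAbs - y.natAbs := by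
          rcases mul_pos_iff.1 h1 with ⟨hx, hy⟩ | ⟨hx, hy⟩ <;> omega
        have e2 := (h.swap.shrink hxy).right.swap
        rw [Nat.add_sub_cancel' hxy.le] at e2
        rw [e1]
        convert e2.swap using 1 <;> ring
  · refine Or.inl ⟨?_, ?_⟩
    · rcases mul_neg_iff.1 h1 with ⟨hx, hy⟩ | ⟨hx, hy⟩
      · exact mul_pos hx (by omega)
      · exact mul_pos_of_neg_of_neg hx (by omega)
    · have e1 : (x - y).natAbs = x.natAbs + y.natAbs := by
        rcases mul_neg_iff.1 h1 with ⟨hx, hy⟩ | ⟨hx, hy⟩ <;> omega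
      rw [e1]
      exact h.left
  · exact Or.inr (Or.inr (Or.inl ⟨h1, by rw [h1]; simpa using h2, h3, h4.symm.imp And.symm And.symm⟩))
  · subst h1 h3
    have e1 : (x - 0).natAbs = 1 := by simpa using h2
    refine Or.inl ⟨?_, ?_⟩
    · rw [sub_zero]
      exact mul_self_pos.2 (by omega)
    · rw [e1, h2]
      rcases h4 with ⟨rfl, rfl⟩ | ⟨rfl, rfl⟩
      · exact .base
      · exact .base'

theorem pred (h : IsTriple T e a b c x y) : IsTriple T e a c (2 * T - a * c - b) x (y - x) := by
  have := h.rotate.neg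
  rwa [neg_sub] at this

theorem succ (h : IsTriple T e a b c x y) : IsTriple T e a (2 * T - a * b - c) b x (y + x) := by
  have := h.neg.rotate
  rwa [sub_neg_eq_add, add_comm] at this

/-- A block of `n` twists consists of `n` flips, each adding `x` to the label `y`, just as in the
recursion of the convergents. -/
theorem seq {ψ : ℤ → A} (hψ : IsTraceSeq T a ψ) (h : IsTriple T e a (ψ 0) (ψ (-1)) x y) (n : ℤ) :
    IsTriple T e a (ψ n) (ψ (n - 1)) x (n * x + y) := by
  induction n using Int.induction_on with
  | zero => simpa using h
  | succ n ih =>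
    have := ih.succ
    rw [← hψ] at this
    rw [add_sub_cancel_right]
    convert this using 1
    ring
  | pred n ih =>
    have := ih.pred
    have h1 := hψ (-n - 1)
    rw [sub_add_cancel] at h1
    rw [h1] at this
    convert this using 1 <;> ring

theorem grown (h : IsTriple T e a b c x y) (hx : x ≠ 0) :
    (x.natAbs = 1 ∧ (a = e ∨ a = T - e)) ∨ ∃ b' c' q, GrownTriple T e a b' c' x.natAbs q := by
  rcases h with ⟨h1, h⟩ | ⟨h1, h⟩ | ⟨h1, h2, h3, h4⟩ | ⟨h1, h2, h3, h4⟩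
  · exact Or.inr ⟨_, _, _, h⟩
  · exact Or.inr ⟨_, _, _, h⟩
  · exact absurd h1 hx
  · exact Or.inl ⟨h2, h4.imp And.left And.left⟩

theorem eq_two (h : IsTriple T e a b c x y) (hx : x = 0) : a = 2 := by
  rcases h with ⟨h1, h⟩ | ⟨h1, h⟩ | ⟨h1, h2, h3, h4⟩ | ⟨h1, h2, h3, h4⟩
  · simp [hx] at h1
  · simp [hx] at h1
  · exact h3
  · omega

end IsTriple

theorem isTriple_traceTripleRec [Algebra ℂ A] {T e₀ : A} (l : List ℤ) :
    ∀ (k : ℤ) (e : A) (ψ : ℤ → A) (x y : ℤ), IsTraceSeq T e ψ →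
      IsTriple T e₀ e (ψ 0) (ψ (-1)) x y → ∃ c w,
      IsTriple T e₀ (traceTripleRec T e ψ (k :: l)).1 c w (fracRec x y (k :: l)).1
        (fracRec x y (k :: l)).2 := by
  induction l with
  | nil =>
    intro k e ψ x y hψ h
    exact ⟨_, _, (h.seq hψ k).swap⟩
  | cons k' l ih =>
    intro k e ψ x y hψ h
    refine ih k' _ _ (k * x + y) x (isTraceSeq_psiNext _ _ _ _) ?_
    rw [psiNext_zero, psiNext_neg_one]
    exact (h.seq hψ k).swap

theorem isTriple_traceTriple [Algebra ℂ A] {T e : A} {k : List ℤ} (hk : k ≠ []) : ∃ c w,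
    IsTriple T e (traceTriple T e k).1 c w (fracNum k) (fracDen k) := by
  obtain ⟨k, l, rfl⟩ := List.exists_cons_of_ne_nil hk
  refine isTriple_traceTripleRec l k _ _ 1 0 (isTraceSeq_psiStart T e) ?_
  rw [psiStart_zero, psiStart_neg_one]
  exact Or.inr (Or.inr (Or.inr ⟨rfl, rfl, rfl, Or.inl ⟨rfl, rfl⟩⟩))

open Polynomial

/-- The polynomial has degree `n` and leading coefficient `±1`. -/
def HasUnitLead {B : Type*} [CommRing B] (f : B[X]) (n : ℕ) : Prop :=
  f.natDegree ≤ n ∧ (f.coeff n = 1 ∨ f.coeff n = -1)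

/-- A flip that increases the labels is dominated by the product of two entries: their degrees add
up, their leading coefficients `±1` multiply, and the third entry has a smaller degree since the
labels are positive. -/
theorem GrownTriple.hasUnitLead {B : Type*} [CommRing B] {T : B} {ε b : B}
    (hε : ε = 1 ∨ ε = -1) {f g h : B[X]} {p q : ℕ}
    (H : GrownTriple (C T) (C ε * X + C b) f g h p q) :
    HasUnitLead f p ∧ HasUnitLead g q ∧ HasUnitLead h (p + q) := by
  have l1 : HasUnitLead (C ε * X + C b) 1 := by
    refine ⟨natDegree_linear_le, ?_⟩
    simp [coeff_C, hε]
  have l2 : HasUnitLead (C T - (C ε * X + C b)) 1 := by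
    refine ⟨(natDegree_sub_le _ _).trans (by simpa using l1.1), ?_⟩
    rcases hε with h | h <;> simp [coeff_X, h]
  have step : ∀ (f g h : B[X]) (p q r : ℕ), HasUnitLead f p → HasUnitLead g q →
      h.natDegree ≤ r → r < p + q → HasUnitLead (2 * C T - f * g - h) (p + q) := by
    intro f g h p q r hf hg hh hr
    have hT : (2 * C T : B[X]) = C (2 * T) := by rw [C_mul]; rfl
    have d1 : (f * g).natDegree ≤ p + q := natDegree_mul_le_of_le hf.1 hg.1
    refine ⟨(natDegree_sub_le_of_le (natDegree_sub_le_of_le (m := p + q) (by rw [hT, natDegree_C]; exact Nat.zero_le _) d1)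
      hh).trans (by omega), ?_⟩
    rw [coeff_sub, coeff_sub, coeff_mul_add_eq_of_natDegree_le hf.1 hg.1, hT, coeff_C_of_ne_zero (by omega),
      coeff_eq_zero_of_natDegree_lt (hh.trans_lt hr)]
    rcases hf.2 with h1 | h1 <;> rcases hg.2 with h2 | h2 <;> simp [h1, h2]
  induction H with
  | base => exact ⟨l1, l2, step _ _ _ 1 1 0 l1 l2 (by simp) (by norm_num)⟩
  | base' => exact ⟨l2, l1, step _ _ _ 1 1 0 l2 l1 (by simp) (by norm_num)⟩
  | @left a b c p q h ih =>
    have := h.pos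
    exact ⟨ih.1, ih.2.2, step _ _ _ _ _ q ih.1 ih.2.2 ih.2.1.1 (by omega)⟩
  | @right a b c p q h ih =>
    have := h.pos
    exact ⟨ih.2.2, ih.2.1, step _ _ _ _ _ p ih.2.2 ih.2.1 ih.1.1 (by omega)⟩

/-- As a polynomial in `r`, for a given value of `t²`, `z + 2` has the absolute value of the
numerator as degree, and leading coefficient `±1`. -/
theorem hasUnitLead_traceTriple {B : Type*} [CommRing B] [Algebra ℂ B] {T ε b : B}
    (hε : ε = 1 ∨ ε = -1) {k : List ℤ} (hk : k ≠ []) (hp : fracNum k ≠ 0) :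
    HasUnitLead (traceTriple (C T) (C ε * X + C b) k).1 (fracNum k).natAbs := by
  obtain ⟨c, w, h⟩ := isTriple_traceTriple (T := C T) (e := C ε * X + C b) hk
  have l1 : HasUnitLead (C ε * X + C b) 1 := by
    refine ⟨natDegree_linear_le, ?_⟩
    simp [coeff_C, hε]
  have l2 : HasUnitLead (C T - (C ε * X + C b)) 1 := by
    refine ⟨(natDegree_sub_le _ _).trans (by simpa using l1.1), ?_⟩
    rcases hε with h | h <;> simp [coeff_X, h]
  rcases h.grown hp with ⟨h1, h2 | h2⟩ | ⟨b', c', q, h⟩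
  · rw [h1, h2]; exact l1
  · rw [h1, h2]; exact l2
  · exact (h.hasUnitLead hε).1

/-- The label 0 carries the constant trace 2. A tangle with vanishing numerator therefore forces `τ
= 2`, which excludes it on the curve and in the exceptional part. -/
theorem traceTriple_of_fracNum_eq_zero [Algebra ℂ A] {T e : A} {k : List ℤ} (hk : k ≠ [])
    (hp : fracNum k = 0) : (traceTriple T e k).1 = 2 := by
  obtain ⟨c, w, h⟩ := isTriple_traceTriple (T := T) (e := e) hk
  exact h.eq_two hp

end Degrees

/-! ### The trace polynomials at `t = 0` -/

section TraceFree

variable {A : Type*} [CommRing A]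

/-- The trace `u + u⁻¹`. -/
def unitTrace (u : Aˣ) : A := (u : A) + ((u⁻¹ : Aˣ) : A)

theorem unitTrace_inv (u : Aˣ) : unitTrace u⁻¹ = unitTrace u := by
  rw [unitTrace, unitTrace, inv_inv, add_comm]

/-- For `T = 0` the recursion is homogeneous; its solutions come from geometric progressions, by the
product formula for `unitTrace`. -/
theorem isTraceSeq_units (α β : Aˣ) :
    IsTraceSeq (0 : A) (-unitTrace α) fun n => -unitTrace (β * α ^ n) := by
  intro n
  have h1 : β * α ^ (n + 1) = β * α ^ n * α := by rw [zpow_add_one, mul_assoc]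
  have h2 : β * α ^ (n - 1) = β * α ^ n * α⁻¹ := by rw [zpow_sub_one, mul_assoc]
  simp only [unitTrace, h1, h2, mul_inv_rev, inv_inv, Units.val_mul]
  ring

variable [Algebra ℂ A]

/-- The exponents of `η` and of `ε` satisfy the recursion of the convergents, with different initial
values. The second unit will be `-1` and records the signs. -/
theorem traceTripleRec_units (η ε : Aˣ) (l : List ℤ) : ∀ (k a b a' b' : ℤ)
    (ψ : ℤ → A), IsTraceSeq (0 : A) (-unitTrace (η ^ a * ε ^ a')) ψ →
    ψ 0 = -unitTrace (η ^ b * ε ^ b') →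
    ψ (-1) = -unitTrace (η ^ b * ε ^ b' * (η ^ a * ε ^ a')⁻¹) →
    let μ := η ^ (fracRec a b (k :: l)).1 * ε ^ (fracRec a' b' (k :: l)).1
    let ν := η ^ (fracRec a b (k :: l)).2 * ε ^ (fracRec a' b' (k :: l)).2
    traceTripleRec 0 (-unitTrace (η ^ a * ε ^ a')) ψ (k :: l) =
      (-unitTrace μ, -unitTrace ν, -unitTrace (μ * ν⁻¹)) := by
  induction l with
  | nil =>
    intro k a b a' b' ψ hψ h0 h1
    have e1 := hψ.eq (isTraceSeq_units (η ^ a * ε ^ a') (η ^ b * ε ^ b')) (by simp [h0])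
      (by rw [h1]; simp)
    have e2 : η ^ b * ε ^ b' * (η ^ a * ε ^ a') ^ k = η ^ (k * a + b) * ε ^ (k * a' + b') := by
      rw [mul_zpow, zpow_add, zpow_add, mul_comm k, mul_comm k, zpow_mul, zpow_mul,
        mul_mul_mul_comm, mul_comm (η ^ b), mul_comm (ε ^ b')]
    have e3 : η ^ b * ε ^ b' * (η ^ a * ε ^ a') ^ (k - 1) =
        η ^ (k * a + b) * ε ^ (k * a' + b') * (η ^ a * ε ^ a')⁻¹ := by
      rw [zpow_sub_one, ← mul_assoc, e2]
    simp only [traceTripleRec, fracRec, e1, e2, e3]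
  | cons k' l ih =>
    intro k a b a' b' ψ hψ h0 h1
    have e1 := hψ.eq (isTraceSeq_units (η ^ a * ε ^ a') (η ^ b * ε ^ b')) (by simp [h0])
      (by rw [h1]; simp)
    have e2 : η ^ b * ε ^ b' * (η ^ a * ε ^ a') ^ k = η ^ (k * a + b) * ε ^ (k * a' + b') := by
      rw [mul_zpow, zpow_add, zpow_add, mul_comm k, mul_comm k, zpow_mul, zpow_mul,
        mul_mul_mul_comm, mul_comm (η ^ b), mul_comm (ε ^ b')]
    have e3 : η ^ b * ε ^ b' * (η ^ a * ε ^ a') ^ (k - 1) =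
        η ^ (k * a + b) * ε ^ (k * a' + b') * (η ^ a * ε ^ a')⁻¹ := by
      rw [zpow_sub_one, ← mul_assoc, e2]
    have e4 : ψ k = -unitTrace (η ^ (k * a + b) * ε ^ (k * a' + b')) := by rw [e1]; simp only [e2]
    have e5 : ψ (k - 1) =
        -unitTrace (η ^ (k * a + b) * ε ^ (k * a' + b') * (η ^ a * ε ^ a')⁻¹) := by
      rw [e1]; simp only [e3]
    rw [traceTripleRec, e4, e5]
    refine ih k' _ _ _ _ _ (isTraceSeq_psiNext _ _ _ _) (psiNext_zero _ _ _ _) ?_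
    rw [psiNext_neg_one, ← unitTrace_inv, mul_inv_rev, inv_inv]

/-- The exponent of the sign that accompanies `fracNum`. -/
def fracNum' (k : List ℤ) : ℤ := (fracRec 0 1 k).1

/-- The exponent of the sign that accompanies `fracDen`. -/
def fracDen' (k : List ℤ) : ℤ := (fracRec 0 1 k).2

/-- Pairs of trace-free matrices are generically binary dihedral: a tangle then acts on the rotation
parameter `η` by powers, with the numerator and the denominator as exponents. -/
theorem traceTriple_units {k : List ℤ} (hk : k ≠ []) (η : Aˣ) :
    let μ := η ^ fracNum k * (-1) ^ fracNum' k
    let ν := η ^ fracDen k * (-1) ^ fracDen' k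
    traceTriple (0 : A) (-unitTrace η) k =
      (-unitTrace μ, -unitTrace ν, -unitTrace (μ * ν⁻¹)) := by
  obtain ⟨k, l, rfl⟩ := List.exists_cons_of_ne_nil hk
  have := traceTripleRec_units η (-1) l k 1 0 0 1 (psiStart (0 : A) (-unitTrace η))
  simp only [zpow_one, zpow_zero, mul_one, one_mul] at this
  refine this (isTraceSeq_psiStart _ _) ?_ ?_
  · rw [psiStart_zero, unitTrace, inv_neg, inv_one]; simp; norm_num
  · rw [psiStart_neg_one, ← unitTrace_inv]; simp [unitTrace, add_comm]

/-- Each step has determinant `-1`. Thus a unit is recovered, up to sign, from its powers `μ` and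
`ν`. -/
theorem fracRec_det (l : List ℤ) : ∀ a b a' b' : ℤ, a * b' - b * a' = 1 ∨ a * b' - b * a' = -1 →
    (fracRec a b l).1 * (fracRec a' b' l).2 - (fracRec a b l).2 * (fracRec a' b' l).1 = 1 ∨
      (fracRec a b l).1 * (fracRec a' b' l).2 - (fracRec a b l).2 * (fracRec a' b' l).1 = -1 := by
  induction l with
  | nil => intro a b a' b' h; exact h
  | cons k l ih =>
    intro a b a' b' h
    refine ih _ _ _ _ ?_
    have e : (k * a + b) * a' - a * (k * a' + b') = -(a * b' - b * a') := by ring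
    rw [e]
    omega

theorem frac_det (k : List ℤ) : fracNum k * fracDen' k - fracDen k * fracNum' k = 1 ∨
    fracNum k * fracDen' k - fracDen k * fracNum' k = -1 :=
  fracRec_det k 1 0 0 1 (by norm_num)

end TraceFree

end Montesinos
end

noncomputable section

namespace Montesinos

/-! ### Pairs of matrices in `SL(2,ℂ)` -/

section Matrices

namespace SL2

theorem mul_00 (M N : SL2) : (M * N).1 0 0 = M.1 0 0 * N.1 0 0 + M.1 0 1 * N.1 1 0 := by
  simp [Matrix.mul_apply, Fin.sum_univ_two]

theorem mul_01 (M N : SL2) : (M * N).1 0 1 = M.1 0 0 * N.1 0 1 + M.1 0 1 * N.1 1 1 := by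
  simp [Matrix.mul_apply, Fin.sum_univ_two]

theorem mul_10 (M N : SL2) : (M * N).1 1 0 = M.1 1 0 * N.1 0 0 + M.1 1 1 * N.1 1 0 := by
  simp [Matrix.mul_apply, Fin.sum_univ_two]

theorem mul_11 (M N : SL2) : (M * N).1 1 1 = M.1 1 0 * N.1 0 1 + M.1 1 1 * N.1 1 1 := by
  simp [Matrix.mul_apply, Fin.sum_univ_two]

theorem inv_00 (M : SL2) : (M⁻¹).1 0 0 = M.1 1 1 := by
  rw [Matrix.SpecialLinearGroup.coe_inv, Matrix.adjugate_fin_two]; simp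

theorem inv_01 (M : SL2) : (M⁻¹).1 0 1 = -M.1 0 1 := by
  rw [Matrix.SpecialLinearGroup.coe_inv, Matrix.adjugate_fin_two]; simp

theorem inv_10 (M : SL2) : (M⁻¹).1 1 0 = -M.1 1 0 := by
  rw [Matrix.SpecialLinearGroup.coe_inv, Matrix.adjugate_fin_two]; simp

theorem inv_11 (M : SL2) : (M⁻¹).1 1 1 = M.1 0 0 := by
  rw [Matrix.SpecialLinearGroup.coe_inv, Matrix.adjugate_fin_two]; simp

theorem det_eq (M : SL2) : M.1 0 0 * M.1 1 1 - M.1 0 1 * M.1 1 0 = 1 := by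
  rw [← Matrix.det_fin_two]; exact M.2

theorem ext' {M N : SL2} (h1 : M.1 0 0 = N.1 0 0) (h2 : M.1 0 1 = N.1 0 1)
    (h3 : M.1 1 0 = N.1 1 0) (h4 : M.1 1 1 = N.1 1 1) : M = N := by
  apply Subtype.ext
  ext i j
  fin_cases i <;> fin_cases j <;> assumption

/-- The matrix with the given entries. -/
def mk (a b c d : ℂ) (h : a * d - b * c = 1) : SL2 :=
  ⟨!![a, b; c, d], by rw [Matrix.det_fin_two_of, h]⟩

end SL2

open SL2

theorem uPlus_00 (κ : ℂˣ) (ξ : ℂ) : (uPlus κ ξ).1 0 0 = κ := rfl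
theorem uPlus_01 (κ : ℂˣ) (ξ : ℂ) : (uPlus κ ξ).1 0 1 = ξ := rfl
theorem uPlus_10 (κ : ℂˣ) (ξ : ℂ) : (uPlus κ ξ).1 1 0 = 0 := rfl
theorem uPlus_11 (κ : ℂˣ) (ξ : ℂ) : (uPlus κ ξ).1 1 1 = (κ : ℂ)⁻¹ := rfl

/-- The lower triangular counterpart of `uPlus`. -/
def lPlus (κ : ℂˣ) (ξ : ℂ) : SL2 := mk κ 0 ξ (κ : ℂ)⁻¹ (by simp)

theorem lPlus_00 (κ : ℂˣ) (ξ : ℂ) : (lPlus κ ξ).1 0 0 = κ := rfl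
theorem lPlus_01 (κ : ℂˣ) (ξ : ℂ) : (lPlus κ ξ).1 0 1 = 0 := rfl
theorem lPlus_10 (κ : ℂˣ) (ξ : ℂ) : (lPlus κ ξ).1 1 0 = ξ := rfl
theorem lPlus_11 (κ : ℂˣ) (ξ : ℂ) : (lPlus κ ξ).1 1 1 = (κ : ℂ)⁻¹ := rfl

/-- The matrices that preserve the line spanned by `v`. -/
def lineStabilizer (v : Fin 2 → ℂ) : Subgroup SL2 where
  carrier := {M | ∃ c : ℂ, M.1.mulVec v = c • v}
  one_mem' := ⟨1, by simp⟩
  mul_mem' := by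
    rintro M N ⟨c, hc⟩ ⟨d, hd⟩
    refine ⟨d * c, ?_⟩
    rw [Matrix.SpecialLinearGroup.coe_mul, ← Matrix.mulVec_mulVec, hd, Matrix.mulVec_smul, hc, smul_smul]
  inv_mem' := by
    rintro M ⟨c, hc⟩
    have h1 : M⁻¹.1.mulVec (M.1.mulVec v) = v := by
      rw [Matrix.mulVec_mulVec, ← Matrix.SpecialLinearGroup.coe_mul, inv_mul_cancel,
        Matrix.SpecialLinearGroup.coe_one, Matrix.one_mulVec]
    rw [hc, Matrix.mulVec_smul] at h1
    by_cases h : c = 0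
    · rw [h, zero_smul] at h1
      exact ⟨0, by rw [← h1]; simp⟩
    · exact ⟨c⁻¹, by rw [← h1, smul_smul, inv_mul_cancel₀ h, one_smul, h1]⟩

theorem mem_lineStabilizer_iff {M : SL2} {v : Fin 2 → ℂ} (hv : v ≠ 0) : M ∈ lineStabilizer v ↔
    (M.1 0 0 * v 0 + M.1 0 1 * v 1) * v 1 = (M.1 1 0 * v 0 + M.1 1 1 * v 1) * v 0 := by
  constructor
  · rintro ⟨c, hc⟩
    have h0 := congrFun hc 0
    have h1 := congrFun hc 1
    simp only [Matrix.mulVec, dotProduct, Fin.sum_univ_two, Pi.smul_apply, smul_eq_mul] at h0 h1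
    rw [h0, h1]; ring
  · intro h
    have e0 : ∀ c, (M.1 0 0 * v 0 + M.1 0 1 * v 1 = c * v 0) →
        (M.1 1 0 * v 0 + M.1 1 1 * v 1 = c * v 1) → M ∈ lineStabilizer v := by
      intro c h1 h2
      refine ⟨c, ?_⟩
      ext i
      fin_cases i
      · simpa [Matrix.mulVec, dotProduct, Fin.sum_univ_two] using h1
      · simpa [Matrix.mulVec, dotProduct, Fin.sum_univ_two] using h2
    by_cases h0 : v 0 = 0
    · have h1 : v 1 ≠ 0 := by
        intro h1; apply hv; ext i; fin_cases i <;> assumption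
      refine e0 (M.1 1 1) ?_ ?_
      · have : M.1 0 1 * v 1 * v 1 = 0 := by rw [h0] at h; linear_combination h
        have : M.1 0 1 = 0 := by simpa [h1] using this
        rw [h0, this]; ring
      · rw [h0]; ring
    · refine e0 ((M.1 0 0 * v 0 + M.1 0 1 * v 1) / v 0) ?_ ?_
      · field_simp
      · field_simp; linear_combination -h

theorem mem_lineStabilizer_e₁ {M : SL2} : M ∈ lineStabilizer ![1, 0] ↔ M.1 1 0 = 0 := by
  rw [mem_lineStabilizer_iff (by simp)]
  simp [eq_comm]

theorem mem_lineStabilizer_e₂ {M : SL2} : M ∈ lineStabilizer ![0, 1] ↔ M.1 0 1 = 0 := by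
  rw [mem_lineStabilizer_iff (by simp)]
  simp

theorem lineStabilizer_conj {P M : SL2} {v : Fin 2 → ℂ} :
    P⁻¹ * M * P ∈ lineStabilizer v ↔ M ∈ lineStabilizer (P.1.mulVec v) := by
  have hP : ∀ w, P.1.mulVec (P⁻¹.1.mulVec w) = w := by
    intro w
    rw [Matrix.mulVec_mulVec, ← Matrix.SpecialLinearGroup.coe_mul, mul_inv_cancel,
        Matrix.SpecialLinearGroup.coe_one, Matrix.one_mulVec]
  have hP' : ∀ w, P⁻¹.1.mulVec (P.1.mulVec w) = w := by
    intro w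
    rw [Matrix.mulVec_mulVec, ← Matrix.SpecialLinearGroup.coe_mul, inv_mul_cancel,
        Matrix.SpecialLinearGroup.coe_one, Matrix.one_mulVec]
  have e : (P⁻¹ * M * P).1.mulVec v = P⁻¹.1.mulVec (M.1.mulVec (P.1.mulVec v)) := by
    simp only [Matrix.SpecialLinearGroup.coe_mul, Matrix.mulVec_mulVec, mul_assoc]
  constructor
  · rintro ⟨c, hc⟩
    refine ⟨c, ?_⟩
    rw [e] at hc
    rw [← hP (M.1.mulVec _), hc, Matrix.mulVec_smul]
  · rintro ⟨c, hc⟩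
    refine ⟨c, ?_⟩
    rw [e, hc, Matrix.mulVec_smul, hP']

/-- The two matrices have no common eigenvector. -/
def IrrPair (M N : SL2) : Prop := ∀ v : Fin 2 → ℂ, v ≠ 0 → M ∈ lineStabilizer v →
  N ∉ lineStabilizer v

theorem IrrPair.conj {M N : SL2} (h : IrrPair M N) (P : SL2) :
    IrrPair (P⁻¹ * M * P) (P⁻¹ * N * P) := by
  intro v hv h1 h2
  refine h (P.1.mulVec v) ?_ (lineStabilizer_conj.1 h1) (lineStabilizer_conj.1 h2)
  intro h0
  apply hv
  have : P⁻¹.1.mulVec (P.1.mulVec v) = v := by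
    rw [Matrix.mulVec_mulVec, ← Matrix.SpecialLinearGroup.coe_mul, inv_mul_cancel,
        Matrix.SpecialLinearGroup.coe_one, Matrix.one_mulVec]
  rw [← this, h0, Matrix.mulVec_zero]

theorem exists_add_inv_eq (t : ℂ) : ∃ κ : ℂˣ, t = κ + (κ : ℂ)⁻¹ := by
  obtain ⟨w, hw⟩ := IsAlgClosed.exists_pow_nat_eq (t ^ 2 - 4) two_pos
  have h : (t + w) / 2 * ((t - w) / 2) = 1 := by linear_combination -hw / 4
  refine ⟨⟨(t + w) / 2, (t - w) / 2, h, by rw [mul_comm, h]⟩, ?_⟩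
  rw [← eq_inv_of_mul_eq_one_right h]
  ring

theorem add_inv_eq_iff {κ ξ : ℂˣ} : (κ : ℂ) + (κ : ℂ)⁻¹ = ξ + (ξ : ℂ)⁻¹ ↔ ξ = κ ∨ ξ = κ⁻¹ := by
  have h1 := κ.ne_zero
  have h2 := ξ.ne_zero
  constructor
  · intro h
    have : ((ξ : ℂ) - κ) * (ξ - (κ : ℂ)⁻¹) = 0 := by
      field_simp at h ⊢
      linear_combination -h
    rcases mul_eq_zero.1 this with h | h
    · exact Or.inl (Units.ext (sub_eq_zero.1 h))
    · exact Or.inr (Units.ext (by rw [sub_eq_zero.1 h]; simp))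
  · rintro (rfl | rfl)
    · rfl
    · simp [add_comm]

/-- An eigenvector becomes the first basis vector. -/
theorem exists_conj_upper {M : SL2} {κ : ℂˣ} (h : tr M = κ + (κ : ℂ)⁻¹) :
    ∃ P : SL2, ∃ a, P⁻¹ * M * P = uPlus κ a := by
  have hκ := κ.ne_zero
  have hdet : (M.1 - (κ : ℂ) • 1).det = 0 := by
    rw [Matrix.det_fin_two]
    simp only [Matrix.sub_apply, Matrix.smul_apply, Matrix.one_apply_eq, smul_eq_mul, mul_one, ne_eq,
      zero_ne_one, one_ne_zero, not_false_eq_true, Matrix.one_apply_ne, mul_zero, sub_zero]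
    have h1 := det_eq M
    rw [tr_eq] at h
    have : (κ : ℂ)⁻¹ * κ = 1 := inv_mul_cancel₀ hκ
    linear_combination h1 - κ * h - this
  obtain ⟨v, hv, h0⟩ := Matrix.exists_mulVec_eq_zero_iff.2 hdet
  rw [Matrix.sub_mulVec, sub_eq_zero, Matrix.smul_mulVec, Matrix.one_mulVec] at h0
  have e0 := congrFun h0 0
  have e1 := congrFun h0 1
  simp only [Matrix.mulVec, dotProduct, Fin.sum_univ_two, Pi.smul_apply, smul_eq_mul] at e0 e1
  obtain ⟨P, p0, p1⟩ : ∃ P : SL2, P.1 0 0 = v 0 ∧ P.1 1 0 = v 1 := by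
    by_cases h : v 0 = 0
    · have h1 : v 1 ≠ 0 := by
        intro h1; apply hv; ext i; fin_cases i <;> assumption
      exact ⟨mk (v 0) (-(v 1)⁻¹) (v 1) 0 (by field_simp; ring), rfl, rfl⟩
    · exact ⟨mk (v 0) 0 (v 1) (v 0)⁻¹ (by field_simp; ring), rfl, rfl⟩
  have hP := det_eq P
  refine ⟨P, (P⁻¹ * M * P).1 0 1, ?_⟩
  have q0 : (P⁻¹ * M * P).1 0 0 = κ := by
    rw [mul_assoc]
    simp only [mul_00, mul_10, inv_00, inv_01]
    rw [p0, p1, e0, e1, ← p0, ← p1]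
    linear_combination κ * hP
  have q1 : (P⁻¹ * M * P).1 1 0 = 0 := by
    rw [mul_assoc]
    simp only [mul_00, mul_10, inv_10, inv_11]
    rw [p0, p1, e0, e1, ← p0, ← p1]
    ring
  refine ext' q0 rfl q1 ?_
  have := det_eq (P⁻¹ * M * P)
  rw [q0, q1] at this
  rw [uPlus_11, eq_comm]
  refine inv_eq_of_mul_eq_one_right ?_
  linear_combination this

theorem conj_diag_upper (s κ : ℂˣ) (a : ℂ) :
    (uPlus s 0)⁻¹ * uPlus κ a * uPlus s 0 = uPlus κ (a / (s : ℂ) ^ 2) := by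
  have := s.ne_zero
  have := κ.ne_zero
  apply ext' <;> simp [mul_00, mul_01, mul_10, mul_11, inv_00, inv_01, inv_10, inv_11, uPlus_00,
    uPlus_01, uPlus_10, uPlus_11] <;> field_simp

theorem conj_diag_lower (s κ : ℂˣ) (a : ℂ) :
    (uPlus s 0)⁻¹ * lPlus κ a * uPlus s 0 = lPlus κ (a * (s : ℂ) ^ 2) := by
  have := s.ne_zero
  have := κ.ne_zero
  apply ext' <;> simp [mul_00, mul_01, mul_10, mul_11, inv_00, inv_01, inv_10, inv_11, uPlus_00,
    uPlus_01, uPlus_10, uPlus_11, lPlus_00, lPlus_01, lPlus_10, lPlus_11] <;> field_simp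

theorem exists_unit_sq (a : ℂ) (ha : a ≠ 0) : ∃ s : ℂˣ, (s : ℂ) ^ 2 = a := by
  obtain ⟨w, hw⟩ := IsAlgClosed.exists_pow_nat_eq a two_pos
  exact ⟨Units.mk0 w (by rintro rfl; apply ha; rw [← hw]; simp), hw⟩

theorem tr_uPlus (κ : ℂˣ) (a : ℂ) : tr (uPlus κ a) = κ + (κ : ℂ)⁻¹ := tr_eq _

theorem tr_lPlus (κ : ℂˣ) (a : ℂ) : tr (lPlus κ a) = κ + (κ : ℂ)⁻¹ := tr_eq _

theorem tr_uPlus_mul_lPlus (κ ξ : ℂˣ) (a b : ℂ) :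
    tr (uPlus κ a * lPlus ξ b) = κ * ξ + a * b + (κ : ℂ)⁻¹ * (ξ : ℂ)⁻¹ := by
  rw [tr_eq, mul_00, mul_11]
  simp only [uPlus_00, uPlus_01, uPlus_10, uPlus_11, lPlus_00, lPlus_01, lPlus_10, lPlus_11]
  ring

theorem tr_conj' (P M : SL2) : tr (P⁻¹ * M * P) = tr M := by
  have := tr_conj P⁻¹ M
  rwa [inv_inv] at this

theorem tr_conj_mul_conj (P M N : SL2) : tr (P⁻¹ * M * P * (P⁻¹ * N * P)) = tr (M * N) := by
  rw [← tr_conj' P (M * N)]; congr 1; group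

/-- A diagonalizable matrix. -/
theorem exists_conj_diag {M : SL2} {l : ℂˣ} (h : tr M = l + (l : ℂ)⁻¹) (hl : l ≠ l⁻¹) :
    ∃ P : SL2, P⁻¹ * M * P = uPlus l 0 := by
  obtain ⟨P, a, hP⟩ := exists_conj_upper h
  have hl' : (l : ℂ) - (l : ℂ)⁻¹ ≠ 0 := by
    intro h0
    apply hl
    ext
    rw [sub_eq_zero.1 h0]; simp
  refine ⟨P * uPlus 1 (-a / (l - (l : ℂ)⁻¹)), ?_⟩
  have e : (P * uPlus 1 (-a / (l - (l : ℂ)⁻¹)))⁻¹ * M * (P * uPlus 1 (-a / (l - (l : ℂ)⁻¹))) =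
      (uPlus 1 (-a / (l - (l : ℂ)⁻¹)))⁻¹ * (P⁻¹ * M * P) * uPlus 1 (-a / (l - (l : ℂ)⁻¹)) := by group
  rw [e, hP]
  set x := -a / (l - (l : ℂ)⁻¹) with hx
  have hx' : x * (l - (l : ℂ)⁻¹) = -a := by rw [hx, div_mul_cancel₀ _ hl']
  apply ext' <;> simp [mul_00, mul_01, mul_10, mul_11, inv_00, inv_01, inv_10, inv_11, uPlus_00,
    uPlus_01, uPlus_10, uPlus_11]
  linear_combination hx'

/-- A parabolic matrix. -/
theorem exists_conj_parabolic {M : SL2} {l : ℂˣ} (h : tr M = l + (l : ℂ)⁻¹)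
    (hM : M ≠ uPlus l 0) (hl : l = l⁻¹) {a : ℂ} (ha : a ≠ 0) :
    ∃ P : SL2, P⁻¹ * M * P = uPlus l a := by
  obtain ⟨P, b, hP⟩ := exists_conj_upper h
  have hb : b ≠ 0 := by
    rintro rfl
    apply hM
    have e : M = P * uPlus l 0 * P⁻¹ := by rw [← hP]; group
    rw [e]
    have hl' : (l : ℂ)⁻¹ = l := by rw [← Units.val_inv_eq_inv_val, ← hl]
    have hdet := det_eq P
    apply ext' <;> simp [mul_00, mul_01, mul_10, mul_11, inv_00, inv_01, inv_10, inv_11, uPlus_00,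
      uPlus_01, uPlus_10, uPlus_11, hl']
    · linear_combination l * hdet
    · ring
    · ring
    · linear_combination l * hdet
  obtain ⟨s, hs⟩ := exists_unit_sq (b / a) (div_ne_zero hb ha)
  refine ⟨P * uPlus s 0, ?_⟩
  have e : (P * uPlus s 0)⁻¹ * M * (P * uPlus s 0) = (uPlus s 0)⁻¹ * (P⁻¹ * M * P) * uPlus s 0 := by
    group
  rw [e, hP, conj_diag_upper, hs]
  congr 1
  field_simp

/-- The normal form of a pair of matrices without a common eigenvector. -/
theorem IrrPair.exists_normal {X Y : SL2} (h : IrrPair X Y) {κ ξ : ℂˣ}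
    (hX : tr X = κ + (κ : ℂ)⁻¹) (hY : tr Y = ξ + (ξ : ℂ)⁻¹) :
    ∃ P : SL2, ∃ b, P⁻¹ * X * P = uPlus κ 1 ∧ P⁻¹ * Y * P = lPlus ξ b := by
  obtain ⟨P, a, hP⟩ := exists_conj_upper hX
  set Y' := P⁻¹ * Y * P with hY'
  have hirr := h.conj P
  rw [hP, ← hY'] at hirr
  -- The eigenvector for `ξ⁻¹`, not for `ξ`, is needed: it is to become the second basis vector, and
  -- then `ξ` is the upper left entry of the lower triangular matrix.
  have hY1 : tr Y' = (ξ⁻¹ : ℂˣ) + ((ξ⁻¹ : ℂˣ) : ℂ)⁻¹ := by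
    rw [hY', tr_conj', hY]; simp [add_comm]
  obtain ⟨Q, b, hQ⟩ := exists_conj_upper hY1
  have hQ0 : Q.1 0 0 = 0 ∨ Q.1 0 0 ≠ 0 := em _
  have hmem : Y' ∈ lineStabilizer (Q.1.mulVec ![1, 0]) := by
    rw [← lineStabilizer_conj, hQ, mem_lineStabilizer_e₁]; rfl
  have hv : Q.1.mulVec ![1, 0] = ![Q.1 0 0, Q.1 1 0] := by
    ext i; fin_cases i <;> simp [Matrix.mulVec, dotProduct, Fin.sum_univ_two]
  have hY2 : Y' * Q = Q * uPlus ξ⁻¹ b := by rw [← hQ]; group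
  have e0 := congrArg (fun M : SL2 => M.1 0 0) hY2
  have e1 := congrArg (fun M : SL2 => M.1 1 0) hY2
  simp only [mul_00, mul_10, uPlus_00, uPlus_10, mul_zero, add_zero, Units.val_inv_eq_inv_val] at e0 e1
  have hQ1 : Q.1 1 0 ≠ 0 := by
    intro h0
    have hq : Q.1 0 0 ≠ 0 := by
      intro h1; have := det_eq Q; rw [h0, h1] at this; norm_num at this
    refine hirr ![1, 0] (by simp) (mem_lineStabilizer_e₁.2 rfl) (mem_lineStabilizer_e₁.2 ?_)
    rw [h0] at e1
    simpa [hq] using e1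
  -- move the eigenvector of `Y'` to the second basis vector
  set x := Q.1 0 0 / Q.1 1 0 with hx
  have hx' : Q.1 0 0 = x * Q.1 1 0 := by rw [hx]; field_simp
  have f0 : Y'.1 0 0 * x + Y'.1 0 1 = x * (ξ : ℂ)⁻¹ := by
    refine mul_right_cancel₀ hQ1 ?_
    rw [hx'] at e0; linear_combination e0
  have f1 : Y'.1 1 0 * x + Y'.1 1 1 = (ξ : ℂ)⁻¹ := by
    refine mul_right_cancel₀ hQ1 ?_
    rw [hx'] at e1; linear_combination e1
  set R := uPlus 1 x with hR
  have hXR : R⁻¹ * uPlus κ a * R = uPlus κ (κ * x + a - x * (κ : ℂ)⁻¹) := by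
    apply ext' <;> simp [hR, mul_00, mul_01, mul_10, mul_11, inv_00, inv_01, inv_10, inv_11, uPlus_00,
      uPlus_01, uPlus_10, uPlus_11]
    ring
  have hdetY := det_eq Y'
  have hξ := ξ.ne_zero
  have hξ' : (ξ : ℂ) * (ξ : ℂ)⁻¹ = 1 := mul_inv_cancel₀ hξ
  have htrY : Y'.1 0 0 + Y'.1 1 1 = ξ + (ξ : ℂ)⁻¹ := by rw [← tr_eq, hY', tr_conj', hY]
  have hYR : R⁻¹ * Y' * R = lPlus ξ (Y'.1 1 0) := by
    apply ext' <;> simp [hR, mul_00, mul_01, mul_10, mul_11, inv_00, inv_01, inv_10, inv_11, uPlus_00,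
      uPlus_01, uPlus_10, uPlus_11, lPlus_00, lPlus_01, lPlus_10, lPlus_11]
    · linear_combination htrY - f1
    · linear_combination f0 - x * f1
    · linear_combination f1
  set a' := κ * x + a - x * (κ : ℂ)⁻¹ with ha'
  have ha0 : a' ≠ 0 := by
    intro h0
    have hirr' := hirr.conj R
    rw [hXR, hYR, h0] at hirr'
    exact hirr' ![0, 1] (by simp) (mem_lineStabilizer_e₂.2 rfl) (mem_lineStabilizer_e₂.2 rfl)
  obtain ⟨s, hs⟩ := exists_unit_sq a' ha0
  refine ⟨P * R * uPlus s 0, Y'.1 1 0 * (s : ℂ) ^ 2, ?_, ?_⟩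
  · have e : (P * R * uPlus s 0)⁻¹ * X * (P * R * uPlus s 0) =
      (uPlus s 0)⁻¹ * (R⁻¹ * (P⁻¹ * X * P) * R) * uPlus s 0 := by group
    rw [e, hP, hXR, conj_diag_upper, hs, div_self ha0]
  · have e : (P * R * uPlus s 0)⁻¹ * Y * (P * R * uPlus s 0) =
      (uPlus s 0)⁻¹ * (R⁻¹ * (P⁻¹ * Y * P) * R) * uPlus s 0 := by group
    rw [e, ← hY', hYR, conj_diag_lower]

/-- Pairs without common eigenvectors are determined up to conjugation by their traces. -/
theorem IrrPair.exists_conj {X Y X' Y' : SL2} (h : IrrPair X Y) (h' : IrrPair X' Y')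
    (h1 : tr X = tr X') (h2 : tr Y = tr Y') (h3 : tr (X * Y) = tr (X' * Y')) :
    ∃ P : SL2, P * X * P⁻¹ = X' ∧ P * Y * P⁻¹ = Y' := by
  obtain ⟨κ, hκ⟩ := exists_add_inv_eq (tr X)
  obtain ⟨ξ, hξ⟩ := exists_add_inv_eq (tr Y)
  obtain ⟨P, b, p1, p2⟩ := h.exists_normal hκ hξ
  obtain ⟨Q, c, q1, q2⟩ := h'.exists_normal (h1 ▸ hκ) (h2 ▸ hξ)
  have e1 : tr (X * Y) = κ * ξ + 1 * b + (κ : ℂ)⁻¹ * (ξ : ℂ)⁻¹ := by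
    rw [← tr_uPlus_mul_lPlus, ← p1, ← p2, tr_conj_mul_conj]
  have e2 : tr (X' * Y') = κ * ξ + 1 * c + (κ : ℂ)⁻¹ * (ξ : ℂ)⁻¹ := by
    rw [← tr_uPlus_mul_lPlus, ← q1, ← q2, tr_conj_mul_conj]
  have hbc : b = c := by rw [h3, e2] at e1; linear_combination -e1
  refine ⟨Q * P⁻¹, ?_, ?_⟩
  · have : Q * P⁻¹ * X * (Q * P⁻¹)⁻¹ = Q * (P⁻¹ * X * P) * Q⁻¹ := by group
    rw [this, p1, ← q1]; group
  · have : Q * P⁻¹ * Y * (Q * P⁻¹)⁻¹ = Q * (P⁻¹ * Y * P) * Q⁻¹ := by group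
    rw [this, p2, hbc, ← q2]; group

/-- Schur's lemma. -/
theorem IrrPair.central {X Y : SL2} (h : IrrPair X Y) {P : SL2} (h1 : P * X = X * P)
    (h2 : P * Y = Y * P) (M : SL2) : P * M * P⁻¹ = M := by
  obtain ⟨κ, hκ⟩ := exists_add_inv_eq (tr X)
  obtain ⟨ξ, hξ⟩ := exists_add_inv_eq (tr Y)
  obtain ⟨Q, b, q1, q2⟩ := h.exists_normal hκ hξ
  have hb : b ≠ 0 := by
    rintro rfl
    have := h.conj Q
    rw [q1, q2] at this
    exact this ![1, 0] (by simp) (mem_lineStabilizer_e₁.2 rfl) (mem_lineStabilizer_e₁.2 rfl)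
  set R := Q⁻¹ * P * Q with hR
  have c1 : R * uPlus κ 1 = uPlus κ 1 * R := by
    rw [hR, ← q1]
    calc Q⁻¹ * P * Q * (Q⁻¹ * X * Q) = Q⁻¹ * (P * X) * Q := by group
      _ = _ := by rw [h1]; group
  have c2 : R * lPlus ξ b = lPlus ξ b * R := by
    rw [hR, ← q2]
    calc Q⁻¹ * P * Q * (Q⁻¹ * Y * Q) = Q⁻¹ * (P * Y) * Q := by group
      _ = _ := by rw [h2]; group
  have f1 := congrArg (fun M : SL2 => M.1 0 0) c1
  have f2 := congrArg (fun M : SL2 => M.1 0 0) c2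
  have f3 := congrArg (fun M : SL2 => M.1 1 0) c2
  simp only [mul_00, mul_10, uPlus_00, uPlus_10, uPlus_01, lPlus_00, lPlus_10, lPlus_11, lPlus_01] at f1 f2 f3
  have r1 : R.1 1 0 = 0 := by linear_combination -f1
  have r2 : R.1 0 1 = 0 := by
    have : R.1 0 1 * b = 0 := by linear_combination f2
    simpa [hb] using this
  have r3 : R.1 1 1 = R.1 0 0 := by
    refine mul_right_cancel₀ hb ?_
    rw [r1] at f3; linear_combination f3
  have hcomm : ∀ N : SL2, R * N = N * R := by
    intro N
    apply ext' <;> simp only [mul_00, mul_01, mul_10, mul_11, r1, r2, r3] <;> ring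
  have := hcomm (Q⁻¹ * M * Q)
  calc P * M * P⁻¹ = Q * (R * (Q⁻¹ * M * Q)) * Q⁻¹ * P⁻¹ := by rw [hR]; group
    _ = M := by rw [this, hR]; group

/-- The trace criterion for a common eigenvector. -/
theorem irrPair_iff {X Y : SL2} {t : ℂ} (hX : tr X = t) (hY : tr Y = t) :
    IrrPair X Y ↔ tr (X * Y) ≠ 2 ∧ tr (X * Y) ≠ t ^ 2 - 2 := by
  obtain ⟨κ, hκ⟩ := exists_add_inv_eq t
  have hκ0 : (κ : ℂ) * (κ : ℂ)⁻¹ = 1 := mul_inv_cancel₀ κ.ne_zero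
  constructor
  · intro h
    constructor
    · intro h2
      -- With `ξ = κ⁻¹` the trace of the product is `2 + b`, and with `ξ = κ` below it is `t² - 2 +
      -- b`. In both cases the excluded value gives `b = 0`, and the first basis vector is a common
      -- eigenvector.
      obtain ⟨P, b, p1, p2⟩ := h.exists_normal (κ := κ) (ξ := κ⁻¹) (hX.trans hκ)
        (by rw [hY, hκ]; simp [add_comm])
      have e1 : tr (X * Y) = κ * (κ⁻¹ : ℂˣ) + 1 * b + (κ : ℂ)⁻¹ * ((κ⁻¹ : ℂˣ) : ℂ)⁻¹ := by
        rw [← tr_uPlus_mul_lPlus, ← p1, ← p2, tr_conj_mul_conj]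
      have hb : b = 0 := by
        rw [h2] at e1
        simp only [Units.val_inv_eq_inv_val, inv_inv] at e1
        linear_combination -e1 - 2 * hκ0
      have := h.conj P
      rw [p1, p2, hb] at this
      exact this ![1, 0] (by simp) (mem_lineStabilizer_e₁.2 rfl) (mem_lineStabilizer_e₁.2 rfl)
    · intro h2
      obtain ⟨P, b, p1, p2⟩ := h.exists_normal (κ := κ) (ξ := κ) (hX.trans hκ) (hY.trans hκ)
      have e1 : tr (X * Y) = κ * κ + 1 * b + (κ : ℂ)⁻¹ * (κ : ℂ)⁻¹ := by
        rw [← tr_uPlus_mul_lPlus, ← p1, ← p2, tr_conj_mul_conj]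
      have hb : b = 0 := by
        rw [h2, hκ] at e1
        linear_combination -e1 + 2 * hκ0
      have := h.conj P
      rw [p1, p2, hb] at this
      exact this ![1, 0] (by simp) (mem_lineStabilizer_e₁.2 rfl) (mem_lineStabilizer_e₁.2 rfl)
  · rintro ⟨h1, h2⟩ v hv ⟨c, hc⟩ ⟨d, hd⟩
    have key : ∀ (M : SL2) (c : ℂ), M.1.mulVec v = c • v → c * c - tr M * c + 1 = 0 := by
      intro M c hc
      have e0 := congrFun hc 0
      have e1 := congrFun hc 1
      simp only [Matrix.mulVec, dotProduct, Fin.sum_univ_two, Pi.smul_apply, smul_eq_mul] at e0 e1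
      have hdet := det_eq M
      rw [tr_eq]
      have f0 : (c * c - (M.1 0 0 + M.1 1 1) * c + 1) * v 0 = 0 := by
        linear_combination (M.1 1 1 - c) * e0 - M.1 0 1 * e1 - v 0 * hdet
      have f1 : (c * c - (M.1 0 0 + M.1 1 1) * c + 1) * v 1 = 0 := by
        linear_combination (M.1 0 0 - c) * e1 - M.1 1 0 * e0 - v 1 * hdet
      by_contra hne
      apply hv
      ext i
      fin_cases i
      · simpa [hne] using f0
      · simpa [hne] using f1
    have hcd : (X * Y).1.mulVec v = (c * d) • v := by
      rw [Matrix.SpecialLinearGroup.coe_mul, ← Matrix.mulVec_mulVec, hd, Matrix.mulVec_smul, hc, smul_smul,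
        mul_comm]
    have k1 := key X c hc
    have k2 := key Y d hd
    have k3 := key _ _ hcd
    rw [hX] at k1
    rw [hY] at k2
    set e := tr (X * Y)
    have hc0 : c ≠ 0 := by rintro rfl; norm_num at k1
    have hd0 : d ≠ 0 := by rintro rfl; norm_num at k2
    -- Both eigenvalues are roots of the same polynomial `X² - t X + 1`, so they are equal or
    -- inverse to each other.
    have : (c - d) * (c * d - 1) = 0 := by linear_combination d * k1 - c * k2
    rcases mul_eq_zero.1 this with h | h
    · apply h2
      have hcd' : c = d := sub_eq_zero.1 h
      subst hcd'
      refine mul_right_cancel₀ (mul_ne_zero hc0 hc0) ?_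
      linear_combination -k3 + (c * c + 1 + t * c) * k1
    · apply h1
      have hcd' : c * d = 1 := sub_eq_zero.1 h
      rw [hcd'] at k3
      linear_combination -k3

/-- All values of the traces are realized. -/
theorem exists_pair (t r : ℂ) : ∃ X Y : SL2, tr X = t ∧ tr Y = t ∧ tr (X * Y) = r := by
  obtain ⟨κ, hκ⟩ := exists_add_inv_eq t
  refine ⟨uPlus κ 1, lPlus κ (r - κ * κ - (κ : ℂ)⁻¹ * (κ : ℂ)⁻¹), ?_, ?_, ?_⟩
  · rw [tr_uPlus, hκ]
  · rw [tr_lPlus, hκ]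
  · rw [tr_uPlus_mul_lPlus]; ring

end Matrices

/-! ### The ends of a rational tangle generate -/

section Ends

variable {G : Type} [Group G]

theorem twist_zpow_mem (N : Subgroup G) (n : ℤ) {p : G × G} (h1 : p.1 ∈ N) (h2 : p.2 ∈ N) :
    ((twist ^ n) p).1 ∈ N ∧ ((twist ^ n) p).2 ∈ N := by
  induction n using Int.induction_on with
  | zero => exact ⟨h1, h2⟩
  | succ n ih =>
    rw [add_comm, zpow_add, zpow_one, Equiv.Perm.mul_apply]
    exact ⟨N.mul_mem (N.mul_mem ih.1 ih.2) (N.inv_mem ih.1), ih.1⟩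
  | pred n ih =>
    rw [sub_eq_add_neg, add_comm, zpow_add, Equiv.Perm.mul_apply, Tangle.twist_zpow_neg_one]
    exact ⟨ih.2, N.mul_mem (N.mul_mem (N.inv_mem ih.2) ih.1) ih.2⟩

/-- Twists are invertible, so the recursion can be run backwards from the ends to the generators;
the third entry, which is not part of the output, is recovered from `X * u * w = v`. -/
theorem mem_of_tangleRec_mem (N : Subgroup G) (l : List ℤ) : ∀ X u v w : G, X * u * w = v → X ∈ N →
    (tangleRec u v w l).1 ∈ N → (tangleRec u v w l).2 ∈ N → u ∈ N ∧ v ∈ N := by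
  induction l with
  | nil => intro X u v w _ _ h1 h2; exact ⟨h1, h2⟩
  | cons k l ih =>
    intro X u v w h hX h1 h2
    have hmul := Tangle.twist_zpow_mul k (u, w)
    simp only at hmul
    obtain ⟨hv, hu'⟩ := ih X⁻¹ v ((twist ^ k) (u, w)).1 ((twist ^ k) (u, w)).2⁻¹ (by
      rw [← h, mul_assoc X u w, ← hmul]; group) (N.inv_mem hX) h1 h2
    have hw' : ((twist ^ k) (u, w)).2 ∈ N := by
      have : ((twist ^ k) (u, w)).2 = ((twist ^ k) (u, w)).1⁻¹ * (X⁻¹ * v) := by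
        rw [← h, mul_assoc X u w, ← hmul]; group
      rw [this]
      exact N.mul_mem (N.inv_mem hu') (N.mul_mem (N.inv_mem hX) hv)
    have := twist_zpow_mem N (-k) hu' hw'
    rw [← Equiv.Perm.mul_apply, ← zpow_add, neg_add_cancel, zpow_zero, Equiv.Perm.one_apply] at this
    exact ⟨this.1, hv⟩

theorem Dart.val_mem_iff {A : Type} (N : Subgroup G) (a : Dart A) (f : A → G) :
    a.val f ∈ N ↔ f a.1 ∈ N := by
  rcases a with ⟨a, b⟩
  cases b <;> simp [Dart.val]

theorem y₀_mem_of_ends_mem {k : List ℤ} (hk : k ≠ []) {f : (rational k).Arc → G}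
    (hf : (rational k).IsColoring f) (N : Subgroup G) (h1 : (rational k).nw.val f ∈ N)
    (h2 : (rational k).ne.val f ∈ N) (h3 : (rational k).sw.val f ∈ N) :
    (rational k).y₀.val f ∈ N := by
  have hends := rational_ends hk f hf
  set x := if Even k.length then (rational k).nw.val f else ((rational k).nw.val f)⁻¹ with hx
  have hxN : x ∈ N := by
    rw [hx]; split_ifs
    · exact h1
    · exact N.inv_mem h1
  refine (mem_of_tangleRec_mem N k x⁻¹ x ((rational k).y₀.val f) ((rational k).y₀.val f) (by group) (N.inv_mem hxN) ?_ ?_).2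
  · rw [← hends]; exact N.inv_mem h3
  · rw [← hends]; exact h2

theorem mem_of_ends_mem {k : List ℤ} (hk : k ≠ []) {f : (rational k).Arc → G}
    (hf : (rational k).IsColoring f) (N : Subgroup G) (h1 : (rational k).nw.val f ∈ N)
    (h2 : (rational k).ne.val f ∈ N) (h3 : (rational k).sw.val f ∈ N) (a : (rational k).Arc) :
    f a ∈ N :=
  (isFree_rational k).gen _ (hf.isClosed_subgroup N) ((Dart.val_mem_iff N _ f).1 h1)
    ((Dart.val_mem_iff N _ f).1 (y₀_mem_of_ends_mem hk hf N h1 h2 h3)) a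

theorem coloring_eq_of_generators {k : List ℤ} {f f' : (rational k).Arc → G}
    (hf : (rational k).IsColoring f) (hf' : (rational k).IsColoring f')
    (h1 : (rational k).nw.val f = (rational k).nw.val f')
    (h2 : (genY k).val f = (genY k).val f') : f = f' := by
  have key : ∀ a : Dart (rational k).Arc, a.val f = a.val f' → f a.1 = f' a.1 := by
    rintro ⟨a, b⟩; cases b <;> simp [Dart.val]
  have h3 : f (rational k).y₀.1 = f' (rational k).y₀.1 := by
    have := key _ h2
    unfold genY at this
    split_ifs at this <;> exact this
  exact funext fun a => (isFree_rational k).gen _ (hf.isClosed_eq hf') (key _ h1) h3 a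

theorem exists_coloring_generators (k : List ℤ) (x y : G) : ∃ f : (rational k).Arc → G,
    (rational k).IsColoring f ∧ (rational k).nw.val f = x ∧ (genY k).val f = y := by
  by_cases h : GenSignPos k
  · obtain ⟨f, h1, h2, h3⟩ := (isFree_rational k).exists_coloring x y
    exact ⟨f, h1, h2, by rw [genY, if_pos h, h3]⟩
  · obtain ⟨f, h1, h2, h3⟩ := (isFree_rational k).exists_coloring x y⁻¹
    exact ⟨f, h1, h2, by rw [genY, if_neg h, Dart.val_rev, h3, inv_inv]⟩

end Ends

end Montesinos
end

noncomputable section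

namespace Montesinos

/-! ### Representations of the Montesinos link as families of colorings -/

section Families

theorem fin_cyclic_induction {m : ℕ} [NeZero m] {p : Fin m → Prop} (h0 : p 0)
    (h : ∀ i, p i → p (i + 1)) (i : Fin m) : p i := by
  obtain ⟨n, rfl⟩ := Nat.exists_eq_succ_of_ne_zero (NeZero.ne m)
  induction i using Fin.induction with
  | zero => exact h0
  | succ i ih => rw [← Fin.coeSucc_eq_succ]; exact h _ ih

variable {m : ℕ} [NeZero m] {k : Fin m → List ℤ}

/-- Colorings of the rational tangles that match at the ends. -/
def IsGlued (k : Fin m → List ℤ) (f : ∀ i, (rational (k i)).Arc → SL2) : Prop :=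
  ∀ i, (rational (k i)).IsColoring (f i) ∧
    (rational (k (i + 1))).nw.val (f (i + 1)) = ((rational (k i)).sw.val (f i))⁻¹ ∧
    (rational (k (i + 1))).ne.val (f (i + 1)) = ((rational (k i)).se.val (f i))⁻¹

theorem IsGlued.isColoring {f : ∀ i, (rational (k i)).Arc → SL2} (h : IsGlued k f) :
    (link k).IsColoring (fun a : Σ i, (rational (k i)).Arc => f a.1 a.2) :=
  isColoring_denominatorOfStack.2 h

/-- The representation that belongs to a matching family of colorings. -/
def IsGlued.hom {f : ∀ i, (rational (k i)).Arc → SL2} (h : IsGlued k f) : (link k).group →* SL2 :=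
  Diagram.IsColoring.hom h.isColoring

theorem IsGlued.hom_arc {f : ∀ i, (rational (k i)).Arc → SL2} (h : IsGlued k f) (i : Fin m)
    (a : Dart (rational (k i)).Arc) : h.hom (arc k i a) = a.val (f i) :=
  Diagram.IsColoring.hom_loop h.isColoring _

/-- The restriction of a representation to a tangle. -/
def restrict (ρ : (link k).group →* SL2) (i : Fin m) (a : (rational (k i)).Arc) : SL2 :=
  ρ (arc k i (a, true))

theorem val_restrict (ρ : (link k).group →* SL2) (i : Fin m) (a : Dart (rational (k i)).Arc) :
    a.val (restrict ρ i) = ρ (arc k i a) :=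
  Diagram.val_coloring (link k) ρ (a.map (Sigma.mk i))

theorem isGlued_restrict (ρ : (link k).group →* SL2) : IsGlued k (restrict ρ) := by
  have h := (isColoring_denominatorOfStack (T := fun i => (rational (k i)).toTangle)
    (f := (link k).coloring ρ)).1 ((link k).isColoring_coloring ρ)
  have e : ∀ i, (fun a => (link k).coloring ρ ⟨i, a⟩) = restrict ρ i := fun i => rfl
  intro i
  have h := h i
  rw [e, e] at h
  exact h

theorem restrict_hom {f : ∀ i, (rational (k i)).Arc → SL2} (h : IsGlued k f) :
    restrict h.hom = f := by
  funext i a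
  exact h.hom_arc i (a, true)

theorem hom_ext_restrict {ρ ρ' : (link k).group →* SL2} (h : restrict ρ = restrict ρ') : ρ = ρ' :=
  Diagram.hom_ext fun a => congrFun (congrFun h a.1) a.2

theorem IsGlued.conj {f : ∀ i, (rational (k i)).Arc → SL2} (h : IsGlued k f) (P : SL2) :
    IsGlued k fun i => MulAut.conj P ∘ f i := by
  intro i
  obtain ⟨h1, h2, h3⟩ := h i
  refine ⟨h1.comp (MulAut.conj P).toMonoidHom, ?_, ?_⟩
  · exact (Dart.val_comp _ _ (MulAut.conj P).toMonoidHom).trans (by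
      rw [h2, map_inv]; exact congrArg _ (Dart.val_comp _ _ (MulAut.conj P).toMonoidHom).symm)
  · exact (Dart.val_comp _ _ (MulAut.conj P).toMonoidHom).trans (by
      rw [h3, map_inv]; exact congrArg _ (Dart.val_comp _ _ (MulAut.conj P).toMonoidHom).symm)

theorem val_conj {A : Type} (a : Dart A) (f : A → SL2) (P : SL2) :
    a.val (MulAut.conj P ∘ f) = P * a.val f * P⁻¹ :=
  Dart.val_comp _ _ (MulAut.conj P).toMonoidHom

/-- The conjugate of a representation. -/
def conjHom {Γ : Type} [Group Γ] (P : SL2) (ρ : Γ →* SL2) : Γ →* SL2 :=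
  (MulAut.conj P).toMonoidHom.comp ρ

theorem conjHom_apply {Γ : Type} [Group Γ] (P : SL2) (ρ : Γ →* SL2) (g : Γ) :
    conjHom P ρ g = P * ρ g * P⁻¹ := rfl

theorem character_conjHom {Γ : Type} [Group Γ] (P : SL2) (ρ : Γ →* SL2) :
    character (conjHom P ρ) = character ρ := by
  funext g
  exact tr_conj P (ρ g)

theorem isReducible_conjHom {Γ : Type} [Group Γ] {P : SL2} {ρ : Γ →* SL2} :
    IsReducible (conjHom P ρ) ↔ IsReducible ρ := by
  have key : ∀ (P : SL2) (ρ : Γ →* SL2), IsReducible ρ → IsReducible (conjHom P ρ) := by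
    rintro P ρ ⟨v, hv, h⟩
    refine ⟨P.1.mulVec v, ?_, fun g => ?_⟩
    · intro h0
      apply hv
      have : P⁻¹.1.mulVec (P.1.mulVec v) = v := by
        rw [Matrix.mulVec_mulVec, ← Matrix.SpecialLinearGroup.coe_mul, inv_mul_cancel,
          Matrix.SpecialLinearGroup.coe_one, Matrix.one_mulVec]
      rw [← this, h0, Matrix.mulVec_zero]
    · refine lineStabilizer_conj.1 ?_
      have e : P⁻¹ * conjHom P ρ g * P = ρ g := by rw [conjHom_apply]; group
      rw [e]
      exact h g
  refine ⟨fun h => ?_, key P ρ⟩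
  have := key P⁻¹ _ h
  have e : conjHom P⁻¹ (conjHom P ρ) = ρ := by
    ext1 g; rw [conjHom_apply, conjHom_apply]; group
  rwa [e] at this

theorem character_eq_of_conj {ρ ρ' : (link k).group →* SL2} (P : SL2)
    (h : ∀ i, MulAut.conj P ∘ restrict ρ i = restrict ρ' i) : character ρ = character ρ' := by
  have : conjHom P ρ = ρ' := hom_ext_restrict (funext fun i => (h i : _))
  rw [← this, character_conjHom]

theorem isReducible_of_mem {ρ : (link k).group →* SL2} {v : Fin 2 → ℂ} (hv : v ≠ 0)
    (h : ∀ i a, restrict ρ i a ∈ lineStabilizer v) : IsReducible ρ := by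
  refine ⟨v, hv, fun g => ?_⟩
  have : (⊤ : Subgroup (link k).group) ≤ (lineStabilizer v).comap ρ := by
    rw [← PresentedGroup.closure_range_of, Subgroup.closure_le]
    rintro _ ⟨⟨i, a⟩, rfl⟩
    have := h i a
    simpa [restrict, arc, Diagram.loop, Dart.word, Dart.map, PresentedGroup.of] using this
  exact this (Subgroup.mem_top g)

/-- By the end relation `nw * ne` is the inverse of `se * sw`, and the gluing turns this inverse
into `nw * ne` of the next tangle. In topological terms, it is the loop around the two strands on
top of a tangle. -/
theorem IsGlued.mul_eq {f : ∀ i, (rational (k i)).Arc → SL2} (h : IsGlued k f) (i : Fin m) :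
    (rational (k i)).nw.val (f i) * (rational (k i)).ne.val (f i) =
      (rational (k 0)).nw.val (f 0) * (rational (k 0)).ne.val (f 0) := by
  refine fin_cyclic_induction (p := fun i => (rational (k i)).nw.val (f i) *
    (rational (k i)).ne.val (f i) = (rational (k 0)).nw.val (f 0) * (rational (k 0)).ne.val (f 0))
    rfl (fun i hi => ?_) i
  obtain ⟨h1, h2, h3⟩ := h i
  rw [h2, h3, ← hi]
  have := (isFree_rational (k i)).rel (f i) h1
  have e : (rational (k i)).nw.val (f i) * (rational (k i)).ne.val (f i) =
      ((rational (k i)).nw.val (f i) * (rational (k i)).ne.val (f i) *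
        (rational (k i)).se.val (f i) * (rational (k i)).sw.val (f i)) *
        ((rational (k i)).sw.val (f i))⁻¹ * ((rational (k i)).se.val (f i))⁻¹ := by group
  rw [e, this, one_mul]

/-- Tangle colorings with the same product at the two upper ends match if the left ends do. -/
theorem isGlued_of_mul_eq {f : ∀ i, (rational (k i)).Arc → SL2} (g : SL2)
    (h1 : ∀ i, (rational (k i)).IsColoring (f i))
    (h2 : ∀ i, (rational (k i)).nw.val (f i) * (rational (k i)).ne.val (f i) = g)
    (h3 : ∀ i, (rational (k (i + 1))).nw.val (f (i + 1)) = ((rational (k i)).sw.val (f i))⁻¹) :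
    IsGlued k f := by
  refine fun i => ⟨h1 i, h3 i, ?_⟩
  have e1 := h2 (i + 1)
  rw [← h2 i, h3 i] at e1
  have := (isFree_rational (k i)).rel (f i) (h1 i)
  rw [mul_assoc, mul_eq_one_iff_eq_inv] at this
  rw [this] at e1
  rw [mul_inv_rev] at e1
  exact mul_left_cancel e1

/-- The lower left end as a function of the other ones. -/
theorem se_eq {k : List ℤ} {f : (rational k).Arc → SL2} (hf : (rational k).IsColoring f) :
    (rational k).se.val f = ((rational k).nw.val f * (rational k).ne.val f)⁻¹ *
      ((rational k).sw.val f)⁻¹ := by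
  have := (isFree_rational k).rel f hf
  calc (rational k).se.val f = ((rational k).nw.val f * (rational k).ne.val f)⁻¹ *
      ((rational k).nw.val f * (rational k).ne.val f * (rational k).se.val f *
        (rational k).sw.val f) * ((rational k).sw.val f)⁻¹ := by group
    _ = _ := by rw [this, mul_one]

/-- The end `ne` is `nw⁻¹ g`, and `sw` is the inverse of `nw` in the next tangle; these three ends
generate the image of each tangle. -/
theorem isReducible_of_ends_mem (hk : ∀ i, k i ≠ []) {ρ : (link k).group →* SL2} {v : Fin 2 → ℂ}
    (hv : v ≠ 0) (h : ∀ i, (rational (k i)).nw.val (restrict ρ i) ∈ lineStabilizer v)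
    (hg : (rational (k 0)).nw.val (restrict ρ 0) * (rational (k 0)).ne.val (restrict ρ 0) ∈
      lineStabilizer v) : IsReducible ρ := by
  refine isReducible_of_mem hv fun i => ?_
  have hG := isGlued_restrict ρ
  refine mem_of_ends_mem (hk i) (hG i).1 _ (h i) ?_ ?_
  · rw [← hG.mul_eq i] at hg
    exact ((lineStabilizer v).mul_mem_cancel_left (h i)).1 hg
  · have := h (i + 1)
    rw [(hG i).2.1] at this
    exact (inv_mem_iff (H := lineStabilizer v)).1 this

theorem tr_val_eq (hK : (link k).IsKnot) (ρ : (link k).group →* SL2) (i : Fin m)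
    (a : Dart (rational (k i)).Arc) :
    tr (a.val (restrict ρ i)) = tCoord k (character ρ) := by
  have h0 : tCoord k (character ρ) = tr ((rational (k 0)).nw.val (restrict ρ 0)) := by
    rw [val_restrict]; rfl
  have key : ∀ (a : Dart (link k).Arc), tr (a.val ((link k).coloring ρ)) =
      tr ((link k).coloring ρ a.1) := by
    rintro ⟨a, b⟩
    cases b
    · exact tr_inv _
    · rfl
  have h1 : ∀ a b, tr ((link k).coloring ρ a) = tr ((link k).coloring ρ b) := by
    intro a b
    rcases hK.isConj (Diagram.isColoring_coloring (link k) ρ) a b with h | h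
    · exact IsConj.tr_eq h
    · rw [IsConj.tr_eq h, tr_inv]
  rw [h0]
  exact (key (a.map (Sigma.mk i))).trans ((h1 _ _).trans
    (key ((rational (k 0)).nw.map (Sigma.mk 0))).symm)

theorem tauCoord_eq (ρ : (link k).group →* SL2) : tauCoord k (character ρ) =
    tr ((rational (k 0)).nw.val (restrict ρ 0) * (rational (k 0)).ne.val (restrict ρ 0)) := by
  rw [val_restrict, val_restrict, ← map_mul]; rfl

theorem rCoord_eq (ρ : (link k).group →* SL2) (i : Fin m) : rCoord k (character ρ) i =
    tr ((rational (k i)).nw.val (restrict ρ i) * (genY (k i)).val (restrict ρ i)) := by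
  rw [val_restrict, val_restrict, ← map_mul]; rfl

theorem tCoord_eq (ρ : (link k).group →* SL2) : tCoord k (character ρ) =
    tr ((rational (k 0)).nw.val (restrict ρ 0)) := by
  rw [val_restrict]; rfl

end Families

/-! ### The decomposition -/

section Decomposition

variable {m : ℕ} [NeZero m] {k : Fin m → List ℤ}

open SL2

theorem tr_inv_mul_conj (P M N : SL2) : tr ((P⁻¹ * M * P)⁻¹ * (P⁻¹ * N * P)) = tr (M⁻¹ * N) := by
  rw [← tr_conj' P (M⁻¹ * N)]; congr 1; group

/-- A representation for which the product of the upper ends is parabolic is reducible. -/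
theorem isReducible_of_tau_eq_two (hk : ∀ i, k i ≠ []) (hK : (link k).IsKnot)
    {ρ : (link k).group →* SL2} (hτ : tauCoord k (character ρ) = 2)
    (hg : (rational (k 0)).nw.val (restrict ρ 0) * (rational (k 0)).ne.val (restrict ρ 0) ≠ 1) :
    IsReducible ρ := by
  rw [tauCoord_eq] at hτ
  have hG := isGlued_restrict ρ
  set g := (rational (k 0)).nw.val (restrict ρ 0) * (rational (k 0)).ne.val (restrict ρ 0) with hgdef
  obtain ⟨P, hP⟩ := exists_conj_parabolic (M := g) (l := 1) (a := 1) (by rw [hτ]; norm_num)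
    (by
      intro h; apply hg; rw [h]
      apply ext' <;> simp [uPlus_00, uPlus_01, uPlus_10, uPlus_11]) (by simp) one_ne_zero
  have hv : P.1.mulVec ![1, 0] ≠ 0 := by
    intro h0
    have : P⁻¹.1.mulVec (P.1.mulVec ![1, 0]) = ![1, 0] := by
      rw [Matrix.mulVec_mulVec, ← Matrix.SpecialLinearGroup.coe_mul, inv_mul_cancel,
        Matrix.SpecialLinearGroup.coe_one, Matrix.one_mulVec]
    rw [h0, Matrix.mulVec_zero] at this
    simpa using congrFun this 0
  refine isReducible_of_ends_mem hk hv (fun i => ?_) ?_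
  · refine lineStabilizer_conj.1 (mem_lineStabilizer_e₁.2 ?_)
    set A := (rational (k i)).nw.val (restrict ρ i) with hA
    have e : A⁻¹ * g = (rational (k i)).ne.val (restrict ρ i) := by
      rw [hgdef, ← hG.mul_eq i, hA]; group
    -- For the normal form of `g` with upper right entry 1, the two traces differ exactly by the
    -- lower left entry of `A`.
    have h1 : tr (A⁻¹ * g) = tr A := by
      rw [e, hA, tr_val_eq hK, tr_val_eq hK]
    rw [← tr_inv_mul_conj P, ← tr_conj' P A, hP, tr_eq, tr_eq] at h1
    simp only [mul_00, mul_11, uPlus_00, uPlus_01, uPlus_10, uPlus_11, inv_00, inv_01, inv_10,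
      inv_11, Units.val_one] at h1
    linear_combination -h1
  · refine lineStabilizer_conj.1 (mem_lineStabilizer_e₁.2 ?_)
    rw [← hgdef, hP]; rfl

/-- If `g = 1`, then `ne` is inverse to `nw`, and by the end relation `se` is inverse to `sw`: these
are the joins of the numerator. -/
theorem exists_union_of_mul_eq_one {ρ : (link k).group →* SL2}
    (hg : (rational (k 0)).nw.val (restrict ρ 0) * (rational (k 0)).ne.val (restrict ρ 0) = 1) :
    ∃ σ : ∀ i, (rational (k i)).numerator.group →* SL2, IsUnion k ρ σ := by
  have hG := isGlued_restrict ρ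
  have hcol : ∀ i, (rational (k i)).numerator.IsColoring (restrict ρ i) := by
    intro i
    have h1 := hG.mul_eq i
    rw [hg] at h1
    refine isColoring_numerator.2 ⟨(hG i).1, eq_inv_of_mul_eq_one_left h1, ?_⟩
    rw [se_eq (hG i).1, h1]; simp
  refine ⟨fun i => (hcol i).hom, fun i a => ?_⟩
  rw [← val_restrict]
  exact (hcol i).hom_loop a

theorem tau_eq_two_of_isUnion {ρ : (link k).group →* SL2}
    {σ : ∀ i, (rational (k i)).numerator.group →* SL2} (h : IsUnion k ρ σ) :
    tauCoord k (character ρ) = 2 := by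
  have hc := isColoring_numerator.1 (Diagram.isColoring_coloring _ (σ 0))
  have h1 := (Diagram.val_coloring _ (σ 0) (rational (k 0)).nw).trans (h 0 _)
  have h2 := (Diagram.val_coloring _ (σ 0) (rational (k 0)).ne).trans (h 0 _)
  rw [tauCoord_eq, val_restrict, val_restrict, ← h1, ← h2]
  have h3 := hc.2.1
  have : (rational (k 0)).nw.val ((rational (k 0)).numerator.coloring (σ 0)) *
      (rational (k 0)).ne.val ((rational (k 0)).numerator.coloring (σ 0)) = 1 := by
    rw [mul_eq_one_iff_eq_inv]; exact h3
  exact (congrArg tr this).trans tr_one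

theorem mem_X₀_of_tCoord_eq_zero (hK : (link k).IsKnot) {χ : (link k).group → ℂ}
    (hχ : χ ∈ irrCharacters (link k).group) (ht : tCoord k χ = 0) : χ ∈ X₀ k := by
  refine ⟨hχ, fun a => ?_⟩
  obtain ⟨ρ, -, rfl⟩ := hχ
  have := tr_val_eq hK ρ a.1.1 (a.1.2, a.2)
  rw [ht, val_restrict] at this
  exact this

theorem irrCharacters_decomposition (hk : ∀ i, k i ≠ []) (hK : (link k).IsKnot) :
    irrCharacters (link k).group = X₀ k ∪ X₁ k ∪ X₂ k ∪ X' k := by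
  ext χ
  constructor
  · intro hχ
    by_cases ht : tCoord k χ = 0
    · exact Or.inl (Or.inl (Or.inl (mem_X₀_of_tCoord_eq_zero hK hχ ht)))
    by_cases hτ : tauCoord k χ = 2
    · obtain ⟨ρ, hρ, rfl⟩ := hχ
      refine Or.inl (Or.inl (Or.inr ⟨ρ, hρ, rfl, ht, exists_union_of_mul_eq_one ?_⟩))
      by_contra hg
      exact hρ (isReducible_of_tau_eq_two hk hK hτ hg)
    by_cases hτ' : tauCoord k χ = tCoord k χ ^ 2 - 2
    -- Here `τ = t² - 2 = -2` would mean `t = 0`, so the condition `τ ≠ -2` is automatic.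
    · refine Or.inr ⟨hχ, ht, hτ', hτ, fun h => ht ?_⟩
      rw [h] at hτ'
      have : tCoord k χ ^ 2 = 0 := by linear_combination -hτ'
      simpa using this
    · exact Or.inl (Or.inr ⟨hχ, ht, hτ, hτ'⟩)
  · rintro (((h | h) | h) | h)
    · exact h.1
    · obtain ⟨ρ, h1, h2, -⟩ := h
      exact ⟨ρ, h1, h2⟩
    · exact h.1
    · exact h.1

theorem pairwise_disjoint_parts : [X₀ k, X₁ k, X₂ k, X' k].Pairwise Disjoint := by
  have h0 : ∀ χ ∈ X₀ k, tCoord k χ = 0 := fun χ h => h.2 _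
  have h1 : ∀ χ ∈ X₁ k, tCoord k χ ≠ 0 ∧ tauCoord k χ = 2 := by
    rintro χ ⟨ρ, -, rfl, h, σ, hσ⟩
    exact ⟨h, tau_eq_two_of_isUnion hσ⟩
  simp only [List.pairwise_cons, List.mem_cons, List.not_mem_nil, or_false, forall_eq_or_imp,
    forall_eq, Set.disjoint_left, List.Pairwise.nil, and_true, false_imp_iff, implies_true]
  refine ⟨⟨fun χ h h' => (h1 χ h').1 (h0 χ h), fun χ h h' => h'.2.1 (h0 χ h),
    fun χ h h' => h'.2.1 (h0 χ h)⟩, ⟨fun χ h h' => h'.2.2.1 (h1 χ h).2,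
    fun χ h h' => h'.2.2.2.1 (h1 χ h).2⟩, fun χ h h' => h.2.2.2 h'.2.2.1⟩

end Decomposition

end Montesinos
end

noncomputable section

namespace Montesinos

open SL2

/-! ### Colorings of a rational tangle and their traces -/

section Tangles

/-- The traces determine the generating pair up to conjugation by some `P`. Since both colorings
agree at `nw` and `ne`, the matrix `P` commutes with these ends, and by `hcent` conjugation by it is
trivial. -/
theorem coloring_eq_of_traces {k : List ℤ} {f f' : (rational k).Arc → SL2}
    (hf : (rational k).IsColoring f) (hf' : (rational k).IsColoring f')
    (h1 : (rational k).nw.val f = (rational k).nw.val f')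
    (h2 : (rational k).ne.val f = (rational k).ne.val f')
    (hirr : IrrPair ((rational k).nw.val f) ((genY k).val f))
    (hcent : ∀ P : SL2, P * (rational k).nw.val f = (rational k).nw.val f * P →
      P * (rational k).ne.val f = (rational k).ne.val f * P → ∀ M, P * M * P⁻¹ = M)
    {t : ℂ} (hx : tr ((rational k).nw.val f) = t) (hy : tr ((genY k).val f) = t)
    (hy' : tr ((genY k).val f') = t)
    (hxy : tr ((rational k).nw.val f * (genY k).val f) =
      tr ((rational k).nw.val f' * (genY k).val f')) : f = f' := by
  have hirr' : IrrPair ((rational k).nw.val f') ((genY k).val f') := by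
    rw [irrPair_iff (h1 ▸ hx) hy', ← hxy, ← irrPair_iff hx hy]
    exact hirr
  obtain ⟨P, p1, p2⟩ := hirr.exists_conj hirr' (congrArg tr h1) (hy.trans hy'.symm) hxy
  have hfP : MulAut.conj P ∘ f = f' := by
    refine coloring_eq_of_generators (hf.comp (MulAut.conj P).toMonoidHom) hf' ?_ ?_
    · exact (val_conj _ f P).trans p1
    · exact (val_conj _ f P).trans p2
  have c1 : P * (rational k).nw.val f = (rational k).nw.val f * P := by
    exact mul_inv_eq_iff_eq_mul.1 (p1.trans h1.symm)
  have c2 : P * (rational k).ne.val f = (rational k).ne.val f * P := by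
    have := val_conj (rational k).ne f P
    rw [hfP, ← h2] at this
    exact (mul_inv_eq_iff_eq_mul.1 this.symm)
  rw [← hfP]
  funext a
  exact (hcent P c1 c2 (f a)).symm

theorem tr_val_y₀ {k : List ℤ} (f : (rational k).Arc → SL2) :
    tr ((rational k).y₀.val f) = tr ((genY k).val f) := by
  unfold genY
  split_ifs
  · rfl
  · rw [Dart.val_rev, tr_inv]

/-- The trace polynomials in terms of the upper left end, of the inverse of the lower left end, and
of the product of the upper ends. -/
theorem tangle_traces {k : List ℤ} (hk : k ≠ []) {f : (rational k).Arc → SL2}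
    (hf : (rational k).IsColoring f) {t : ℂ} {A A' g : SL2} (hA : (rational k).nw.val f = A)
    (hA' : ((rational k).sw.val f)⁻¹ = A')
    (hg : (rational k).nw.val f * (rational k).ne.val f = g)
    (hx : tr A = t) (hy : tr ((genY k).val f) = t) {r : ℂ} (hr : tr (A * (genY k).val f) = r) :
    z k t r + 2 = tr g ∧ zDot k t r + 2 = tr (A * A'⁻¹) ∧ zGrave k t r + 2 = tr (A * (g⁻¹ * A')) ∧
      tr A' = t ∧ tr (A⁻¹ * g) = t ∧ tr (A'⁻¹ * g) = t := by
  have h := rational_traces hk hf (t := t) (by rw [hA, hx]) (by rw [tr_val_y₀, hy])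
  rw [hA, hr] at h
  obtain ⟨h1, h2, h3, h4, h5, h6⟩ := h
  have hse := se_eq hf
  rw [hg, hA'] at hse
  have hsw : (rational k).sw.val f = A'⁻¹ := by rw [← hA', inv_inv]
  rw [hA] at hg
  refine ⟨by rw [h1, hg], by rw [h2, hsw], by rw [h3, hse], ?_, ?_, ?_⟩
  · rw [← hA', tr_inv, h5]
  · rw [← hg, inv_mul_cancel_left, h4]
  · rw [← h6, hse, ← tr_inv]; simp

theorem exists_coloring_traces (k : List ℤ) (t r : ℂ) : ∃ f : (rational k).Arc → SL2,
    (rational k).IsColoring f ∧ tr ((rational k).nw.val f) = t ∧ tr ((genY k).val f) = t ∧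
      tr ((rational k).nw.val f * (genY k).val f) = r := by
  obtain ⟨X, Y, h1, h2, h3⟩ := exists_pair t r
  obtain ⟨f, hf, f1, f2⟩ := exists_coloring_generators k X Y
  exact ⟨f, hf, by rw [f1, h1], by rw [f2, h2], by rw [f1, f2, h3]⟩

end Tangles

/-! ### Normal forms relative to the product of the upper ends -/

section NormalForms

variable {t : ℂ}

/-- Both traces are linear in the diagonal entries of `M`, and for `l ≠ ±1` they determine them.
Only the ratio in which the off-diagonal entries share their product remains free; this is the
action of the centralizer of `g`. -/
theorem diag_entries {l : ℂˣ} (hl : l ≠ l⁻¹) {M : SL2} (h1 : tr M = t)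
    (h2 : tr (M⁻¹ * uPlus l 0) = t) :
    ((l : ℂ) + 1) * M.1 1 1 = t ∧ ((l : ℂ) + 1) * M.1 0 0 = t * l := by
  have hl0 := l.ne_zero
  have hl1 : (l : ℂ) - 1 ≠ 0 := by
    intro h; apply hl
    have : l = 1 := Units.ext (sub_eq_zero.1 h)
    rw [this, inv_one]
  rw [tr_eq] at h1 h2
  simp only [mul_00, mul_11, uPlus_00, uPlus_01, uPlus_10, uPlus_11, inv_00, inv_01, inv_10,
      inv_11] at h2
  have h3 : M.1 1 1 * l ^ 2 + M.1 0 0 = t * l := by field_simp at h2; linear_combination h2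
  have h4 : ((l : ℂ) + 1) * M.1 1 1 = t := by
    refine mul_left_cancel₀ hl1 ?_
    linear_combination h3 - h1
  exact ⟨h4, by linear_combination (l + 1) * h1 - h4⟩

theorem add_inv_add_two {l : ℂˣ} : ((l : ℂ) + (l : ℂ)⁻¹ + 2) * l = (l + 1) ^ 2 := by
  have := mul_inv_cancel₀ l.ne_zero
  linear_combination this

/-- The determinant fixes the product of the off-diagonal entries. It vanishes exactly for `τ = t² -
2`; otherwise `M 0 1` is a non-zero coordinate. -/
theorem diag_det {l : ℂˣ} (hl : l ≠ l⁻¹) {M : SL2} (h1 : tr M = t)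
    (h2 : tr (M⁻¹ * uPlus l 0) = t) :
    M.1 0 1 * M.1 1 0 * (l + (l : ℂ)⁻¹ + 2) = -(l + (l : ℂ)⁻¹ + 2 - t ^ 2) := by
  obtain ⟨e1, e2⟩ := diag_entries hl h1 h2
  have hdet := det_eq M
  refine mul_right_cancel₀ l.ne_zero ?_
  have h3 := add_inv_add_two (l := l)
  linear_combination (M.1 0 1 * M.1 1 0 + 1) * h3 - (l + 1) ^ 2 * hdet + (l + 1) * M.1 0 0 * e1 + t * e2

/-- This gives the factors of `H` their meaning. The bracket equals `M 0 1 * N 1 0 * (τ + 2) * (l -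
1)`, and by `diag_det` multiplication by `N 0 1` replaces the entries of `N` by a constant. -/
theorem diag_bracket {l : ℂˣ} (hl : l ≠ l⁻¹) {M N : SL2} (h1 : tr M = t)
    (h2 : tr (M⁻¹ * uPlus l 0) = t) (h1' : tr N = t) (h2' : tr (N⁻¹ * uPlus l 0) = t) :
    ((1 + (l : ℂ)⁻¹) * (tr (M * N⁻¹) - 2) + (1 + l) * (tr (M * ((uPlus l 0)⁻¹ * N)) - 2) +
      2 * (l + (l : ℂ)⁻¹ + 2 - t ^ 2)) * N.1 0 1 =
      (1 - l) * (l + (l : ℂ)⁻¹ + 2 - t ^ 2) * M.1 0 1 := by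
  obtain ⟨e1, e2⟩ := diag_entries hl h1 h2
  obtain ⟨e1', e2'⟩ := diag_entries hl h1' h2'
  have hl0 := l.ne_zero
  have hl1 : (l : ℂ) + 1 ≠ 0 := by
    intro h; apply hl
    have : l = -1 := Units.ext (by rw [eq_neg_of_add_eq_zero_left h]; simp)
    rw [this]; simp
  have key := diag_det hl h1' h2'
  have a1 : M.1 1 1 = t / (l + 1) := by rw [← e1]; field_simp
  have a2 : M.1 0 0 = t * l / (l + 1) := by rw [← e2]; field_simp
  have a1' : N.1 1 1 = t / (l + 1) := by rw [← e1']; field_simp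
  have a2' : N.1 0 0 = t * l / (l + 1) := by rw [← e2']; field_simp
  have main : (1 + (l : ℂ)⁻¹) * (tr (M * N⁻¹) - 2) + (1 + l) * (tr (M * ((uPlus l 0)⁻¹ * N)) - 2) +
      2 * (l + (l : ℂ)⁻¹ + 2 - t ^ 2) = M.1 0 1 * N.1 1 0 * (l + (l : ℂ)⁻¹ + 2) * (l - 1) := by
    rw [tr_eq, tr_eq]
    simp only [mul_00, mul_11, mul_01, mul_10, uPlus_00, uPlus_01, uPlus_10, uPlus_11, inv_00, inv_01,
      inv_10, inv_11, a1, a2, a1', a2']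
    field_simp
    ring
  rw [main]
  linear_combination (l - 1) * M.1 0 1 * key

theorem diag_unique {l : ℂˣ} (hl : l ≠ l⁻¹) {M N : SL2} (h1 : tr M = t)
    (h2 : tr (M⁻¹ * uPlus l 0) = t) (h1' : tr N = t) (h2' : tr (N⁻¹ * uPlus l 0) = t)
    (h : M.1 0 1 = N.1 0 1) (h0 : N.1 0 1 ≠ 0) : M = N := by
  obtain ⟨e1, e2⟩ := diag_entries hl h1 h2
  obtain ⟨e1', e2'⟩ := diag_entries hl h1' h2'
  have hl1 : (l : ℂ) + 1 ≠ 0 := by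
    intro h; apply hl
    have : l = -1 := Units.ext (by rw [eq_neg_of_add_eq_zero_left h]; simp)
    rw [this]; simp
  have a1 : M.1 1 1 = N.1 1 1 := mul_left_cancel₀ hl1 (e1.trans e1'.symm)
  have a2 : M.1 0 0 = N.1 0 0 := mul_left_cancel₀ hl1 (e2.trans e2'.symm)
  refine ext' a2 h ?_ a1
  have d1 := det_eq M
  have d2 := det_eq N
  rw [h, a1, a2] at d1
  refine mul_left_cancel₀ h0 ?_
  linear_combination d2 - d1

theorem conj_diag_01 (s : ℂˣ) (M : SL2) :
    ((uPlus s 0)⁻¹ * M * uPlus s 0).1 0 1 = M.1 0 1 / (s : ℂ) ^ 2 := by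
  simp only [mul_00, mul_01, uPlus_01, uPlus_11, inv_00, inv_01]
  field_simp
  ring

theorem conj_diag_diag (s l : ℂˣ) : (uPlus s 0)⁻¹ * uPlus l 0 * uPlus s 0 = uPlus l 0 := by
  rw [conj_diag_upper, zero_div]

/-- For `l = -1` the lower left entry is fixed, and the free coordinate is `M 0 0`. The centralizer
of the parabolic `g` shifts it by multiples of `2 t`, so quotients are replaced by differences. -/
theorem parabolic_entry {M : SL2} (h1 : tr M = t) (h2 : tr (M⁻¹ * uPlus (-1) (-1)) = t) :
    M.1 1 0 = 2 * t := by
  rw [tr_eq] at h1 h2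
  simp only [mul_00, mul_11, uPlus_00, uPlus_01, uPlus_10, uPlus_11, inv_00, inv_01, inv_10,
      inv_11, Units.val_neg, Units.val_one, inv_neg, inv_one] at h2
  linear_combination h2 + h1

theorem parabolic_bracket {M N : SL2} (h1 : tr M = t)
    (h2 : tr (M⁻¹ * uPlus (-1) (-1)) = t) (h1' : tr N = t) (h2' : tr (N⁻¹ * uPlus (-1) (-1)) = t) :
    t ^ 2 + (tr (M * N⁻¹) - 2 - (tr (M * ((uPlus (-1) (-1))⁻¹ * N)) - 2)) =
      2 * t * (N.1 0 0 - M.1 0 0) := by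
  have e := parabolic_entry h1 h2
  have e' := parabolic_entry h1' h2'
  rw [tr_eq] at h1 h1'
  rw [tr_eq, tr_eq]
  simp only [mul_00, mul_11, mul_01, mul_10, uPlus_00, uPlus_01, uPlus_10, uPlus_11, inv_00, inv_01,
      inv_10, inv_11, Units.val_neg, Units.val_one, inv_neg, inv_one, e, e']
  linear_combination (N.1 0 0 + N.1 1 1) * h1 + t * h1' - 2 * t * h1'

theorem parabolic_unique (ht : t ≠ 0) {M N : SL2} (h1 : tr M = t)
    (h2 : tr (M⁻¹ * uPlus (-1) (-1)) = t) (h1' : tr N = t) (h2' : tr (N⁻¹ * uPlus (-1) (-1)) = t)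
    (h : M.1 0 0 = N.1 0 0) : M = N := by
  have e := parabolic_entry h1 h2
  have e' := parabolic_entry h1' h2'
  rw [tr_eq] at h1 h1'
  have a : M.1 1 1 = N.1 1 1 := by linear_combination h1 - h1' - h
  refine ext' h ?_ (e.trans e'.symm) a
  have d1 := det_eq M
  have d2 := det_eq N
  rw [h, a, e] at d1
  rw [e'] at d2
  refine mul_right_cancel₀ (mul_ne_zero two_ne_zero ht) ?_
  linear_combination d2 - d1

theorem conj_shear_00 (x : ℂ) (M : SL2) :
    ((uPlus 1 x)⁻¹ * M * uPlus 1 x).1 0 0 = M.1 0 0 - x * M.1 1 0 := by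
  simp only [mul_00, mul_01, uPlus_00, uPlus_01, uPlus_10, uPlus_11, inv_00, inv_01,
      Units.val_one]
  ring

theorem conj_shear_parabolic (x y : ℂ) (l : ℂˣ) (hl : l = l⁻¹) :
    (uPlus 1 x)⁻¹ * uPlus l y * uPlus 1 x = uPlus l y := by
  have hl' : (l : ℂ)⁻¹ = l := by rw [← Units.val_inv_eq_inv_val, ← hl]
  apply ext' <;> simp [mul_00, mul_11, mul_01, mul_10, uPlus_00, uPlus_01, uPlus_10, uPlus_11, inv_00,
    inv_01, inv_10, inv_11, hl']
  ring

end NormalForms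

/-! ### The equation of the curve -/

section CurveEquation

variable {m : ℕ} {k : Fin m → List ℤ}

theorem H_eq_zero_iff {l t : ℂ} (hl : l ≠ -1) (r : Fin m → ℂ) : H k l t r = 0 ↔
    ∏ i, ((1 + l⁻¹) * zDot (k i) t (r i) + (1 + l) * zGrave (k i) t (r i)
          + 2 * (l + l⁻¹ + 2 - t ^ 2)) = ((1 - l) * (l + l⁻¹ + 2 - t ^ 2)) ^ m := by
  have : l + 1 ≠ 0 := fun h => hl (eq_neg_of_add_eq_zero_left h)
  rw [H, if_neg hl, mul_eq_zero, or_iff_right (one_div_ne_zero this), sub_eq_zero, mul_pow]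

theorem H_neg_one_eq_zero_iff {t : ℂ} (ht : t ≠ 0) (r : Fin m → ℂ) : H k (-1) t r = 0 ↔
    ∑ i, (t ^ 2 + (zDot (k i) t (r i) - zGrave (k i) t (r i))) = 0 := by
  rw [H, if_pos rfl, Finset.sum_add_distrib]
  simp [ht]

variable [NeZero m]

theorem prod_shift {M : Type*} [CommMonoid M] (b : Fin m → M) : ∏ i, b (i + 1) = ∏ i, b i :=
  Equiv.prod_comp (Equiv.addRight 1) b

theorem sum_shift {M : Type*} [AddCommMonoid M] (b : Fin m → M) : ∑ i, b (i + 1) = ∑ i, b i :=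
  Equiv.sum_comp (Equiv.addRight 1) b

/-- An irreducible character lies on the curve. -/
theorem mem_curve_of_mem_X₂ (hk : ∀ i, k i ≠ []) (hK : (link k).IsKnot)
    {χ : (link k).group → ℂ} (hχ : χ ∈ X₂ k) (l : ℂ) (hl : l ≠ 0) (hτ : l + l⁻¹ = tauCoord k χ) :
    (Fin.cons l (Fin.cons (tCoord k χ) (rCoord k χ)) : Fin (m + 2) → ℂ) ∈ curve k := by
  obtain ⟨⟨ρ, -, rfl⟩, ht, hτ2, hτt⟩ := hχ
  have hG := isGlued_restrict ρ
  set t := tCoord k (character ρ) with htdef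
  set g := (rational (k 0)).nw.val (restrict ρ 0) * (rational (k 0)).ne.val (restrict ρ 0) with hgdef
  have htg : tr g = l + l⁻¹ := by rw [hτ, tauCoord_eq]
  set A := fun i => (rational (k i)).nw.val (restrict ρ i) with hA
  have htr := fun i => tangle_traces (hk i) (hG i).1 (A := A i) (A' := A (i + 1)) (g := g) (t := t) rfl
    (hG i).2.1.symm (hG.mul_eq i) (tr_val_eq hK ρ i _) (tr_val_eq hK ρ i _)
    (rCoord_eq ρ i).symm
  have hAt : ∀ i, tr (A i) = t := fun i => tr_val_eq hK ρ i _
  refine ⟨hl, ht, ?_, ?_, ?_, ?_⟩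
  · change l + l⁻¹ ≠ 2
    rw [hτ]; exact hτ2
  · change l + l⁻¹ ≠ t ^ 2 - 2
    rw [hτ]; exact hτt
  · intro i
    change z (k i) t (rCoord k (character ρ) i) = l + l⁻¹ - 2
    rw [← htg, ← (htr i).1]; ring
  change H k l t (rCoord k (character ρ)) = 0
  by_cases hl1 : l = -1
  · subst hl1
    rw [H_neg_one_eq_zero_iff ht]
    -- The case `g = -1` is impossible: then `ne` would be `-nw⁻¹`, of trace `-t`, and `t ≠ 0`.
    obtain ⟨P, hP⟩ := exists_conj_parabolic (M := g) (l := -1) (a := -1) (by rw [htg]; simp) (by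
      intro h
      have e : (A 0)⁻¹ * g = (rational (k 0)).ne.val (restrict ρ 0) := by
        rw [hgdef, hA]; group
      have h1 := (htr 0).2.2.2.2.1
      have h2 := hAt 0
      rw [h, tr_eq] at h1
      rw [tr_eq] at h2
      simp only [mul_00, mul_11, uPlus_00, uPlus_01, uPlus_10, uPlus_11, inv_00, inv_01, inv_10,
        inv_11, Units.val_neg, Units.val_one, inv_neg, inv_one] at h1
      apply ht
      have : 2 * t = 0 := by linear_combination -h1 - h2
      simpa using this) (by simp) (by norm_num)
    have key : ∀ i, t ^ 2 + (zDot (k i) t (rCoord k (character ρ) i) -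
        zGrave (k i) t (rCoord k (character ρ) i)) =
        2 * t * ((P⁻¹ * A (i + 1) * P).1 0 0 - (P⁻¹ * A i * P).1 0 0) := by
      intro i
      obtain ⟨h1, h2, h3, h4, h5, h6⟩ := htr i
      rw [← parabolic_bracket (t := t) (M := P⁻¹ * A i * P) (N := P⁻¹ * A (i + 1) * P)
        (by rw [tr_conj', hAt]) (by rw [← hP, tr_inv_mul_conj, h5])
        (by rw [tr_conj', hAt]) (by rw [← hP, tr_inv_mul_conj, h6]), ← hP]
      have e1 : P⁻¹ * A i * P * (P⁻¹ * A (i + 1) * P)⁻¹ = P⁻¹ * (A i * (A (i + 1))⁻¹) * P := by group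
      have e2 : P⁻¹ * A i * P * ((P⁻¹ * g * P)⁻¹ * (P⁻¹ * A (i + 1) * P)) =
        P⁻¹ * (A i * (g⁻¹ * A (i + 1))) * P := by group
      rw [e1, e2, tr_conj', tr_conj', ← h2, ← h3]
      ring
    -- The sum of the differences telescopes around the cycle.
    rw [Finset.sum_congr rfl fun i _ => key i, ← Finset.mul_sum, Finset.sum_sub_distrib,
      sum_shift fun i => (P⁻¹ * A i * P).1 0 0, sub_self, mul_zero]
  · rw [H_eq_zero_iff hl1]
    obtain ⟨lu, rfl⟩ : ∃ lu : ℂˣ, (lu : ℂ) = l := ⟨Units.mk0 l hl, rfl⟩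
    have hlu : lu ≠ lu⁻¹ := by
      intro h
      have h1 : (lu : ℂ) * lu = 1 := by
        have := congrArg (fun u : ℂˣ => (u : ℂ) * lu) h
        simpa using this
      rcases mul_self_eq_one_iff.1 h1 with h | h
      · apply hτ2; rw [← hτ, h]; norm_num
      · exact hl1 h
    obtain ⟨P, hP⟩ := exists_conj_diag htg hlu
    set b := fun i => (P⁻¹ * A i * P).1 0 1 with hb
    have hD : (lu : ℂ) + (lu : ℂ)⁻¹ + 2 - t ^ 2 ≠ 0 := by
      rw [hτ]; intro h; apply hτt; linear_combination h
    have hM1 : ∀ i, tr (P⁻¹ * A i * P) = t := fun i => by rw [tr_conj', hAt]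
    have hM2 : ∀ i, tr ((P⁻¹ * A i * P)⁻¹ * uPlus lu 0) = t := fun i => by
      rw [← hP, tr_inv_mul_conj, (htr i).2.2.2.2.1]
    -- This uses `τ ≠ t² - 2`.
    have hb0 : ∀ i, b i ≠ 0 := by
      intro i h
      have h1 : (P⁻¹ * A i * P).1 0 1 = 0 := h
      have h2 := diag_det hlu (hM1 i) (hM2 i)
      rw [h1] at h2
      apply hD
      linear_combination h2
    have key : ∀ i, ((1 + (lu : ℂ)⁻¹) * zDot (k i) t (rCoord k (character ρ) i) +
        (1 + (lu : ℂ)) * zGrave (k i) t (rCoord k (character ρ) i) +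
        2 * ((lu : ℂ) + (lu : ℂ)⁻¹ + 2 - t ^ 2)) * b (i + 1) =
        (1 - lu) * ((lu : ℂ) + (lu : ℂ)⁻¹ + 2 - t ^ 2) * b i := by
      intro i
      obtain ⟨h1, h2, h3, h4, h5, h6⟩ := htr i
      have h0 := diag_bracket hlu (hM1 i) (hM2 i) (hM1 (i + 1)) (hM2 (i + 1))
      rw [← hP] at h0
      have e1 : P⁻¹ * A i * P * (P⁻¹ * A (i + 1) * P)⁻¹ = P⁻¹ * (A i * (A (i + 1))⁻¹) * P := by group
      have e2 : P⁻¹ * A i * P * ((P⁻¹ * g * P)⁻¹ * (P⁻¹ * A (i + 1) * P)) =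
        P⁻¹ * (A i * (g⁻¹ * A (i + 1))) * P := by group
      rw [e1, e2, tr_conj', tr_conj', ← h2, ← h3, add_sub_cancel_right, add_sub_cancel_right] at h0
      exact h0
    have hprod := Finset.prod_congr rfl fun (i : Fin m) (_ : i ∈ Finset.univ) => key i
    rw [Finset.prod_mul_distrib, Finset.prod_mul_distrib, prod_shift b, Finset.prod_const,
      Finset.card_univ, Fintype.card_fin] at hprod
    exact mul_right_cancel₀ (Finset.prod_ne_zero_iff.2 fun i _ => hb0 i) hprod

/-- Every point of the curve comes from a representation. -/
theorem exists_hom_of_mem_curve (hk : ∀ i, k i ≠ []) {v : Fin (m + 2) → ℂ} (hv : v ∈ curve k) :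
    ∃ ρ : (link k).group →* SL2, tCoord k (character ρ) = v 1 ∧
      tauCoord k (character ρ) = v 0 + (v 0)⁻¹ ∧
      ∀ i : Fin m, rCoord k (character ρ) i = v i.succ.succ := by
  obtain ⟨h0, ht, hτ2, hτt, hz, hH⟩ := hv
  set t := v 1
  set r : Fin m → ℂ := fun i => v i.succ.succ with hrdef
  choose f hf f1 f2 f3 using fun i : Fin m => exists_coloring_traces (k i) t (r i)
  set g := fun i => (rational (k i)).nw.val (f i) * (rational (k i)).ne.val (f i) with hg
  set A := fun i => (rational (k i)).nw.val (f i) with hA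
  set A' := fun i => ((rational (k i)).sw.val (f i))⁻¹ with hA'
  have htr := fun i => tangle_traces (hk i) (hf i) (A := A i) (A' := A' i) (g := g i) (t := t) rfl
    rfl rfl (f1 i) (f2 i) (f3 i)
  have htg : ∀ i, tr (g i) = v 0 + (v 0)⁻¹ := by
    intro i
    rw [← (htr i).1, hz i]; ring
  -- it suffices to move the tangle colorings into matching positions
  suffices h : ∃ (G : SL2) (Q : Fin m → SL2), (∀ i, (Q i)⁻¹ * g i * Q i = G) ∧
      ∀ i, (Q (i + 1))⁻¹ * A (i + 1) * Q (i + 1) = (Q i)⁻¹ * A' i * Q i by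
    obtain ⟨G, Q, hQ1, hQ2⟩ := h
    have hval : ∀ i (a : Dart (rational (k i)).Arc),
        a.val (MulAut.conj (Q i)⁻¹ ∘ f i) = (Q i)⁻¹ * a.val (f i) * Q i := by
      intro i a
      rw [val_conj, inv_inv]
    have hglue : IsGlued k (fun i => MulAut.conj (Q i)⁻¹ ∘ f i) := by
      refine isGlued_of_mul_eq G (fun i => (hf i).comp (MulAut.conj (Q i)⁻¹).toMonoidHom) ?_ ?_
      · intro i
        rw [hval, hval, ← hQ1 i, hg]
        group
      · intro i
        rw [hval, hval]
        refine (hQ2 i).trans ?_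
        rw [hA']
        group
    refine ⟨hglue.hom, ?_, ?_, fun i => ?_⟩
    · rw [tCoord_eq, restrict_hom, hval, tr_conj', f1]
    · rw [tauCoord_eq, restrict_hom, hval, hval, tr_conj_mul_conj]
      exact htg 0
    · rw [rCoord_eq, restrict_hom, hval, hval, tr_conj_mul_conj, f3]
  by_cases hl1 : v 0 = -1
  · rw [hl1] at htg hH
    rw [H_neg_one_eq_zero_iff ht] at hH
    have hP : ∀ i, ∃ P : SL2, P⁻¹ * g i * P = uPlus (-1) (-1) := by
      intro i
      refine exists_conj_parabolic (M := g i) (l := -1) (a := -1) (by rw [htg]; simp) (fun h => ?_)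
        (by simp) (by norm_num)
      have h1 := (htr i).2.2.2.2.1
      have h2 := f1 i
      rw [h, tr_eq] at h1
      rw [tr_eq] at h2
      simp only [mul_00, mul_11, uPlus_00, uPlus_01, uPlus_10, uPlus_11, inv_00, inv_01, inv_10,
        inv_11, Units.val_neg, Units.val_one, inv_neg, inv_one] at h1
      apply ht
      have : 2 * t = 0 := by linear_combination -h1 - h2
      simpa using this
    choose P hP using hP
    set a := fun i => (P⁻¹ i * A i * P i).1 0 0 with ha
    set a' := fun i => (P⁻¹ i * A' i * P i).1 0 0 with ha'
    have hM1 : ∀ i, tr ((P i)⁻¹ * A i * P i) = t := fun i => by rw [tr_conj']; exact f1 i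
    have hM2 : ∀ i, tr (((P i)⁻¹ * A i * P i)⁻¹ * uPlus (-1) (-1)) = t := fun i => by
      rw [← hP i, tr_inv_mul_conj, (htr i).2.2.2.2.1]
    have hM1' : ∀ i, tr ((P i)⁻¹ * A' i * P i) = t := fun i => by
      rw [tr_conj', (htr i).2.2.2.1]
    have hM2' : ∀ i, tr (((P i)⁻¹ * A' i * P i)⁻¹ * uPlus (-1) (-1)) = t := fun i => by
      rw [← hP i, tr_inv_mul_conj, (htr i).2.2.2.2.2]
    have key : ∀ i, t ^ 2 + (zDot (k i) t (r i) - zGrave (k i) t (r i)) =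
        2 * t * (a' i - a i) := by
      intro i
      obtain ⟨h1, h2, h3, h4, h5, h6⟩ := htr i
      rw [ha, ha']
      have h0 := parabolic_bracket (hM1 i) (hM2 i) (hM1' i) (hM2' i)
      rw [← hP i] at h0
      have e1 : (P i)⁻¹ * A i * P i * ((P i)⁻¹ * A' i * P i)⁻¹ =
        (P i)⁻¹ * (A i * (A' i)⁻¹) * P i := by group
      have e2 : (P i)⁻¹ * A i * P i * (((P i)⁻¹ * g i * P i)⁻¹ * ((P i)⁻¹ * A' i * P i)) =
        (P i)⁻¹ * (A i * ((g i)⁻¹ * A' i)) * P i := by group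
      rw [e1, e2, tr_conj', tr_conj', ← h2, ← h3, add_sub_cancel_right, add_sub_cancel_right] at h0
      exact h0
    rw [Finset.sum_congr rfl fun i _ => key i, ← Finset.mul_sum, mul_eq_zero,
      or_iff_right (mul_ne_zero two_ne_zero ht)] at hH
    -- The values `α i` are the coordinates that the matrices `A i` are to have after the tangles
    -- have been moved. The equation `H = 0` says that these requirements are consistent around the
    -- cycle.
    obtain ⟨β, -, hβ⟩ := exists_cyclic_potential (G := Multiplicative ℂ)
      (fun i => Multiplicative.ofAdd (a' i - a i)) (by
        rw [← ofAdd_sum, hH]; rfl)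
    set α : Fin m → ℂ := fun i => (β i).toAdd with hα
    have hα' : ∀ i, α (i + 1) = α i + (a' i - a i) := fun i => by
      rw [hα]; simp only [hβ i]; rfl
    -- Conjugation by `uPlus 1 x` subtracts `2 t x` from the coordinate, so this shear moves `a i`
    -- to `α i`.
    set x : Fin m → ℂ := fun i => (a i - α i) / (2 * t) with hx
    have hxt : ∀ i, x i * (2 * t) = a i - α i := fun i => by rw [hx]; field_simp
    refine ⟨uPlus (-1) (-1), fun i => P i * uPlus 1 (x i), fun i => ?_, fun i => ?_⟩
    · have e : (P i * uPlus 1 (x i))⁻¹ * g i * (P i * uPlus 1 (x i)) =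
        (uPlus 1 (x i))⁻¹ * ((P i)⁻¹ * g i * P i) * uPlus 1 (x i) := by group
      rw [e, hP, conj_shear_parabolic _ _ _ (by simp)]
    · have e : ∀ i M, (P i * uPlus 1 (x i))⁻¹ * M * (P i * uPlus 1 (x i)) =
        (uPlus 1 (x i))⁻¹ * ((P i)⁻¹ * M * P i) * uPlus 1 (x i) := by intros; group
      have e' : ∀ i, uPlus (-1) (-1) = (uPlus 1 (x i))⁻¹ * uPlus (-1) (-1) * uPlus 1 (x i) :=
        fun i => (conj_shear_parabolic _ _ _ (by simp)).symm
      rw [e, e]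
      refine parabolic_unique ht (by rw [tr_conj', hM1]) ?_ (by rw [tr_conj', hM1']) ?_ ?_
      · rw [e' (i + 1), tr_inv_mul_conj, hM2]
      · rw [e' i, tr_inv_mul_conj, hM2']
      · rw [conj_shear_00, conj_shear_00, parabolic_entry (hM1 _) (hM2 _),
          parabolic_entry (hM1' _) (hM2' _), hxt, hxt]
        change a (i + 1) - (a (i + 1) - α (i + 1)) = a' i - (a i - α i)
        rw [hα']; ring
  · rw [H_eq_zero_iff hl1] at hH
    obtain ⟨l, hl⟩ : ∃ l : ℂˣ, (l : ℂ) = v 0 := ⟨Units.mk0 _ h0, rfl⟩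
    rw [← hl] at hτ2 hτt hH htg hl1
    have hlu : l ≠ l⁻¹ := by
      intro h
      have h1 : (l : ℂ) * l = 1 := by
        have := congrArg (fun u : ℂˣ => (u : ℂ) * l) h
        simpa using this
      rcases mul_self_eq_one_iff.1 h1 with h | h
      · apply hτ2; rw [h]; norm_num
      · exact hl1 h
    choose P hP using fun i => exists_conj_diag (htg i) hlu
    set b := fun i => ((P i)⁻¹ * A i * P i).1 0 1 with hb
    set b' := fun i => ((P i)⁻¹ * A' i * P i).1 0 1 with hb'
    have hD : (l : ℂ) + (l : ℂ)⁻¹ + 2 - t ^ 2 ≠ 0 := by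
      intro h; apply hτt; linear_combination h
    have hM1 : ∀ i, tr ((P i)⁻¹ * A i * P i) = t := fun i => by rw [tr_conj']; exact f1 i
    have hM2 : ∀ i, tr (((P i)⁻¹ * A i * P i)⁻¹ * uPlus l 0) = t := fun i => by
      rw [← hP i, tr_inv_mul_conj, (htr i).2.2.2.2.1]
    have hM1' : ∀ i, tr ((P i)⁻¹ * A' i * P i) = t := fun i => by
      rw [tr_conj', (htr i).2.2.2.1]
    have hM2' : ∀ i, tr (((P i)⁻¹ * A' i * P i)⁻¹ * uPlus l 0) = t := fun i => by
      rw [← hP i, tr_inv_mul_conj, (htr i).2.2.2.2.2]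
    have hne : ∀ M : SL2, tr M = t → tr (M⁻¹ * uPlus l 0) = t → M.1 0 1 ≠ 0 := by
      intro M h1 h2 h
      have h2 := diag_det hlu h1 h2
      rw [h] at h2
      apply hD
      linear_combination h2
    have hb0 : ∀ i, b i ≠ 0 := fun i => hne _ (hM1 i) (hM2 i)
    have hb0' : ∀ i, b' i ≠ 0 := fun i => hne _ (hM1' i) (hM2' i)
    have key : ∀ i, ((1 + (l : ℂ)⁻¹) * zDot (k i) t (r i) +
        (1 + (l : ℂ)) * zGrave (k i) t (r i) +
        2 * ((l : ℂ) + (l : ℂ)⁻¹ + 2 - t ^ 2)) * b' i =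
        (1 - l) * ((l : ℂ) + (l : ℂ)⁻¹ + 2 - t ^ 2) * b i := by
      intro i
      obtain ⟨h1, h2, h3, h4, h5, h6⟩ := htr i
      have h0 := diag_bracket hlu (hM1 i) (hM2 i) (hM1' i) (hM2' i)
      rw [← hP i] at h0
      have e1 : (P i)⁻¹ * A i * P i * ((P i)⁻¹ * A' i * P i)⁻¹ =
        (P i)⁻¹ * (A i * (A' i)⁻¹) * P i := by group
      have e2 : (P i)⁻¹ * A i * P i * (((P i)⁻¹ * g i * P i)⁻¹ * ((P i)⁻¹ * A' i * P i)) =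
        (P i)⁻¹ * (A i * ((g i)⁻¹ * A' i)) * P i := by group
      rw [e1, e2, tr_conj', tr_conj', ← h2, ← h3, add_sub_cancel_right, add_sub_cancel_right] at h0
      exact h0
    have hprod := Finset.prod_congr rfl fun (i : Fin m) (_ : i ∈ Finset.univ) => key i
    rw [Finset.prod_mul_distrib, Finset.prod_mul_distrib, Finset.prod_const,
      Finset.card_univ, Fintype.card_fin, hH] at hprod
    have hl1' : (1 : ℂ) - l ≠ 0 := by
      intro h; apply hτ2; rw [← sub_eq_zero.1 h]; norm_num
    have hbb := mul_left_cancel₀ (pow_ne_zero m (mul_ne_zero hl1' hD)) hprod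
    obtain ⟨β, -, hβ⟩ := exists_cyclic_potential (fun i => Units.mk0 (b' i / b i)
      (div_ne_zero (hb0' i) (hb0 i))) (by
        ext
        rw [Units.coe_prod]
        simp only [Units.val_mk0, Finset.prod_div_distrib, hbb, Units.val_one]
        exact div_self (Finset.prod_ne_zero_iff.2 fun i _ => hb0 i))
    have hβ' : ∀ i, (β (i + 1) : ℂ) = β i * (b' i / b i) := fun i => by rw [hβ i]; rfl
    -- Conjugation by `uPlus s 0` divides the coordinate by `s²`, so this choice moves `b i` to `β
    -- i`.
    choose s hs using fun i => exists_unit_sq (b i / β i) (div_ne_zero (hb0 i) (β i).ne_zero)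
    refine ⟨uPlus l 0, fun i => P i * uPlus (s i) 0, fun i => ?_, fun i => ?_⟩
    · have e : (P i * uPlus (s i) 0)⁻¹ * g i * (P i * uPlus (s i) 0) =
        (uPlus (s i) 0)⁻¹ * ((P i)⁻¹ * g i * P i) * uPlus (s i) 0 := by group
      rw [e, hP, conj_diag_diag]
    · have e : ∀ i M, (P i * uPlus (s i) 0)⁻¹ * M * (P i * uPlus (s i) 0) =
        (uPlus (s i) 0)⁻¹ * ((P i)⁻¹ * M * P i) * uPlus (s i) 0 := by intros; group
      have e' : ∀ i, uPlus l 0 = (uPlus (s i) 0)⁻¹ * uPlus l 0 * uPlus (s i) 0 :=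
        fun i => (conj_diag_diag _ _).symm
      rw [e, e]
      have hβ0 := fun i => (β i).ne_zero
      refine diag_unique hlu (by rw [tr_conj', hM1]) ?_ (by rw [tr_conj', hM1']) ?_ ?_ ?_
      · rw [e' (i + 1), tr_inv_mul_conj, hM2]
      · rw [e' i, tr_inv_mul_conj, hM2']
      · rw [conj_diag_01, conj_diag_01, hs, hs]
        change b (i + 1) / (b (i + 1) / β (i + 1)) = b' i / (b i / β i)
        rw [div_div_cancel₀ (hb0 _), hβ']
        have := hb0 i
        have := hβ0 i
        field_simp
      · rw [conj_diag_01]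
        exact div_ne_zero (hb0' i) (pow_ne_zero 2 (s i).ne_zero)

/-- Characters with `τ ≠ 2, t² - 2` are determined by `t`, `τ`, `r`. -/
theorem character_eq_of_coords (hK : (link k).IsKnot)
    {ρ ρ' : (link k).group →* SL2} (h1 : tCoord k (character ρ) = tCoord k (character ρ'))
    (h2 : tauCoord k (character ρ) = tauCoord k (character ρ'))
    (h3 : ∀ i, rCoord k (character ρ) i = rCoord k (character ρ') i)
    (hτ : tauCoord k (character ρ) ≠ 2)
    (hτ' : tauCoord k (character ρ) ≠ tCoord k (character ρ) ^ 2 - 2) :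
    character ρ = character ρ' := by
  set t := tCoord k (character ρ) with ht
  have hG := isGlued_restrict ρ
  have hG' := isGlued_restrict ρ'
  have hirr := (irrPair_iff (tr_val_eq hK ρ 0 (rational (k 0)).nw)
    (tr_val_eq hK ρ 0 (rational (k 0)).ne)).2 ⟨by rwa [← tauCoord_eq], by rwa [← tauCoord_eq]⟩
  have hirr' := (irrPair_iff (tr_val_eq hK ρ' 0 (rational (k 0)).nw)
    (tr_val_eq hK ρ' 0 (rational (k 0)).ne)).2
    ⟨by rwa [← tauCoord_eq, ← h2], by rwa [← tauCoord_eq, ← h2, ← h1]⟩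
  obtain ⟨P, p1, p2⟩ := hirr.exists_conj hirr' (by rw [tr_val_eq hK, tr_val_eq hK, ← h1])
    (by rw [tr_val_eq hK, tr_val_eq hK, ← h1]) (by rw [← tauCoord_eq, ← tauCoord_eq, h2])
  refine character_eq_of_conj P ?_
  have hGP := hG.conj P
  have hmul : ∀ i, (rational (k i)).nw.val (MulAut.conj P ∘ restrict ρ i) *
      (rational (k i)).ne.val (MulAut.conj P ∘ restrict ρ i) =
      (rational (k i)).nw.val (restrict ρ' i) * (rational (k i)).ne.val (restrict ρ' i) := by
    intro i
    rw [hGP.mul_eq i, hG'.mul_eq i, val_conj, val_conj, p1, p2]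
  have step : ∀ i, (rational (k i)).nw.val (MulAut.conj P ∘ restrict ρ i) =
      (rational (k i)).nw.val (restrict ρ' i) → MulAut.conj P ∘ restrict ρ i = restrict ρ' i := by
    intro i hi
    have hne : (rational (k i)).ne.val (MulAut.conj P ∘ restrict ρ i) =
        (rational (k i)).ne.val (restrict ρ' i) := by
      have := hmul i
      rw [hi] at this
      exact mul_left_cancel this
    have htr : ∀ a : Dart (rational (k i)).Arc, tr (a.val (MulAut.conj P ∘ restrict ρ i)) = t := fun a => by
      rw [val_conj, tr_conj, tr_val_eq hK]
    have hirr_i : IrrPair ((rational (k i)).nw.val (MulAut.conj P ∘ restrict ρ i))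
        ((rational (k i)).ne.val (MulAut.conj P ∘ restrict ρ i)) := by
      rw [irrPair_iff (htr _) (htr _), hmul i, hG'.mul_eq i, ← tauCoord_eq, ← h2]
      exact ⟨hτ, hτ'⟩
    refine coloring_eq_of_traces (hGP i).1 (hG' i).1 hi hne ?_ (fun Q c1 c2 => hirr_i.central c1 c2)
      (htr _) (htr _) (by rw [tr_val_eq hK, ← h1]) ?_
    · intro v hv m1 m2
      refine hirr_i v hv m1 ?_
      rw [Dart.val_mem_iff] at m1 m2 ⊢
      refine (isFree_rational (k i)).gen _ ((hGP i).1.isClosed_subgroup (lineStabilizer v)) m1 ?_ _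
      unfold genY at m2
      split_ifs at m2 <;> exact m2
    · have := h3 i
      rw [rCoord_eq, rCoord_eq] at this
      rw [← this, val_conj, val_conj, ← tr_conj P ((rational (k i)).nw.val (restrict ρ i) *
        (genY (k i)).val (restrict ρ i))]
      congr 1; group
  -- Equality propagates down the stack: equal colorings of one tangle give equal lower left ends,
  -- hence equal upper left ends of the next tangle, and the common product gives the upper right
  -- ends.
  have hnw : ∀ i, (rational (k i)).nw.val (MulAut.conj P ∘ restrict ρ i) =
      (rational (k i)).nw.val (restrict ρ' i) := by
    refine fin_cyclic_induction ?_ fun i hi => ?_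
    · rw [val_conj, p1]
    · exact (hGP i).2.1.trans ((congrArg (fun f => ((rational (k i)).sw.val f)⁻¹) (step i hi)).trans
        (hG' i).2.1.symm)
  exact fun i => step i (hnw i)

theorem existsUnique_of_mem_curve (hk : ∀ i, k i ≠ []) (hK : (link k).IsKnot)
    {v : Fin (m + 2) → ℂ} (hv : v ∈ curve k) : ∃! χ, χ ∈ X₂ k ∧ tauCoord k χ = v 0 + (v 0)⁻¹ ∧
      tCoord k χ = v 1 ∧ rCoord k χ = fun i => v i.succ.succ := by
  obtain ⟨ρ, h1, h2, h3⟩ := exists_hom_of_mem_curve hk hv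
  have hτ2 : tauCoord k (character ρ) ≠ 2 := h2 ▸ hv.2.2.1
  have hτt : tauCoord k (character ρ) ≠ tCoord k (character ρ) ^ 2 - 2 := h2 ▸ h1 ▸ hv.2.2.2.1
  refine ⟨character ρ, ⟨⟨⟨ρ, ?_, rfl⟩, h1 ▸ hv.2.1, hτ2, hτt⟩, h2, h1, funext h3⟩, ?_⟩
  · rintro ⟨w, hw, h⟩
    have hirr := (irrPair_iff (tr_val_eq hK ρ 0 (rational (k 0)).nw)
      (tr_val_eq hK ρ 0 (rational (k 0)).ne)).2 ⟨by rwa [← tauCoord_eq], by rwa [← tauCoord_eq]⟩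
    rw [val_restrict, val_restrict] at hirr
    exact hirr w hw (h _) (h _)
  · rintro χ ⟨⟨⟨ρ', -, rfl⟩, -⟩, g2, g1, g3⟩
    refine (character_eq_of_coords hK (h1.trans g1.symm) (h2.trans g2.symm) (fun i => ?_)
      hτ2 hτt).symm
    rw [h3, g3]

end CurveEquation

end Montesinos
end

noncomputable section

namespace Montesinos

/-! ### Dimension theory -/

section Dimension

open MvPolynomial

/-- Splitting off one variable, a maximal ideal contracts to a maximal ideal because polynomial
rings over a field are Jacobson, and its height is larger by one. -/
theorem natCast_le_height_of_isMaximal (n : ℕ) (P : Ideal (MvPolynomial (Fin n) ℂ)) [hP : P.IsMaximal] :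
    (n : ℕ∞) ≤ P.height := by
  induction n with
  | zero => simp
  | succ n ih =>
    let e := (finSuccEquiv ℂ n).toRingEquiv
    set Q : Ideal (Polynomial (MvPolynomial (Fin n) ℂ)) := P.comap (e.symm : _ →+* _) with hQ
    have hQmax : Q.IsMaximal := Ideal.comap_isMaximal_of_equiv e.symm
    have hunder : (Q.comap (Polynomial.C : MvPolynomial (Fin n) ℂ →+* _)).IsMaximal :=
      Polynomial.isMaximal_comap_C_of_isJacobsonRing Q
    have : Q.LiesOver (Q.comap (Polynomial.C : MvPolynomial (Fin n) ℂ →+* _)) := ⟨rfl⟩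
    have h1 := Polynomial.height_eq_height_add_one
      (Q.comap (Polynomial.C : MvPolynomial (Fin n) ℂ →+* _)) Q
    have h2 : Q.height = P.height := RingEquiv.height_comap e.symm P
    rw [← h2, h1, Nat.cast_succ]
    gcongr
    exact ih _

/-- Incomparability: contraction along an integral map is strictly monotone on prime ideals. -/
theorem ringKrullDim_le_of_isIntegral {A B : Type*} [CommRing A] [CommRing B] [Algebra A B]
    [Algebra.IsIntegral A B] : ringKrullDim B ≤ ringKrullDim A := by
  refine Order.krullDim_le_of_strictMono (PrimeSpectrum.comap (algebraMap A B)) ?_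
  intro p q h
  exact Ideal.IsIntegral.comap_lt_comap (R := A) (I := p.asIdeal) (J := q.asIdeal) h

/-- A ring that is integral, but not faithful, over the polynomial ring in two variables. -/
theorem ringKrullDim_le_one_of_isIntegral {A : Type*} [CommRing A] [Algebra ℂ A]
    (φ : MvPolynomial (Fin 2) ℂ →ₐ[ℂ] A) (hφ : φ.toRingHom.IsIntegral)
    (hinj : ¬ Function.Injective φ) : ringKrullDim A ≤ 1 := by
  obtain ⟨f, hf, hf0⟩ : ∃ f, φ f = 0 ∧ f ≠ 0 := by
    by_contra h
    push Not at h
    exact hinj ((injective_iff_map_eq_zero φ).2 h)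
  let ψ : MvPolynomial (Fin 2) ℂ ⧸ Ideal.span {f} →+* A := Ideal.Quotient.lift _ φ.toRingHom (by
    intro a ha
    obtain ⟨b, rfl⟩ := Ideal.mem_span_singleton'.1 ha
    rw [map_mul]
    exact mul_eq_zero_of_right _ hf)
  let := ψ.toAlgebra
  have hint : Algebra.IsIntegral (MvPolynomial (Fin 2) ℂ ⧸ Ideal.span {f}) A := by
    refine ⟨fun a => ?_⟩
    obtain ⟨p, hp, h⟩ := hφ a
    refine ⟨p.map (Ideal.Quotient.mk _), hp.map _, ?_⟩
    rw [Polynomial.eval₂_map]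
    exact h
  refine ringKrullDim_le_of_isIntegral.trans (?_ : ringKrullDim (_ ⧸ Ideal.span {f}) ≤ 1)
  have h1 := ringKrullDim_quotient_succ_le_of_nonZeroDivisor (mem_nonZeroDivisors_of_ne_zero hf0)
  rw [MvPolynomial.ringKrullDim_of_isNoetherianRing, ringKrullDim_eq_zero_of_field, zero_add,
    Nat.card_fin] at h1
  have h2 : ((2 : ℕ) : WithBot ℕ∞) = 1 + 1 := by norm_num
  rw [h2] at h1
  generalize ringKrullDim (MvPolynomial (Fin 2) ℂ ⧸ Ideal.span {f}) = a at h1 ⊢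
  induction a with
  | bot => exact bot_le
  | coe a =>
    norm_cast at h1 ⊢
    exact (ENat.add_le_add_iff_right ENat.one_ne_top).1 (WithBot.coe_le_coe.1 h1)

/-- A subset of affine `n + 1`-space given by `n` equations and one inequality is a curve if all
components of the corresponding scheme have dimension at most one. -/
theorem isAlgebraicCurve_of_ringKrullDim_le {n : ℕ} (s : Finset (MvPolynomial (Fin (n + 1)) ℂ))
    (hs : s.card ≤ n) (u : MvPolynomial (Fin (n + 1)) ℂ) {S : Set (Fin (n + 1) → ℂ)}
    (hS : ∀ v, v ∈ S ↔ (∀ f ∈ s, aeval v f = 0) ∧ aeval v u ≠ 0)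
    (hdim : ∀ P : Ideal (MvPolynomial (Fin (n + 1)) ℂ), P.IsPrime → (∀ f ∈ s, f ∈ P) → u ∉ P →
      ringKrullDim (MvPolynomial (Fin (n + 1)) ℂ ⧸ P) ≤ 1) : IsAlgebraicCurve S := by
  refine ⟨⟨Ideal.span s, Ideal.span {u}, ?_⟩, fun P hP => ?_⟩
  · ext v
    rw [hS, zeroLocus_span, zeroLocus_span]
    simp
  · have hprime : P.IsPrime := hP.1.1
    have hu : u ∉ P := by
      intro h
      obtain ⟨y, hy, hy'⟩ := Ideal.exists_mul_mem_of_mem_minimalPrimes hP h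
      apply hy
      intro v hv
      have := hy' v hv
      rw [map_mul] at this
      exact (mul_eq_zero.1 this).resolve_left ((hS v).1 hv).2
    have hsP : ∀ f ∈ s, f ∈ P := fun f hf => hP.1.2 fun v hv => ((hS v).1 hv).1 f hf
    -- A component on which `u` does not vanish identically is a component of the scheme of the
    -- equations alone: by the Nullstellensatz `a * u` lies in the radical of the equations if `a`
    -- vanishes on `S`.
    have hmin : P ∈ (Ideal.span (s : Set (MvPolynomial (Fin (n + 1)) ℂ))).minimalPrimes := by
      refine ⟨⟨hprime, Ideal.span_le.2 hsP⟩, ?_⟩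
      rintro Q ⟨hQ, hsQ⟩ hQP
      refine hP.2 ⟨hQ, fun a ha => ?_⟩ hQP
      have h1 : a * u ∈ vanishingIdeal ℂ (zeroLocus ℂ (Ideal.span
          (s : Set (MvPolynomial (Fin (n + 1)) ℂ)))) := by
        intro v hv
        rw [zeroLocus_span] at hv
        rw [map_mul]
        by_cases h0 : aeval v u = 0
        · rw [h0, mul_zero]
        · rw [ha v ((hS v).2 ⟨hv, h0⟩), zero_mul]
      rw [vanishingIdeal_zeroLocus_eq_radical] at h1
      have h2 : a * u ∈ Q := hQ.radical_le_iff.2 hsQ h1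
      exact (hQ.mem_or_mem h2).resolve_right fun h => hu (hQP h)
    refine le_antisymm (hdim P hprime hsP hu) ?_
    -- In dimension zero `P` would be maximal, hence of height at least `n + 1`. But it is minimal
    -- over an ideal with `n` generators, and Krull's theorem bounds its height by `n`.
    by_contra hlt
    have hnontriv : Nontrivial (MvPolynomial (Fin (n + 1)) ℂ ⧸ P) := Ideal.Quotient.nontrivial_iff.2
      hprime.ne_top
    have h0 : Ring.KrullDimLE 0 (MvPolynomial (Fin (n + 1)) ℂ ⧸ P) := by
      rw [Ring.krullDimLE_iff]
      have h1 := not_le.1 hlt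
      generalize ringKrullDim (MvPolynomial (Fin (n + 1)) ℂ ⧸ P) = a at h1 ⊢
      induction a with
      | bot => exact bot_le
      | coe a =>
        norm_cast at h1 ⊢
        exact (Order.lt_one_iff.1 h1).le
    have hmax : P.IsMaximal := by
      have : IsField (MvPolynomial (Fin (n + 1)) ℂ ⧸ P) := Ring.KrullDimLE.isField_of_isDomain
      exact Ideal.Quotient.maximal_of_isField _ this
    have h1 := natCast_le_height_of_isMaximal _ P
    have h2 := Ideal.height_le_card_of_mem_minimalPrimes_span_finset hmin
    have h3 := h1.trans (h2.trans (Nat.cast_le.2 hs))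
    have h4 := Nat.cast_le.1 h3
    omega

end Dimension

/-! ### The curve has dimension one -/

section CurveDimension

variable {m : ℕ} {k : Fin m → List ℤ}

/-- Taylor expansion to first order; with `y = l + 1` it provides both the division by `l + 1` and
the value of the quotient at `l = -1`. -/
theorem prod_add_mul_expansion {A ι : Type*} [CommRing A] [DecidableEq ι] (s : Finset ι) (a y : A)
    (B : ι → A) : ∃ c, ∏ i ∈ s, (a + y * B i) =
      a ^ s.card + y * (a ^ (s.card - 1) * ∑ i ∈ s, B i) + y ^ 2 * c := by
  induction s using Finset.induction_on with
  | empty => exact ⟨0, by simp⟩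
  | insert j s hj ih =>
    obtain ⟨c, hc⟩ := ih
    rw [Finset.prod_insert hj, hc, Finset.card_insert_of_notMem hj, Finset.sum_insert hj,
      Nat.add_sub_cancel]
    have h : a * (a ^ (s.card - 1) * ∑ i ∈ s, B i) = a ^ s.card * ∑ i ∈ s, B i := by
      rcases s.eq_empty_or_nonempty with rfl | hs
      · simp
      · rw [← mul_assoc, mul_pow_sub_one hs.card_pos.ne']
    refine ⟨a * c + B j * (a ^ (s.card - 1) * ∑ i ∈ s, B i) + y * B j * c, ?_⟩
    linear_combination y * h

open MvPolynomial

/-- `e₀` as a polynomial. -/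
def eZeroPoly (k : Fin m → List ℤ) (i : Fin m) : MvPolynomial (Fin (m + 2)) ℂ :=
  open Classical in
  if (GenSignPos (k i) ↔ Even (k i).length) then X i.succ.succ else X 1 ^ 2 - X i.succ.succ

/-- `(z + 2, ż + 2, z̀ + 2)` as polynomials. -/
def triplePoly (k : Fin m → List ℤ) (i : Fin m) : MvPolynomial (Fin (m + 2)) ℂ ×
    MvPolynomial (Fin (m + 2)) ℂ × MvPolynomial (Fin (m + 2)) ℂ :=
  traceTriple (X 1 ^ 2) (eZeroPoly k i) (k i)

theorem aeval_eZeroPoly (i : Fin m) (v : Fin (m + 2) → ℂ) :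
    aeval v (eZeroPoly k i) = eZero (k i) (v 1) (v i.succ.succ) := by
  unfold eZeroPoly eZero
  split_ifs <;> simp

theorem aeval_triplePoly (i : Fin m) (v : Fin (m + 2) → ℂ) :
    traceTriple (v 1 ^ 2) (eZero (k i) (v 1) (v i.succ.succ)) (k i) =
      (aeval v (triplePoly k i).1, aeval v (triplePoly k i).2.1, aeval v (triplePoly k i).2.2) := by
  rw [triplePoly, ← map_traceTriple, aeval_eZeroPoly, map_pow, aeval_X]

/-- The factor for one tangle in the equation of the curve, up to a power of `l`. -/
def bracketPoly (k : Fin m → List ℤ) (i : Fin m) : MvPolynomial (Fin (m + 2)) ℂ :=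
  (X 0 + 1) * ((triplePoly k i).2.1 - 2) + X 0 * (X 0 + 1) * ((triplePoly k i).2.2 - 2) +
    2 * ((X 0 + 1) ^ 2 - X 0 * X 1 ^ 2)

/-- After multiplication by powers of `l`, all factors of both products are congruent to the same `a
= -2 l t²` modulo `l + 1`. So the zeroth order terms cancel, and the first order terms give the
value at `l = -1`. -/
theorem exists_H_poly (k : Fin m → List ℤ) : ∃ h : MvPolynomial (Fin (m + 2)) ℂ,
    (X 0 + 1) * h = ∏ i, bracketPoly k i - ((1 - X 0) * ((X 0 + 1) ^ 2 - X 0 * X 1 ^ 2)) ^ m ∧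
    ∀ v : Fin (m + 2) → ℂ, v 0 = -1 → aeval v h = (2 * v 1 ^ 2) ^ (m - 1) *
      ∑ i, (v 1 ^ 2 + (aeval v (triplePoly k i).2.1 - aeval v (triplePoly k i).2.2)) := by
  set a : MvPolynomial (Fin (m + 2)) ℂ := -2 * X 0 * X 1 ^ 2 with ha
  set y : MvPolynomial (Fin (m + 2)) ℂ := X 0 + 1 with hy
  set B : Fin m → MvPolynomial (Fin (m + 2)) ℂ := fun i =>
    (triplePoly k i).2.1 - 2 + X 0 * ((triplePoly k i).2.2 - 2) + 2 * y with hB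
  set D : MvPolynomial (Fin (m + 2)) ℂ := (1 - X 0) * y + X 0 * X 1 ^ 2 with hD
  obtain ⟨c, hc⟩ := prod_add_mul_expansion Finset.univ a y B
  obtain ⟨c', hc'⟩ := prod_add_mul_expansion (Finset.univ : Finset (Fin m)) a y fun _ => D
  rw [Finset.prod_const] at hc'
  simp only [Finset.card_univ, Fintype.card_fin, Finset.sum_const, nsmul_eq_mul] at hc hc'
  refine ⟨a ^ (m - 1) * (∑ i, B i - m * D) + y * (c - c'), ?_, fun v hv => ?_⟩
  · have e1 : ∀ i, bracketPoly k i = a + y * B i := by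
      intro i; rw [bracketPoly, ha, hB, hy]; ring
    have e2 : (1 - X 0) * (y ^ 2 - X 0 * X 1 ^ 2) = a + y * D := by
      rw [ha, hD, hy]; ring
    rw [Finset.prod_congr rfl fun i _ => e1 i, e2, hc, hc']
    ring
  · simp only [ha, hB, hD, hy, map_add, map_mul, map_sub, map_pow, map_sum, aeval_X, hv, map_one,
      map_ofNat, map_neg, map_natCast, Finset.sum_add_distrib, Finset.sum_sub_distrib]
    simp only [neg_add_cancel, zero_mul, add_zero, mul_zero, Finset.sum_const_zero,
      neg_mul, one_mul, neg_sub, Finset.sum_sub_distrib, Finset.sum_const, Finset.card_univ,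
      Fintype.card_fin, nsmul_eq_mul, mul_neg, neg_neg, mul_one]
    ring

/-- The equations `z_i + 2 = l + l⁻¹`. -/
def fiberPoly (k : Fin m → List ℤ) (i : Fin m) : MvPolynomial (Fin (m + 2)) ℂ :=
  X 0 * (triplePoly k i).1 - X 0 ^ 2 - 1

/-- The excluded locus. -/
def excludedPoly (m : ℕ) : MvPolynomial (Fin (m + 2)) ℂ :=
  X 0 * X 1 * (X 0 - 1) * (X 0 ^ 2 + 1 - (X 1 ^ 2 - 2) * X 0)

/-- On the curve `l` is invertible, so powers of `l` are harmless; at `l = -1` the factor `(2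
t²)^(m-1)` can be cancelled because `t ≠ 0`. -/
theorem mem_curve_iff [NeZero m] {h : MvPolynomial (Fin (m + 2)) ℂ}
    (h1 : (X 0 + 1) * h =
      ∏ i, bracketPoly k i - ((1 - X 0) * ((X 0 + 1) ^ 2 - X 0 * X 1 ^ 2)) ^ m)
    (h2 : ∀ v : Fin (m + 2) → ℂ, v 0 = -1 → aeval v h = (2 * v 1 ^ 2) ^ (m - 1) *
      ∑ i, (v 1 ^ 2 + (aeval v (triplePoly k i).2.1 - aeval v (triplePoly k i).2.2)))
    (v : Fin (m + 2) → ℂ) : v ∈ curve k ↔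
      ((∀ i, aeval v (fiberPoly k i) = 0) ∧ aeval v h = 0) ∧ aeval v (excludedPoly m) ≠ 0 := by
  have hex : aeval v (excludedPoly m) ≠ 0 ↔
      v 0 ≠ 0 ∧ v 1 ≠ 0 ∧ v 0 + (v 0)⁻¹ ≠ 2 ∧ v 0 + (v 0)⁻¹ ≠ v 1 ^ 2 - 2 := by
    simp only [excludedPoly, map_mul, map_add, map_sub, map_pow, aeval_X, map_one, map_ofNat, ne_eq,
      mul_eq_zero, not_or, and_assoc]
    refine and_congr_right fun h0 => and_congr_right fun _ => and_congr ?_ ?_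
    · refine not_congr ⟨fun h => ?_, fun h => ?_⟩
      · rw [sub_eq_zero.1 h]; norm_num
      · have : (v 0 - 1) ^ 2 = 0 := by field_simp at h; linear_combination h
        simpa using this
    · refine not_congr ⟨fun h => ?_, fun h => ?_⟩
      · field_simp; linear_combination h
      · field_simp at h; linear_combination h
  have hz : v 0 ≠ 0 → ((∀ i, aeval v (fiberPoly k i) = 0) ↔
      ∀ i : Fin m, z (k i) (v 1) (v i.succ.succ) = v 0 + (v 0)⁻¹ - 2) := by
    intro h0
    refine forall_congr' fun i => ?_
    rw [z_eq, aeval_triplePoly]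
    simp only [fiberPoly, map_mul, map_sub, map_pow, aeval_X, map_one]
    constructor
    · intro h; field_simp; linear_combination h
    · intro h; field_simp at h; linear_combination h
  have hH : v 0 ≠ 0 → v 1 ≠ 0 →
      (aeval v h = 0 ↔ H k (v 0) (v 1) (fun i => v i.succ.succ) = 0) := by
    intro h0 ht
    by_cases hl : v 0 = -1
    · rw [h2 v hl, mul_eq_zero, or_iff_right (pow_ne_zero _ (mul_ne_zero two_ne_zero
        (pow_ne_zero 2 ht))), hl, H_neg_one_eq_zero_iff ht]
      refine Eq.congr (Finset.sum_congr rfl fun i _ => ?_) rfl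
      rw [zDot_eq, zGrave_eq, aeval_triplePoly]
      ring
    · have hl' : v 0 + 1 ≠ 0 := fun h => hl (eq_neg_of_add_eq_zero_left h)
      rw [H_eq_zero_iff hl, ← mul_right_inj' hl', mul_zero]
      have e := congrArg (aeval v) h1
      simp only [map_mul, map_add, map_sub, map_pow, map_prod, aeval_X, map_one] at e
      rw [e, sub_eq_zero]
      have e1 : ∀ i, aeval v (bracketPoly k i) =
          v 0 * ((1 + (v 0)⁻¹) * zDot (k i) (v 1) (v i.succ.succ) +
            (1 + v 0) * zGrave (k i) (v 1) (v i.succ.succ) +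
            2 * (v 0 + (v 0)⁻¹ + 2 - v 1 ^ 2)) := by
        intro i
        rw [zDot_eq, zGrave_eq, aeval_triplePoly]
        simp only [bracketPoly, map_mul, map_add, map_sub, map_pow, aeval_X, map_one, map_ofNat]
        field_simp
        ring
      have e2 : (1 - v 0) * ((v 0 + 1) ^ 2 - v 0 * v 1 ^ 2) =
          v 0 * ((1 - v 0) * (v 0 + (v 0)⁻¹ + 2 - v 1 ^ 2)) := by
        field_simp
        ring
      rw [Finset.prod_congr rfl fun i _ => e1 i, e2, Finset.prod_mul_distrib, Finset.prod_const,
        Finset.card_univ, Fintype.card_fin, mul_pow]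
      exact mul_right_inj' (pow_ne_zero m h0)
  rw [hex]
  constructor
  · rintro ⟨h0, ht, g1, g2, g3, g4⟩
    exact ⟨⟨(hz h0).2 g3, (hH h0 ht).2 g4⟩, h0, ht, g1, g2⟩
  · rintro ⟨⟨g3, g4⟩, h0, ht, g1, g2⟩
    exact ⟨h0, ht, g1, g2, (hz h0).1 g3, (hH h0 ht).1 g4⟩

/-- The equations have no solution with `t = 0` and `l + l⁻¹ = 5/2`. -/
theorem no_solution_at_trace_zero [NeZero m] (hk : ∀ i, k i ≠ []) (hK : (link k).IsKnot) {l : ℂˣ}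
    (hl : (l : ℂ) + (l : ℂ)⁻¹ = 5 / 2) (e : Fin m → ℂ)
    (h1 : ∀ i, (traceTriple 0 (e i) (k i)).1 = 5 / 2)
    (h2 : ∏ i, ((l + 1) * ((traceTriple 0 (e i) (k i)).2.1 - 2) +
      l * (l + 1) * ((traceTriple 0 (e i) (k i)).2.2 - 2) + 2 * (l + 1) ^ 2) =
      ((1 - (l : ℂ)) * (l + 1) ^ 2) ^ m) : False := by
  have hp : ∀ i, fracNum (k i) ≠ 0 := by
    intro i h
    have := h1 i
    rw [traceTriple_of_fracNum_eq_zero (hk i) h] at this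
    norm_num at this
  -- The parameter `η` is determined up to inversion, and so is `μ`; one of the two choices gives `μ
  -- = -l`.
  have hη : ∀ i, ∃ η : ℂˣ, e i = -unitTrace η ∧ η ^ fracNum (k i) * (-1) ^ fracNum' (k i) = -l := by
    intro i
    obtain ⟨η, hη⟩ := exists_add_inv_eq (-e i)
    have hη' : e i = -unitTrace η := by rw [unitTrace, Units.val_inv_eq_inv_val, ← hη, neg_neg]
    have h3 := h1 i
    rw [hη', traceTriple_units (hk i) η] at h3
    set μ := η ^ fracNum (k i) * (-1) ^ fracNum' (k i) with hμ
    have h4 : ((-μ : ℂˣ) : ℂ) + ((-μ : ℂˣ) : ℂ)⁻¹ = l + (l : ℂ)⁻¹ := by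
      rw [hl, ← h3]
      simp only [unitTrace, Units.val_neg, inv_neg, Units.val_inv_eq_inv_val]
      ring
    rcases add_inv_eq_iff.1 h4.symm with h | h
    · exact ⟨η, hη', by rw [← h, neg_neg]⟩
    · refine ⟨η⁻¹, by rw [hη', unitTrace_inv], ?_⟩
      have : (η⁻¹ ^ fracNum (k i) * (-1) ^ fracNum' (k i))⁻¹ = μ := by
        rw [mul_inv, inv_zpow, inv_inv, hμ, ← inv_zpow, inv_neg, inv_one]
      rw [← inv_inj, this, inv_neg, ← h, neg_neg]
  choose η hη1 hη2 using hη
  set ν : Fin m → ℂˣ := fun i => η i ^ fracDen (k i) * (-1) ^ fracDen' (k i) with hν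
  have hl0 := l.ne_zero
  -- For `μ = -l` each factor is `-ν⁻¹` times the constant on the right-hand side of the equation,
  -- so the equation just says that the product of these `-ν⁻¹` is one.
  have hfac : ∀ i, (l + 1) * ((traceTriple 0 (e i) (k i)).2.1 - 2) +
      l * (l + 1) * ((traceTriple 0 (e i) (k i)).2.2 - 2) + 2 * (l + 1) ^ 2 =
      -((ν i)⁻¹ : ℂˣ) * ((1 - (l : ℂ)) * (l + 1) ^ 2) := by
    intro i
    have h3 := traceTriple_units (hk i) (η i)
    simp only [hη2] at h3
    rw [hη1, h3]
    have := (ν i).ne_zero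
    change (l + 1) * (-unitTrace (ν i) - 2) + l * (l + 1) * (-unitTrace (-l * (ν i)⁻¹) - 2) +
      2 * (l + 1) ^ 2 = _
    simp only [unitTrace, mul_inv_rev, inv_inv, Units.val_mul, Units.val_inv_eq_inv_val, Units.val_neg,
      inv_neg]
    field_simp
    ring
  have hK0 : (1 - (l : ℂ)) * (l + 1) ^ 2 ≠ 0 := by
    refine mul_ne_zero (fun h => ?_) (pow_ne_zero 2 fun h => ?_)
    · rw [← sub_eq_zero.1 h] at hl; norm_num at hl
    · rw [eq_neg_of_add_eq_zero_left h] at hl; norm_num at hl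
  rw [Finset.prod_congr rfl fun i _ => hfac i, Finset.prod_mul_distrib, Finset.prod_const,
    Finset.card_univ, Fintype.card_fin] at h2
  have h3 : ∏ i, (-((ν i)⁻¹ : ℂˣ) : ℂ) = 1 :=
    mul_right_cancel₀ (pow_ne_zero m hK0) (h2.trans (one_mul _).symm)
  -- Absolute values remove signs and roots of unity: `|η|^p = |l|` and `|ν| = |η|^q`, so `log |ν| =
  -- (q / p) * log |l|`.
  have h4 : ∑ i, Real.log ‖(ν i : ℂ)‖ = 0 := by
    have := congrArg norm h3
    rw [norm_prod, norm_one] at this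
    simp only [norm_neg, Units.val_inv_eq_inv_val, norm_inv, Finset.prod_inv_distrib, inv_eq_one] at this
    rw [← Real.log_prod fun i _ => norm_ne_zero_iff.2 (ν i).ne_zero, this, Real.log_one]
  have hsign : ∀ n : ℤ, ‖(((-1 : ℂˣ) ^ n : ℂˣ) : ℂ)‖ = 1 := by
    intro n; simp
  have h5 : ∀ i, fracNum (k i) * Real.log ‖(η i : ℂ)‖ = Real.log ‖(l : ℂ)‖ := by
    intro i
    have := congrArg (fun u : ℂˣ => Real.log ‖(u : ℂ)‖) (hη2 i)
    simp only [Units.val_mul, norm_mul, Units.val_neg, norm_neg,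
      Units.val_zpow_eq_zpow_val, norm_zpow] at this
    simpa using this
  have h6 : ∀ i, Real.log ‖(ν i : ℂ)‖ = (fracDen (k i) / fracNum (k i) : ℚ) * Real.log ‖(l : ℂ)‖ := by
    intro i
    have hp' : (fracNum (k i) : ℝ) ≠ 0 := by exact_mod_cast hp i
    have : Real.log ‖(ν i : ℂ)‖ = fracDen (k i) * Real.log ‖(η i : ℂ)‖ := by
      simp only [hν, Units.val_mul, norm_mul, Units.val_zpow_eq_zpow_val, norm_zpow]
      simp
    rw [this, ← h5 i]
    push_cast
    field_simp
  rw [Finset.sum_congr rfl fun i _ => h6 i, ← Finset.sum_mul, mul_eq_zero] at h4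
  rcases h4 with h4 | h4
  · exact sum_inv_frac_ne_zero hk hK hp (by exact_mod_cast h4)
  -- This is why `5 / 2` was chosen: `|l| = 1` would imply `|l + l⁻¹| ≤ 2`.
  · have h7 : ‖(l : ℂ)‖ = 1 := by
      have hpos : 0 < ‖(l : ℂ)‖ := norm_pos_iff.2 hl0
      rcases Real.log_eq_zero.1 h4 with h | h | h
      · exact absurd h hpos.ne'
      · exact h
      · linarith
    have h8 := norm_add_le (l : ℂ) (l : ℂ)⁻¹
    rw [hl, norm_inv, h7] at h8
    norm_num at h8

theorem isIntegral_of_hasUnitLead {A B : Type*} [CommRing A] [CommRing B] [Algebra A B]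
    {f : Polynomial A} {n : ℕ} (hf : HasUnitLead f n) (hn : n ≠ 0) {w : A} {r : B}
    (h : Polynomial.aeval r f = algebraMap A B w) : IsIntegral A r := by
  have key : ∀ c : A, c * f.coeff n = 1 → IsIntegral A r := by
    intro c hc
    refine ⟨Polynomial.C c * (f - Polynomial.C w), ?_, ?_⟩
    · refine Polynomial.monic_of_natDegree_le_of_coeff_eq_one n ?_ ?_
      · exact (Polynomial.natDegree_C_mul_le _ _).trans
          (Polynomial.natDegree_sub_C.trans_le hf.1)
      · rw [Polynomial.coeff_C_mul, Polynomial.coeff_sub, Polynomial.coeff_C_of_ne_zero hn, sub_zero, hc]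
    · rw [← Polynomial.aeval_def, map_mul, map_sub, h, Polynomial.aeval_C, Polynomial.aeval_C, sub_self, mul_zero]
  rcases hf.2 with h1 | h1
  · exact key 1 (by rw [h1, one_mul])
  · exact key (-1) (by rw [h1]; ring)

/-- Modulo `P` all `z i + 2` agree with one element `w = l + l⁻¹`. Over the polynomials in `w` and
`t`, each `r i` is integral by the leading coefficient `±1`, and `l` by `l² - w l + 1 = 0`. If this
were an extension of the polynomial ring in two variables, lying over would give a point of the
component above `w = 5/2`, `t = 0`. This point lies outside of the curve itself, so the polynomial
equations are needed there. -/
theorem ringKrullDim_quotient_le_one [NeZero m] (hk : ∀ i, k i ≠ []) (hK : (link k).IsKnot)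
    {h : MvPolynomial (Fin (m + 2)) ℂ} (h1 : (X 0 + 1) * h =
      ∏ i, bracketPoly k i - ((1 - X 0) * ((X 0 + 1) ^ 2 - X 0 * X 1 ^ 2)) ^ m)
    (P : Ideal (MvPolynomial (Fin (m + 2)) ℂ)) (hP : P.IsPrime) (hf : ∀ i, fiberPoly k i ∈ P)
    (hh : h ∈ P) (hu : excludedPoly m ∉ P) :
    ringKrullDim (MvPolynomial (Fin (m + 2)) ℂ ⧸ P) ≤ 1 := by
  set π := Ideal.Quotient.mkₐ ℂ P with hπ
  have hπ0 : ∀ a, π a = 0 ↔ a ∈ P := fun a => Ideal.Quotient.eq_zero_iff_mem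
  have hl0 : π (X 0) ≠ 0 := by
    rw [Ne, hπ0]
    intro hmem
    refine hu ?_
    rw [excludedPoly, mul_assoc, mul_assoc]
    exact P.mul_mem_right _ hmem
  set w := π (triplePoly k 0).1 with hw
  have hfib : ∀ i, π (X 0) * π (triplePoly k i).1 = π (X 0) ^ 2 + 1 := by
    intro i
    have := (hπ0 _).2 (hf i)
    simp only [fiberPoly, map_sub, map_mul, map_pow, map_one] at this
    linear_combination this
  have hwi : ∀ i, π (triplePoly k i).1 = w := fun i =>
    mul_left_cancel₀ hl0 ((hfib i).trans (hfib 0).symm)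
  have hp : ∀ i, fracNum (k i) ≠ 0 := by
    intro i h0
    have h2 : (triplePoly k i).1 = 2 := traceTriple_of_fracNum_eq_zero (hk i) h0
    have h3 := hfib i
    rw [h2, map_ofNat] at h3
    have h4 : (π (X 0) - 1) ^ 2 = 0 := by linear_combination -h3
    have h5 : X 0 - 1 ∈ P := by
      rw [← hπ0, map_sub, map_one]
      exact pow_eq_zero_iff two_ne_zero |>.1 h4
    exact hu (P.mul_mem_right _ (P.mul_mem_left _ h5))
  set φ : MvPolynomial (Fin 2) ℂ →ₐ[ℂ] MvPolynomial (Fin (m + 2)) ℂ ⧸ P :=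
    aeval ![w, π (X 1)] with hφ
  have hφ0 : φ (X 0) = w := by rw [hφ, aeval_X]; rfl
  have hφ1 : φ (X 1) = π (X 1) := by rw [hφ, aeval_X]; rfl
  let := φ.toRingHom.toAlgebra
  have htower : IsScalarTower ℂ (MvPolynomial (Fin 2) ℂ) (MvPolynomial (Fin (m + 2)) ℂ ⧸ P) :=
    IsScalarTower.of_algebraMap_eq' φ.comp_algebraMap.symm
  have hint : ∀ a, IsIntegral (MvPolynomial (Fin 2) ℂ) (π a) := by
    have hX0 : IsIntegral (MvPolynomial (Fin 2) ℂ) (π (X 0)) := by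
      refine ⟨Polynomial.X ^ 2 - Polynomial.C (X 0) * Polynomial.X + 1, ?_, ?_⟩
      · refine Polynomial.monic_of_natDegree_le_of_coeff_eq_one 2 (by compute_degree) ?_
        simp [Polynomial.coeff_one]
      · have : Polynomial.eval₂ (algebraMap (MvPolynomial (Fin 2) ℂ)
            (MvPolynomial (Fin (m + 2)) ℂ ⧸ P)) (π (X 0))
            (Polynomial.X ^ 2 - Polynomial.C (X 0) * Polynomial.X + 1) =
            π (X 0) ^ 2 - φ (X 0) * π (X 0) + 1 := by
          simp only [Polynomial.eval₂_add, Polynomial.eval₂_sub, Polynomial.eval₂_pow,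
            Polynomial.eval₂_mul, Polynomial.eval₂_X, Polynomial.eval₂_C, Polynomial.eval₂_one]
          rfl
        rw [this, hφ0]
        linear_combination -hfib 0
    have hX1 : IsIntegral (MvPolynomial (Fin 2) ℂ) (π (X 1)) := by
      rw [← hφ1]
      exact isIntegral_algebraMap (R := MvPolynomial (Fin 2) ℂ) (x := X 1)
    have hXr : ∀ i : Fin m, IsIntegral (MvPolynomial (Fin 2) ℂ) (π (X i.succ.succ)) := by
      intro i
      have hcase : ∃ (ε b : MvPolynomial (Fin 2) ℂ), (ε = 1 ∨ ε = -1) ∧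
          π (eZeroPoly k i) = φ ε * π (X i.succ.succ) + φ b := by
        unfold eZeroPoly
        split_ifs
        · exact ⟨1, 0, Or.inl rfl, by simp⟩
        · refine ⟨-1, X 1 ^ 2, Or.inr rfl, ?_⟩
          rw [map_sub, map_pow, map_neg, map_one, map_pow, hφ1]
          ring
      obtain ⟨ε, b, hε, he⟩ := hcase
      have hlead := hasUnitLead_traceTriple (T := (X 1 ^ 2 : MvPolynomial (Fin 2) ℂ)) (b := b) hε
        (hk i) (hp i)
      refine isIntegral_of_hasUnitLead hlead (Int.natAbs_ne_zero.2 (hp i)) (w := X 0) ?_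
      let ψ : Polynomial (MvPolynomial (Fin 2) ℂ) →ₐ[ℂ] MvPolynomial (Fin (m + 2)) ℂ ⧸ P :=
        (Polynomial.aeval (π (X i.succ.succ))).restrictScalars ℂ
      have hψC : ∀ c, ψ (Polynomial.C c) = φ c := fun c => Polynomial.aeval_C _ _
      have hψX : ψ Polynomial.X = π (X i.succ.succ) := Polynomial.aeval_X _
      have h3 := map_traceTriple ψ (Polynomial.C (X 1 ^ 2)) (Polynomial.C ε * Polynomial.X +
        Polynomial.C b) (k i)
      rw [hψC, map_add, map_mul, hψC, hψC, hψX, ← he, map_pow, hφ1, ← map_pow, map_traceTriple π] at h3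
      have h4 := congrArg Prod.fst h3
      exact h4.symm.trans ((hwi i).trans hφ0.symm)
    intro a
    induction a using MvPolynomial.induction_on with
    | C c =>
      have : π (C c) = algebraMap (MvPolynomial (Fin 2) ℂ) _ (C c) := by
        rw [← MvPolynomial.algebraMap_eq, ← MvPolynomial.algebraMap_eq,
          ← IsScalarTower.algebraMap_apply]
        exact π.commutes c
      rw [this]
      exact isIntegral_algebraMap
    | add p q hp hq => rw [map_add]; exact hp.add hq
    | mul_X p j hp =>
      rw [map_mul]
      refine hp.mul ?_
      refine Fin.cases hX0 (fun j => ?_) j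
      refine Fin.cases hX1 (fun j => ?_) j
      exact hXr j
  have hφint : φ.toRingHom.IsIntegral := by
    intro a
    obtain ⟨b, rfl⟩ := Ideal.Quotient.mk_surjective a
    exact hint b
  refine ringKrullDim_le_one_of_isIntegral φ hφint fun hinj => ?_
  -- lie over the point `t = 0`, `l + l⁻¹ = 5/2`
  have : Algebra.IsIntegral (MvPolynomial (Fin 2) ℂ) (MvPolynomial (Fin (m + 2)) ℂ ⧸ P) := ⟨hφint⟩
  obtain ⟨Q, hQ, hQ'⟩ := Ideal.exists_ideal_over_maximal_of_isIntegral
    (S := MvPolynomial (Fin (m + 2)) ℂ ⧸ P) (vanishingIdeal ℂ {(![5 / 2, 0] : Fin 2 → ℂ)}) (by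
      intro a ha
      have : a = 0 := hinj (by rw [map_zero]; exact ha)
      rw [this]; exact Ideal.zero_mem _)
  have hQmem : ∀ a, φ a ∈ Q ↔ aeval (![5 / 2, 0] : Fin 2 → ℂ) a = 0 := by
    intro a
    rw [← mem_vanishingIdeal_singleton_iff, ← hQ']; rfl
  have hR : (Q.comap π).IsMaximal := Ideal.comap_isMaximal_of_surjective _
    (Ideal.Quotient.mk_surjective)
  obtain ⟨v, hv⟩ := isMaximal_iff_eq_vanishingIdeal_singleton.1 hR
  have hvmem : ∀ a, aeval v a = 0 ↔ π a ∈ Q := by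
    intro a
    rw [← mem_vanishingIdeal_singleton_iff, ← hv]; rfl
  have hvP : ∀ a ∈ P, aeval v a = 0 := by
    intro a ha
    rw [hvmem, (hπ0 a).2 ha]
    exact Q.zero_mem
  have hv1 : v 1 = 0 := by
    have : aeval v (X 1 : MvPolynomial (Fin (m + 2)) ℂ) = 0 := by
      rw [hvmem, ← hφ1, hQmem, aeval_X]; rfl
    rwa [aeval_X] at this
  have hvw : ∀ i, aeval v (triplePoly k i).1 = 5 / 2 := by
    intro i
    have : aeval v ((triplePoly k i).1 - C (5 / 2)) = 0 := by
      rw [hvmem, map_sub, hwi, ← hφ0]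
      have e : π (C (5 / 2)) = φ (C (5 / 2)) := by
        rw [← MvPolynomial.algebraMap_eq, ← MvPolynomial.algebraMap_eq, π.commutes, φ.commutes]
      rw [e, ← map_sub, hQmem]
      simp
    rw [map_sub, aeval_C, sub_eq_zero] at this
    exact this
  have hv0 : ∀ i, v 0 * aeval v (triplePoly k i).1 = v 0 ^ 2 + 1 := by
    intro i
    have := hvP _ (hf i)
    simp only [fiberPoly, map_sub, map_mul, map_pow, map_one, aeval_X] at this
    linear_combination this
  have hv00 : v 0 ≠ 0 := by
    intro h0
    have := hv0 0
    rw [h0] at this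
    norm_num at this
  have hN := congrArg (aeval v) h1
  rw [map_mul, hvP h hh, mul_zero] at hN
  have htri := fun i => aeval_triplePoly (k := k) i v
  rw [hv1, zero_pow two_ne_zero] at htri
  refine no_solution_at_trace_zero hk hK (l := Units.mk0 (v 0) hv00) ?_
    (fun i => eZero (k i) 0 (v i.succ.succ)) (fun i => ?_) ?_
  · have := hv0 0
    rw [hvw] at this
    change v 0 + (v 0)⁻¹ = 5 / 2
    field_simp
    linear_combination -2 * this
  · rw [htri, hvw]
  · simp only [htri, Units.val_mk0]
    simp only [map_sub, map_prod, bracketPoly, map_mul, map_add, map_pow, aeval_X, map_one, map_ofNat,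
      hv1] at hN
    simp only [zero_pow two_ne_zero, mul_zero, sub_zero] at hN
    exact (sub_eq_zero.1 hN.symm)

/-- The curve is an algebraic curve. -/
theorem isAlgebraicCurve_curve [NeZero m] (hk : ∀ i, k i ≠ []) (hK : (link k).IsKnot) :
    IsAlgebraicCurve (curve k) := by
  classical
  obtain ⟨h, h1, h2⟩ := exists_H_poly k
  refine isAlgebraicCurve_of_ringKrullDim_le (insert h (Finset.univ.image (fiberPoly k))) ?_
    (excludedPoly m) (fun v => ?_) fun P hP hs hu => ?_
  -- There are `m + 1` equations in affine space of dimension `m + 2`.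
  · refine (Finset.card_insert_le _ _).trans (Nat.succ_le_succ ?_)
    exact Finset.card_image_le.trans (by simp)
  · rw [mem_curve_iff h1 h2 v]
    simp only [Finset.mem_insert, Finset.mem_image, Finset.mem_univ, true_and, forall_eq_or_imp,
      forall_exists_index, forall_apply_eq_imp_iff]
    rw [and_comm (a := ∀ i, _)]
  · refine ringKrullDim_quotient_le_one hk hK h1 P hP (fun i => hs _ ?_) (hs _ ?_) hu
    · simp
    · simp

end CurveDimension

end Montesinos
end

noncomputable section

namespace Montesinos

/-! ### Tangles coloured by triangular matrices -/

section Triangular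

open SL2

theorem Diagram.isColoring_of_comp {G H : Type} [Group G] [Group H] {d : Diagram} {f : d.Arc → G}
    {φ : G →* H} (hφ : Function.Injective φ) (h : d.IsColoring (φ ∘ f)) : d.IsColoring f := by
  refine ⟨fun a b c hc => hφ ?_, fun a b hj => hφ ?_⟩
  · have := h.1 a b c hc
    simpa only [Dart.val_comp, ← map_mul, ← map_inv] using this
  · have := h.2 a b hj
    simpa only [Dart.val_comp] using this

/-- The upper triangular matrices. -/
abbrev upperGroup : Subgroup SL2 := lineStabilizer ![1, 0]

theorem upperGroup_apply (M : upperGroup) : M.1.1 1 0 = 0 := mem_lineStabilizer_e₁.1 M.2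

theorem upperGroup_det (M : upperGroup) : M.1.1 0 0 * M.1.1 1 1 = 1 := by
  have := det_eq M.1
  rwa [upperGroup_apply, mul_zero, sub_zero] at this

/-- The upper left entry. -/
def diagHom : upperGroup →* ℂˣ where
  toFun M := ⟨M.1.1 0 0, M.1.1 1 1, upperGroup_det M, by rw [mul_comm, upperGroup_det]⟩
  map_one' := by ext; rfl
  map_mul' M N := by
    ext
    change (M.1 * N.1).1 0 0 = M.1.1 0 0 * N.1.1 0 0
    rw [mul_00, upperGroup_apply N]; ring

/-- Scaling the upper right entry, followed by a conjugation. -/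
def affineHom (c d : ℂ) : upperGroup →* SL2 where
  toFun M := SL2.mk (M.1.1 0 0) (c * M.1.1 0 1 + d * (M.1.1 0 0 - M.1.1 1 1)) 0 (M.1.1 1 1)
    (by rw [upperGroup_det]; ring)
  map_one' := by
    refine SL2.ext' rfl ?_ rfl rfl
    change c * (1 : Matrix (Fin 2) (Fin 2) ℂ) 0 1 + d * ((1 : Matrix (Fin 2) (Fin 2) ℂ) 0 0 -
      (1 : Matrix (Fin 2) (Fin 2) ℂ) 1 1) = (1 : Matrix (Fin 2) (Fin 2) ℂ) 0 1
    simp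
  map_mul' M N := by
    have h1 := upperGroup_apply M
    have h2 := upperGroup_apply N
    refine SL2.ext' ?_ ?_ ?_ ?_
    · rw [mul_00]
      change (M.1 * N.1).1 0 0 = M.1.1 0 0 * N.1.1 0 0 + _ * 0
      rw [mul_00, h2]; ring
    · rw [mul_01]
      change c * (M.1 * N.1).1 0 1 + d * ((M.1 * N.1).1 0 0 - (M.1 * N.1).1 1 1) =
        M.1.1 0 0 * (c * N.1.1 0 1 + d * (N.1.1 0 0 - N.1.1 1 1)) +
          (c * M.1.1 0 1 + d * (M.1.1 0 0 - M.1.1 1 1)) * N.1.1 1 1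
      rw [mul_01, mul_00, mul_11, h1, h2]; ring
    · rw [mul_10]
      change (0 : ℂ) = 0 * N.1.1 0 0 + M.1.1 1 1 * 0
      ring
    · rw [mul_11]
      change (M.1 * N.1).1 1 1 = 0 * _ + M.1.1 1 1 * N.1.1 1 1
      rw [mul_11, h1]; ring

theorem uPlus_mem (κ : ℂˣ) (a : ℂ) : uPlus κ a ∈ upperGroup := mem_lineStabilizer_e₁.2 rfl

open Classical in
theorem redPair_eq {k : List ℤ} (hk : k ≠ []) {κ : ℂˣ} {f : (rational k).Arc → SL2}
    (hf : (rational k).IsColoring f) (h1 : (rational k).nw.val f = uPlus κ 0)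
    (h2 : (genY k).val f = uPlus κ 1) :
    redPair k κ = (((rational k).sw.val f)⁻¹, (rational k).ne.val f) := by
  have hy : (rational k).y₀.val f = if GenSignPos k then uPlus κ 1 else (uPlus κ 1)⁻¹ := by
    unfold genY at h2
    split_ifs at h2 ⊢
    · exact h2
    · rw [← h2, Dart.val_rev, inv_inv]
  rw [rational_ends hk f hf, h1, hy]
  rfl

/-- A tangle with three upper triangular ends. -/
theorem upper_ends {k : List ℤ} (hk : k ≠ []) {f : (rational k).Arc → SL2}
    (hf : (rational k).IsColoring f) {κ : ℂˣ} (hκ : κ ≠ κ⁻¹) {b b' : ℂ}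
    (h1 : (rational k).nw.val f = uPlus κ b) (h2 : ((rational k).sw.val f)⁻¹ = uPlus κ b')
    (h3 : (rational k).nw.val f * (rational k).ne.val f = uPlus (κ ^ 2) 0) :
    ∃ c, (genY k).val f = uPlus κ (b + c) ∧
      b * (1 + ((κ : ℂ) ^ 2)⁻¹) = -(c * varthetaNE k κ) ∧ b' = b + c * varthetaSW k κ ∧
      Odd (fracNum k) ∧ (redPair k κ).1.1 0 0 = κ ∧ (redPair k κ).2.1 0 0 = κ := by
  have hne : (rational k).ne.val f = uPlus κ (-(b * ((κ : ℂ) ^ 2)⁻¹)) := by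
    have : (rational k).ne.val f = (uPlus κ b)⁻¹ * uPlus (κ ^ 2) 0 := by rw [← h3, h1]; group
    rw [this]
    have h0 : (κ : ℂ) ≠ 0 := κ.ne_zero
    refine SL2.ext' ?_ ?_ ?_ ?_ <;>
    simp only [mul_00, mul_01, mul_10, mul_11, inv_00, inv_01, inv_10, inv_11, uPlus_00, uPlus_01,
      uPlus_10, uPlus_11, Units.val_pow_eq_pow_val] <;> field_simp <;> ring
  have hmem : ∀ a, f a ∈ upperGroup := mem_of_ends_mem hk hf upperGroup (by rw [h1]; exact uPlus_mem _ _)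
    (by rw [hne]; exact uPlus_mem _ _)
    (by rw [← inv_mem_iff, h2]; exact uPlus_mem _ _)
  set f' : (rational k).Arc → upperGroup := fun a => ⟨f a, hmem a⟩ with hf'
  have hff' : f = upperGroup.subtype ∘ f' := rfl
  have hcf' : (rational k).IsColoring f' :=
    Diagram.isColoring_of_comp (Subgroup.subtype_injective _) (hff' ▸ hf)
  have hval : ∀ a : Dart (rational k).Arc, (a.val f').1 = a.val f := fun a => by
    rw [hff', Dart.val_comp]; rfl
  -- The diagonal entries form a coloring by `ℂˣ` with the value `κ` at both upper ends; so the
  -- second generator has the diagonal entry `κ`, too.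
  obtain ⟨hodd, hY⟩ := genY_val hk (hcf'.comp diagHom) hκ
    (by rw [Dart.val_comp]; ext; change ((rational k).nw.val f').1.1 0 0 = _; rw [hval, h1]; rfl)
    (by rw [Dart.val_comp]; ext; change ((rational k).ne.val f').1.1 0 0 = _; rw [hval, hne]; rfl)
  have hYf : (genY k).val f = uPlus κ (b + (((genY k).val f).1 0 1 - b)) := by
    rw [Dart.val_comp] at hY
    have e1 : ((genY k).val f).1 0 0 = κ := by
      rw [← hval]; exact congrArg Units.val hY
    have e2 : ((genY k).val f).1 1 1 = (κ : ℂ)⁻¹ := by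
      rw [← hval, ← Units.val_inv_eq_inv_val]; exact congrArg Units.inv hY
    have e3 : ((genY k).val f).1 1 0 = 0 := by rw [← hval]; exact upperGroup_apply _
    refine SL2.ext' e1 ?_ e3 e2
    rw [uPlus_01]; ring
  set c := ((genY k).val f).1 0 1 - b with hc
  -- The standard reducible coloring. The given one is its image under a homomorphism that scales
  -- the upper right entry by `c` and then conjugates, so all entries are affine functions of the
  -- entries `ϑ`.
  obtain ⟨f₀, c0, n0, y0⟩ := exists_coloring_generators k (⟨uPlus κ 0, uPlus_mem _ _⟩ : upperGroup)
    ⟨uPlus κ 1, uPlus_mem _ _⟩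
  have hκ0 : (κ : ℂ) - (κ : ℂ)⁻¹ ≠ 0 := by
    intro h
    apply hκ
    ext
    rw [Units.val_inv_eq_inv_val]
    linear_combination h
  have hfeq : affineHom c (b / ((κ : ℂ) - (κ : ℂ)⁻¹)) ∘ f₀ = f := by
    refine coloring_eq_of_generators (c0.comp _) hf ?_ ?_
    · rw [Dart.val_comp, n0, h1]
      refine SL2.ext' rfl ?_ rfl rfl
      change c * 0 + b / ((κ : ℂ) - (κ : ℂ)⁻¹) * ((κ : ℂ) - (κ : ℂ)⁻¹) = b
      rw [div_mul_cancel₀ _ hκ0]; ring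
    · rw [Dart.val_comp, y0, hYf]
      refine SL2.ext' rfl ?_ rfl rfl
      change c * 1 + b / ((κ : ℂ) - (κ : ℂ)⁻¹) * ((κ : ℂ) - (κ : ℂ)⁻¹) = b + c
      rw [div_mul_cancel₀ _ hκ0]; ring
  have hred := redPair_eq hk (c0.comp upperGroup.subtype) (by rw [Dart.val_comp, n0]; rfl)
    (by rw [Dart.val_comp, y0]; rfl)
  have hvv : ∀ a : Dart (rational k).Arc, a.val f = affineHom c (b / ((κ : ℂ) - (κ : ℂ)⁻¹))
    (a.val f₀) := fun a => by rw [← hfeq, Dart.val_comp]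
  rw [Dart.val_comp, Dart.val_comp, ← map_inv] at hred
  have hNE : affineHom c (b / ((κ : ℂ) - (κ : ℂ)⁻¹)) ((rational k).ne.val f₀) =
    uPlus κ (-(b * ((κ : ℂ) ^ 2)⁻¹)) := by rw [← hvv, hne]
  have hSW : affineHom c (b / ((κ : ℂ) - (κ : ℂ)⁻¹)) ((rational k).sw.val f₀)⁻¹ =
    uPlus κ b' := by rw [map_inv, ← hvv, h2]
  have entry : ∀ {M : upperGroup} {x : ℂ}, affineHom c (b / ((κ : ℂ) - (κ : ℂ)⁻¹)) M = uPlus κ x →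
      M.1.1 0 0 = κ ∧ x = c * M.1.1 0 1 + b := by
    intro M x h
    have e0 : M.1.1 0 0 = κ := congrArg (fun N : SL2 => N.1 0 0) h
    have e1 : M.1.1 1 1 = (κ : ℂ)⁻¹ := congrArg (fun N : SL2 => N.1 1 1) h
    have e2 : c * M.1.1 0 1 + b / ((κ : ℂ) - (κ : ℂ)⁻¹) * (M.1.1 0 0 - M.1.1 1 1) = x :=
      congrArg (fun N : SL2 => N.1 0 1) h
    refine ⟨e0, ?_⟩
    rw [← e2, e0, e1, div_mul_cancel₀ _ hκ0]
  obtain ⟨n1, n2⟩ := entry hNE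
  obtain ⟨s1, s2⟩ := entry hSW
  refine ⟨c, hYf, ?_, ?_, hodd, ?_, ?_⟩
  · rw [varthetaNE, hred]
    change b * _ = -(c * ((rational k).ne.val f₀).1.1 0 1)
    linear_combination -n2
  · rw [varthetaSW, hred]
    change b' = b + c * (((rational k).sw.val f₀)⁻¹).1.1 0 1
    linear_combination s2
  · rw [hred]; exact s1
  · rw [hred]; exact n1

/-- Conjugation by this matrix exchanges upper and lower triangular matrices. -/
def flipMatrix : SL2 := SL2.mk 0 1 (-1) 0 (by ring)

theorem flip_conj (M : SL2) : (flipMatrix * M * flipMatrix⁻¹).1 0 0 = M.1 1 1 ∧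
    (flipMatrix * M * flipMatrix⁻¹).1 0 1 = -M.1 1 0 ∧
    (flipMatrix * M * flipMatrix⁻¹).1 1 0 = -M.1 0 1 ∧
    (flipMatrix * M * flipMatrix⁻¹).1 1 1 = M.1 0 0 := by
  have e00 : flipMatrix.1 0 0 = 0 := rfl
  have e01 : flipMatrix.1 0 1 = 1 := rfl
  have e10 : flipMatrix.1 1 0 = -1 := rfl
  have e11 : flipMatrix.1 1 1 = 0 := rfl
  refine ⟨?_, ?_, ?_, ?_⟩ <;>
  simp only [mul_00, mul_01, mul_10, mul_11, inv_00, inv_01, inv_10, inv_11, e00, e01, e10, e11] <;>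
  ring

theorem flip_conj_lPlus (κ : ℂˣ) (a : ℂ) :
    flipMatrix * lPlus κ a * flipMatrix⁻¹ = uPlus κ⁻¹ (-a) := by
  obtain ⟨h1, h2, h3, h4⟩ := flip_conj (lPlus κ a)
  refine SL2.ext' ?_ ?_ ?_ ?_
  · rw [h1, lPlus_11, uPlus_00, Units.val_inv_eq_inv_val]
  · rw [h2, lPlus_10, uPlus_01]
  · rw [h3, lPlus_01, uPlus_10, neg_zero]
  · rw [h4, lPlus_00, uPlus_11, Units.val_inv_eq_inv_val, inv_inv]

theorem flip_conj_uPlus (κ : ℂˣ) : flipMatrix * uPlus κ 0 * flipMatrix⁻¹ = uPlus κ⁻¹ 0 := by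
  have : uPlus κ 0 = lPlus κ 0 := SL2.ext' rfl rfl rfl rfl
  rw [this, flip_conj_lPlus, neg_zero]

/-- A tangle with three lower triangular ends. -/
theorem lower_ends {k : List ℤ} (hk : k ≠ []) {f : (rational k).Arc → SL2}
    (hf : (rational k).IsColoring f) {κ : ℂˣ} (hκ : κ ≠ κ⁻¹) {b b' : ℂ}
    (h1 : (rational k).nw.val f = lPlus κ b) (h2 : ((rational k).sw.val f)⁻¹ = lPlus κ b')
    (h3 : (rational k).nw.val f * (rational k).ne.val f = uPlus (κ ^ 2) 0) :
    ∃ c, (genY k).val f = lPlus κ (b + c) ∧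
      b * (1 + (κ : ℂ) ^ 2) = -(c * varthetaNE k κ⁻¹) ∧ b' = b + c * varthetaSW k κ⁻¹ ∧
      Odd (fracNum k) ∧ (redPair k κ⁻¹).1.1 0 0 = (κ⁻¹ : ℂˣ) ∧
      (redPair k κ⁻¹).2.1 0 0 = (κ⁻¹ : ℂˣ) := by
  have hflip : ∀ a : Dart (rational k).Arc, a.val (MulAut.conj flipMatrix ∘ f) =
    flipMatrix * a.val f * flipMatrix⁻¹ := fun a => val_conj a f flipMatrix
  obtain ⟨c, e1, e2, e3, e4, e5, e6⟩ := upper_ends hk (f := MulAut.conj flipMatrix ∘ f)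
    (hf.comp (MulAut.conj flipMatrix).toMonoidHom) (κ := κ⁻¹) (b := -b) (b' := -b')
    (by rw [inv_inv]; exact hκ.symm) (by rw [hflip, h1, flip_conj_lPlus])
    (by
      rw [hflip, ← flip_conj_lPlus, ← h2]; group)
    (by
      rw [hflip, hflip, inv_pow, ← flip_conj_uPlus, ← h3]; group)
  refine ⟨-c, ?_, ?_, ?_, e4, e5, e6⟩
  · rw [hflip, show -b + c = -(b + -c) by ring, ← flip_conj_lPlus] at e1
    exact mul_left_cancel (mul_right_cancel e1)
  · have : (1 + (κ : ℂ) ^ 2) = 1 + (((κ⁻¹ : ℂˣ) : ℂ) ^ 2)⁻¹ := by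
      rw [Units.val_inv_eq_inv_val, inv_pow, inv_inv]
    rw [this]
    linear_combination -e2
  · linear_combination -e3

end Triangular

end Montesinos

end

noncomputable section

namespace Montesinos

/-! ### Representations with triangular meridians -/

section TriangularReps

open SL2

/-- An upper triangular matrix for `e = true`, and a lower triangular one for `e = false`. -/
def triMatrix (κ : ℂˣ) (e : Bool) (b : ℂ) : SL2 := if e then uPlus κ b else lPlus κ b⁻¹

/-- Storing the inverse of the lower left entry makes the diagonal matrices act on `b` by the same
factor for both types. So the quotients `b (i + 1) / b i` are invariants also when the types differ.
-/
theorem triMatrix_conj (s κ : ℂˣ) (e : Bool) (b : ℂ) :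
    (uPlus s 0)⁻¹ * triMatrix κ e b * uPlus s 0 = triMatrix κ e (b / (s : ℂ) ^ 2) := by
  unfold triMatrix
  split_ifs
  · exact conj_diag_upper s κ b
  · rw [conj_diag_lower, inv_div]; congr 1; field_simp

variable {m : ℕ} [NeZero m] {k : Fin m → List ℤ}

/-- All upper ends of the tangles are triangular but not diagonal, and the product of any two of them is
`diag(κ², κ⁻²)`. -/
structure IsTriangular (k : Fin m → List ℤ) (κ : ℂˣ) (e : Fin m → Bool) (b : Fin m → ℂ)
    (f : ∀ i, (rational (k i)).Arc → SL2) : Prop where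
  glued : IsGlued k f
  mul_eq : ∀ i, (rational (k i)).nw.val (f i) * (rational (k i)).ne.val (f i) = uPlus (κ ^ 2) 0
  ne_zero : ∀ i, b i ≠ 0
  nw_eq : ∀ i, (rational (k i)).nw.val (f i) = triMatrix κ (e i) (b i)
  order : (κ : ℂ) ^ 4 ≠ 1

theorem ne_inv_of_pow_ne_one {κ : ℂˣ} (h : (κ : ℂ) ^ 4 ≠ 1) : κ ≠ κ⁻¹ := by
  intro h'
  apply h
  have h1 : (κ : ℂ) * κ = 1 := by
    have := congrArg (fun u : ℂˣ => (u : ℂ) * κ) h'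
    simpa using this
  linear_combination ((κ : ℂ) ^ 2 + 1) * h1

theorem one_add_sq_ne_zero {κ : ℂˣ} (h : (κ : ℂ) ^ 4 ≠ 1) : 1 + (κ : ℂ) ^ 2 ≠ 0 := by
  intro h'
  apply h
  linear_combination ((κ : ℂ) ^ 2 - 1) * h'

theorem one_add_inv_sq_ne_zero {κ : ℂˣ} (h : (κ : ℂ) ^ 4 ≠ 1) : 1 + ((κ : ℂ) ^ 2)⁻¹ ≠ 0 := by
  intro h'
  apply one_add_sq_ne_zero h
  have h0 := κ.ne_zero
  field_simp at h'
  linear_combination h'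

/-- As `κ⁴ ≠ 1`, the only invariant lines of `diag (κ², κ⁻²)` are the two axes; a non-diagonal
triangular matrix of this kind preserves just one of them. -/
theorem eq_of_mem_lineStabilizer {κ : ℂˣ} (h : (κ : ℂ) ^ 4 ≠ 1) {v : Fin 2 → ℂ} (hv : v ≠ 0)
    (hg : uPlus (κ ^ 2) 0 ∈ lineStabilizer v) {b c : ℂ} (hb : b ≠ 0) (hc : c ≠ 0)
    (h1 : uPlus κ b ∈ lineStabilizer v) (h2 : lPlus κ c ∈ lineStabilizer v) : False := by
  rw [mem_lineStabilizer_iff hv] at hg h1 h2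
  simp only [uPlus_00, uPlus_01, uPlus_10, uPlus_11, lPlus_00, lPlus_01, lPlus_10, lPlus_11,
    Units.val_pow_eq_pow_val] at hg h1 h2
  have h0 := κ.ne_zero
  have h3 : ((κ : ℂ) ^ 4 - 1) * (v 0 * v 1) = 0 := by
    field_simp at hg
    linear_combination hg
  rcases mul_eq_zero.1 ((mul_eq_zero.1 h3).resolve_left (sub_ne_zero.2 h)) with h4 | h4
  · rw [h4] at h1
    have : b * v 1 * v 1 = 0 := by linear_combination h1
    have h5 : v 1 = 0 := by simpa [hb] using this
    exact hv (funext fun i => by fin_cases i <;> assumption)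
  · rw [h4] at h2
    have : c * v 0 * v 0 = 0 := by linear_combination -h2
    have h5 : v 0 = 0 := by simpa [hc] using this
    exact hv (funext fun i => by fin_cases i <;> assumption)

namespace IsTriangular

variable {κ : ℂˣ} {e : Fin m → Bool} {b : Fin m → ℂ} {f : ∀ i, (rational (k i)).Arc → SL2}

theorem sw_eq (h : IsTriangular k κ e b f) (i : Fin m) :
    ((rational (k i)).sw.val (f i))⁻¹ = triMatrix κ (e (i + 1)) (b (i + 1)) := by
  rw [← h.nw_eq, (h.glued i).2.1]

theorem irrPair (h : IsTriangular k κ e b f) {i : Fin m} (hi : e i ≠ e (i + 1)) :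
    IrrPair ((rational (k i)).nw.val (f i)) ((genY (k i)).val (f i)) := by
  intro v hv m1 m2
  have hall : ∀ a : Dart (rational (k i)).Arc, a.val (f i) ∈ lineStabilizer v := by
    intro a
    rw [Dart.val_mem_iff] at m1 m2 ⊢
    refine (isFree_rational (k i)).gen _ ((h.glued i).1.isClosed_subgroup (lineStabilizer v)) m1 ?_ _
    unfold genY at m2
    split_ifs at m2 <;> exact m2
  have hg := mul_mem (hall (rational (k i)).nw) (hall (rational (k i)).ne)
  rw [h.mul_eq] at hg
  have h1 := hall (rational (k i)).nw
  rw [h.nw_eq] at h1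
  have h2 := inv_mem (hall (rational (k i)).sw)
  rw [h.sw_eq] at h2
  have b1 := h.ne_zero i
  have b2 := h.ne_zero (i + 1)
  cases he : e i <;> cases he' : e (i + 1) <;> rw [he] at h1 <;> rw [he'] at h2
  · exact hi (he.trans he'.symm)
  · exact eq_of_mem_lineStabilizer h.order hv hg b2 (inv_ne_zero b1) h2 h1
  · exact eq_of_mem_lineStabilizer h.order hv hg b1 (inv_ne_zero b2) h1 h2
  · exact hi (he.trans he'.symm)

theorem conj_diag (h : IsTriangular k κ e b f) (s : ℂˣ) :
    IsTriangular k κ e (fun i => b i / (s : ℂ) ^ 2) (fun i => MulAut.conj (uPlus s 0)⁻¹ ∘ f i) where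
  glued := h.glued.conj _
  mul_eq i := by
    rw [val_conj, val_conj, ← conj_diag_diag s (κ ^ 2), ← h.mul_eq i]
    group
  ne_zero i := div_ne_zero (h.ne_zero i) (pow_ne_zero _ s.ne_zero)
  nw_eq i := by rw [val_conj, h.nw_eq, inv_inv, triMatrix_conj]
  order := h.order

/-- The relation for a tangle with upper triangular ends. -/
theorem upper (hk : ∀ i, k i ≠ []) (h : IsTriangular k κ e b f) {i : Fin m} (h1 : e i = true)
    (h2 : e (i + 1) = true) :
    ∃ c, (genY (k i)).val (f i) = uPlus κ (b i + c) ∧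
      b i * (1 + ((κ : ℂ) ^ 2)⁻¹) = -(c * varthetaNE (k i) κ) ∧ varthetaNE (k i) κ ≠ 0 ∧
      b (i + 1) * varthetaNE (k i) κ =
        b i * (varthetaNE (k i) κ - (1 + ((κ : ℂ) ^ 2)⁻¹) * varthetaSW (k i) κ) ∧
      (redPair (k i) κ).1.1 0 0 = κ ∧ (redPair (k i) κ).2.1 0 0 = κ := by
  obtain ⟨c, e1, e2, e3, -, e5, e6⟩ := upper_ends (hk i) (h.glued i).1 (ne_inv_of_pow_ne_one h.order)
    (b := b i) (b' := b (i + 1)) (by rw [h.nw_eq, h1]; rfl) (by rw [h.sw_eq, h2]; rfl) (h.mul_eq i)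
  refine ⟨c, e1, e2, ?_, ?_, e5, e6⟩
  · intro h0
    rw [h0, mul_zero, neg_zero] at e2
    exact (mul_ne_zero (h.ne_zero i) (one_add_inv_sq_ne_zero h.order)) e2
  · linear_combination varthetaNE (k i) κ * e3 + varthetaSW (k i) κ * e2

/-- The relation for a tangle with lower triangular ends. -/
theorem lower (hk : ∀ i, k i ≠ []) (h : IsTriangular k κ e b f) {i : Fin m} (h1 : e i = false)
    (h2 : e (i + 1) = false) :
    ∃ c, (genY (k i)).val (f i) = lPlus κ ((b i)⁻¹ + c) ∧
      (b i)⁻¹ * (1 + (κ : ℂ) ^ 2) = -(c * varthetaNE (k i) κ⁻¹) ∧ varthetaNE (k i) κ⁻¹ ≠ 0 ∧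
      b i * varthetaNE (k i) κ⁻¹ =
        b (i + 1) * (varthetaNE (k i) κ⁻¹ - (1 + (κ : ℂ) ^ 2) * varthetaSW (k i) κ⁻¹) ∧
      (redPair (k i) κ⁻¹).1.1 0 0 = (κ⁻¹ : ℂˣ) ∧ (redPair (k i) κ⁻¹).2.1 0 0 = (κ⁻¹ : ℂˣ) := by
  obtain ⟨c, e1, e2, e3, -, e5, e6⟩ := lower_ends (hk i) (h.glued i).1 (ne_inv_of_pow_ne_one h.order)
    (b := (b i)⁻¹) (b' := (b (i + 1))⁻¹) (by rw [h.nw_eq, h1]; rfl) (by rw [h.sw_eq, h2]; rfl)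
    (h.mul_eq i)
  refine ⟨c, e1, e2, ?_, ?_, e5, e6⟩
  · intro h0
    rw [h0, mul_zero, neg_zero] at e2
    exact (mul_ne_zero (inv_ne_zero (h.ne_zero i)) (one_add_sq_ne_zero h.order)) e2
  · have hb := h.ne_zero i
    have hb' := h.ne_zero (i + 1)
    have : (b (i + 1))⁻¹ * varthetaNE (k i) κ⁻¹ =
        (b i)⁻¹ * (varthetaNE (k i) κ⁻¹ - (1 + (κ : ℂ) ^ 2) * varthetaSW (k i) κ⁻¹) := by
      linear_combination varthetaNE (k i) κ⁻¹ * e3 + varthetaSW (k i) κ⁻¹ * e2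
    field_simp at this
    linear_combination this

variable {t : ℂ} {r : Fin m → ℂ}

theorem z_eq (hk : ∀ i, k i ≠ []) (h : IsTriangular k κ e b f)
    (ht : ∀ i (a : Dart (rational (k i)).Arc), tr (a.val (f i)) = t)
    (hr : ∀ i, tr ((rational (k i)).nw.val (f i) * (genY (k i)).val (f i)) = r i) (i : Fin m) :
    z (k i) t (r i) + 2 = (κ : ℂ) ^ 2 + ((κ : ℂ) ^ 2)⁻¹ := by
  obtain ⟨e1, -⟩ := tangle_traces (hk i) (h.glued i).1 rfl rfl (h.mul_eq i) (ht i _) (ht i _) (hr i)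
  rw [e1, tr_eq, uPlus_00, uPlus_11, Units.val_pow_eq_pow_val]

/-- For ends of different types the quotient can be read off from the traces: `ż = -b i / b (i + 1)`
and `z̀ = κ² b i / b (i + 1)`. Eliminating the quotient gives the relation between `ż` and `z̀`. -/
theorem mixed_upper (hk : ∀ i, k i ≠ []) (h : IsTriangular k κ e b f)
    (ht : ∀ i (a : Dart (rational (k i)).Arc), tr (a.val (f i)) = t)
    (hr : ∀ i, tr ((rational (k i)).nw.val (f i) * (genY (k i)).val (f i)) = r i) {i : Fin m}
    (h1 : e i = true) (h2 : e (i + 1) = false) :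
    b (i + 1) * zDot (k i) t (r i) = -b i ∧
      (κ : ℂ) ^ 2 * zDot (k i) t (r i) + zGrave (k i) t (r i) = 0 ∧ r i ≠ 2 ∧ r i ≠ t ^ 2 - 2 := by
  obtain ⟨-, e2, e3, -⟩ := tangle_traces (hk i) (h.glued i).1 (h.nw_eq i) (h.sw_eq i) (h.mul_eq i)
    (by rw [← h.nw_eq, ht]) (ht i _) (by rw [← h.nw_eq, hr])
  have hirr := (irrPair_iff (ht i _) (ht i _)).1 (h.irrPair (i := i) (by rw [h1, h2]; decide))
  rw [hr] at hirr
  have h0 := κ.ne_zero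
  have hb' := h.ne_zero (i + 1)
  rw [h1, h2] at e2 e3
  simp only [triMatrix, if_true, Bool.false_eq_true, if_false, tr_eq, mul_00, mul_01, mul_10, mul_11,
    inv_00, inv_01, inv_10, inv_11, uPlus_00, uPlus_01, uPlus_10, uPlus_11, lPlus_00, lPlus_01, lPlus_10,
    lPlus_11, Units.val_pow_eq_pow_val] at e2 e3
  field_simp at e2 e3
  refine ⟨by linear_combination e2, mul_right_cancel₀ (mul_ne_zero hb' (pow_ne_zero 2 h0)) ?_, hirr⟩
  linear_combination (κ : ℂ) ^ 4 * e2 + e3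

theorem mixed_lower (hk : ∀ i, k i ≠ []) (h : IsTriangular k κ e b f)
    (ht : ∀ i (a : Dart (rational (k i)).Arc), tr (a.val (f i)) = t)
    (hr : ∀ i, tr ((rational (k i)).nw.val (f i) * (genY (k i)).val (f i)) = r i) {i : Fin m}
    (h1 : e i = false) (h2 : e (i + 1) = true) :
    b (i + 1) = -(b i * zDot (k i) t (r i)) ∧
      zDot (k i) t (r i) + (κ : ℂ) ^ 2 * zGrave (k i) t (r i) = 0 ∧ r i ≠ 2 ∧ r i ≠ t ^ 2 - 2 := by
  obtain ⟨-, e2, e3, -⟩ := tangle_traces (hk i) (h.glued i).1 (h.nw_eq i) (h.sw_eq i) (h.mul_eq i)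
    (by rw [← h.nw_eq, ht]) (ht i _) (by rw [← h.nw_eq, hr])
  have hirr := (irrPair_iff (ht i _) (ht i _)).1 (h.irrPair (i := i) (by rw [h1, h2]; decide))
  rw [hr] at hirr
  have h0 := κ.ne_zero
  have hb' := h.ne_zero i
  rw [h1, h2] at e2 e3
  simp only [triMatrix, if_true, Bool.false_eq_true, if_false, tr_eq, mul_00, mul_01, mul_10, mul_11,
    inv_00, inv_01, inv_10, inv_11, uPlus_00, uPlus_01, uPlus_10, uPlus_11, lPlus_00, lPlus_01, lPlus_10,
    lPlus_11, Units.val_pow_eq_pow_val] at e2 e3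
  field_simp at e2 e3
  refine ⟨by linear_combination e2, mul_right_cancel₀ hb' ?_, hirr⟩
  linear_combination e2 + e3

/-- The representation is determined by `κ`, the types of the meridians, and the traces. -/
theorem unique (hk : ∀ i, k i ≠ []) {b' : Fin m → ℂ} {f' : ∀ i, (rational (k i)).Arc → SL2}
    (h : IsTriangular k κ e b f) (h' : IsTriangular k κ e b' f') (h0 : b 0 = b' 0)
    (ht : ∀ i (a : Dart (rational (k i)).Arc), tr (a.val (f i)) = t)
    (ht' : ∀ i (a : Dart (rational (k i)).Arc), tr (a.val (f' i)) = t)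
    (hr : ∀ i, tr ((rational (k i)).nw.val (f i) * (genY (k i)).val (f i)) =
      tr ((rational (k i)).nw.val (f' i) * (genY (k i)).val (f' i))) (i : Fin m) : f i = f' i := by
  have step : ∀ i, (rational (k i)).nw.val (f i) = (rational (k i)).nw.val (f' i) → f i = f' i := by
    intro i hi
    have hb : b i = b' i := by
      rw [h.nw_eq, h'.nw_eq] at hi
      cases he : e i
      · rw [he] at hi
        exact inv_injective (congrArg (fun M : SL2 => M.1 1 0) hi)
      · rw [he] at hi
        exact congrArg (fun M : SL2 => M.1 0 1) hi
    by_cases hmix : e i = e (i + 1)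
    -- Ends of the same type: `b i` and `κ` determine the parameter `c`, because `ϑ^ne` does not
    -- vanish.
    · refine coloring_eq_of_generators (h.glued i).1 (h'.glued i).1 hi ?_
      cases he : e i
      · obtain ⟨c, y1, c1, n1, -⟩ := h.lower hk he (hmix ▸ he)
        obtain ⟨c', y2, c2, -⟩ := h'.lower hk he (hmix ▸ he)
        rw [y1, y2, hb]
        congr 2
        rw [hb] at c1
        exact mul_right_cancel₀ n1 (by linear_combination c1 - c2)
      · obtain ⟨c, y1, c1, n1, -⟩ := h.upper hk he (hmix ▸ he)
        obtain ⟨c', y2, c2, -⟩ := h'.upper hk he (hmix ▸ he)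
        rw [y1, y2, hb]
        congr 2
        rw [hb] at c1
        exact mul_right_cancel₀ n1 (by linear_combination c1 - c2)
    · have hne : (rational (k i)).ne.val (f i) = (rational (k i)).ne.val (f' i) := by
        have := (h.mul_eq i).trans (h'.mul_eq i).symm
        rw [hi] at this
        exact mul_left_cancel this
      refine coloring_eq_of_traces (h.glued i).1 (h'.glued i).1 hi hne (h.irrPair hmix) ?_
        (ht i _) (ht i _) (ht' i _) (hr i)
      -- Ends of different types: commuting with `diag (κ², κ⁻²)` makes `P` diagonal, and commuting
      -- with a non-diagonal triangular matrix makes it scalar.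
      intro P c1 c2 M
      have c3 : P * uPlus (κ ^ 2) 0 = uPlus (κ ^ 2) 0 * P := by
        rw [← h.mul_eq i, ← mul_assoc, c1, mul_assoc, c2, mul_assoc]
      have h0 := κ.ne_zero
      have key : ∀ x, ((κ : ℂ) ^ 4 - 1) * x = 0 → x = 0 := fun x hx =>
        (mul_eq_zero.1 hx).resolve_left (sub_ne_zero.2 h.order)
      have p01 : P.1 0 1 = 0 := by
        have := congrArg (fun M : SL2 => M.1 0 1) c3
        simp only [mul_01, uPlus_00, uPlus_01, uPlus_11, Units.val_pow_eq_pow_val] at this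
        field_simp at this
        exact key _ (by linear_combination -this)
      have p10 : P.1 1 0 = 0 := by
        have := congrArg (fun M : SL2 => M.1 1 0) c3
        simp only [mul_10, uPlus_00, uPlus_10, uPlus_11, Units.val_pow_eq_pow_val] at this
        field_simp at this
        exact key _ (by linear_combination this)
      have hdd : P.1 0 0 = P.1 1 1 := by
        rw [h.nw_eq] at c1
        have hb := h.ne_zero i
        cases he : e i
        · rw [he] at c1
          have := congrArg (fun M : SL2 => M.1 1 0) c1
          simp only [triMatrix, Bool.false_eq_true, if_false, mul_10, lPlus_00, lPlus_10, lPlus_11,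
            p10] at this
          refine mul_right_cancel₀ (inv_ne_zero hb) ?_
          linear_combination -this
        · rw [he] at c1
          have := congrArg (fun M : SL2 => M.1 0 1) c1
          simp only [triMatrix, if_true, mul_01, uPlus_00, uPlus_01, uPlus_11, p01] at this
          refine mul_right_cancel₀ hb ?_
          linear_combination this
      have hPM : P * M = M * P := by
        refine SL2.ext' ?_ ?_ ?_ ?_ <;> simp only [mul_00, mul_01, mul_10, mul_11, p01, p10, hdd] <;> ring
      rw [hPM, mul_assoc, mul_inv_cancel, mul_one]
  refine step i ?_
  revert i
  refine fin_cyclic_induction ?_ fun i hi => ?_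
  · rw [h.nw_eq, h'.nw_eq, h0]
  · rw [(h.glued i).2.1, (h'.glued i).2.1, step i hi]

end IsTriangular

end TriangularReps

end Montesinos

end

noncomputable section

namespace Montesinos

/-! ### Normal form of the characters in `X'` -/

section Extraction

open SL2

theorem exists_not_succ {m : ℕ} [NeZero m] {p : Fin m → Prop} {i j : Fin m} (hi : p i) (hj : ¬ p j) :
    ∃ i, p i ∧ ¬ p (i + 1) := by
  by_contra! h
  have := fin_cyclic_induction (p := fun a => p (i + a)) (by rwa [add_zero])
    (fun a ha => by rw [← add_assoc]; exact h _ ha) (j - i)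
  rw [add_sub_cancel] at this
  exact hj this

variable {m : ℕ} [NeZero m] {k : Fin m → List ℤ}

theorem restrict_conjHom (P : SL2) (ρ : (link k).group →* SL2) (i : Fin m) :
    restrict (conjHom P ρ) i = MulAut.conj P ∘ restrict ρ i := rfl

theorem eq_uPlus {κ : ℂˣ} {M : SL2} (h1 : M.1 0 0 = κ) (h2 : M.1 1 1 = (κ : ℂ)⁻¹) (h : M.1 1 0 = 0) :
    M = uPlus κ (M.1 0 1) := SL2.ext' h1 rfl h h2

theorem eq_lPlus {κ : ℂˣ} {M : SL2} (h1 : M.1 0 0 = κ) (h2 : M.1 1 1 = (κ : ℂ)⁻¹) (h : M.1 0 1 = 0) :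
    M = lPlus κ (M.1 1 0) := SL2.ext' h1 h rfl h2

/-- A tangle with diagonal matrices only at the upper ends. -/
theorem diagonal_start {k : List ℤ} (hk : k ≠ []) {f : (rational k).Arc → SL2}
    (hf : (rational k).IsColoring f) {κ : ℂˣ} (hκ : κ ≠ κ⁻¹)
    (h1 : (rational k).nw.val f = uPlus κ 0) {b : ℂ} (hb : b ≠ 0)
    (h2 : ((rational k).sw.val f)⁻¹ = uPlus κ b ∨ ((rational k).sw.val f)⁻¹ = lPlus κ b)
    (h3 : (rational k).nw.val f * (rational k).ne.val f = uPlus (κ ^ 2) 0) :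
    Odd (fracNum k) ∧ ∃ ι : ℤˣ, varthetaNE k (κ ^ (ι : ℤ)) = 0 := by
  rcases h2 with h2 | h2
  · obtain ⟨c, -, e1, e2, hodd, -⟩ := upper_ends hk hf hκ h1 h2 h3
    refine ⟨hodd, 1, ?_⟩
    rw [Units.val_one, zpow_one]
    have hc : c ≠ 0 := by rintro rfl; apply hb; rw [e2]; ring
    exact (mul_eq_zero.1 (by linear_combination e1 : c * varthetaNE k κ = 0)).resolve_left hc
  · obtain ⟨c, -, e1, e2, hodd, -⟩ := lower_ends hk hf hκ (b := 0) (h1.trans rfl) h2 h3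
    refine ⟨hodd, -1, ?_⟩
    rw [Units.val_neg, Units.val_one, zpow_neg_one]
    have hc : c ≠ 0 := by rintro rfl; apply hb; rw [e2]; ring
    exact (mul_eq_zero.1 (by linear_combination e1 : c * varthetaNE k κ⁻¹ = 0)).resolve_left hc

/-- A tangle with diagonal matrices only at the lower ends. -/
theorem diagonal_end {k : List ℤ} (hk : k ≠ []) {f : (rational k).Arc → SL2}
    (hf : (rational k).IsColoring f) {κ : ℂˣ} (hκ : κ ≠ κ⁻¹) {b : ℂ} (hb : b ≠ 0)
    (h1 : (rational k).nw.val f = uPlus κ b ∨ (rational k).nw.val f = lPlus κ b)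
    (h2 : ((rational k).sw.val f)⁻¹ = uPlus κ 0)
    (h3 : (rational k).nw.val f * (rational k).ne.val f = uPlus (κ ^ 2) 0) :
    Odd (fracNum k) ∧ ∃ ε : ℤˣ, varthetaNE k (κ ^ (ε : ℤ)) =
      (1 + (κ : ℂ) ^ (-2 * (ε : ℤ))) * varthetaSW k (κ ^ (ε : ℤ)) := by
  rcases h1 with h1 | h1
  · obtain ⟨c, -, e1, e2, hodd, -⟩ := upper_ends hk hf hκ h1 h2 h3
    refine ⟨hodd, 1, ?_⟩
    rw [Units.val_one, zpow_one, mul_one, zpow_neg, zpow_ofNat]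
    have hc : c ≠ 0 := by rintro rfl; apply hb; linear_combination -e2
    refine mul_left_cancel₀ hc ?_
    change c * _ = c * ((1 + ((κ : ℂ) ^ 2)⁻¹) * _)
    linear_combination (1 + ((κ : ℂ) ^ 2)⁻¹) * e2 + e1
  · obtain ⟨c, -, e1, e2, hodd, -⟩ := lower_ends hk hf hκ (b' := 0) h1 (h2.trans rfl) h3
    refine ⟨hodd, -1, ?_⟩
    rw [Units.val_neg, Units.val_one, zpow_neg_one, neg_mul_neg, mul_one, zpow_ofNat]
    have hc : c ≠ 0 := by rintro rfl; apply hb; linear_combination -e2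
    refine mul_left_cancel₀ hc ?_
    linear_combination (1 + (κ : ℂ) ^ 2) * e2 + e1

/-- If `κ` is an eigenvalue of a meridian, then `τ = t² - 2` says that `κ²` is an eigenvalue of `g`,
and `τ ≠ ±2` says that `κ⁴ ≠ 1`. So `g` can be made diagonal, and `diag_entries` gives the diagonals
of the meridians. -/
theorem exists_normalized (hk : ∀ i, k i ≠ []) (hK : (link k).IsKnot) {χ : (link k).group → ℂ}
    (hχ : χ ∈ X' k) : ∃ (ρ : (link k).group →* SL2) (κ : ℂˣ), ¬ IsReducible ρ ∧ character ρ = χ ∧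
      (κ : ℂ) ^ 4 ≠ 1 ∧ tCoord k χ = κ + (κ : ℂ)⁻¹ ∧
      (∀ i, (rational (k i)).nw.val (restrict ρ i) * (rational (k i)).ne.val (restrict ρ i) =
        uPlus (κ ^ 2) 0) ∧
      ∀ i, ((rational (k i)).nw.val (restrict ρ i)).1 0 0 = κ ∧
        ((rational (k i)).nw.val (restrict ρ i)).1 1 1 = (κ : ℂ)⁻¹ := by
  obtain ⟨⟨ρ, hirr, rfl⟩, ht, hτ, hτ1, hτ2⟩ := hχ
  obtain ⟨κ, hκt⟩ := exists_add_inv_eq (tCoord k (character ρ))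
  have h0 := κ.ne_zero
  have hτκ : tauCoord k (character ρ) = (κ : ℂ) ^ 2 + ((κ : ℂ) ^ 2)⁻¹ := by
    rw [hτ, hκt]; field_simp; ring
  have hord : (κ : ℂ) ^ 4 ≠ 1 := by
    intro h
    have : ((κ : ℂ) ^ 2 - 1) * ((κ : ℂ) ^ 2 + 1) = 0 := by linear_combination h
    rcases mul_eq_zero.1 this with h | h
    · apply hτ1; rw [hτκ, sub_eq_zero.1 h]; norm_num
    · apply hτ2; rw [hτκ, eq_neg_of_add_eq_zero_left h]; norm_num
  have hl : κ ^ 2 ≠ (κ ^ 2)⁻¹ := by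
    intro h
    apply hord
    have : κ ^ 2 * κ ^ 2 = 1 := by nth_rewrite 1 [h]; rw [inv_mul_cancel]
    have := congrArg Units.val this
    push_cast at this
    linear_combination this
  obtain ⟨P, hP⟩ := exists_conj_diag (l := κ ^ 2) (M := (rational (k 0)).nw.val (restrict ρ 0) *
    (rational (k 0)).ne.val (restrict ρ 0)) (by
    rw [← tauCoord_eq, hτκ, Units.val_pow_eq_pow_val]) hl
  set ρ' := conjHom P⁻¹ ρ with hρ'
  have hchar : character ρ' = character ρ := character_conjHom _ _
  have hmul : ∀ i, (rational (k i)).nw.val (restrict ρ' i) * (rational (k i)).ne.val (restrict ρ' i) =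
      uPlus (κ ^ 2) 0 := by
    intro i
    rw [(isGlued_restrict ρ').mul_eq i, hρ', restrict_conjHom, val_conj, val_conj, ← hP]
    group
  refine ⟨ρ', κ, by rwa [isReducible_conjHom], hchar, hord, hκt, hmul, fun i => ?_⟩
  obtain ⟨-, -, -, -, h5, -⟩ := tangle_traces (hk i) (isGlued_restrict ρ' i).1 rfl rfl (hmul i)
    (tr_val_eq hK ρ' i _) (tr_val_eq hK ρ' i _) rfl
  obtain ⟨e1, e2⟩ := diag_entries hl (tr_val_eq hK ρ' i _) h5
  rw [hchar, hκt, Units.val_pow_eq_pow_val] at e1 e2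
  have h1 : (κ : ℂ) ^ 2 + 1 ≠ 0 := by rw [add_comm]; exact one_add_sq_ne_zero hord
  constructor
  · refine mul_left_cancel₀ h1 (e2.trans ?_)
    field_simp
  · refine mul_left_cancel₀ h1 (e1.trans ?_)
    field_simp

/-- The diagonal `κ, κ⁻¹` and the determinant make one off-diagonal entry of each `A i` vanish. If
all `A i` were diagonal, the representation would be reducible. If only some were, the cycle would
contain a tangle that leaves the diagonal matrices and another one that returns to them, and these
satisfy the two equations that the generic condition excludes. -/
theorem exists_isTriangular {q : Fin m → ℚ} (hq : ∀ i, HasFraction (k i) (q i))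
    (hK : (link k).IsKnot) (hgen : IsGeneric k q) {χ : (link k).group → ℂ} (hχ : χ ∈ X' k) :
    ∃ (ρ : (link k).group →* SL2) (κ : ℂˣ) (e : Fin m → Bool) (b : Fin m → ℂ),
      IsTriangular k κ e b (restrict ρ) ∧ character ρ = χ ∧ tCoord k χ = κ + (κ : ℂ)⁻¹ ∧ b 0 = 1 := by
  have hk : ∀ i, k i ≠ [] := fun i => (hq i).ne_nil
  obtain ⟨ρ, κ, hirr, hchar, hord, ht, hmul, hdiag⟩ := exists_normalized hk hK hχ
  set A : Fin m → SL2 := fun i => (rational (k i)).nw.val (restrict ρ i) with hA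
  have hG := isGlued_restrict ρ
  have hsw : ∀ i, ((rational (k i)).sw.val (restrict ρ i))⁻¹ = A (i + 1) := fun i => (hG i).2.1.symm
  have hκ := ne_inv_of_pow_ne_one hord
  have hzero : ∀ i, (A i).1 0 1 = 0 ∨ (A i).1 1 0 = 0 := by
    intro i
    have := det_eq (A i)
    rw [(hdiag i).1, (hdiag i).2, mul_inv_cancel₀ κ.ne_zero] at this
    exact mul_eq_zero.1 (by linear_combination -this)
  have htri : ∀ i, ¬ ((A i).1 0 1 = 0 ∧ (A i).1 1 0 = 0) →
      ∃ b, b ≠ 0 ∧ (A i = uPlus κ b ∨ A i = lPlus κ b) := by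
    intro i hi
    by_cases h : (A i).1 1 0 = 0
    · exact ⟨_, fun h' => hi ⟨h', h⟩, Or.inl (eq_uPlus (hdiag i).1 (hdiag i).2 h)⟩
    · exact ⟨_, h, Or.inr (eq_lPlus (hdiag i).1 (hdiag i).2 ((hzero i).resolve_right h))⟩
  have hnd : ∀ i, ¬ ((A i).1 0 1 = 0 ∧ (A i).1 1 0 = 0) := by
    intro i₀ hi₀
    have hex : ∃ j, ¬ ((A j).1 0 1 = 0 ∧ (A j).1 1 0 = 0) := by
      by_contra! h
      refine hirr (isReducible_of_ends_mem hk (v := ![1, 0]) (by simp) (fun i => ?_) ?_)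
      · exact mem_lineStabilizer_e₁.2 (h i).2
      · rw [hmul]; exact uPlus_mem _ _
    obtain ⟨j₀, hj₀⟩ := hex
    obtain ⟨i, hi, hi'⟩ := exists_not_succ (p := fun i => (A i).1 0 1 = 0 ∧ (A i).1 1 0 = 0) hi₀ hj₀
    obtain ⟨j, hj, hj'⟩ := exists_not_succ (p := fun i => ¬ ((A i).1 0 1 = 0 ∧ (A i).1 1 0 = 0))
      hj₀ (not_not.2 hi₀)
    have hdiag_eq : ∀ i, (A i).1 0 1 = 0 ∧ (A i).1 1 0 = 0 → A i = uPlus κ 0 := fun i h =>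
      (eq_uPlus (hdiag i).1 (hdiag i).2 h.2).trans (congrArg (uPlus κ) h.1)
    obtain ⟨b, hb, hb'⟩ := htri _ hi'
    obtain ⟨c, hc, hc'⟩ := htri _ hj
    obtain ⟨o1, ι, e1⟩ := diagonal_start (hk i) (hG i).1 hκ (hdiag_eq i hi) hb
      (by rwa [hsw]) (hmul i)
    obtain ⟨o2, ε, e2⟩ := diagonal_end (hk j) (hG j).1 hκ hc hc'
      (by rw [hsw]; exact hdiag_eq _ (not_not.1 hj')) (hmul j)
    exact hgen i j (by rintro rfl; exact hj hi) ((hq i).odd_num_iff.2 o1) ((hq j).odd_num_iff.2 o2)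
      ι ε κ hord ⟨e1, e2⟩
  have hex : ∀ i, ∃ (e : Bool) (b : ℂ), b ≠ 0 ∧ A i = triMatrix κ e b := by
    intro i
    obtain ⟨b, hb, h | h⟩ := htri i (hnd i)
    · exact ⟨true, b, hb, h⟩
    · exact ⟨false, b⁻¹, inv_ne_zero hb, by rw [h, triMatrix, inv_inv]; rfl⟩
  choose e b hb hAb using hex
  have hT : IsTriangular k κ e b (restrict ρ) := ⟨hG, hmul, hb, hAb, hord⟩
  obtain ⟨s, hs⟩ := exists_unit_sq (b 0) (hb 0)
  refine ⟨conjHom (uPlus s 0)⁻¹ ρ, κ, e, _, hT.conj_diag s, ?_, ht, ?_⟩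
  · rw [character_conjHom, hchar]
  · rw [hs, div_self (hb 0)]

end Extraction

end Montesinos

end

noncomputable section

namespace Montesinos

/-! ### The reducible representations near a fourth root of unity -/

section Expansion

open SL2

/-- The Laurent polynomial functions. -/
def laurentFunctions : Subalgebra ℂ (ℂˣ → ℂ) :=
  Algebra.adjoin ℂ {fun κ : ℂˣ => (κ : ℂ), fun κ : ℂˣ => (κ : ℂ)⁻¹}

/-- A family of upper triangular matrices, given up to sign and modulo `κ² + 1` by its upper right
entry. -/
def HasExpansion (M : ℂˣ → SL2) (σ : ℤˣ) (n : ℤ) : Prop :=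
  ∃ f : laurentFunctions, ∀ κ : ℂˣ, (M κ).1 0 0 = ((κ ^ (σ : ℤ) : ℂˣ) : ℂ) ∧ (M κ).1 1 0 = 0 ∧
    (M κ).1 1 1 = ((κ ^ (-(σ : ℤ)) : ℂˣ) : ℂ) ∧
    (M κ).1 0 1 = (σ : ℤ) * n + ((κ : ℂ) ^ 2 + 1) * f.1 κ

theorem HasExpansion.congr {M : ℂˣ → SL2} {σ : ℤˣ} {n n' : ℤ} (h : HasExpansion M σ n) (hn : n = n') :
    HasExpansion M σ n' := hn ▸ h

theorem HasExpansion.inv {M : ℂˣ → SL2} {σ : ℤˣ} {n : ℤ} (h : HasExpansion M σ n) :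
    HasExpansion (fun κ => (M κ)⁻¹) (-σ) n := by
  obtain ⟨f, h⟩ := h
  refine ⟨-f, fun κ => ?_⟩
  obtain ⟨h1, h2, h3, h4⟩ := h κ
  rw [inv_00, inv_01, inv_10, inv_11, h1, h2, h3, h4, Units.val_neg, neg_neg]
  refine ⟨rfl, neg_zero, rfl, ?_⟩
  change _ = _ + _ * -(f.1 κ)
  push_cast; ring

/-- Modulo `κ² + 1` the squares `κ^{±2}` are `-1`. Hence conjugation acts on the entries, normalized
by the signs, as the reflection `n' ↦ 2 n - n'`. The witnesses in the four cases of signs are the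
exact quotients by `κ² + 1`. -/
theorem HasExpansion.conj {M N : ℂˣ → SL2} {σ σ' : ℤˣ} {n n' : ℤ} (h : HasExpansion M σ n)
    (h' : HasExpansion N σ' n') :
    HasExpansion (fun κ => M κ * N κ * (M κ)⁻¹) σ' (2 * n - n') := by
  obtain ⟨f, h⟩ := h
  obtain ⟨g, h'⟩ := h'
  let x : laurentFunctions := ⟨_, Algebra.subset_adjoin (Or.inl rfl)⟩
  let y : laurentFunctions := ⟨_, Algebra.subset_adjoin (Or.inr rfl)⟩
  have hx : ∀ κ, x.1 κ = κ := fun _ => rfl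
  have hy : ∀ κ, y.1 κ = (κ : ℂ)⁻¹ := fun _ => rfl
  have hint : ∀ (n : ℤ) κ, (n : laurentFunctions).1 κ = n := fun n κ => by simp
  have hpow : ∀ (x : laurentFunctions) (n : ℕ) κ, (x ^ n).1 κ = x.1 κ ^ n := fun _ _ _ => rfl
  have hadd : ∀ (x y : laurentFunctions) κ, (x + y).1 κ = x.1 κ + y.1 κ := fun _ _ _ => rfl
  have hsub : ∀ (x y : laurentFunctions) κ, (x - y).1 κ = x.1 κ - y.1 κ := fun _ _ _ => rfl
  have hmul : ∀ (x y : laurentFunctions) κ, (x * y).1 κ = x.1 κ * y.1 κ := fun _ _ _ => rfl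
  have hone : ∀ κ, (1 : laurentFunctions).1 κ = 1 := fun _ => rfl
  have diag : ∀ κ, (M κ * N κ * (M κ)⁻¹).1 0 0 = ((κ ^ (σ' : ℤ) : ℂˣ) : ℂ) ∧
      (M κ * N κ * (M κ)⁻¹).1 1 0 = 0 ∧
      (M κ * N κ * (M κ)⁻¹).1 1 1 = ((κ ^ (-(σ' : ℤ)) : ℂˣ) : ℂ) ∧
      (M κ * N κ * (M κ)⁻¹).1 0 1 = (M κ).1 0 0 ^ 2 * (N κ).1 0 1 - (M κ).1 0 0 * (N κ).1 0 0 *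
        (M κ).1 0 1 + (M κ).1 0 0 * (N κ).1 1 1 * (M κ).1 0 1 := by
    intro κ
    have hd := det_eq (M κ)
    obtain ⟨h1, h2, h3, h4⟩ := h κ
    obtain ⟨h1', h2', h3', h4'⟩ := h' κ
    rw [← h1', ← h3']
    simp only [mul_00, mul_01, mul_10, mul_11, inv_00, inv_01, inv_10, inv_11]
    rw [h2, mul_zero, sub_zero] at hd
    rw [h2, h2']
    refine ⟨?_, ?_, ?_, ?_⟩
    · linear_combination (N κ).1 0 0 * hd
    · ring
    · linear_combination (N κ).1 1 1 * hd
    · ring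
  set s : laurentFunctions := ((σ : ℤ) * n : ℤ) + (x ^ 2 + 1) * f with hs
  set s' : laurentFunctions := ((σ' : ℤ) * n' : ℤ) + (x ^ 2 + 1) * g with hs'
  have fin : ∀ F : laurentFunctions, (∀ κ : ℂˣ, (M κ).1 0 0 ^ 2 * (N κ).1 0 1 -
      (M κ).1 0 0 * (N κ).1 0 0 * (M κ).1 0 1 + (M κ).1 0 0 * (N κ).1 1 1 * (M κ).1 0 1 =
        (σ' : ℤ) * (2 * n - n' : ℤ) + ((κ : ℂ) ^ 2 + 1) * F.1 κ) →
      HasExpansion (fun κ => M κ * N κ * (M κ)⁻¹) σ' (2 * n - n') := fun F hF =>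
    ⟨F, fun κ => ⟨(diag κ).1, (diag κ).2.1, (diag κ).2.2.1, (diag κ).2.2.2.trans (hF κ)⟩⟩
  rcases Int.units_eq_one_or σ with hσ | hσ <;> rcases Int.units_eq_one_or σ' with hσ' | hσ'
  · refine fin (2 * f - g + s' - s) fun κ => ?_
    have h0 := κ.ne_zero
    rw [(h κ).1, (h κ).2.2.2, (h' κ).1, (h' κ).2.2.1, (h' κ).2.2.2, hs, hs', hσ, hσ']
    have h2 : (2 : laurentFunctions) = ((2 : ℤ) : laurentFunctions) := by norm_num
    simp only [hadd, hsub, hmul, h2, hint, hpow, hone, hx, Units.val_one, zpow_one, zpow_neg,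
      Units.val_inv_eq_inv_val]
    push_cast
    field_simp
    ring
  · refine fin (s + s' - 2 * f - g) fun κ => ?_
    have h0 := κ.ne_zero
    rw [(h κ).1, (h κ).2.2.2, (h' κ).1, (h' κ).2.2.1, (h' κ).2.2.2, hs, hs', hσ, hσ']
    have h2 : (2 : laurentFunctions) = ((2 : ℤ) : laurentFunctions) := by norm_num
    simp only [hadd, hsub, hmul, h2, hint, hpow, hone, hx, Units.val_one, Units.val_neg, neg_neg,
      zpow_one, zpow_neg, Units.val_inv_eq_inv_val]
    push_cast
    field_simp
    ring
  · refine fin (y ^ 2 * (s + s') - 2 * f - g) fun κ => ?_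
    have h0 := κ.ne_zero
    rw [(h κ).1, (h κ).2.2.2, (h' κ).1, (h' κ).2.2.1, (h' κ).2.2.2, hs, hs', hσ, hσ']
    have h2 : (2 : laurentFunctions) = ((2 : ℤ) : laurentFunctions) := by norm_num
    simp only [hadd, hsub, hmul, h2, hint, hpow, hone, hx, hy, Units.val_one, Units.val_neg,
      zpow_one, zpow_neg, Units.val_inv_eq_inv_val]
    push_cast
    field_simp
    ring
  · refine fin (y ^ 2 * (s' - s) + 2 * f - g) fun κ => ?_
    have h0 := κ.ne_zero
    rw [(h κ).1, (h κ).2.2.2, (h' κ).1, (h' κ).2.2.1, (h' κ).2.2.2, hs, hs', hσ, hσ']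
    have h2 : (2 : laurentFunctions) = ((2 : ℤ) : laurentFunctions) := by norm_num
    simp only [hadd, hsub, hmul, h2, hint, hpow, hone, hx, hy, Units.val_one, Units.val_neg, neg_neg,
      zpow_one, zpow_neg, Units.val_inv_eq_inv_val]
    push_cast
    field_simp
    ring

theorem hasExpansion_twist {u w : ℂˣ → SL2} {x y : ℤ} (hu : ∃ σ, HasExpansion u σ x)
    (hw : ∃ σ, HasExpansion w σ y) (n : ℤ) :
    (∃ σ, HasExpansion (fun κ => ((twist ^ n) (u κ, w κ)).1) σ (x + n * (x - y))) ∧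
      ∃ σ, HasExpansion (fun κ => ((twist ^ n) (u κ, w κ)).2) σ (y + n * (x - y)) := by
  induction n using Int.induction_on with
  | zero => simpa using ⟨hu, hw⟩
  | succ n ih =>
    obtain ⟨⟨σ, h1⟩, σ', h2⟩ := ih
    have e : ∀ κ, (twist ^ ((n : ℤ) + 1)) (u κ, w κ) = twist ((twist ^ (n : ℤ)) (u κ, w κ)) := fun κ => by
      rw [add_comm, zpow_one_add]; rfl
    simp only [e]
    refine ⟨⟨σ', ?_⟩, σ, ?_⟩
    · exact (h1.conj h2).congr (by ring)
    · exact h1.congr (by ring)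
  | pred n ih =>
    obtain ⟨⟨σ, h1⟩, σ', h2⟩ := ih
    have e : ∀ κ, (twist ^ (-(n : ℤ) - 1)) (u κ, w κ) =
        (twist ^ (-1 : ℤ)) ((twist ^ (-(n : ℤ))) (u κ, w κ)) := fun κ => by
      rw [sub_eq_neg_add, zpow_add]; rfl
    simp only [e, Tangle.twist_zpow_neg_one]
    refine ⟨⟨σ', ?_⟩, σ, ?_⟩
    · exact h2.congr (by ring)
    · have := h2.inv.conj h1
      simp only [inv_inv] at this
      exact this.congr (by ring)

/-- Reflections make a block of twists act linearly on the normalized entries, which thus follow the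
convergents up to a common sign `η` that changes with each block. -/
theorem hasExpansion_tangleRec (l : List ℤ) : ∀ (η : ℤˣ) (a b : ℤ) (u v w : ℂˣ → SL2),
    (∃ σ, HasExpansion u σ (η * b)) → (∃ σ, HasExpansion v σ (-η * a)) →
    (∃ σ, HasExpansion w σ (η * (b - a))) → ∃ η' : ℤˣ,
      (∃ σ, HasExpansion (fun κ => (tangleRec (u κ) (v κ) (w κ) l).1) σ
        (η' * (fracRec a b l).2)) ∧
      ∃ σ, HasExpansion (fun κ => (tangleRec (u κ) (v κ) (w κ) l).2) σ
        (-η' * (fracRec a b l).1) := by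
  induction l with
  | nil => intro η a b u v w hu hv hw; exact ⟨η, hu, hv⟩
  | cons k l ih =>
    intro η a b u v w hu hv hw
    obtain ⟨h1, σ, h2⟩ := hasExpansion_twist hu hw k
    refine ih (-η) (k * a + b) a v _ _ ?_ ?_ ?_
    · simpa using hv
    · obtain ⟨σ, h1⟩ := h1
      exact ⟨σ, h1.congr (by push_cast; ring)⟩
    · refine ⟨-σ, ?_⟩
      exact h2.inv.congr (by push_cast; ring)

theorem hasExpansion_uPlus (n : ℤ) : HasExpansion (fun κ => uPlus κ n) 1 n := by
  refine ⟨0, fun κ => ⟨?_, rfl, ?_, ?_⟩⟩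
  · simp [uPlus_00]
  · simp [uPlus_11]
  · rw [uPlus_01]; simp

/-- Modulo `κ² + 1`, the ratio of the entries `ϑ` is the inverse of the fraction. -/
theorem vartheta_expansion (k : List ℤ) : ∃ (η σ σ' : ℤˣ) (f g : laurentFunctions), ∀ κ : ℂˣ,
    (redPair k κ).1.1 0 0 = ((κ ^ (σ : ℤ) : ℂˣ) : ℂ) ∧
    (redPair k κ).2.1 0 0 = ((κ ^ (σ' : ℤ) : ℂˣ) : ℂ) ∧
    varthetaSW k κ = (σ : ℤ) * (η * fracDen k : ℤ) + ((κ : ℂ) ^ 2 + 1) * f.1 κ ∧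
    varthetaNE k κ = (σ' : ℤ) * (-η * fracNum k : ℤ) + ((κ : ℂ) ^ 2 + 1) * g.1 κ := by
  have h0 : HasExpansion (fun κ => uPlus κ 0) 1 0 := by simpa using hasExpansion_uPlus 0
  have h1 : HasExpansion (fun κ => uPlus κ 1) 1 1 := by simpa using hasExpansion_uPlus 1
  have hx : ∃ σ, HasExpansion (fun κ => if Even k.length then uPlus κ 0 else (uPlus κ 0)⁻¹) σ 0 := by
    split_ifs
    exacts [⟨_, h0⟩, ⟨_, h0.inv⟩]
  have hy : ∃ σ, HasExpansion (fun κ => open Classical in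
      if GenSignPos k then uPlus κ 1 else (uPlus κ 1)⁻¹) σ 1 := by
    split_ifs
    exacts [⟨_, h1⟩, ⟨_, h1.inv⟩]
  obtain ⟨η, ⟨σ, f, hf⟩, σ', g, hg⟩ := hasExpansion_tangleRec k (-1) 1 0 _ _ _ (by simpa using hx)
    (by simpa using hy) (by simpa using hy)
  exact ⟨η, σ, σ', f, g, fun κ => ⟨(hf κ).1, (hg κ).1, (hf κ).2.2.2, (hg κ).2.2.2⟩⟩

/-- The expansion of the entries `ϑ`, with the signs in the case that matters. -/
theorem exists_vartheta_expansion {k : List ℤ} {κ₀ : ℂˣ} (hκ : κ₀ ≠ κ₀⁻¹)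
    (h1 : (redPair k κ₀).1.1 0 0 = κ₀) (h2 : (redPair k κ₀).2.1 0 0 = κ₀) :
    ∃ (η : ℤˣ) (f g : laurentFunctions), ∀ κ : ℂˣ,
    varthetaSW k κ = (η * fracDen k : ℤ) + ((κ : ℂ) ^ 2 + 1) * f.1 κ ∧
    varthetaNE k κ = (-η * fracNum k : ℤ) + ((κ : ℂ) ^ 2 + 1) * g.1 κ := by
  obtain ⟨η, σ, σ', f, g, h⟩ := vartheta_expansion k
  have key : ∀ σ : ℤˣ, (κ₀ : ℂ) = ((κ₀ ^ (σ : ℤ) : ℂˣ) : ℂ) → σ = 1 := by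
    intro σ hσ
    rcases Int.units_eq_one_or σ with rfl | rfl
    · rfl
    · exact absurd (Units.ext (by simpa using hσ)) hκ
  have s1 := key σ (h1.symm.trans (h κ₀).1)
  have s2 := key σ' (h2.symm.trans (h κ₀).2.1)
  subst s1 s2
  refine ⟨η, f, g, fun κ => ?_⟩
  simpa using (h κ).2.2

end Expansion
end Montesinos

end

noncomputable section

namespace Montesinos

/-! ### First order expansions in a local ring -/

section Jets

open IsLocalRing

theorem chebyshev_C_eval (y : ℂˣ) (n : ℤ) : (Polynomial.Chebyshev.C ℂ n).eval ((y : ℂ) + (y : ℂ)⁻¹) =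
    (y : ℂ) ^ n + ((y : ℂ) ^ n)⁻¹ := by
  have h0 := y.ne_zero
  induction n using Polynomial.Chebyshev.induct with
  | zero => simp; norm_num
  | one => simp
  | add_two n h1 h2 =>
    rw [Polynomial.Chebyshev.C_add_two, Polynomial.eval_sub, Polynomial.eval_mul, Polynomial.eval_X,
      h1, h2, show (n : ℤ) + 2 = n + 1 + 1 by ring]
    simp only [zpow_add₀ h0, zpow_one]
    field_simp
    ring
  | neg_add_one n h1 h2 =>
    rw [Polynomial.Chebyshev.C_sub_one, Polynomial.eval_sub, Polynomial.eval_mul, Polynomial.eval_X,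
      h1, h2]
    simp only [zpow_add₀ h0, zpow_sub₀ h0, zpow_neg, zpow_one]
    field_simp
    ring

/-- The derivative of `C n` at `2 ω` is `n` times the value of `U (n - 1)` at `ω = ±1`, which is
`±n² ≠ 0`. -/
theorem chebyshev_C_derivative_ne_zero {n : ℤ} (hn : n ≠ 0) {ω : ℂ} (hω : ω = 1 ∨ ω = -1) :
    (Polynomial.derivative (Polynomial.Chebyshev.C ℂ n)).eval (2 * ω) ≠ 0 := by
  have h1 := congrArg (fun f => (Polynomial.derivative f).eval ω)
    (Polynomial.Chebyshev.C_comp_two_mul_X ℂ n)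
  have h2 : (2 : Polynomial ℂ) = Polynomial.C 2 := rfl
  simp only [Polynomial.derivative_comp, Polynomial.eval_mul, Polynomial.eval_comp, h2,
    Polynomial.derivative_mul, Polynomial.derivative_C, Polynomial.derivative_X,
    Polynomial.eval_C, Polynomial.eval_X, zero_mul, zero_add,
    Polynomial.eval_intCast, mul_one, Polynomial.Chebyshev.T_derivative_eq_U] at h1
  have hn' : (n : ℂ) ≠ 0 := Int.cast_ne_zero.2 hn
  have h3 : (Polynomial.Chebyshev.U ℂ (n - 1)).eval ω ≠ 0 := by
    rcases hω with rfl | rfl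
    · rw [Polynomial.Chebyshev.U_eval_one]; simpa using hn'
    · rw [Polynomial.Chebyshev.U_eval_neg_one]
      refine mul_ne_zero ?_ (by simpa using hn')
      exact_mod_cast (n - 1).negOnePow.ne_zero
  intro h
  rw [h] at h1
  simp [hn', h3] at h1

/-- At trace zero, the trace polynomial has simple critical values. -/
theorem traceTriple_derivative_ne_zero {k : List ℤ} (hk : k ≠ []) (hp : fracNum k ≠ 0) {ω : ℂ}
    (hω : ω = 1 ∨ ω = -1) :
    (Polynomial.derivative (traceTriple (0 : Polynomial ℂ) Polynomial.X k).1).eval (-2 * ω) ≠ 0 := by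
  have hs : ((-1 : ℂ) ^ fracNum' k = 1 ∨ (-1 : ℂ) ^ fracNum' k = -1) := by
    rcases Int.even_or_odd (fracNum' k) with h | h
    · exact Or.inl h.neg_one_zpow
    · exact Or.inr h.neg_one_zpow
  set s : ℂ := (-1 : ℂ) ^ fracNum' k
  have hs2 : s⁻¹ = s := by rcases hs with h | h <;> rw [h] <;> norm_num
  have hs0 : s ≠ 0 := by rcases hs with h | h <;> rw [h] <;> norm_num
  have key : (traceTriple (0 : Polynomial ℂ) Polynomial.X k).1 =
      Polynomial.C (-s) * (Polynomial.Chebyshev.C ℂ (fracNum k)).comp (-Polynomial.X) := by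
    refine Polynomial.funext fun x => ?_
    obtain ⟨y, hy⟩ := exists_add_inv_eq (-x)
    have h1 := map_traceTriple (Polynomial.aeval x) (0 : Polynomial ℂ) Polynomial.X k
    have h2 := traceTriple_units hk y
    rw [map_zero, Polynomial.aeval_X] at h1
    rw [← Polynomial.coe_aeval_eq_eval]
    have h3 : x = -unitTrace y := by
      rw [unitTrace, Units.val_inv_eq_inv_val, ← hy, neg_neg]
    rw [← h3] at h2
    have h4 := congrArg Prod.fst (h1.symm.trans h2)
    refine h4.trans ?_
    rw [Polynomial.coe_aeval_eq_eval, Polynomial.eval_mul, Polynomial.eval_comp, Polynomial.eval_neg,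
      Polynomial.eval_X, Polynomial.eval_C, hy, chebyshev_C_eval]
    simp only [unitTrace, Units.val_mul, Units.val_inv_eq_inv_val, Units.val_zpow_eq_zpow_val,
      Units.val_neg, Units.val_one, mul_inv_rev]
    change -(_ * s + s⁻¹ * _) = _
    rw [hs2]; ring
  rw [key, Polynomial.derivative_C_mul, Polynomial.derivative_comp]
  simp only [Polynomial.eval_mul, Polynomial.eval_comp, Polynomial.derivative_neg,
    Polynomial.derivative_X, Polynomial.eval_neg, Polynomial.eval_X, Polynomial.eval_C,
    Polynomial.eval_one]
  have h5 := chebyshev_C_derivative_ne_zero hp hω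
  rw [show -(-2 * ω) = 2 * ω by ring]
  simp [hs0, h5]

variable {V : Type} [CommRing V] [Algebra ℂ V]

/-- `x = c (1 + s δ)` up to second order in `δ`. -/
def HasJet (δ x : V) (c : ℂ) (s : V) : Prop := ∃ y, x = algebraMap ℂ V c * (1 + s * δ) + δ ^ 2 * y

namespace HasJet

variable {δ x x' s s' : V} {c c' : ℂ}

theorem mul (h : HasJet δ x c s) (h' : HasJet δ x' c' s') : HasJet δ (x * x') (c * c') (s + s') := by
  obtain ⟨y, rfl⟩ := h
  obtain ⟨y', rfl⟩ := h'
  refine ⟨algebraMap ℂ V c * algebraMap ℂ V c' * s * s' + algebraMap ℂ V c * (1 + s * δ) * y' +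
    y * algebraMap ℂ V c' * (1 + s' * δ) + δ ^ 2 * y * y', ?_⟩
  rw [map_mul]; ring

theorem one : HasJet δ 1 1 (0 : V) := ⟨0, by simp⟩

theorem inv (h : HasJet δ x c s) (hc : c ≠ 0) (hx : x * x' = 1) : HasJet δ x' c⁻¹ (-s) := by
  obtain ⟨y, hy⟩ := h
  have hc' : algebraMap ℂ V c⁻¹ * algebraMap ℂ V c = 1 := by
    rw [← map_mul, inv_mul_cancel₀ hc, map_one]
  refine ⟨s ^ 2 * x' - algebraMap ℂ V c⁻¹ * (1 - s * δ) * y * x', ?_⟩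
  rw [hy] at hx
  linear_combination (-(1 - s ^ 2 * δ ^ 2) * x') * hc' + algebraMap ℂ V c⁻¹ * (1 - s * δ) * hx

theorem congr (h : HasJet δ x c s) (hs : ∃ y, s = s' + δ * y) : HasJet δ x c s' := by
  obtain ⟨y, rfl⟩ := h
  obtain ⟨w, rfl⟩ := hs
  exact ⟨y + algebraMap ℂ V c * w, by ring⟩

theorem zpow {x : Vˣ} (h : HasJet δ (x : V) c s) (hc : c ≠ 0) (n : ℤ) :
    HasJet δ ((x ^ n : Vˣ) : V) (c ^ n) (n * s) := by
  induction n using Int.induction_on with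
  | zero => simpa using HasJet.one
  | succ n ih =>
    have := ih.mul h
    rw [zpow_add_one, zpow_add_one₀ hc, Units.val_mul]
    exact this.congr ⟨0, by push_cast; ring⟩
  | pred n ih =>
    have := ih.mul (h.inv hc (x' := ((x⁻¹ : Vˣ) : V)) (by simp))
    rw [zpow_sub_one, zpow_sub_one₀ hc, Units.val_mul]
    exact this.congr ⟨0, by push_cast; ring⟩

theorem prod {ι : Type*} (S : Finset ι) {x : ι → V} {c : ι → ℂ} {s : ι → V}
    (h : ∀ i ∈ S, HasJet δ (x i) (c i) (s i)) :
    HasJet δ (∏ i ∈ S, x i) (∏ i ∈ S, c i) (∑ i ∈ S, s i) := by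
  classical
  induction S using Finset.induction_on with
  | empty => simpa using HasJet.one
  | insert i S hi ih =>
    rw [Finset.prod_insert hi, Finset.prod_insert hi, Finset.sum_insert hi]
    exact (h i (Finset.mem_insert_self _ _)).mul (ih fun j hj => h j (Finset.mem_insert_of_mem hj))

end HasJet

theorem eq_zero_of_algebraMap_mem [IsLocalRing V] {c : ℂ}
    (h : algebraMap ℂ V c ∈ maximalIdeal V) : c = 0 := by
  by_contra hc
  exact h ((IsUnit.mk0 c hc).map (algebraMap ℂ V))

/-- A non-zero complex constant is a unit, so constants that agree modulo the maximal ideal are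
equal; then `δ` can be cancelled in a domain. -/
theorem HasJet.unique [IsDomain V] [IsLocalRing V] {δ x : V} {c c' : ℂ} {s s' : V}
    (hδ : δ ∈ maximalIdeal V) (hδ0 : δ ≠ 0) (hc : c ≠ 0) (h : HasJet δ x c s)
    (h' : HasJet δ x c' s') : c = c' ∧ ∃ y, s = s' + δ * y := by
  obtain ⟨y, h⟩ := h
  obtain ⟨y', h'⟩ := h'
  have hcc : c = c' := by
    rw [← sub_eq_zero]
    apply eq_zero_of_algebraMap_mem (V := V)
    have : algebraMap ℂ V (c - c') = δ * (algebraMap ℂ V c' * s' + δ * y' - algebraMap ℂ V c * s -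
        δ * y) := by
      rw [map_sub]; linear_combination h' - h
    rw [this]
    exact Ideal.mul_mem_right _ _ hδ
  subst hcc
  have hc' : algebraMap ℂ V c⁻¹ * algebraMap ℂ V c = 1 := by
    rw [← map_mul, inv_mul_cancel₀ hc, map_one]
  refine ⟨rfl, algebraMap ℂ V c⁻¹ * (y' - y), mul_left_cancel₀ hδ0 ?_⟩
  linear_combination algebraMap ℂ V c⁻¹ * (h' - h) - δ * (s - s') * hc'

/-- The logarithmic derivative of `x` with respect to `l`, at `l = -1`, is `s`. -/
def HasSlope (l : Vˣ) (x : V) (s : ℂ) : Prop :=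
  ∃ c : ℂ, c ≠ 0 ∧ HasJet ((l : V) + 1) x c (algebraMap ℂ V s)

namespace HasSlope

variable {l : Vˣ} {x x' : V} {s : ℂ}

theorem inv (h : HasSlope l x s) (hx : x * x' = 1) : HasSlope l x' (-s) := by
  obtain ⟨c, hc, h⟩ := h
  refine ⟨c⁻¹, inv_ne_zero hc, ?_⟩
  rw [map_neg]
  exact h.inv hc hx

theorem swap (h : HasSlope l⁻¹ x s) : HasSlope l x (-s) := by
  obtain ⟨c, hc, y, h⟩ := h
  have hl : (l : V) * ((l⁻¹ : Vˣ) : V) = 1 := by simp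
  refine ⟨c, hc, algebraMap ℂ V c * algebraMap ℂ V s * ((l⁻¹ : Vˣ) : V) + ((l⁻¹ : Vˣ) : V) ^ 2 * y, ?_⟩
  rw [h, map_neg]
  linear_combination (-algebraMap ℂ V c * algebraMap ℂ V s * (l + 1 + 1) -
    y * (2 * ((l⁻¹ : Vˣ) : V) + l * ((l⁻¹ : Vˣ) : V) + 1)) * hl

/-- Logarithmic derivatives of factors add up, and that of 1 is zero. The sum is only known modulo
`l + 1`, but it is a complex constant. -/
theorem sum_eq_zero [IsDomain V] [IsLocalRing V] (hl : (l : V) + 1 ∈ maximalIdeal V)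
    (hl0 : (l : V) + 1 ≠ 0) {ι : Type*} (S : Finset ι) {x : ι → V} {s : ι → ℂ}
    (h : ∀ i ∈ S, HasSlope l (x i) (s i)) (hx : ∏ i ∈ S, x i = 1) : ∑ i ∈ S, s i = 0 := by
  choose! c hc hj using h
  have h1 := HasJet.prod S hj
  rw [hx] at h1
  obtain ⟨-, y, hy⟩ := h1.unique hl hl0 (Finset.prod_ne_zero_iff.2 hc) HasJet.one
  apply eq_zero_of_algebraMap_mem (V := V)
  rw [map_sum, hy, zero_add]
  exact Ideal.mul_mem_right _ _ hl

/-- The slope for a tangle with upper triangular ends. -/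
theorem of_expansion [IsLocalRing V] (hl : (l : V) + 1 ∈ maximalIdeal V) {a b : ℂ} (ha : a ≠ 0)
    {NE SW f g u : V} (hNE : NE = algebraMap ℂ V a + (l + 1) * g)
    (hSW : SW = algebraMap ℂ V b + (l + 1) * f)
    (hu : u * NE = NE - (1 + ((l⁻¹ : Vˣ) : V)) * SW) : HasSlope l u (b / a) := by
  have hunit : IsUnit NE := by
    by_contra h
    apply ha
    apply eq_zero_of_algebraMap_mem (V := V)
    have : algebraMap ℂ V a = NE - (l + 1) * g := by rw [hNE]; ring
    rw [this]
    exact sub_mem h (Ideal.mul_mem_right _ _ hl)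
  obtain ⟨N, hN⟩ := hunit.exists_right_inv
  have hlinv : (l : V) * ((l⁻¹ : Vˣ) : V) = 1 := by simp
  set li := ((l⁻¹ : Vˣ) : V)
  have hba : algebraMap ℂ V (b / a) * algebraMap ℂ V a = algebraMap ℂ V b := by
    rw [← map_mul, div_mul_cancel₀ _ ha]
  refine ⟨1, one_ne_zero, f * N - algebraMap ℂ V (b / a) * g * N - li * SW * N, ?_⟩
  rw [map_one]
  have h1 : u = 1 - (1 + li) * SW * N := by linear_combination N * hu - (u - 1) * hN
  have h2 : SW * N = algebraMap ℂ V (b / a) + (l + 1) * (f * N - algebraMap ℂ V (b / a) * g * N) := by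
    linear_combination N * hSW - N * hba - algebraMap ℂ V (b / a) * (N * hNE) +
      algebraMap ℂ V (b / a) * hN
  linear_combination h1 + (l + 1) * h2 + (SW * N * (l + 1 + 1)) * hlinv

end HasSlope

end Jets

end Montesinos

end

noncomputable section

namespace Montesinos

/-! ### Trace polynomials near trace zero over a local ring -/

section MixedSlope

open IsLocalRing

variable {V : Type} [CommRing V] [Algebra ℂ V]

/-- In the quotient by `D` the formulas for trace zero hold exactly. -/
theorem traceTriple_units_mod {k : List ℤ} (hk : k ≠ []) (η : Vˣ) (D t : V) :
    let μ := η ^ fracNum k * (-1) ^ fracNum' k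
    let ν := η ^ fracDen k * (-1) ^ fracDen' k
    ∃ x y w, traceTriple (D * t) (-unitTrace η) k =
      (-unitTrace μ + D * x, -unitTrace ν + D * y, -unitTrace (μ * ν⁻¹) + D * w) := by
  intro μ ν
  let π := Ideal.Quotient.mkₐ ℂ (Ideal.span {D})
  have hu : ∀ u : Vˣ, unitTrace (Units.map π.toRingHom.toMonoidHom u) = π (unitTrace u) := fun u => by
    rw [unitTrace, unitTrace, map_add, ← map_inv]; rfl
  have hD : π (D * t) = 0 :=
    Ideal.Quotient.eq_zero_iff_mem.2 (Ideal.mul_mem_right _ _ (Ideal.mem_span_singleton_self D))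
  have h1 := map_traceTriple π (D * t) (-unitTrace η) k
  have h2 := traceTriple_units hk (Units.map π.toRingHom.toMonoidHom η)
  have h3 : ((-1 : (V ⧸ Ideal.span {D})ˣ)) = Units.map π.toRingHom.toMonoidHom (-1) := by
    ext; simp
  rw [h3, ← map_zpow, ← map_zpow, ← map_zpow, ← map_zpow, ← map_mul, ← map_mul] at h2
  rw [hD, map_neg, ← hu] at h1
  have h4 := h1.symm.trans h2
  rw [← map_inv, ← map_mul, hu, hu, hu, ← map_neg, ← map_neg, ← map_neg] at h4
  have key : ∀ a b : V, π a = π b → ∃ x, a = b + D * x := by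
    intro a b h
    obtain ⟨x, hx⟩ := Ideal.mem_span_singleton.1 (Ideal.Quotient.eq.1 h)
    exact ⟨x, by rw [← hx]; ring⟩
  obtain ⟨x, hx⟩ := key _ _ (congrArg Prod.fst h4)
  obtain ⟨y, hy⟩ := key _ _ (congrArg (fun p => p.2.1) h4)
  obtain ⟨w, hw⟩ := key _ _ (congrArg (fun p => p.2.2) h4)
  exact ⟨x, y, w, Prod.ext hx (Prod.ext hy hw)⟩

variable [IsLocalRing V]

theorem two_notMem : (2 : V) ∉ maximalIdeal V := fun h => by
  have : (2 : ℂ) = 0 := eq_zero_of_algebraMap_mem (V := V) (by rwa [map_ofNat])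
  norm_num at this

/-- Near trace zero, a root of the trace polynomial that is close to a critical value is one of the
traces of abelian representations. -/
theorem traceTriple_ne_of_near_critical [IsDomain V] {k : List ℤ} (hk : k ≠ [])
    (hp : fracNum k ≠ 0) {T e e' : V}
    (hT : T ∈ maximalIdeal V) {ω : ℂ} (hω : ω = 1 ∨ ω = -1)
    (he' : e' - algebraMap ℂ V (-2 * ω) ∈ maximalIdeal V) (hee : e - e' ∈ maximalIdeal V)
    (hne : e ≠ e') : (traceTriple T e k).1 ≠ (traceTriple T e' k).1 := by
  intro hZ
  set G := (traceTriple (Polynomial.C T) (Polynomial.X : Polynomial V) k).1 with hG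
  have hev : ∀ x, (traceTriple T x k).1 = G.eval x := by
    intro x
    have h1 := map_traceTriple ((Polynomial.aeval (R := V) x).restrictScalars ℂ) (Polynomial.C T)
      Polynomial.X k
    have h2 : ((Polynomial.aeval (R := V) x).restrictScalars ℂ) (Polynomial.C T) = T := by
      simp
    have h3 : ((Polynomial.aeval (R := V) x).restrictScalars ℂ) Polynomial.X = x := by simp
    rw [h2, h3] at h1
    rw [h1, ← Polynomial.coe_aeval_eq_eval]
    rfl
  rw [hev, hev] at hZ
  -- Equal values at `e ≠ e'` would make the derivative at `e'` a multiple of `e - e'`, hence a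
  -- non-unit; but its residue is the non-zero derivative at trace zero.
  obtain ⟨c, hc⟩ := G.binomExpansion e' (e - e')
  rw [add_sub_cancel, hZ] at hc
  have hd : G.derivative.eval e' = -(c * (e - e')) := by
    refine mul_right_cancel₀ (sub_ne_zero.2 hne) ?_
    linear_combination -hc
  have hmem : G.derivative.eval e' ∈ maximalIdeal V := by
    rw [hd]
    exact neg_mem (Ideal.mul_mem_left _ _ hee)
  let π := Ideal.Quotient.mkₐ ℂ (maximalIdeal V)
  have hπ0 : ∀ a, π a = 0 ↔ a ∈ maximalIdeal V := fun a => Ideal.Quotient.eq_zero_iff_mem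
  set Z := (traceTriple (0 : Polynomial ℂ) Polynomial.X k).1 with hZdef
  have hmap : G.map π.toRingHom = Z.map (algebraMap ℂ (V ⧸ maximalIdeal V)) := by
    have h1 := map_traceTriple (Polynomial.mapAlgHom π) (Polynomial.C T) Polynomial.X k
    have h2 := map_traceTriple (Polynomial.mapAlgHom (Algebra.ofId ℂ (V ⧸ maximalIdeal V)))
      (0 : Polynomial ℂ) Polynomial.X k
    have e1 : Polynomial.mapAlgHom π (Polynomial.C T) = 0 := by
      rw [Polynomial.coe_mapAlgHom, Polynomial.map_C]
      change Polynomial.C (π T) = 0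
      rw [(hπ0 T).2 hT, Polynomial.C_0]
    have e2 : Polynomial.mapAlgHom π Polynomial.X = Polynomial.X := by
      rw [Polynomial.coe_mapAlgHom, Polynomial.map_X]
    have e3 : Polynomial.mapAlgHom (Algebra.ofId ℂ (V ⧸ maximalIdeal V)) Polynomial.X =
        Polynomial.X := by
      rw [Polynomial.coe_mapAlgHom, Polynomial.map_X]
    rw [e1, e2] at h1
    rw [map_zero, e3] at h2
    exact congrArg Prod.fst (h1.symm.trans h2)
  have hval : π (G.derivative.eval e') =
      algebraMap ℂ (V ⧸ maximalIdeal V) (Z.derivative.eval (-2 * ω)) := by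
    have e1 : π e' = algebraMap ℂ (V ⧸ maximalIdeal V) (-2 * ω) := by
      rw [← sub_eq_zero, ← π.commutes, ← map_sub]
      exact (hπ0 _).2 he'
    calc π (G.derivative.eval e') = (G.derivative.map π.toRingHom).eval (π e') :=
          (Polynomial.eval_map_apply (f := π.toRingHom) (p := G.derivative) e').symm
      _ = (Z.derivative.map (algebraMap ℂ (V ⧸ maximalIdeal V))).eval
            (algebraMap ℂ (V ⧸ maximalIdeal V) (-2 * ω)) := by
          rw [← Polynomial.derivative_map, hmap, Polynomial.derivative_map, e1]
      _ = _ := Polynomial.eval_map_apply (f := algebraMap ℂ (V ⧸ maximalIdeal V)) _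
  rw [(hπ0 _).2 hmem] at hval
  refine traceTriple_derivative_ne_zero hk hp hω ?_
  refine eq_zero_of_algebraMap_mem (V := V) ((hπ0 _).1 ?_)
  rw [π.commutes]
  exact hval.symm

/-- An element that is a root of unity up to `δ` is a complex number up to `δ`. -/
theorem exists_rootOfUnity {δ ν : V} (hδ : δ ∈ maximalIdeal V) {N : ℕ} (hN : N ≠ 0)
    (h : ∃ y, ν ^ N = 1 + δ * y) :
    ∃ ζ : ℂ, ζ ≠ 0 ∧ ζ ^ N = 1 ∧ ∃ y, ν = algebraMap ℂ V ζ + δ * y := by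
  classical
  obtain ⟨y, hy⟩ := h
  have h1 := Polynomial.X_pow_sub_one_eq_prod (Nat.pos_of_ne_zero hN) (Complex.isPrimitiveRoot_exp N hN)
  have h2 := congrArg (Polynomial.aeval ν) h1
  rw [map_prod] at h2
  simp only [map_sub, map_pow, Polynomial.aeval_X, map_one, Polynomial.aeval_C] at h2
  have h3 : ν ^ N - 1 = δ * y := by rw [hy]; ring
  rw [h3] at h2
  have h4 : ∏ ζ ∈ Polynomial.nthRootsFinset N (1 : ℂ), (ν - algebraMap ℂ V ζ) ∈ maximalIdeal V := by
    rw [← h2]; exact Ideal.mul_mem_right _ _ hδ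
  obtain ⟨ζ, hζ, hm⟩ := (Ideal.IsPrime.prod_mem_iff).1 h4
  have hζN : ζ ^ N = 1 := (Polynomial.mem_nthRootsFinset (Nat.pos_of_ne_zero hN) (1 : ℂ)).1 hζ
  -- Different roots of unity remain different modulo the maximal ideal, so `ν` is close to only one
  -- of them, and the other factors are units.
  have hu : IsUnit (∏ ξ ∈ (Polynomial.nthRootsFinset N (1 : ℂ)).erase ζ, (ν - algebraMap ℂ V ξ)) := by
    rw [IsUnit.prod_iff]
    intro ξ hξ
    by_contra hn
    have : algebraMap ℂ V (ζ - ξ) ∈ maximalIdeal V := by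
      have h5 := sub_mem (show ν - algebraMap ℂ V ξ ∈ maximalIdeal V from hn) hm
      rw [map_sub]
      convert h5 using 1; ring
    exact (Finset.ne_of_mem_erase hξ) (sub_eq_zero.1 (eq_zero_of_algebraMap_mem this)).symm
  obtain ⟨w, hw⟩ := hu.exists_right_inv
  rw [← Finset.mul_prod_erase _ _ hζ] at h2
  refine ⟨ζ, ?_, hζN, y * w, ?_⟩
  · rintro rfl
    rw [zero_pow hN] at hζN
    exact zero_ne_one hζN
  · linear_combination (-w) * h2 - (ν - algebraMap ℂ V ζ) * hw

end MixedSlope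

end Montesinos

end

noncomputable section

namespace Montesinos

/-! ### The slope of a tangle whose upper and lower ends have different types -/

section MixedSlope

open IsLocalRing

theorem add_inv_add_two_eq {V : Type} [CommRing V] (l : Vˣ) :
    (l : V) + ((l⁻¹ : Vˣ) : V) + 2 = ((l : V) + 1) ^ 2 * ((l⁻¹ : Vˣ) : V) := by
  have h : (l : V) * ((l⁻¹ : Vˣ) : V) = 1 := by simp
  linear_combination (-(l : V) - 2) * h

variable {V : Type} [CommRing V] [Algebra ℂ V] [IsLocalRing V]

/-- In the residue field `η^p` and `η^q` are powers of `-1`, and `hd` gives a Bézout relation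
between `p` and `q`; so `η` itself is `±1` there. -/
theorem unit_sub_mem_of_zpow {η : Vˣ} {p q p' q' : ℤ} (hd : p * q' - q * p' = 1 ∨ p * q' - q * p' = -1)
    (hμ : ((η ^ p * (-1) ^ p' : Vˣ) : V) - 1 ∈ maximalIdeal V)
    (hν : ((η ^ q * (-1) ^ q' : Vˣ) : V) + 1 ∈ maximalIdeal V) :
    ∃ ω : ℂ, (ω = 1 ∨ ω = -1) ∧ (η : V) - algebraMap ℂ V ω ∈ maximalIdeal V := by
  let π := Ideal.Quotient.mk (maximalIdeal V)
  let φ := Units.map (π : V →* V ⧸ maximalIdeal V)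
  have hφ : ∀ u : Vˣ, ((φ u : (V ⧸ maximalIdeal V)ˣ) : V ⧸ maximalIdeal V) = π u := fun _ => rfl
  have hφ1 : φ (-1) = -1 := by ext; simp [hφ]
  let H := Subgroup.zpowers (-1 : (V ⧸ maximalIdeal V)ˣ)
  have hneg : ∀ n : ℤ, φ ((-1) ^ n) ∈ H := fun n => by
    rw [map_zpow, hφ1]; exact Subgroup.zpow_mem _ (Subgroup.mem_zpowers _) n
  have hp : φ (η ^ p) ∈ H := by
    have : φ (η ^ p * (-1) ^ p') = 1 := by
      ext
      rw [hφ, Units.val_one, ← map_one π, Ideal.Quotient.eq]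
      exact hμ
    rw [map_mul] at this
    rw [eq_inv_of_mul_eq_one_left this]
    exact inv_mem (hneg _)
  have hq : φ (η ^ q) ∈ H := by
    have : φ (η ^ q * (-1) ^ q') = -1 := by
      ext
      rw [hφ, Units.val_neg, Units.val_one, ← map_one π, ← map_neg, Ideal.Quotient.eq, sub_neg_eq_add]
      exact hν
    rw [map_mul] at this
    rw [eq_mul_inv_of_mul_eq this]
    exact mul_mem (Subgroup.mem_zpowers _) (inv_mem (hneg _))
  have hη : φ η ∈ H := by
    have h1 : φ η ^ (p * q' - q * p') ∈ H := by
      rw [zpow_sub, zpow_mul, zpow_mul, ← map_zpow φ η p, ← map_zpow φ η q]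
      exact mul_mem (Subgroup.zpow_mem _ hp _) (inv_mem (Subgroup.zpow_mem _ hq _))
    rcases hd with h | h
    · rwa [h, zpow_one] at h1
    · rwa [h, zpow_neg_one, inv_mem_iff] at h1
  obtain ⟨n, hn⟩ := Subgroup.mem_zpowers_iff.1 hη
  rcases Int.even_or_odd n with h | h
  · refine ⟨1, Or.inl rfl, ?_⟩
    rw [h.neg_one_zpow] at hn
    rw [map_one, ← Ideal.Quotient.eq, map_one]
    exact (congrArg Units.val hn).symm
  · refine ⟨-1, Or.inr rfl, ?_⟩
    rw [h.neg_one_zpow] at hn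
    rw [map_neg, map_one, ← Ideal.Quotient.eq, map_neg, map_one]
    exact (congrArg Units.val hn).symm

/-- If `ν` were `-1` in the residue field, then `η` would be `ω = ±1`, and `e` would be close to one
of the abelian values `e' = 2` or `e' = τ`, where `τ` is close to `-2`. The trace polynomial at `e'`
is 2 or `τ`. The first is impossible since it would make 2 and `-2` equal in the residue field, and
the second by `traceTriple_ne_of_near_critical`, because `e ≠ e'`. -/
theorem isUnit_one_add_of_traces [IsDomain V] {k : List ℤ} (hk : k ≠ [])
    (hp : fracNum k ≠ 0) {l : Vˣ}
    (hl : (l : V) + 1 ∈ maximalIdeal V) {η : Vˣ}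
    (hZ : (traceTriple ((l : V) + ((l⁻¹ : Vˣ) : V) + 2) (-unitTrace η) k).1 = l + ((l⁻¹ : Vˣ) : V))
    (hμ : ((η ^ fracNum k * (-1) ^ fracNum' k : Vˣ) : V) - 1 ∈ maximalIdeal V)
    (hnon : ∀ e' : V, e' = 2 ∨ e' = l + ((l⁻¹ : Vˣ) : V) → -unitTrace η ≠ e' ∧
      ((traceTriple ((l : V) + ((l⁻¹ : Vˣ) : V) + 2) e' k).1 = 2 ∨
        (traceTriple ((l : V) + ((l⁻¹ : Vˣ) : V) + 2) e' k).1 = l + ((l⁻¹ : Vˣ) : V))) :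
    IsUnit (1 + ((η ^ fracDen k * (-1) ^ fracDen' k : Vˣ) : V)) := by
  by_contra hn
  have hν : ((η ^ fracDen k * (-1) ^ fracDen' k : Vˣ) : V) + 1 ∈ maximalIdeal V := by
    rw [add_comm]; exact hn
  obtain ⟨ω, hω, hη⟩ := unit_sub_mem_of_zpow (frac_det k) hμ hν
  have hω2 : algebraMap ℂ V ω * algebraMap ℂ V ω = 1 := by
    rw [← map_mul]; rcases hω with rfl | rfl <;> simp
  have hT : (l : V) + ((l⁻¹ : Vˣ) : V) + 2 ∈ maximalIdeal V := by
    rw [add_inv_add_two_eq, sq, mul_assoc]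
    exact Ideal.mul_mem_right _ _ hl
  set T := (l : V) + ((l⁻¹ : Vˣ) : V) + 2 with hTdef
  have hηi : (η : V) * ((η⁻¹ : Vˣ) : V) = 1 := by simp
  have he : -unitTrace η - algebraMap ℂ V (-2 * ω) ∈ maximalIdeal V := by
    have : -unitTrace η - algebraMap ℂ V (-2 * ω) = ((η : V) - algebraMap ℂ V ω) *
        (-1 + ((η⁻¹ : Vˣ) : V) * algebraMap ℂ V ω) := by
      rw [unitTrace, map_mul, map_neg, map_ofNat]
      linear_combination ((η⁻¹ : Vˣ) : V) * hω2 - algebraMap ℂ V ω * hηi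
    rw [this]
    exact Ideal.mul_mem_right _ _ hη
  obtain ⟨e', he2, he'⟩ : ∃ e' : V, (e' = 2 ∨ e' = l + ((l⁻¹ : Vˣ) : V)) ∧
      e' - algebraMap ℂ V (-2 * ω) ∈ maximalIdeal V := by
    rcases hω with rfl | rfl
    · refine ⟨_, Or.inr rfl, ?_⟩
      have : (l : V) + ((l⁻¹ : Vˣ) : V) - algebraMap ℂ V (-2 * 1) = T := by
        rw [hTdef, mul_one, map_neg, map_ofNat]; ring
      rwa [this]
    · refine ⟨2, Or.inl rfl, ?_⟩
      have : (2 : V) - algebraMap ℂ V (-2 * -1) = 0 := by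
        rw [neg_mul_neg, mul_one, map_ofNat, sub_self]
      rw [this]; exact zero_mem _
  have hee : -unitTrace η - e' ∈ maximalIdeal V := by
    have := sub_mem he he'
    rwa [sub_sub_sub_cancel_right] at this
  obtain ⟨hne, h2 | h2⟩ := hnon e' he2
  · let π := Ideal.Quotient.mkₐ ℂ (maximalIdeal V)
    have h3 : π (-unitTrace η) = π e' := Ideal.Quotient.eq.2 hee
    have h4 := map_traceTriple π T (-unitTrace η) k
    rw [h3, map_traceTriple π T e' k] at h4
    have h5 : π 2 = π (l + ((l⁻¹ : Vˣ) : V)) := by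
      rw [← h2, ← hZ]; exact congrArg Prod.fst h4
    have h6 := Ideal.Quotient.eq.1 h5
    have h7 : (2 : V) * 2 ∈ maximalIdeal V := by
      have := add_mem h6 hT
      convert this using 1; rw [hTdef]; ring
    rcases (inferInstance : (maximalIdeal V).IsPrime).mem_or_mem h7 with h | h <;>
      exact two_notMem h
  · exact traceTriple_ne_of_near_critical hk hp hT hω he' hee hne (hZ.trans h2.symm)

/-- The slope for a tangle with meridians of different types at the upper and lower ends. -/
theorem HasSlope.of_traces [IsDomain V] [IsIntegrallyClosed V] {k : List ℤ} (hk : k ≠ [])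
    (hp : fracNum k ≠ 0) {l : Vˣ} (hl : (l : V) + 1 ∈ maximalIdeal V) (hl0 : (l : V) + 1 ≠ 0) {η : Vˣ} {zd zg : V}
    (htr : traceTriple ((l : V) + ((l⁻¹ : Vˣ) : V) + 2) (-unitTrace η) k =
      (l + ((l⁻¹ : Vˣ) : V), zd + 2, zg + 2))
    (hrel : l * zd + zg = 0)
    (hnon : ∀ e' : V, e' = 2 ∨ e' = l + ((l⁻¹ : Vˣ) : V) → -unitTrace η ≠ e' ∧
      ((traceTriple ((l : V) + ((l⁻¹ : Vˣ) : V) + 2) e' k).1 = 2 ∨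
        (traceTriple ((l : V) + ((l⁻¹ : Vˣ) : V) + 2) e' k).1 = l + ((l⁻¹ : Vˣ) : V))) :
    HasSlope l (-zd) (fracDen k / fracNum k) := by
  -- Here `T = l + l⁻¹ + 2 = (l + 1)² l⁻¹`, so the formulas for trace zero hold up to second order
  -- in `δ = l + 1`.
  have hexp := traceTriple_units_mod hk η (((l : V) + 1) ^ 2) ((l⁻¹ : Vˣ) : V)
  rw [← add_inv_add_two_eq, htr] at hexp
  have hunit := isUnit_one_add_of_traces hk hp hl (congrArg Prod.fst htr) (η := η)
  set μ : Vˣ := η ^ fracNum k * (-1) ^ fracNum' k with hμdef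
  set ν : Vˣ := η ^ fracDen k * (-1) ^ fracDen' k with hνdef
  set δ : V := (l : V) + 1 with hδ
  have hlδ : (l : V) = δ - 1 := by rw [hδ]; ring
  have hTl := add_inv_add_two_eq l
  rw [← hδ] at hTl
  set li := ((l⁻¹ : Vˣ) : V) with hli
  clear_value δ
  obtain ⟨x, y, w, hexp⟩ := hexp
  obtain ⟨e1, e23⟩ := Prod.mk.injEq _ _ _ _ ▸ hexp
  obtain ⟨e2, e3⟩ := Prod.mk.injEq _ _ _ _ ▸ e23
  have hμi : (μ : V) * ((μ⁻¹ : Vˣ) : V) = 1 := by simp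
  have hνi : (ν : V) * ((ν⁻¹ : Vˣ) : V) = 1 := by simp
  simp only [unitTrace, mul_inv_rev, inv_inv, Units.val_mul] at e1 e2 e3
  -- Both `μ + μ⁻¹ - 2` and `T` are divisible by `δ²`. As the ring is integrally closed, `μ - 1` is
  -- divisible by `δ`; the quotient `m` is the slope of `μ`.
  have hsq : ((μ : V) - 1) ^ 2 = δ ^ 2 * (μ * (x - li)) := by
    linear_combination (μ : V) * e1 - (μ : V) * hTl - hμi
  obtain ⟨m, hm⟩ := (IsIntegrallyClosed.pow_dvd_pow_iff (two_ne_zero)).1 (Dvd.intro _ hsq.symm)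
  have hμm : (μ : V) = 1 + δ * m := by rw [← hm]; ring
  have hu := hunit (by rw [hm]; exact Ideal.mul_mem_right _ _ hl) hnon
  -- the relation between `μ` and `ν`
  have hm1 : ∃ c, (2 - (1 + (ν : V))) * m + (1 + (ν : V)) = δ * c := by
    obtain ⟨v, hv⟩ := hu.exists_right_inv
    have h1 : δ * ((1 + (ν : V)) * ((m - 1) * (1 + ν) - 2 * m)) = δ * (δ * (m * (1 + ν) ^ 2 + m ^ 2 -
        (μ * ν) * ((δ - 1) * y + w))) := by
      have h2 : (δ - 1) * (-((ν : V) + ((ν⁻¹ : Vˣ) : V)) + δ ^ 2 * y - 2) +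
          (-(μ * ((ν⁻¹ : Vˣ) : V) + ν * ((μ⁻¹ : Vˣ) : V)) + δ ^ 2 * w - 2) = 0 := by
        rw [← hlδ, ← e2, ← e3]; linear_combination hrel
      have h3 : ((δ - 1) * (-((ν : V) ^ 2 + 1) * μ + μ * ν * (δ ^ 2 * y - 2)) -
          (μ ^ 2 + ν ^ 2) + μ * ν * (δ ^ 2 * w - 2)) = 0 := by
        linear_combination (μ * ν : V) * h2 + (μ * (δ - 1) + μ ^ 2 : V) * hνi + (ν ^ 2 : V) * hμi
      rw [hμm] at h3 ⊢
      linear_combination h3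
    have h4 := mul_left_cancel₀ hl0 h1
    refine ⟨-v * (m * (1 + ν) ^ 2 + m ^ 2 - (μ * ν) * ((δ - 1) * y + w)), ?_⟩
    linear_combination (-v) * h4 + ((m - 1) * (1 + (ν : V)) - 2 * m) * hv
  -- `ν` is a root of unity up to first order
  have hpow : ∀ a b : ℤ, (((-1 : Vˣ) ^ a) ^ (2 * b)) = 1 := fun a b => by
    rw [← zpow_mul, mul_left_comm]; exact (even_two_mul _).neg_one_zpow
  have hμν : ν ^ (2 * fracNum k) = μ ^ (2 * fracDen k) := by
    rw [hμdef, hνdef, mul_zpow, mul_zpow, hpow, hpow, ← zpow_mul, ← zpow_mul]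
    congr 2; ring
  set N := (2 * fracNum k).natAbs with hN
  have hN0 : N ≠ 0 := Int.natAbs_ne_zero.2 (mul_ne_zero two_ne_zero hp)
  have hNσ : (N : ℤ) = 2 * fracNum k * (fracNum k).sign := by
    rw [hN, Int.natAbs_mul, Nat.cast_mul, mul_assoc, Int.mul_sign_self]; rfl
  have hνN : ν ^ (N : ℤ) = μ ^ (2 * fracDen k * (fracNum k).sign) := by
    rw [hNσ, zpow_mul, hμν, ← zpow_mul]
  have jμ : HasJet δ (μ : V) 1 m := ⟨0, by rw [hμm, map_one]; ring⟩
  have jμn := jμ.zpow one_ne_zero (2 * fracDen k * (fracNum k).sign)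
  rw [← hνN, one_zpow] at jμn
  obtain ⟨ζ, hζ0, hζN, y₀, hy₀⟩ := exists_rootOfUnity hl hN0 (ν := (ν : V)) (by
    obtain ⟨y, hy⟩ := jμn
    rw [zpow_natCast, Units.val_pow_eq_pow_val, map_one] at hy
    exact ⟨((2 * fracDen k * (fracNum k).sign : ℤ) : V) * m + δ * y, by rw [hy]; ring⟩)
  have halg : ∀ {a b : ℂ}, a * b = 1 → algebraMap ℂ V a * algebraMap ℂ V b = 1 := fun h => by
    rw [← map_mul, h, map_one]
  have jν : HasJet δ (ν : V) ζ (algebraMap ℂ V ζ⁻¹ * y₀) :=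
    ⟨0, by linear_combination hy₀ - δ * y₀ * halg (mul_inv_cancel₀ hζ0)⟩
  have hn0 : ((fracNum k : ℤ) : ℂ) ≠ 0 := Int.cast_ne_zero.2 hp
  obtain ⟨-, y₁, hy₁⟩ := (jν.zpow hζ0 N).unique hl hl0 (zpow_ne_zero _ hζ0) jμn
  set qp : ℂ := (fracDen k : ℂ) / fracNum k with hqp
  have hNC : (N : ℂ) ≠ 0 := Nat.cast_ne_zero.2 hN0
  have hratio : (N : ℂ)⁻¹ * (2 * fracDen k * (fracNum k).sign : ℤ) = qp := by
    have h1 : (N : ℂ) = 2 * fracNum k * (fracNum k).sign := by exact_mod_cast congrArg (Int.cast (R := ℂ)) hNσ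
    rw [inv_mul_eq_iff_eq_mul₀ hNC, h1, hqp]
    field_simp
    push_cast
    ring
  have hs : algebraMap ℂ V ζ⁻¹ * y₀ = algebraMap ℂ V qp * m + δ * (algebraMap ℂ V (N : ℂ)⁻¹ * y₁) := by
    have h1 := halg (inv_mul_cancel₀ hNC)
    have h2 := congrArg (algebraMap ℂ V) hratio
    rw [map_mul, map_intCast] at h2
    rw [map_natCast] at h1
    rw [Int.cast_natCast] at hy₁
    linear_combination (-(algebraMap ℂ V ζ⁻¹ * y₀)) * h1 + algebraMap ℂ V (N : ℂ)⁻¹ * hy₁ + m * h2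
  obtain ⟨c, hc⟩ := hm1
  -- Modulo `δ` the relation between `μ` and `ν` has complex coefficients and determines the slope
  -- `m` as `-(1 + ζ) / (1 - ζ)`.
  have hmζ : algebraMap ℂ V (1 - ζ) * m + algebraMap ℂ V (1 + ζ) = δ * (c + y₀ * m - y₀) := by
    rw [map_sub, map_add, map_one]
    linear_combination hc + (m - 1) * hy₀
  have hζ1 : 1 - ζ ≠ 0 := by
    intro h
    have hζ : ζ = 1 := by linear_combination -h
    rw [h, map_zero, zero_mul, zero_add, hζ, map_add, map_one] at hmζ
    refine two_notMem (V := V) ?_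
    rw [← one_add_one_eq_two, hmζ]
    exact Ideal.mul_mem_right _ _ hl
  have hζ2 : 1 + ζ ≠ 0 := by
    intro h
    have hζ : ζ = -1 := by linear_combination h
    refine (mem_nonunits_iff.1 (show 1 + (ν : V) ∈ maximalIdeal V from ?_)) hu
    rw [hy₀, hζ, map_neg, map_one, add_neg_cancel_left]
    exact Ideal.mul_mem_right _ _ hl
  set m₀ : ℂ := -(1 + ζ) / (1 - ζ) with hm₀
  have hmm : m = algebraMap ℂ V m₀ + δ * (algebraMap ℂ V (1 - ζ)⁻¹ * (c + y₀ * m - y₀)) := by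
    have h1 := halg (inv_mul_cancel₀ hζ1)
    have h2 : algebraMap ℂ V m₀ = -(algebraMap ℂ V (1 - ζ)⁻¹ * algebraMap ℂ V (1 + ζ)) := by
      rw [← map_mul, ← map_neg, hm₀]; congr 1; field_simp
    rw [h2]
    linear_combination (-m) * h1 + algebraMap ℂ V (1 - ζ)⁻¹ * hmζ
  have jν' : HasJet δ (ν : V) ζ (algebraMap ℂ V (qp * m₀)) := by
    refine jν.congr ⟨algebraMap ℂ V (N : ℂ)⁻¹ * y₁ +
      algebraMap ℂ V qp * (algebraMap ℂ V (1 - ζ)⁻¹ * (c + y₀ * m - y₀)), ?_⟩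
    rw [map_mul]
    linear_combination hs + algebraMap ℂ V qp * hmm
  have jν1 : HasJet δ (1 + (ν : V)) (1 + ζ) (algebraMap ℂ V (ζ * (qp * m₀) / (1 + ζ))) := by
    obtain ⟨y₂, hy₂⟩ := jν'
    have h1 : algebraMap ℂ V (1 + ζ) * algebraMap ℂ V (ζ * (qp * m₀) / (1 + ζ)) =
        algebraMap ℂ V ζ * algebraMap ℂ V (qp * m₀) := by
      rw [← map_mul, ← map_mul, mul_div_cancel₀ _ hζ2]
    have h2 : algebraMap ℂ V (1 + ζ) = 1 + algebraMap ℂ V ζ := by rw [map_add, map_one]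
    exact ⟨y₂, by linear_combination hy₂ - δ * h1 - h2⟩
  -- Up to second order `-zd` is `ν + ν⁻¹ + 2 = (1 + ν)² ν⁻¹`; its jet comes from that of `ν`, which
  -- has slope `(q / p) m₀`.
  obtain ⟨y₃, hy₃⟩ := (jν1.mul jν1).mul (jν'.inv hζ0 hνi)
  have hfin : HasJet δ (-zd) ((1 + ζ) * (1 + ζ) * ζ⁻¹) (algebraMap ℂ V (ζ * (qp * m₀) / (1 + ζ)) +
      algebraMap ℂ V (ζ * (qp * m₀) / (1 + ζ)) + -algebraMap ℂ V (qp * m₀)) :=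
    ⟨y₃ - y, by linear_combination hy₃ - e2 - ((ν : V) + 2) * hνi⟩
  -- The slope does not depend on the unknown root of unity `ζ`: the factor `m₀` is cancelled by `(ζ
  -- - 1) / (1 + ζ)`.
  have hsum : ζ * (qp * m₀) / (1 + ζ) + ζ * (qp * m₀) / (1 + ζ) + -(qp * m₀) = qp := by
    have h1 : m₀ * (1 - ζ) = -(1 + ζ) := by rw [hm₀, div_mul_cancel₀ _ hζ1]
    field_simp
    linear_combination (-qp) * h1
  refine ⟨_, mul_ne_zero (mul_ne_zero hζ2 hζ2) (inv_ne_zero hζ0), ?_⟩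
  rw [← hδ]
  refine hfin.congr ⟨0, ?_⟩
  rw [mul_zero, add_zero, ← map_neg, ← map_add, ← map_add, hsum]

end MixedSlope

end Montesinos

end

noncomputable section

namespace Montesinos

/-! ### A place at a fourth root of unity -/

section Place

open SL2 IsLocalRing

/-- For a representation by diagonal matrices, the products of meridians have the obvious traces. -/
theorem traceTriple_of_diagonal {k : List ℤ} (hk : k ≠ []) (κ : ℂˣ) {e : ℂ}
    (he : e = 2 ∨ e = (κ : ℂ) ^ 2 + ((κ : ℂ) ^ 2)⁻¹) :
    (traceTriple ((κ : ℂ) ^ 2 + ((κ : ℂ) ^ 2)⁻¹ + 2) e k).1 = 2 ∨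
      (traceTriple ((κ : ℂ) ^ 2 + ((κ : ℂ) ^ 2)⁻¹ + 2) e k).1 = (κ : ℂ) ^ 2 + ((κ : ℂ) ^ 2)⁻¹ := by
  have h0 := κ.ne_zero
  let φ : ℂˣ →* SL2 :=
    { toFun := fun u => uPlus u 0
      map_one' := SL2.ext' rfl rfl rfl (by rw [uPlus_11]; simp)
      map_mul' := fun u v => by
        refine SL2.ext' ?_ ?_ ?_ ?_ <;>
          simp only [mul_00, mul_01, mul_10, mul_11, uPlus_00, uPlus_01, uPlus_10, uPlus_11,
            Units.val_mul, mul_inv] <;> ring }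
  have hφ : ∀ u, tr (φ u) = u + (u : ℂ)⁻¹ := fun u => tr_uPlus u 0
  have hsq : tr (φ (κ * κ)) = (κ : ℂ) ^ 2 + ((κ : ℂ) ^ 2)⁻¹ := by
    rw [hφ, Units.val_mul, ← sq]
  have hone : tr (φ (κ * κ⁻¹)) = 2 := by rw [mul_inv_cancel, map_one, tr_one]
  obtain ⟨y, hy, hr⟩ : ∃ y : ℂˣ, (y = κ ∨ y = κ⁻¹) ∧
      eZero k ((κ : ℂ) + (κ : ℂ)⁻¹) (tr (φ (κ * y))) = e := by
    have hT : ((κ : ℂ) + (κ : ℂ)⁻¹) ^ 2 = (κ : ℂ) ^ 2 + ((κ : ℂ) ^ 2)⁻¹ + 2 := by field_simp; ring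
    unfold eZero
    split_ifs
    · rcases he with rfl | rfl
      · exact ⟨_, Or.inr rfl, hone⟩
      · exact ⟨_, Or.inl rfl, hsq⟩
    · rcases he with rfl | rfl
      · exact ⟨_, Or.inl rfl, by rw [hsq, hT]; ring⟩
      · exact ⟨_, Or.inr rfl, by rw [hone, hT]; ring⟩
  obtain ⟨f, hf, hx, hY⟩ := exists_coloring_generators k κ y
  have hy₀ : (rational k).y₀.val f = κ ∨ (rational k).y₀.val f = κ⁻¹ := by
    unfold genY at hY
    split_ifs at hY
    · rw [hY]; exact hy
    · rw [Dart.val_rev, inv_eq_iff_eq_inv] at hY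
      rw [hY]; rcases hy with rfl | rfl
      · exact Or.inr rfl
      · exact Or.inl (inv_inv _)
  have hne : (rational k).ne.val f = κ ∨ (rational k).ne.val f = κ⁻¹ := by
    rcases Diagram.sameDir_cases k (rational k).ne with h | h | h | h <;>
      rw [h.val_eq_of_comm hf] <;> try rw [Dart.val_rev]
    · exact Or.inl hx
    · exact Or.inr (congrArg _ hx)
    · exact hy₀
    · rcases hy₀ with h | h <;> rw [h]
      · exact Or.inr rfl
      · exact Or.inl (inv_inv _)
  have htr : ∀ u : ℂˣ, u = κ ∨ u = κ⁻¹ → tr (φ u) = (κ : ℂ) + (κ : ℂ)⁻¹ := by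
    rintro u (rfl | rfl)
    · exact hφ _
    · rw [map_inv, tr_inv, hφ]
  obtain ⟨h1, -⟩ := tangle_traces hk (hf.comp φ) rfl rfl rfl (by rw [Dart.val_comp, htr _ (Or.inl hx)])
    (by rw [Dart.val_comp, hY, htr _ hy]) rfl
  rw [Dart.val_comp, Dart.val_comp, Dart.val_comp, ← map_mul, ← map_mul, hx, hY, z_eq, sub_add_cancel,
    hr] at h1
  rw [show (κ : ℂ) ^ 2 + ((κ : ℂ) ^ 2)⁻¹ + 2 = ((κ : ℂ) + (κ : ℂ)⁻¹) ^ 2 by field_simp; ring, h1]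
  rcases hne with h | h <;> rw [h]
  · exact Or.inr hsq
  · exact Or.inl hone

theorem HasSlope.isUnit {V : Type} [CommRing V] [Algebra ℂ V] [IsLocalRing V] {l : Vˣ} {x : V} {s : ℂ}
    (hl : (l : V) + 1 ∈ maximalIdeal V) (h : HasSlope l x s) : IsUnit x := by
  obtain ⟨c, hc, y, hy⟩ := h
  by_contra hx
  apply hc
  apply eq_zero_of_algebraMap_mem (V := V)
  have : algebraMap ℂ V c = x - (l + 1) * (algebraMap ℂ V c * algebraMap ℂ V s + (l + 1) * y) := by
    rw [hy]; ring
  rw [this]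
  exact sub_mem hx (Ideal.mul_mem_right _ _ hl)

theorem add_one_mem_of_inv {V : Type} [CommRing V] [IsLocalRing V] {l : Vˣ}
    (h : (l : V) + 1 ∈ maximalIdeal V) : ((l⁻¹ : Vˣ) : V) + 1 ∈ maximalIdeal V := by
  have : ((l⁻¹ : Vˣ) : V) + 1 = ((l⁻¹ : Vˣ) : V) * (l + 1) := by
    rw [mul_add, mul_one, Units.inv_mul, add_comm]
  rw [this]
  exact Ideal.mul_mem_left _ _ h

variable {S Ω V : Type} [Field Ω] [Algebra ℂ Ω] (π : (S → ℂ) →ₐ[ℂ] Ω)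

/-- A function without zeros is a unit, and so is its image. -/
theorem AlgHom.apply_ne_apply_of_forall_ne {f g : S → ℂ} (h : ∀ s, f s ≠ g s) : π f ≠ π g := by
  intro he
  have h1 : (f - g) * (fun s => (f s - g s)⁻¹) = 1 := by
    funext s
    exact mul_inv_cancel₀ (sub_ne_zero.2 (h s))
  have h2 := congrArg π h1
  rw [map_mul, map_sub, he, sub_self, zero_mul, map_one] at h2
  exact zero_ne_one h2

variable {π} [CommRing V] [Algebra V Ω] {κ : S → ℂˣ} {K : Vˣ}

theorem algebraMap_inv_eq (hK : algebraMap V Ω K = π fun s => (κ s : ℂ)) :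
    algebraMap V Ω ((K⁻¹ : Vˣ) : V) = π fun s => ((κ⁻¹ s : ℂˣ) : ℂ) := by
  have h1 : (fun s => (κ s : ℂ)) * (fun s => ((κ⁻¹ s : ℂˣ) : ℂ)) = 1 := by
    funext s
    exact (κ s).mul_inv
  have h2 := congrArg π h1
  rw [map_mul, map_one, ← hK] at h2
  have h3 : algebraMap V Ω K * algebraMap V Ω ((K⁻¹ : Vˣ) : V) = 1 := by
    rw [← map_mul, Units.mul_inv, map_one]
  exact mul_left_cancel₀ (left_ne_zero_of_mul_eq_one h2) (h3.trans h2.symm)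

theorem algebraMap_sq_add_inv (hK : algebraMap V Ω K = π fun s => (κ s : ℂ)) :
    algebraMap V Ω (((K ^ 2 : Vˣ) : V) + (((K ^ 2)⁻¹ : Vˣ) : V)) =
      π fun s => (κ s : ℂ) ^ 2 + ((κ s : ℂ) ^ 2)⁻¹ := by
  rw [← inv_pow, map_add, Units.val_pow_eq_pow_val, Units.val_pow_eq_pow_val, map_pow, map_pow, hK,
    algebraMap_inv_eq hK, ← map_pow, ← map_pow, ← map_add]
  congr 1; funext s
  change (κ s : ℂ) ^ 2 + (((κ s)⁻¹ : ℂˣ) : ℂ) ^ 2 = _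
  rw [Units.val_inv_eq_inv_val, inv_pow]

variable [Algebra ℂ V] [IsScalarTower ℂ V Ω]

theorem exists_algebraMap_eq_laurent (hK : algebraMap V Ω K = π fun s => (κ s : ℂ))
    (f : laurentFunctions) : ∃ v : V, algebraMap V Ω v = π fun s => f.1 (κ s) := by
  obtain ⟨f, hf⟩ := f
  refine Algebra.adjoin_induction (p := fun f _ => ∃ v : V, algebraMap V Ω v = π fun s => f (κ s))
    ?_ ?_ ?_ ?_ hf
  · rintro f (rfl | rfl)
    · exact ⟨K, hK⟩
    · refine ⟨((K⁻¹ : Vˣ) : V), (algebraMap_inv_eq hK).trans ?_⟩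
      congr 1; funext s; exact Units.val_inv_eq_inv_val _
  · intro c
    refine ⟨algebraMap ℂ V c, ?_⟩
    rw [← IsScalarTower.algebraMap_apply, ← π.commutes]; rfl
  · rintro f g - - ⟨v, hv⟩ ⟨w, hw⟩
    exact ⟨v + w, by rw [map_add, hv, hw, ← map_add]; rfl⟩
  · rintro f g - - ⟨v, hv⟩ ⟨w, hw⟩
    exact ⟨v * w, by rw [map_mul, hv, hw, ← map_mul]; rfl⟩

variable [IsLocalRing V]

/-- The quotient is `1 - (1 + l⁻¹) ϑ^sw / ϑ^ne`. At `l = -1` the constant terms of `ϑ^sw` and `ϑ^ne`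
are `η q` and `-η p`, which makes `ϑ^ne` a unit and gives the slope `-q / p`. -/
theorem exists_hasSlope_upper (hK : algebraMap V Ω K = π fun s => (κ s : ℂ))
    (hl : ((K ^ 2 : Vˣ) : V) + 1 ∈ maximalIdeal V) {k : List ℤ} (hp : fracNum k ≠ 0)
    {s₀ : S} (h0 : κ s₀ ≠ (κ s₀)⁻¹) (h1 : (redPair k (κ s₀)).1.1 0 0 = κ s₀)
    (h2 : (redPair k (κ s₀)).2.1 0 0 = κ s₀) {u : S → ℂ}
    (hu : ∀ s, u s * varthetaNE k (κ s) =
      varthetaNE k (κ s) - (1 + ((κ s : ℂ) ^ 2)⁻¹) * varthetaSW k (κ s)) :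
    ∃ v : V, algebraMap V Ω v = π u ∧ HasSlope (K ^ 2) v (-((fracDen k : ℂ) / fracNum k)) := by
  obtain ⟨η, f, g, hfg⟩ := exists_vartheta_expansion h0 h1 h2
  obtain ⟨f', hf'⟩ := exists_algebraMap_eq_laurent hK f
  obtain ⟨g', hg'⟩ := exists_algebraMap_eq_laurent hK g
  set l : Vˣ := K ^ 2 with hldef
  have hlK : algebraMap V Ω (l : V) = π fun s => (κ s : ℂ) ^ 2 := by
    rw [hldef, Units.val_pow_eq_pow_val, map_pow, hK, ← map_pow]; rfl
  have hconst : ∀ c : ℂ, algebraMap V Ω (algebraMap ℂ V c) = π fun _ => c := fun c => by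
    rw [← IsScalarTower.algebraMap_apply, ← π.commutes]; rfl
  have hexp : ∀ (c : ℂ) (φ : S → ℂ) (v : V), algebraMap V Ω v = π φ →
      algebraMap V Ω (algebraMap ℂ V c + (l + 1) * v) = π fun s => c + ((κ s : ℂ) ^ 2 + 1) * φ s := by
    intro c φ v hv
    rw [map_add, map_mul, map_add, map_one, hv, hlK, hconst, ← map_one π, ← map_add, ← map_mul, ← map_add]
    rfl
  set SW : V := algebraMap ℂ V (η * fracDen k : ℤ) + (l + 1) * f' with hSW
  set NE : V := algebraMap ℂ V (-η * fracNum k : ℤ) + (l + 1) * g' with hNE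
  have eSW : algebraMap V Ω SW = π fun s => varthetaSW k (κ s) := by
    rw [hSW, hexp _ _ _ hf']; congr 1; funext s; exact (hfg _).1.symm
  have eNE : algebraMap V Ω NE = π fun s => varthetaNE k (κ s) := by
    rw [hNE, hexp _ _ _ hg']; congr 1; funext s; exact (hfg _).2.symm
  have ha : ((-η * fracNum k : ℤ) : ℂ) ≠ 0 := by
    rw [Int.cast_ne_zero]
    exact mul_ne_zero (neg_ne_zero.2 η.ne_zero) hp
  have hunit : IsUnit NE := by
    by_contra h
    apply ha
    apply eq_zero_of_algebraMap_mem (V := V)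
    rw [show algebraMap ℂ V (-η * fracNum k : ℤ) = NE - (l + 1) * g' by rw [hNE]; ring]
    exact sub_mem h (Ideal.mul_mem_right _ _ hl)
  obtain ⟨N, hN⟩ := hunit.exists_right_inv
  clear_value NE SW
  have hv : (NE - (1 + ((l⁻¹ : Vˣ) : V)) * SW) * N * NE = NE - (1 + ((l⁻¹ : Vˣ) : V)) * SW := by
    linear_combination (NE - (1 + ((l⁻¹ : Vˣ) : V)) * SW) * hN
  refine ⟨(NE - (1 + ((l⁻¹ : Vˣ) : V)) * SW) * N, ?_, ?_⟩
  · have hne : algebraMap V Ω NE ≠ 0 := by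
      have := congrArg (algebraMap V Ω) hN
      rw [map_mul, map_one] at this
      exact left_ne_zero_of_mul_eq_one this
    refine mul_right_cancel₀ hne ?_
    have hli : algebraMap V Ω ((l⁻¹ : Vˣ) : V) = π fun s => ((κ s : ℂ) ^ 2)⁻¹ := by
      rw [hldef, ← inv_pow, Units.val_pow_eq_pow_val, map_pow, algebraMap_inv_eq hK, ← map_pow]
      congr 1; funext s
      change (((κ s)⁻¹ : ℂˣ) : ℂ) ^ 2 = _
      rw [Units.val_inv_eq_inv_val, inv_pow]
    rw [← map_mul, hv, map_sub, map_mul, map_add, map_one, hli, eNE, eSW, ← map_one π, ← map_add, ← map_mul,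
      ← map_sub, ← map_mul]
    congr 1; funext s; exact (hu s).symm
  · have := HasSlope.of_expansion hl ha hNE hSW hv
    convert this using 1
    rcases Int.units_eq_one_or η with rfl | rfl
    · push_cast; rw [one_mul, neg_one_mul, div_neg]
    · push_cast; simp [neg_div]

/-- Lower triangular ends are upper triangular ones for `κ⁻¹`, with the inverse quotient; the two
changes of sign of the slope cancel. -/
theorem exists_hasSlope_lower (hK : algebraMap V Ω K = π fun s => (κ s : ℂ))
    (hl : ((K ^ 2 : Vˣ) : V) + 1 ∈ maximalIdeal V) {k : List ℤ} (hp : fracNum k ≠ 0)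
    {s₀ : S} (h0 : κ s₀ ≠ (κ s₀)⁻¹) (h1 : (redPair k (κ s₀)⁻¹).1.1 0 0 = ((κ s₀)⁻¹ : ℂˣ))
    (h2 : (redPair k (κ s₀)⁻¹).2.1 0 0 = ((κ s₀)⁻¹ : ℂˣ)) {u : S → ℂ} (hu0 : ∀ s, u s ≠ 0)
    (hu : ∀ s, varthetaNE k (κ s)⁻¹ = u s * (varthetaNE k (κ s)⁻¹ -
      (1 + (κ s : ℂ) ^ 2) * varthetaSW k (κ s)⁻¹)) :
    ∃ v : V, algebraMap V Ω v = π u ∧ HasSlope (K ^ 2) v (-((fracDen k : ℂ) / fracNum k)) := by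
  have hl' : (((K⁻¹) ^ 2 : Vˣ) : V) + 1 ∈ maximalIdeal V := by
    rw [inv_pow]; exact add_one_mem_of_inv hl
  obtain ⟨v, hv, hs⟩ := exists_hasSlope_upper (algebraMap_inv_eq hK) hl' hp (s₀ := s₀)
    (by rw [Pi.inv_apply, inv_inv]; exact h0.symm) h1 h2 (u := u⁻¹) (fun s => by
      have h3 : (((κ⁻¹ s : ℂˣ) : ℂ) ^ 2)⁻¹ = (κ s : ℂ) ^ 2 := by
        rw [Pi.inv_apply, Units.val_inv_eq_inv_val, inv_pow, inv_inv]
      rw [h3, Pi.inv_apply, Pi.inv_apply, inv_mul_eq_iff_eq_mul₀ (hu0 s)]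
      exact hu s)
  obtain ⟨w, hw⟩ := (hs.isUnit hl').exists_right_inv
  refine ⟨w, ?_, ?_⟩
  · have h3 := congrArg (algebraMap V Ω) hw
    have h4 : π u⁻¹ * π u = 1 := by
      rw [← map_mul, ← map_one π]
      congr 1; funext s
      exact inv_mul_cancel₀ (hu0 s)
    rw [map_mul, map_one, hv] at h3
    exact mul_left_cancel₀ (left_ne_zero_of_mul_eq_one h4) (h3.trans h4.symm)
  · have := hs.inv hw
    rw [inv_pow, neg_neg] at this
    exact this.swap

variable [IsDomain V] [IsIntegrallyClosed V] [IsFractionRing V Ω]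

/-- The image of `e` under `π` is integral over `V`, by the leading coefficient `±1` of the trace
polynomial, and the roots of `x² + e x + 1` are integral, too; so all of them lie in `V`. The
identities, which hold at each `s`, pass to `Ω` and descend along the inclusion of `V`. -/
theorem exists_hasSlope_mixed (hK : algebraMap V Ω K = π fun s => (κ s : ℂ))
    (hl : ((K ^ 2 : Vˣ) : V) + 1 ∈ maximalIdeal V) (hl0 : ((K ^ 2 : Vˣ) : V) + 1 ≠ 0)
    {k : List ℤ} (hk : k ≠ []) (hp : fracNum k ≠ 0) {e zd zg : S → ℂ}
    (htr : ∀ s, traceTriple ((κ s : ℂ) ^ 2 + ((κ s : ℂ) ^ 2)⁻¹ + 2) (e s) k =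
      ((κ s : ℂ) ^ 2 + ((κ s : ℂ) ^ 2)⁻¹, zd s + 2, zg s + 2))
    (hrel : ∀ s, (κ s : ℂ) ^ 2 * zd s + zg s = 0) (he2 : ∀ s, e s ≠ 2)
    (heτ : ∀ s, e s ≠ (κ s : ℂ) ^ 2 + ((κ s : ℂ) ^ 2)⁻¹) :
    ∃ v : V, algebraMap V Ω v = π zd ∧ HasSlope (K ^ 2) (-v) ((fracDen k : ℂ) / fracNum k) := by
  set l : Vˣ := K ^ 2 with hldef
  set τ : S → ℂ := fun s => (κ s : ℂ) ^ 2 + ((κ s : ℂ) ^ 2)⁻¹ with hτ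
  set τ' : V := l + ((l⁻¹ : Vˣ) : V) with hτ'
  have hττ : algebraMap V Ω τ' = π τ := algebraMap_sq_add_inv hK
  have hinj : Function.Injective (algebraMap V Ω) := IsFractionRing.injective V Ω
  let j : V →ₐ[ℂ] Ω := IsScalarTower.toAlgHom ℂ V Ω
  have hpi : ∀ e : S → ℂ, traceTriple (π τ + 2) (π e) k =
      ((π (fun s => (traceTriple (τ s + 2) (e s) k).1)),
        (π (fun s => (traceTriple (τ s + 2) (e s) k).2.1)),
        (π (fun s => (traceTriple (τ s + 2) (e s) k).2.2))) := by
    intro e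
    have h1 := map_traceTriple π (τ + 2) e k
    rw [map_add, map_ofNat] at h1
    have h2 : ∀ s, traceTriple (τ s + 2) (e s) k = _ := fun s =>
      map_traceTriple (Pi.evalAlgHom ℂ (fun _ : S => ℂ) s) (τ + 2) e k
    simp only [h1, h2]
    rfl
  have hmapV : ∀ e : V, traceTriple (algebraMap V Ω τ' + 2) (algebraMap V Ω e) k =
      (algebraMap V Ω (traceTriple (τ' + 2) e k).1, algebraMap V Ω (traceTriple (τ' + 2) e k).2.1,
        algebraMap V Ω (traceTriple (τ' + 2) e k).2.2) := by
    intro e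
    have h1 := map_traceTriple j (τ' + 2) e k
    rw [map_add, map_ofNat] at h1
    exact h1
  have hZ := hpi e
  have hZ' : traceTriple (π τ + 2) (π e) k = (π τ, π zd + 2, π zg + 2) := by
    rw [hZ]
    simp only [hτ, htr]
    rw [← map_ofNat π 2, ← map_add, ← map_add]
    rfl
  -- the trace coordinate is integral
  have hint : IsIntegral V (π e) := by
    refine isIntegral_of_hasUnitLead (w := τ') (hasUnitLead_traceTriple (T := τ' + 2) (ε := (1 : V)) (b := 0)
      (Or.inl rfl) hk hp) (Int.natAbs_ne_zero.2 hp) ?_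
    have h1 := map_traceTriple ((Polynomial.aeval (R := V) (π e)).restrictScalars ℂ)
      (Polynomial.C (τ' + 2)) (Polynomial.C 1 * Polynomial.X + Polynomial.C 0) k
    rw [AlgHom.restrictScalars_apply, AlgHom.restrictScalars_apply, Polynomial.aeval_C, map_add,
      map_ofNat, hττ] at h1
    simp only [map_one, one_mul, map_zero, add_zero, Polynomial.aeval_X] at h1 ⊢
    rw [hZ'] at h1
    rw [hττ]
    exact (congrArg Prod.fst h1).symm
  obtain ⟨e', he'⟩ := IsIntegrallyClosed.algebraMap_eq_of_integral hint
  choose η hη using fun s => exists_add_inv_eq (-(e s))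
  have hroot : ∀ x y : S → ℂ, (∀ s, x s * y s = 1) → (∀ s, -(e s) = x s + y s) → IsIntegral V (π x) := by
    intro x y hxy hs
    refine ⟨Polynomial.X ^ 2 + Polynomial.C e' * Polynomial.X + 1, ?_, ?_⟩
    · rw [← Polynomial.C_1, add_assoc]
      exact Polynomial.monic_X_pow_add (Polynomial.degree_linear_lt)
    · rw [← Polynomial.aeval_def]
      simp only [map_add, map_mul, map_pow, Polynomial.aeval_X, Polynomial.aeval_C, map_one, he']
      rw [← map_one π, ← map_mul, ← map_pow, ← map_add, ← map_add, ← map_zero π]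
      congr 1; funext s
      change x s ^ 2 + e s * x s + 1 = 0
      linear_combination (-x s) * hs s - hxy s
  obtain ⟨a, ha⟩ := IsIntegrallyClosed.algebraMap_eq_of_integral (hroot (fun s => (η s : ℂ))
    (fun s => (η s : ℂ)⁻¹) (fun s => mul_inv_cancel₀ (η s).ne_zero) hη)
  obtain ⟨a', ha'⟩ := IsIntegrallyClosed.algebraMap_eq_of_integral (hroot (fun s => (η s : ℂ)⁻¹)
    (fun s => (η s : ℂ)) (fun s => inv_mul_cancel₀ (η s).ne_zero) fun s => by rw [hη]; ring)
  have haa : a * a' = 1 := by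
    apply hinj
    rw [map_mul, ha, ha', ← map_mul, map_one, ← map_one π]
    congr 1; funext s; exact mul_inv_cancel₀ (η s).ne_zero
  let E : Vˣ := ⟨a, a', haa, by rw [mul_comm, haa]⟩
  have hE : -unitTrace E = e' := by
    apply hinj
    change algebraMap V Ω (-(a + a')) = _
    rw [map_neg, map_add, ha, ha', he', ← map_add, ← map_neg]
    congr 1; funext s
    change -((η s : ℂ) + (η s : ℂ)⁻¹) = _
    rw [← hη, neg_neg]
  have hV := hmapV e'
  rw [hττ, he', hZ'] at hV
  obtain ⟨v1, v23⟩ := Prod.mk.injEq _ _ _ _ ▸ hV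
  obtain ⟨v2, v3⟩ := Prod.mk.injEq _ _ _ _ ▸ v23
  set Z := traceTriple (τ' + 2) e' k with hZdef
  have hzd : algebraMap V Ω (Z.2.1 - 2) = π zd := by rw [map_sub, map_ofNat, ← v2, add_sub_cancel_right]
  have hzg : algebraMap V Ω (Z.2.2 - 2) = π zg := by rw [map_sub, map_ofNat, ← v3, add_sub_cancel_right]
  refine ⟨Z.2.1 - 2, hzd, HasSlope.of_traces hk hp hl hl0 (η := E) (zg := Z.2.2 - 2) ?_ ?_ ?_⟩
  · rw [hE, sub_add_cancel, sub_add_cancel, ← hτ', ← hZdef]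
    refine Prod.ext (hinj ?_) rfl
    rw [hττ, ← v1]
  · apply hinj
    rw [map_add, map_mul, hzd, hzg, map_zero, hldef, Units.val_pow_eq_pow_val, map_pow, hK, ← map_pow,
      ← map_mul, ← map_add, ← map_zero π]
    congr 1; funext s; exact hrel s
  · have key : ∀ (w : V) (φ : S → ℂ), algebraMap V Ω w = π φ → (∀ s, φ s = 2 ∨ φ s = τ s) →
        (∀ s, e s ≠ φ s) → -unitTrace E ≠ w ∧
          ((traceTriple (τ' + 2) w k).1 = 2 ∨ (traceTriple (τ' + 2) w k).1 = τ') := by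
      intro w φ hw hφ hne
      constructor
      · rw [hE]
        intro h
        apply AlgHom.apply_ne_apply_of_forall_ne π hne
        rw [← he', h, hw]
      · have h1 := hmapV w
        rw [hττ, hw, hpi φ] at h1
        have h2 := congrArg Prod.fst h1
        simp only at h2
        have h3 : ((traceTriple (τ' + 2) w k).1 - 2) * ((traceTriple (τ' + 2) w k).1 - τ') = 0 := by
          apply hinj
          rw [map_mul, map_sub, map_sub, ← h2, map_ofNat, hττ, ← map_ofNat π 2, ← map_sub, ← map_sub,
            ← map_mul, map_zero, ← map_zero π]
          congr 1; funext s
          rcases traceTriple_of_diagonal hk (κ s) (hφ s) with h | h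
          · exact mul_eq_zero_of_left (sub_eq_zero.2 h) _
          · exact mul_eq_zero_of_right _ (sub_eq_zero.2 h)
        rcases mul_eq_zero.1 h3 with h | h
        · exact Or.inl (sub_eq_zero.1 h)
        · exact Or.inr (sub_eq_zero.1 h)
    rintro w (rfl | rfl)
    · exact key 2 (fun _ => 2) (by rw [map_ofNat, ← map_ofNat π 2]; rfl) (fun _ => Or.inl rfl) he2
    · exact key _ τ hττ (fun _ => Or.inr rfl) heτ

end Place

end Montesinos

end

noncomputable section

namespace Montesinos

/-! ### Finiteness of the exceptional part -/

section Finiteness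

open SL2 IsLocalRing

/-- The germs along a non-principal ultrafilter form a field. Since `κ` takes each value only
finitely often, its germ `x` is transcendental over `ℂ`. So `x - i` generates a proper ideal of
`ℂ[x]`, and some valuation ring of the field contains `ℂ[x]` and has this ideal in its maximal
ideal; there `κ² = -1` in the residue field. -/
theorem exists_place {S : Type} [Infinite S] (κ : S → ℂˣ) (hκ : ∀ c : ℂ, {s | (κ s : ℂ) = c}.Finite) :
    ∃ (Ω V : Type) (_ : Field Ω) (_ : Algebra ℂ Ω) (_ : CommRing V) (_ : IsDomain V)
      (_ : IsLocalRing V) (_ : IsIntegrallyClosed V) (_ : Algebra ℂ V) (_ : Algebra V Ω)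
      (_ : IsScalarTower ℂ V Ω) (_ : IsFractionRing V Ω) (π : (S → ℂ) →ₐ[ℂ] Ω) (K : Vˣ),
      algebraMap V Ω K = π (fun s => (κ s : ℂ)) ∧ ((K ^ 2 : Vˣ) : V) + 1 ∈ maximalIdeal V ∧
        ((K ^ 2 : Vˣ) : V) + 1 ≠ 0 := by
  let φ := Filter.hyperfilter S
  let Ω := Filter.Germ (φ : Filter S) ℂ
  let π₀ : (S → ℂ) →+* Ω := Filter.Germ.coeRingHom (φ : Filter S)
  let _ : Algebra ℂ Ω := (π₀.comp (algebraMap ℂ (S → ℂ))).toAlgebra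
  let π : (S → ℂ) →ₐ[ℂ] Ω := { π₀ with commutes' := fun _ => rfl }
  set x : Ω := π fun s => (κ s : ℂ) with hx
  have hpoly : ∀ p : Polynomial ℂ, Polynomial.aeval x p = π fun s => p.eval (κ s : ℂ) := by
    intro p
    rw [hx, Polynomial.aeval_algHom_apply]
    congr 1; funext s
    have := Polynomial.aeval_algHom_apply (Pi.evalAlgHom ℂ (fun _ : S => ℂ) s) (fun s => (κ s : ℂ)) p
    exact this.symm
  have htrans : ∀ p : Polynomial ℂ, Polynomial.aeval x p = 0 → p = 0 := by
    intro p hp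
    by_contra hp0
    rw [hpoly] at hp
    have h1 : ∀ᶠ s in (φ : Filter S), p.eval (κ s : ℂ) = 0 := Filter.Germ.coe_eq.1 hp
    refine Filter.notMem_hyperfilter_of_finite (s := {s | p.eval (κ s : ℂ) = 0}) ?_ h1
    refine ((p.roots.toFinset.finite_toSet).biUnion fun c _ => hκ c).subset fun s hs => ?_
    simp only [Set.mem_iUnion]
    exact ⟨κ s, by simpa [hp0] using hs, rfl⟩
  let A : Subring Ω := (Polynomial.aeval x : Polynomial ℂ →ₐ[ℂ] Ω).toRingHom.range
  have hxA : x ∈ A := ⟨Polynomial.X, Polynomial.aeval_X x⟩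
  have hCA : ∀ c : ℂ, algebraMap ℂ Ω c ∈ A := fun c => ⟨Polynomial.C c, Polynomial.aeval_C x c⟩
  let y : A := ⟨x, hxA⟩ - ⟨_, hCA Complex.I⟩
  have hI : Ideal.span {y} ≠ ⊤ := by
    intro h
    obtain ⟨⟨_, p, rfl⟩, hz⟩ := Ideal.mem_span_singleton'.1 ((Ideal.eq_top_iff_one _).1 h)
    have h1 : Polynomial.aeval x (p * (Polynomial.X - Polynomial.C Complex.I) - 1) = 0 := by
      rw [map_sub, map_mul, map_sub, Polynomial.aeval_X, Polynomial.aeval_C, map_one, sub_eq_zero]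
      exact congrArg Subtype.val hz
    have h2 := congrArg (Polynomial.eval Complex.I) (htrans _ h1)
    simp at h2
  obtain ⟨B, hAB, hB⟩ := Ideal.image_subset_nonunits_valuationSubring _ hI
  have hxB : x ∈ B := hAB hxA
  have hCB : ∀ c : ℂ, algebraMap ℂ Ω c ∈ B := fun c => hAB (hCA c)
  let algB : Algebra ℂ B := ((algebraMap ℂ Ω).codRestrict B.toSubring hCB).toAlgebra
  have tower : IsScalarTower ℂ B Ω := IsScalarTower.of_algebraMap_eq fun _ => rfl
  let X : B := ⟨x, hxB⟩
  let Y : B := X - algebraMap ℂ B Complex.I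
  have hY : Y ∈ maximalIdeal B := by
    have h1 : (Y : Ω) ∈ B.nonunits := hB ⟨y, Ideal.subset_span rfl, rfl⟩
    rw [← SetLike.mem_coe, ← B.image_maximalIdeal] at h1
    obtain ⟨w, hw, he⟩ := h1
    rwa [Subtype.ext he] at hw
  have hII : algebraMap ℂ B Complex.I * algebraMap ℂ B Complex.I = -1 := by
    rw [← map_mul, Complex.I_mul_I, map_neg, map_one]
  have hX : IsUnit X := by
    by_contra hX
    have h1 : algebraMap ℂ B Complex.I ∈ maximalIdeal B := by
      have := sub_mem (show X ∈ maximalIdeal B from hX) hY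
      rwa [sub_sub_cancel] at this
    exact Complex.I_ne_zero (eq_zero_of_algebraMap_mem h1)
  obtain ⟨K, hK⟩ := hX
  have hK2 : ((K ^ 2 : Bˣ) : B) + 1 = Y * (X + algebraMap ℂ B Complex.I) := by
    rw [Units.val_pow_eq_pow_val, hK]
    linear_combination hII
  refine ⟨Ω, B, inferInstance, inferInstance, inferInstance, inferInstance, inferInstance, inferInstance,
    algB, inferInstance, tower, inferInstance, π, K, ?_, ?_, ?_⟩
  · rw [hK]; rfl
  · rw [hK2]; exact Ideal.mul_mem_right _ _ hY
  · intro h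
    rw [Units.val_pow_eq_pow_val, hK] at h
    have h1 : Polynomial.aeval x (Polynomial.X ^ 2 + 1 : Polynomial ℂ) = 0 := by
      rw [map_add, map_pow, Polynomial.aeval_X, map_one]
      exact congrArg Subtype.val h
    have h2 := congrArg (Polynomial.eval 0) (htrans _ h1)
    simp at h2

variable {m : ℕ} [NeZero m] {k : Fin m → List ℤ} {q : Fin m → ℚ}

theorem fracNum_ne_zero_of_z {k : List ℤ} (hk : k ≠ []) {κ : ℂˣ} (hκ : (κ : ℂ) ^ 4 ≠ 1) {t r : ℂ}
    (hz : z k t r + 2 = (κ : ℂ) ^ 2 + ((κ : ℂ) ^ 2)⁻¹) : fracNum k ≠ 0 := by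
  intro hp
  rw [z_eq, traceTriple_of_fracNum_eq_zero hk hp] at hz
  have h0 := κ.ne_zero
  have h1 : ((κ : ℂ) ^ 2 - 1) ^ 2 = 0 := by
    field_simp at hz
    linear_combination -hz
  have h2 := pow_eq_zero_iff (two_ne_zero) |>.1 h1
  exact hκ (by linear_combination ((κ : ℂ) ^ 2 + 1) * h2)

/-- For given `t`, the trace polynomial has degree `|p| > 0` in `r`. -/
theorem finite_setOf_z_eq {k : List ℤ} (hk : k ≠ []) (hp : fracNum k ≠ 0) (t w : ℂ) :
    {r : ℂ | z k t r = w}.Finite := by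
  obtain ⟨ε, b, hε, he⟩ : ∃ ε b : ℂ, (ε = 1 ∨ ε = -1) ∧ ∀ r, eZero k t r = ε * r + b := by
    unfold eZero
    split_ifs
    · exact ⟨1, 0, Or.inl rfl, fun r => by ring⟩
    · exact ⟨-1, t ^ 2, Or.inr rfl, fun r => by ring⟩
  have hlead := hasUnitLead_traceTriple (T := t ^ 2) (b := b) hε hk hp
  set f := (traceTriple (Polynomial.C (t ^ 2)) (Polynomial.C ε * Polynomial.X + Polynomial.C b) k).1
    with hf
  have heval : ∀ r, f.eval r = z k t r + 2 := by
    intro r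
    have h1 := map_traceTriple (Polynomial.aeval (R := ℂ) r) (Polynomial.C (t ^ 2))
      (Polynomial.C ε * Polynomial.X + Polynomial.C b) k
    have h2 := congrArg Prod.fst h1
    simp only [map_add, map_mul, Polynomial.aeval_C, Polynomial.aeval_X, Algebra.algebraMap_self,
      RingHom.id_apply, ← he] at h2
    rw [z_eq, sub_add_cancel, h2, ← hf, Polynomial.coe_aeval_eq_eval]
  have hne : f - Polynomial.C (w + 2) ≠ 0 := by
    intro h
    have h1 := congrArg (fun g => Polynomial.coeff g (fracNum k).natAbs) h
    simp only [Polynomial.coeff_sub, Polynomial.coeff_C_of_ne_zero (Int.natAbs_ne_zero.2 hp), sub_zero,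
      Polynomial.coeff_zero] at h1
    rcases hlead.2 with h2 | h2 <;> rw [h2] at h1 <;> norm_num at h1
  refine (f - Polynomial.C (w + 2)).roots.toFinset.finite_toSet.subset fun r hr => ?_
  rw [Finset.mem_coe, Multiset.mem_toFinset, Polynomial.mem_roots hne, Polynomial.IsRoot,
    Polynomial.eval_sub, Polynomial.eval_C, heval, show z k t r = w from hr, sub_self]

/-- A family of representations with triangular meridians of fixed types has only finitely many
eigenvalues up to multiplicity. -/
theorem false_of_infinite_family (hk : ∀ i, k i ≠ []) (hK : (link k).IsKnot)
    (hp : ∀ i, fracNum (k i) ≠ 0) {S : Type} [Infinite S] {κ : S → ℂˣ}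
    (hκ : ∀ c : ℂ, {s | (κ s : ℂ) = c}.Finite) {e : Fin m → Bool} {b : S → Fin m → ℂ}
    {f : S → ∀ i, (rational (k i)).Arc → SL2} (h : ∀ s, IsTriangular k (κ s) e (b s) (f s))
    (ht : ∀ s i (a : Dart (rational (k i)).Arc), tr (a.val (f s i)) = κ s + (κ s : ℂ)⁻¹) : False := by
  obtain ⟨Ω, V, _, _, _, _, _, _, _, _, _, _, π, K, hKκ, hl, hl0⟩ := exists_place κ hκ
  obtain ⟨s₀⟩ : Nonempty S := inferInstance
  set r : S → Fin m → ℂ := fun s i => tr ((rational (k i)).nw.val (f s i) * (genY (k i)).val (f s i))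
    with hr
  have hr' : ∀ s i, tr ((rational (k i)).nw.val (f s i) * (genY (k i)).val (f s i)) = r s i :=
    fun _ _ => rfl
  have hT : ∀ s, ((κ s : ℂ) + (κ s : ℂ)⁻¹) ^ 2 = (κ s : ℂ) ^ 2 + ((κ s : ℂ) ^ 2)⁻¹ + 2 := by
    intro s
    have h0 := (κ s).ne_zero
    field_simp; ring
  have h0 := ne_inv_of_pow_ne_one (h s₀).order
  have mixed : ∀ (i : Fin m) (κ' : S → ℂˣ) (K' : Vˣ), (κ' = κ ∧ K' = K ∨ κ' = κ⁻¹ ∧ K' = K⁻¹) →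
      (∀ s, (κ' s : ℂ) ^ 2 * zDot (k i) (κ s + (κ s : ℂ)⁻¹) (r s i) +
        zGrave (k i) (κ s + (κ s : ℂ)⁻¹) (r s i) = 0) →
      (∀ s, r s i ≠ 2 ∧ r s i ≠ (κ s + (κ s : ℂ)⁻¹) ^ 2 - 2) →
      ∃ v : V, algebraMap V Ω v = π (fun s => zDot (k i) (κ s + (κ s : ℂ)⁻¹) (r s i)) ∧
        HasSlope (K' ^ 2) (-v) ((fracDen (k i) : ℂ) / fracNum (k i)) := by
    intro i κ' K' hκ' hrel hne
    have hτ : ∀ s, (κ' s : ℂ) ^ 2 + ((κ' s : ℂ) ^ 2)⁻¹ = (κ s : ℂ) ^ 2 + ((κ s : ℂ) ^ 2)⁻¹ := by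
      rcases hκ' with ⟨rfl, -⟩ | ⟨rfl, -⟩
      · exact fun _ => rfl
      · intro s
        rw [Pi.inv_apply, Units.val_inv_eq_inv_val, inv_pow, inv_inv, add_comm]
    have he : ∀ s, eZero (k i) (κ s + (κ s : ℂ)⁻¹) (r s i) ≠ 2 ∧
        eZero (k i) (κ s + (κ s : ℂ)⁻¹) (r s i) ≠ (κ' s : ℂ) ^ 2 + ((κ' s : ℂ) ^ 2)⁻¹ := by
      intro s
      have h1 := hne s
      rw [hT, add_sub_cancel_right] at h1
      rw [hτ]
      unfold eZero
      split_ifs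
      · exact h1
      · rw [hT]
        exact ⟨fun h2 => h1.2 (by linear_combination -h2), fun h2 => h1.1 (by linear_combination -h2)⟩
    refine exists_hasSlope_mixed (κ := κ') ?_ ?_ ?_ (hk i) (hp i)
      (e := fun s => eZero (k i) (κ s + (κ s : ℂ)⁻¹) (r s i)) ?_ hrel (fun s => (he s).1)
      fun s => (he s).2
    · rcases hκ' with ⟨rfl, rfl⟩ | ⟨rfl, rfl⟩
      · exact hKκ
      · exact algebraMap_inv_eq hKκ
    · rcases hκ' with ⟨-, rfl⟩ | ⟨-, rfl⟩
      · exact hl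
      · rw [inv_pow]; exact add_one_mem_of_inv hl
    · rcases hκ' with ⟨-, rfl⟩ | ⟨-, rfl⟩
      · exact hl0
      · rw [inv_pow]
        intro h1
        apply hl0
        have h2 := congrArg (fun x => ((K ^ 2 : Vˣ) : V) * x) h1
        simp only [mul_add, mul_one, Units.mul_inv, mul_zero] at h2
        rw [add_comm, h2]
    · intro s
      have h1 := (h s).z_eq hk (ht s) (hr' s) i
      rw [hτ, zDot_eq, zGrave_eq, sub_add_cancel, sub_add_cancel, ← hT, ← h1, z_eq, sub_add_cancel]
  -- The four cases of types give the same slope; for mixed types the quotient is `-ż` or its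
  -- inverse, and replacing `l` by `l⁻¹` accounts for the remaining sign.
  have slope : ∀ i, ∃ v : V, algebraMap V Ω v = π (fun s => b s (i + 1) / b s i) ∧
      HasSlope (K ^ 2) v (-((fracDen (k i) : ℂ) / fracNum (k i))) := by
    intro i
    have hb : ∀ s i, b s i ≠ 0 := fun s => (h s).ne_zero
    cases e1 : e i <;> cases e2 : e (i + 1)
    · have hlow := fun s => (h s).lower hk e1 e2
      obtain ⟨_, -, -, -, -, h5, h6⟩ := hlow s₀
      refine exists_hasSlope_lower hKκ hl (hp i) h0 h5 h6
        (fun s => div_ne_zero (hb s _) (hb s _)) fun s => ?_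
      obtain ⟨_, -, -, -, h4, -, -⟩ := hlow s
      rw [div_mul_eq_mul_div, eq_div_iff (hb s i)]
      linear_combination h4
    · have hmix := fun s => (h s).mixed_lower hk (ht s) (hr' s) e1 e2
      obtain ⟨v, hv, hs⟩ := mixed i κ⁻¹ K⁻¹ (Or.inr ⟨rfl, rfl⟩) (fun s => by
        have h0 := (κ s).ne_zero
        rw [Pi.inv_apply, Units.val_inv_eq_inv_val, inv_pow]
        have := (hmix s).2.1
        generalize zDot (k i) _ _ = zd at *
        generalize zGrave (k i) _ _ = zg at *
        field_simp
        linear_combination this) fun s => (hmix s).2.2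
      refine ⟨-v, ?_, ?_⟩
      · rw [map_neg, hv, ← map_neg]
        congr 1; funext s
        rw [Pi.neg_apply, (hmix s).1, neg_div, mul_div_cancel_left₀ _ (hb s i)]
      · rw [inv_pow] at hs; exact hs.swap
    · have hmix := fun s => (h s).mixed_upper hk (ht s) (hr' s) e1 e2
      obtain ⟨v, hv, hs⟩ := mixed i κ K (Or.inl ⟨rfl, rfl⟩) (fun s => (hmix s).2.1) fun s => (hmix s).2.2
      obtain ⟨w, hw⟩ := (hs.isUnit hl).exists_right_inv
      refine ⟨w, ?_, hs.inv hw⟩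
      have h3 := congrArg (algebraMap V Ω) hw
      rw [map_mul, map_one, map_neg, hv, ← map_neg] at h3
      refine mul_left_cancel₀ (left_ne_zero_of_mul_eq_one h3) (h3.trans ?_)
      rw [← map_mul, ← map_one π]
      congr 1; funext s
      have h4 := (hmix s).1
      change 1 = -(zDot (k i) (κ s + (κ s : ℂ)⁻¹) (r s i)) * (b s (i + 1) / b s i)
      rw [← mul_div_assoc, eq_div_iff (hb s i)]
      linear_combination h4
    · have hup := fun s => (h s).upper hk e1 e2
      obtain ⟨_, -, -, -, -, h5, h6⟩ := hup s₀
      refine exists_hasSlope_upper hKκ hl (hp i) h0 h5 h6 fun s => ?_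
      obtain ⟨_, -, -, -, h4, -, -⟩ := hup s
      rw [div_mul_eq_mul_div, div_eq_iff (hb s i)]
      linear_combination h4
  choose v hv hs using slope
  -- The quotients `b (i + 1) / b i` cancel around the cycle, for each `s`.
  have hprod : ∏ i, v i = 1 := by
    apply IsFractionRing.injective V Ω
    rw [map_prod, map_one, Finset.prod_congr rfl fun i _ => hv i, ← map_prod, ← map_one π]
    congr 1; funext s
    rw [Finset.prod_apply, Finset.prod_div_distrib, prod_shift, Pi.one_apply]
    exact div_self (Finset.prod_ne_zero_iff.2 fun i _ => (h s).ne_zero i)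
  have hsum := HasSlope.sum_eq_zero hl hl0 Finset.univ (fun i _ => hs i) hprod
  apply sum_inv_frac_ne_zero hk hK hp
  rw [Finset.sum_neg_distrib, neg_eq_zero] at hsum
  exact_mod_cast hsum

/-- There are finitely many patterns of types, so infinitely many characters would share one. Within
a pattern `κ` is finite-to-one, and this is what the argument with the place needs. -/
theorem finite_X' (hk : ∀ i, k i ≠ []) (hK : (link k).IsKnot) (hq : ∀ i, HasFraction (k i) (q i))
    (hgen : IsGeneric k q) : (X' k).Finite := by
  by_contra hinf
  have hinf : Infinite (X' k) := Set.infinite_coe_iff.2 hinf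
  choose ρ κ e b hT hχ ht hb using fun χ : X' k => exists_isTriangular hq hK hgen χ.2
  have htr : ∀ χ i (a : Dart (rational (k i)).Arc),
      tr (a.val (restrict (ρ χ) i)) = κ χ + (κ χ : ℂ)⁻¹ := by
    intro χ i a
    rw [← ht, ← hχ χ]
    exact tr_val_eq hK (ρ χ) i a
  have hz : ∀ χ i, z (k i) (κ χ + (κ χ : ℂ)⁻¹) (rCoord k χ.1 i) =
      (κ χ : ℂ) ^ 2 + ((κ χ : ℂ) ^ 2)⁻¹ - 2 := by
    intro χ i
    rw [← (hT χ).z_eq hk (htr χ) (fun i => rfl) i, add_sub_cancel_right, ← rCoord_eq, hχ]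
  have hp : ∀ i, fracNum (k i) ≠ 0 := by
    intro i
    obtain ⟨χ⟩ : Nonempty (X' k) := inferInstance
    exact fracNum_ne_zero_of_z (hk i) (hT χ).order (by rw [hz χ i]; ring)
  obtain ⟨e₀, he₀⟩ := Finite.exists_infinite_fiber e
  refine false_of_infinite_family hk hK hp (S := e ⁻¹' {e₀}) (κ := fun s => κ s.1) ?_
    (e := e₀) (b := fun s => b s.1) (f := fun s => restrict (ρ s.1)) ?_ (fun s => htr s.1)
  · intro c
    -- The value of `κ` fixes `t` and `τ`, so each `r i` is a root of a non-constant polynomial; and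
    -- by `IsTriangular.unique` the types, `κ`, the normalization `b 0 = 1` and the `r i` determine
    -- the representation.
    refine Set.Finite.of_finite_image (f := fun s => rCoord k s.1.1) ?_ ?_
    · refine (Set.Finite.pi' fun i => finite_setOf_z_eq (hk i) (hp i) (c + c⁻¹)
        (c ^ 2 + (c ^ 2)⁻¹ - 2)).subset ?_
      rintro _ ⟨s, hs, rfl⟩ i
      rw [← (show (κ s.1 : ℂ) = c from hs)]
      exact hz s.1 i
    · rintro ⟨χ, h1⟩ hc ⟨χ', h2⟩ hc' hr
      have hκ : κ χ = κ χ' := Units.ext (hc.trans hc'.symm)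
      have hT' := hT χ'
      rw [← hκ, show e χ' = e χ from h2.trans h1.symm] at hT'
      have htr' := htr χ'
      rw [← hκ] at htr'
      have hρ : restrict (ρ χ) = restrict (ρ χ') := by
        funext i
        refine congrFun (funext fun i => (hT χ).unique hk hT' ((hb χ).trans (hb χ').symm) (htr χ) htr' ?_ i) i
        intro i
        rw [← rCoord_eq, ← rCoord_eq, hχ, hχ]
        exact congrFun hr i
      refine Subtype.ext (Subtype.ext ?_)
      rw [← hχ χ, ← hχ χ', hom_ext_restrict hρ]
  · intro s
    have := hT s.1
    rwa [show e s.1 = e₀ from s.2] at this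

end Finiteness

end Montesinos

end

theorem theorem1p1 {m : ℕ} [NeZero m] (k : Fin m → List ℤ) (q : Fin m → ℚ)
    (hq : ∀ i, HasFraction (k i) (q i)) (hK : (link k).IsKnot) :
    -- the decomposition
    (irrCharacters (link k).group = X₀ k ∪ X₁ k ∪ X₂ k ∪ X' k ∧
      [X₀ k, X₁ k, X₂ k, X' k].Pairwise Disjoint) ∧
    -- the rational links whose representations are united in `X₁` are knots, with at most one exception
    ((∃ i₀, (∀ i, i ≠ i₀ → (rational (k i)).numerator.IsKnot) ∧
        ((rational (k i₀)).numerator.numComponents = 1 ∨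
          (rational (k i₀)).numerator.numComponents = 2)) ∧
      -- compatible representations of the rational links have a unique union
      ∀ σ : ∀ i, (rational (k i)).numerator.group →* SL2,
        (∀ i,
          σ (i + 1) ((rational (k (i + 1))).numerator.loop (rational (k (i + 1))).nw) =
              (σ i ((rational (k i)).numerator.loop (rational (k i)).sw))⁻¹ ∧
          σ (i + 1) ((rational (k (i + 1))).numerator.loop (rational (k (i + 1))).ne) =
              (σ i ((rational (k i)).numerator.loop (rational (k i)).se))⁻¹) →
        ∃! ρ : (link k).group →* SL2, IsUnion k ρ σ) ∧
    -- `X₂` is an algebraic curve with explicit equations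
    (IsAlgebraicCurve (curve k) ∧
      (∀ χ ∈ X₂ k, ∀ l : ℂ, l ≠ 0 → l + l⁻¹ = tauCoord k χ →
        (Fin.cons l (Fin.cons (tCoord k χ) (rCoord k χ)) : Fin (m + 2) → ℂ) ∈ curve k) ∧
      (∀ v ∈ curve k, ∃! χ, χ ∈ X₂ k ∧ tauCoord k χ = v 0 + (v 0)⁻¹ ∧
        tCoord k χ = v 1 ∧ rCoord k χ = fun i => v i.succ.succ)) ∧
    -- `X'` is finite under the generic condition
    (IsGeneric k q → (X' k).Finite) := by
  have hk : ∀ i, k i ≠ [] := fun i => (hq i).ne_nil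
  obtain ⟨i₀, hi₀⟩ := exists_even_unique hk hK
  refine ⟨⟨irrCharacters_decomposition hk hK, pairwise_disjoint_parts⟩,
    ⟨⟨i₀, fun i hi => isKnot_numerator (hk i) (hi₀ i hi), numComponents_numerator (k i₀)⟩,
      fun σ h => existsUnique_isUnion σ h⟩,
    ⟨isAlgebraicCurve_curve hk hK, fun χ hχ l hl hτ => mem_curve_of_mem_X₂ hk hK hχ l hl hτ,
      fun v hv => existsUnique_of_mem_curve hk hK hv⟩, ?_⟩
  exact finite_X' hk hK hq
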